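/- **Theorem.** Let $T>0$, $p\in[1,\infty)$ and $\frac1p+\frac1q=1$. Let $b:[0,T]\times\mathbb{R}^d\to\mathbb{R}^d$ be a vector field such that $$b\in L^1\big([0,T],(W^{1,q}_{loc}(\mathbb{R}^d))^d\big),\qquad \operatorname{div} b\in L^1\big([0,T],L^\infty(\mathbb{R}^d)\big),\qquad \frac{|b|}{1+|x|}\in L^1\big([0,T],L^1(\mathbb{R}^d)\big)+L^1\big([0,T],L^\infty(\mathbb{R}^d)\big),$$ where $\operatorname{div} b$ is the distributional divergence of $b$ in $x$. Let $(\Omega,\mathcal F,\mathbb P)$ be a probability space and let $B_n=(B_n^1,\dots,B_n^d)$ be an $\mathbb{R}^d$-valued stochastic process on $[0,T]$ whose paths are almost surely continuous and of bounded variation (for instance, one of a sequence of such approximations of a Brownian motion). Then for every $u_0\in L^p(\mathbb{R}^d)$ there is a unique weak $L^p$-solution of the Cauchy problem $$\frac{d}{dt}u_n(t,x)+b(t,x)\cdot\nabla u_n(t,x)+\nabla u_n(t,x)\cdot\frac{dB_n}{dt}(t)=0,\qquad u_n(0,x)=u_0(x).$$ Here a *weak $L^p$-solution* is a stochastic process $u_n\in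 L^\infty(\Omega\times[0,T],L^p(\mathbb{R}^d))$ such that, for every $\varphi\in C_c^\infty(\mathbb{R}^d)$, the process $\int u_n(t,x)\varphi(x)\,dx$ has a continuous modification on $[0,T]$ and, for this modification, almost surely for all $t\in[0,T]$, $$\int u_n(t,x)\varphi(x)\,dx=\int u_0(x)\varphi(x)\,dx+\int_0^t\!\!\int b(s,x)\cdot\nabla\varphi(x)\,u_n(s,x)\,dx\,ds+\int_0^t\!\!\int \operatorname{div} b(s,x)\,\varphi(x)\,u_n(s,x)\,dx\,ds+\sum_{i=1}^d\int_0^t\Big(\int D_i\varphi(x)\,u_n(s,x)\,dx\Big)\,dB_n^i(s),$$ where the last integrals are pathwise Stieltjes integrals of the continuous modifications of $\int D_i\varphi(x)\,u_n(s,x)\,dx$. Uniqueness means that any two weak $L^p$-solutions $u,u'$ with the same $u_0$ are modifications of each other: for every $t\in[0,T]$, $u(t)=u'(t)$ in $L^p(\mathbb{R}^d)$ almost surely. -/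

import Mathlib

open MeasureTheory Set
open scoped ENNReal Distributions LineDeriv

noncomputable section

namespace StochTransport

/-- The space `ℝᵈ` with its Euclidean norm. -/
abbrev Space (d : ℕ) : Type := EuclideanSpace ℝ (Fin d)

/-- Real test functions: smooth compactly supported functions on `ℝᵈ`. -/
abbrev TestFun (d : ℕ) : Type := 𝓓((⊤ : TopologicalSpace.Opens (Space d)), ℝ)

/-- `L¹([0,T], Lʳ(ℝᵈ; F))`: jointly measurable with `∫₀ᵀ ‖f(t,·)‖_{Lʳ} dt < ∞`. -/
def MemL1L {d : ℕ} {F : Type*} [NormedAddCommGroup F]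
    (T : ℝ) (r : ℝ≥0∞) (f : ℝ → Space d → F) : Prop :=
  AEStronglyMeasurable (Function.uncurry f)
      ((volume.restrict (Icc (0 : ℝ) T)).prod (volume : Measure (Space d))) ∧
    ∫⁻ t in Icc (0 : ℝ) T, eLpNorm (f t) r volume < ∞

/-- `L¹([0,T], Lʳ_loc(ℝᵈ; F))`: jointly measurable with `∫₀ᵀ ‖f(t,·)‖_{Lʳ(K)} dt < ∞` for every
compact `K ⊆ ℝᵈ`. -/
def MemL1LLoc {d : ℕ} {F : Type*} [NormedAddCommGroup F]
    (T : ℝ) (r : ℝ≥0∞) (f : ℝ → Space d → F) : Prop :=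
  AEStronglyMeasurable (Function.uncurry f)
      ((volume.restrict (Icc (0 : ℝ) T)).prod (volume : Measure (Space d))) ∧
    ∀ K : Set (Space d), IsCompact K →
      ∫⁻ t in Icc (0 : ℝ) T, eLpNorm (f t) r (volume.restrict K) < ∞

/-- `Df` is the weak (distributional) derivative of the vector field `f`; both are functions. -/
def HasWeakFDeriv {d : ℕ} (f : Space d → Space d) (Df : Space d → Space d →L[ℝ] Space d) : Prop :=
  LocallyIntegrable f volume ∧ LocallyIntegrable Df volume ∧
    ∀ (φ : TestFun d) (v : Space d),
      ∫ x, fderiv ℝ φ x v • f x = - ∫ x, φ x • Df x v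

/-- `g` is the weak (distributional) divergence of the vector field `f`; both are functions. Here
`fderiv ℝ φ x (f x)` is `f(x) · ∇φ(x)`. -/
def HasWeakDiv {d : ℕ} (f : Space d → Space d) (g : Space d → ℝ) : Prop :=
  LocallyIntegrable f volume ∧ LocallyIntegrable g volume ∧
    ∀ φ : TestFun d, ∫ x, fderiv ℝ φ x (f x) = - ∫ x, φ x * g x

/-- `L¹([0,T], (W^{1,r}_loc(ℝᵈ))ᵈ)`. -/
def MemL1W1Loc {d : ℕ} (T : ℝ) (r : ℝ≥0∞) (b : ℝ → Space d → Space d) : Prop :=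
  MemL1LLoc T r b ∧
    ∃ Db : ℝ → Space d → Space d →L[ℝ] Space d, MemL1LLoc T r Db ∧
      ∀ᵐ t ∂(volume.restrict (Icc (0 : ℝ) T)), HasWeakFDeriv (b t) (Db t)

/-- The growth condition `|b| / (1 + |x|) ∈ L¹([0,T], L¹(ℝᵈ)) + L¹([0,T], L^∞(ℝᵈ))`. -/
def GrowthCondition {d : ℕ} (T : ℝ) (b : ℝ → Space d → Space d) : Prop :=
  ∃ f₁ f₂ : ℝ → Space d → ℝ, MemL1L T 1 f₁ ∧ MemL1L T ∞ f₂ ∧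
    ∀ᵐ t ∂(volume.restrict (Icc (0 : ℝ) T)), ∀ᵐ x : Space d,
      ‖b t x‖ / (1 + ‖x‖) = f₁ t x + f₂ t x

/-- An `ℝᵈ`-valued stochastic process on `[0,T]` with almost surely continuous paths of bounded
variation. -/
structure IsContinuousBVProcess {d : ℕ} {Ω : Type*} [MeasurableSpace Ω] (P : Measure Ω)
    (T : ℝ) (B : ℝ → Ω → Space d) : Prop where
  measurable : ∀ t ∈ Icc (0 : ℝ) T, Measurable (B t)
  continuous : ∀ᵐ ω ∂P, ContinuousOn (fun t => B t ω) (Icc (0 : ℝ) T)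
  boundedVariation : ∀ᵐ ω ∂P, BoundedVariationOn (fun t => B t ω) (Icc (0 : ℝ) T)

open scoped Classical in
/-- The Lebesgue–Stieltjes integral `∫₀ᵗ f(s) dg(s)`, for `t ∈ [0,T]` and `g : [0,T] → ℝ` continuous
of bounded variation: the integral over `(0,t]` against the signed Stieltjes measure of `g`, after
`g` is extended from `[0,T]` to `ℝ` by `g 0` to the left of `0` and by `g T` to the right of `T`.
(It is set to `0` when `g` does not have bounded variation on `[0,T]`.) -/
def stieltjesIntegral (T : ℝ) (f g : ℝ → ℝ) (t : ℝ) : ℝ :=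
  if h : BoundedVariationOn (fun s => g (max 0 (min T s))) univ then
    ∫ᵛ s in Ioc (0 : ℝ) t, f s ∂•h.vectorMeasure
  else 0

/-- Weak `Lᵖ`-solutions `u ∈ L^∞(Ω × [0,T], Lᵖ(ℝᵈ))` of
`∂ₜ u + b · ∇u + ∇u · dB/dt = 0`, `u(0,·) = u₀`, where `divb` is the divergence of `b`.

`X φ` is the continuous modification of the process `t ↦ ∫ u(t,x) φ(x) dx`. Two continuous
modifications of a process are indistinguishable, so the choice of `X` is immaterial. As usual, it is
the continuous modification of `t ↦ ∫ u(t,x) Dᵢφ(x) dx` that is integrated against `dBⁱ`. -/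
def IsWeakLpSolution {d : ℕ} {Ω : Type*} [MeasurableSpace Ω] (P : Measure Ω) (T : ℝ)
    (p : ℝ≥0∞) [Fact (1 ≤ p)] (b : ℝ → Space d → Space d) (divb : ℝ → Space d → ℝ)
    (B : ℝ → Ω → Space d) (u₀ : Lp ℝ p (volume : Measure (Space d)))
    (u : ℝ → Ω → Lp ℝ p (volume : Measure (Space d))) : Prop :=
  (∀ t ∈ Icc (0 : ℝ) T, AEStronglyMeasurable (u t) P) ∧
  MemLp (fun z : Ω × ℝ => u z.2 z.1) ∞ (P.prod (volume.restrict (Icc (0 : ℝ) T))) ∧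
  ∃ X : TestFun d → ℝ → Ω → ℝ, ∀ φ : TestFun d,
    (∀ t ∈ Icc (0 : ℝ) T, ∀ᵐ ω ∂P, X φ t ω = ∫ x, u t ω x * φ x) ∧
    (∀ᵐ ω ∂P, ContinuousOn (fun t => X φ t ω) (Icc (0 : ℝ) T)) ∧
    (∀ᵐ ω ∂P, ∀ t ∈ Icc (0 : ℝ) T,
      X φ t ω = (∫ x, u₀ x * φ x)
        + (∫ s in (0 : ℝ)..t, ∫ x, fderiv ℝ φ x (b s x) * u s ω x)
        + (∫ s in (0 : ℝ)..t, ∫ x, divb s x * φ x * u s ω x)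
        + ∑ i : Fin d, stieltjesIntegral T
            (fun s => X (∂_{EuclideanSpace.single i (1 : ℝ)} φ) s ω) (fun s => B s ω i) t)

end StochTransport

end

/-!
The driving path enters only through translations: in coordinates moving along the path, that is,
tested against `φ (· - B t)` with `φ` fixed, the Stieltjes term is cancelled by the chain rule
`ito_wentzell`, and what is left is a linear transport equation with the drift in which `B` is just a
continuous parameter, `ShiftedEquation`. Both directions of this equivalence hold along almost every
path: `RegularDrift.stieltjes_equation` and `IsWeakLpSolution.shiftedEquation`.

Uniqueness is the method of DiPerna and Lions. The commutator of transport and mollification tends to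
zero in `L¹` locally, because `b` has a Sobolev derivative (`tendsto_lintegral_commutator`), so
`j ∘ u` solves the equation whenever `u` does, for smooth bounded `j` (`RegularDrift.renormalized`).
Integrating `j ∘ u`, with `j` approximating the indicator function of `{|s| > l}`, against an
integrable weight which tends to the constant `1`, the growth condition makes the error due to the
gradient of the weight vanish, and Gronwall's lemma bounds the measure of `{|u t| > l}` by a constant
times that of `{|u₀| > l}`, for every `l ≥ 0`. The constant does not depend on the path
(`RegularDrift.volume_superlevel_le`). Integration over `l` is the stability estimate in `Lᵖ`
(`RegularDrift.eLpNorm_le`); applied to the difference of two solutions it gives uniqueness.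

Existence for bounded `u₀` is the dual statement. Sums of functions `η t * ψ (x - B t)` with
`η T = 0` satisfy an `L¹` estimate in terms of their image under the adjoint equation
(`RegularDrift.integral_abs_le_of_dual`). Hence the functional that the initial value defines on such
images is bounded in `L¹`, and it extends, by the Hahn-Banach theorem, to one that is represented by a
bounded function (`exists_bounded_density`). This is the solution. The argument is run on
`Ω × [0,T] × ℝᵈ` at once, so that the solution is jointly measurable without any selection
(`RegularDrift.exists_dual_density`, `RegularDrift.exists_bounded_solution`). For `u₀` in `Lᵖ`,
approximate by bounded functions: by stability the solutions converge in `Lᵖ`, along every path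
and at every time (`RegularDrift.limit_solution`).
-/

noncomputable section

namespace StochTransport

open Filter Topology
open scoped ContDiff Convolution

/-! ### Functions of one variable: telescoping, chain rule, Gronwall -/

/-- A function whose increments are, on short intervals, at most any prescribed fraction of the
increments of a fixed function `V` is constant. -/
theorem eq_of_increments_small {T : ℝ} {f V : ℝ → ℝ}
    (h : ∀ ε > 0, ∃ δ > 0, ∀ s t, 0 ≤ s → s ≤ t → t ≤ T → t - s < δ →
      |f t - f s| ≤ ε * (V t - V s)) {t : ℝ} (ht : t ∈ Icc 0 T) : f t = f 0 := by
  have key : ∀ ε > 0, |f t - f 0| ≤ ε * (V t - V 0) := by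
    intro ε hε
    obtain ⟨δ, hδ, H⟩ := h ε hε
    obtain ⟨n, hn⟩ := exists_nat_gt (t / δ)
    have hn0 : (0 : ℝ) < n + 1 := by positivity
    have hstep : ∀ k : ℕ, k ≤ n + 1 →
        |f (k * (t / (n + 1))) - f 0| ≤ ε * (V (k * (t / (n + 1))) - V 0) := by
      intro k
      induction k with
      | zero => intro _; simp
      | succ k ih =>
        intro hk
        have ih := ih (by omega)
        have ht0 : 0 ≤ t / (n + 1) := div_nonneg ht.1 hn0.le
        have hk' : ((k + 1 : ℕ) : ℝ) ≤ n + 1 := by exact_mod_cast hk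
        have h1 := H (k * (t / (n + 1))) ((k + 1 : ℕ) * (t / (n + 1))) (by positivity)
          (by push_cast; nlinarith)
          (by
            calc ((k + 1 : ℕ) : ℝ) * (t / (n + 1)) ≤ (n + 1) * (t / (n + 1)) := by gcongr
              _ = t := by field_simp
              _ ≤ T := ht.2)
          (by
            have : ((k + 1 : ℕ) : ℝ) * (t / (n + 1)) - k * (t / (n + 1)) = t / (n + 1) := by
              push_cast; ring
            rw [this, div_lt_iff₀ hn0]
            rw [div_lt_iff₀ hδ] at hn
            nlinarith)
        calc _ ≤ |f ((k + 1 : ℕ) * (t / (n + 1))) - f (k * (t / (n + 1)))|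
              + |f (k * (t / (n + 1))) - f 0| := abs_sub_le _ _ _
          _ ≤ _ := by linarith
    have := hstep (n + 1) le_rfl
    have e : ((n + 1 : ℕ) : ℝ) * (t / (n + 1)) = t := by push_cast; field_simp
    rwa [e] at this
  have h0 : |f t - f 0| ≤ 0 := by
    have hV : 0 ≤ V t - V 0 := by
      have := key 1 one_pos
      linarith [abs_nonneg (f t - f 0)]
    refine le_of_forall_pos_le_add fun ε hε => ?_
    have := key (ε / (V t - V 0 + 1)) (by positivity)
    refine this.trans ?_
    rw [div_mul_eq_mul_div, zero_add, div_le_iff₀ (by positivity)]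
    nlinarith
  exact sub_eq_zero.1 (abs_nonpos_iff.1 h0)

theorem intervalIntegrable_of_mem {T : ℝ} {g : ℝ → ℝ}
    (hg : IntegrableOn g (Icc 0 T)) {s t : ℝ} (hs : s ∈ Icc 0 T) (ht : t ∈ Icc 0 T) :
    IntervalIntegrable g volume s t :=
  (hg.mono_set (ordConnected_Icc.uIcc_subset hs ht)).intervalIntegrable

theorem continuousOn_of_eq_primitive {T : ℝ} {F g : ℝ → ℝ} (hg : IntegrableOn g (Icc 0 T))
    (hF : ∀ t ∈ Icc 0 T, F t = F 0 + ∫ s in (0 : ℝ)..t, g s) : ContinuousOn F (Icc 0 T) := by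
  rcases lt_or_ge T 0 with h | h
  · rw [Icc_eq_empty (not_le.2 h)]
    exact continuousOn_empty F
  have h1 : ContinuousOn (fun t => F 0 + ∫ s in (0 : ℝ)..t, g s) (Icc 0 T) :=
    continuousOn_const.add ((intervalIntegral.continuousOn_primitive_interval' (b₁ := 0) (b₂ := T)
      (intervalIntegrable_of_mem hg ⟨le_rfl, h⟩ ⟨h, le_rfl⟩) left_mem_uIcc).mono Icc_subset_uIcc)
  exact h1.congr hF

/-- The chain rule for an absolutely continuous function, given as a primitive. -/
theorem comp_eq_integral_of_eq_primitive {T m M : ℝ} {F g j j' : ℝ → ℝ}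
    (hg : IntegrableOn g (Icc 0 T))
    (hF : ∀ t ∈ Icc 0 T, F t = F 0 + ∫ s in (0 : ℝ)..t, g s)
    (hm : ∀ t ∈ Icc 0 T, F t ∈ Icc m M)
    (hj : ∀ z ∈ Icc m M, HasDerivWithinAt j (j' z) (Icc m M) z) (hj' : ContinuousOn j' (Icc m M))
    {t : ℝ} (ht : t ∈ Icc 0 T) :
    IntegrableOn (fun s => j' (F s) * g s) (Icc 0 T) ∧
    j (F t) = j (F 0) + ∫ s in (0 : ℝ)..t, j' (F s) * g s := by
  have hT : (0 : ℝ) ≤ T := ht.1.trans ht.2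
  have hFc : ContinuousOn F (Icc 0 T) := continuousOn_of_eq_primitive hg hF
  have hjF : ContinuousOn (fun s => j' (F s)) (Icc 0 T) := hj'.comp hFc hm
  have hint : IntegrableOn (fun s => j' (F s) * g s) (Icc 0 T) :=
    hg.continuousOn_mul hjF isCompact_Icc
  refine ⟨hint, ?_⟩
  have hUj := isCompact_Icc.uniformContinuousOn_of_continuous hj'
  have hUF := isCompact_Icc.uniformContinuousOn_of_continuous hFc
  have := eq_of_increments_small (T := T)
    (f := fun t => j (F t) - ∫ s in (0 : ℝ)..t, j' (F s) * g s)
    (V := fun t => ∫ s in (0 : ℝ)..t, |g s|) ?_ ht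
  · simp only [intervalIntegral.integral_same, sub_zero] at this
    linarith
  intro ε hε
  rw [Metric.uniformContinuousOn_iff] at hUj hUF
  obtain ⟨δ₁, hδ₁, H₁⟩ := hUj (ε / 2) (by positivity)
  obtain ⟨δ₂, hδ₂, H₂⟩ := hUF δ₁ hδ₁
  refine ⟨δ₂, hδ₂, fun s t hs hst htT hd => ?_⟩
  have hsm : s ∈ Icc 0 T := ⟨hs, hst.trans htT⟩
  have htm : t ∈ Icc 0 T := ⟨hs.trans hst, htT⟩
  have h0m : (0 : ℝ) ∈ Icc 0 T := ⟨le_rfl, hT⟩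
  have hgi := intervalIntegrable_of_mem hg hsm htm
  have e1 : (∫ r in (0 : ℝ)..t, j' (F r) * g r) - ∫ r in (0 : ℝ)..s, j' (F r) * g r
      = ∫ r in s..t, j' (F r) * g r :=
    intervalIntegral.integral_interval_sub_left (intervalIntegrable_of_mem hint h0m htm)
      (intervalIntegrable_of_mem hint h0m hsm)
  have e2 : (∫ r in (0 : ℝ)..t, |g r|) - ∫ r in (0 : ℝ)..s, |g r| = ∫ r in s..t, |g r| :=
    intervalIntegral.integral_interval_sub_left (intervalIntegrable_of_mem hg.abs h0m htm)
      (intervalIntegrable_of_mem hg.abs h0m hsm)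
  have e3 : F t - F s = ∫ r in s..t, g r := by
    rw [hF t htm, hF s hsm, add_sub_add_left_eq_sub]
    exact intervalIntegral.integral_interval_sub_left (intervalIntegrable_of_mem hg h0m htm)
      (intervalIntegrable_of_mem hg h0m hsm)
  have hb : |F t - F s| ≤ ∫ r in s..t, |g r| := by
    rw [e3]; exact intervalIntegral.abs_integral_le_integral_abs hst
  have hclose : ∀ r ∈ Icc s t, |j' (F r) - j' (F s)| ≤ ε / 2 := by
    intro r hr
    have hrm : r ∈ Icc 0 T := ⟨hs.trans hr.1, hr.2.trans htT⟩
    have := H₂ r hrm s hsm (by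
      rw [Real.dist_eq, abs_of_nonneg (by linarith [hr.1])]; linarith [hr.2])
    exact (H₁ _ (hm r hrm) _ (hm s hsm) this).le
  have hj1 : |j (F t) - j (F s) - j' (F s) * (F t - F s)| ≤ ε / 2 * |F t - F s| := by
    have hsub : uIcc (F s) (F t) ⊆ Icc m M := ordConnected_Icc.uIcc_subset (hm s hsm) (hm t htm)
    have := (convex_uIcc (F s) (F t)).norm_image_sub_le_of_norm_hasDerivWithin_le
      (f := fun z => j z - j' (F s) * z) (f' := fun z => j' z - j' (F s)) (C := ε / 2)
      (x := F s) (y := F t) (fun z hz => ?_) (fun z hz => ?_) left_mem_uIcc right_mem_uIcc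
    · simp only [Real.norm_eq_abs] at this
      convert this using 2
      ring
    · have hd := ((hj z (hsub hz)).mono hsub).sub
        ((hasDerivWithinAt_id z _).const_mul (j' (F s)))
      rw [mul_one] at hd
      exact hd
    · have h3 := H₂ t htm s hsm (by
        rw [Real.dist_eq, abs_of_nonneg (by linarith)]; linarith)
      refine (H₁ _ (hsub hz) _ (hm s hsm) (lt_of_le_of_lt ?_ h3)).le
      rw [dist_comm z, dist_comm (F t)]
      exact Real.dist_left_le_of_mem_uIcc hz
  have hj2 : |∫ r in s..t, (j' (F r) - j' (F s)) * g r| ≤ ε / 2 * ∫ r in s..t, |g r| := by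
    rw [← intervalIntegral.integral_const_mul, ← Real.norm_eq_abs]
    refine intervalIntegral.norm_integral_le_of_norm_le hst (ae_of_all _ fun r hr => ?_)
      (hgi.abs.const_mul _)
    rw [Real.norm_eq_abs, abs_mul]
    exact mul_le_mul_of_nonneg_right (hclose r ⟨hr.1.le, hr.2⟩) (abs_nonneg _)
  have e4 : ∫ r in s..t, (j' (F r) - j' (F s)) * g r
      = (∫ r in s..t, j' (F r) * g r) - j' (F s) * (F t - F s) := by
    rw [e3, ← intervalIntegral.integral_const_mul,
      ← intervalIntegral.integral_sub (intervalIntegrable_of_mem hint hsm htm) (hgi.const_mul _)]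
    congr 1; ext r; ring
  rw [e4] at hj2
  rw [e2]
  have e5 : (j (F t) - ∫ r in (0 : ℝ)..t, j' (F r) * g r)
      - (j (F s) - ∫ r in (0 : ℝ)..s, j' (F r) * g r)
      = (j (F t) - j (F s) - j' (F s) * (F t - F s))
        - ((∫ r in s..t, j' (F r) * g r) - j' (F s) * (F t - F s)) := by linarith
  rw [e5]
  refine (abs_sub _ _).trans ?_
  nlinarith

/-- Gronwall's inequality in integral form, with an integrable coefficient. -/
theorem gronwall_integral {T A : ℝ} {a y : ℝ → ℝ} (hA : 0 ≤ A)
    (ha : IntegrableOn a (Icc 0 T)) (hay : IntegrableOn (fun s => a s * y s) (Icc 0 T))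
    (ha0 : ∀ s, 0 ≤ a s) (hy0 : ∀ s, 0 ≤ y s)
    (hy : ∀ᵐ s ∂(volume.restrict (Icc 0 T)), y s ≤ A + ∫ r in (0 : ℝ)..s, a r * y r)
    {t : ℝ} (ht : t ∈ Icc 0 T) :
    A + ∫ r in (0 : ℝ)..t, a r * y r ≤ A * Real.exp (∫ r in (0 : ℝ)..T, a r) := by
  have hT : (0 : ℝ) ≤ T := ht.1.trans ht.2
  have h0m : (0 : ℝ) ∈ Icc 0 T := ⟨le_rfl, hT⟩
  have hTm : T ∈ Icc 0 T := ⟨hT, le_rfl⟩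
  have hmono : ∀ s ∈ Icc 0 T, ∫ r in (0 : ℝ)..s, a r * y r ≤ ∫ r in (0 : ℝ)..T, a r * y r := by
    intro s hs
    exact intervalIntegral.integral_mono_interval le_rfl hs.1 hs.2
      (ae_of_all _ fun r => mul_nonneg (ha0 r) (hy0 r)) (intervalIntegrable_of_mem hay h0m hTm)
  have hnn : ∀ s ∈ Icc 0 T, 0 ≤ ∫ r in (0 : ℝ)..s, a r * y r := fun s hs =>
    intervalIntegral.integral_nonneg hs.1 fun r _ => mul_nonneg (ha0 r) (hy0 r)
  have key : ∀ ε > 0, A + ∫ r in (0 : ℝ)..t, a r * y r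
      ≤ (A + ε) * Real.exp (∫ r in (0 : ℝ)..T, a r) := by
    intro ε hε
    set F : ℝ → ℝ := fun t => A + ε + ∫ r in (0 : ℝ)..t, a r * y r with hFdef
    have hF0 : F 0 = A + ε := by simp [hFdef]
    have hFpos : ∀ s ∈ Icc 0 T, ε ≤ F s := fun s hs => by
      have := hnn s hs
      simp only [hFdef]; linarith
    obtain ⟨hi, hlog⟩ := comp_eq_integral_of_eq_primitive (F := F) (m := ε) (M := F T)
      (j := Real.log) (j' := fun z => z⁻¹) hay (fun s _ => by rw [hF0])
      (fun s hs => ⟨hFpos s hs, by have := hmono s hs; simp only [hFdef]; linarith⟩)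
      (fun z hz => (Real.hasDerivAt_log (by linarith [hz.1])).hasDerivWithinAt)
      (continuousOn_id.inv₀ fun z hz => by simp only [id]; linarith [hz.1]) ht
    have hle : ∫ s in (0 : ℝ)..t, (F s)⁻¹ * (a s * y s) ≤ ∫ s in (0 : ℝ)..T, a s := by
      refine le_trans ?_ (intervalIntegral.integral_mono_interval le_rfl ht.1 ht.2
        (ae_of_all _ fun r => ha0 r) (intervalIntegrable_of_mem ha h0m hTm))
      refine intervalIntegral.integral_mono_ae_restrict ht.1 (intervalIntegrable_of_mem hi h0m ht)
        (intervalIntegrable_of_mem ha h0m ht) ?_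
      have hy' := ae_restrict_of_ae_restrict_of_subset (Icc_subset_Icc_right ht.2) hy
      filter_upwards [hy', ae_restrict_mem measurableSet_Icc] with s hs hsm
      have hp := hFpos s ⟨hsm.1, hsm.2.trans ht.2⟩
      rw [inv_mul_le_iff₀ (by linarith)]
      have : y s ≤ F s := by simp only [hFdef]; linarith
      nlinarith [ha0 s]
    have h1 : Real.log (F t) ≤ Real.log (A + ε) + ∫ s in (0 : ℝ)..T, a s := by
      rw [hlog, hF0]; linarith
    have hFt : 0 < F t := hε.trans_le (hFpos t ht)
    have h2 : F t ≤ (A + ε) * Real.exp (∫ r in (0 : ℝ)..T, a r) := by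
      rw [← Real.exp_log hFt]
      refine (Real.exp_le_exp.2 h1).trans ?_
      rw [Real.exp_add, Real.exp_log (by linarith)]
    have : A + ∫ r in (0 : ℝ)..t, a r * y r ≤ F t := by simp only [hFdef]; linarith
    exact this.trans h2
  have hlim : Tendsto (fun ε : ℝ => (A + ε) * Real.exp (∫ r in (0 : ℝ)..T, a r)) (𝓝[>] 0)
      (𝓝 ((A + 0) * Real.exp (∫ r in (0 : ℝ)..T, a r))) :=
    (((continuous_const.add continuous_id).mul continuous_const).tendsto 0).mono_left
      nhdsWithin_le_nhds
  rw [add_zero] at hlim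
  exact ge_of_tendsto hlim (eventually_mem_nhdsWithin.mono fun ε hε => key ε hε)

/-! ### Stieltjes integrals against continuous functions of bounded variation -/

section Stieltjes

variable {T : ℝ} {g : ℝ → ℝ}

theorem boundedVariationOn_clamp (hT : 0 ≤ T) (hg : BoundedVariationOn g (Icc 0 T)) :
    BoundedVariationOn (fun s => g (max 0 (min T s))) univ := by
  refine ne_top_of_le_ne_top hg (eVariationOn.comp_le_of_monotoneOn g
    (φ := fun s => max 0 (min T s)) ?_ ?_)
  · exact fun a _ b _ hab => max_le_max le_rfl (min_le_min le_rfl hab)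
  · exact fun s _ => ⟨le_max_left _ _, max_le hT (min_le_left _ _)⟩

theorem continuous_clamp (hT : 0 ≤ T) {X : Type*} [TopologicalSpace X] {g : ℝ → X}
    (hg : ContinuousOn g (Icc 0 T)) : Continuous (fun s => g (max 0 (min T s))) :=
  hg.comp_continuous (f := fun s => max 0 (min T s)) (by fun_prop) fun _ => ⟨le_max_left _ _, max_le hT (min_le_left _ _)⟩

theorem clamp_eq {s : ℝ} (hs : s ∈ Icc 0 T) : max 0 (min T s) = s := by
  rw [min_eq_right hs.2, max_eq_right hs.1]

instance isFiniteMeasure_variation {X : Type*} [MeasurableSpace X] (μ : SignedMeasure X) :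
    IsFiniteMeasure (VectorMeasure.variation μ) := by
  rw [← SignedMeasure.totalVariation_eq_variation]
  unfold SignedMeasure.totalVariation
  infer_instance

/-- The properties of the Stieltjes integral `t ↦ ∫₀ᵗ f dg` that are used below: linearity in the
integrand, `∫₀ᵗ dg = g t - g 0`, and a bound on increments by those of a fixed function. -/
structure IsIntegrator (T : ℝ) (g : ℝ → ℝ) (I : (ℝ → ℝ) → ℝ → ℝ) (V : ℝ → ℝ) : Prop where
  sub : ∀ f₁ f₂, ContinuousOn f₁ (Icc 0 T) → ContinuousOn f₂ (Icc 0 T) → ∀ t ∈ Icc 0 T,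
    I (fun s => f₁ s - f₂ s) t = I f₁ t - I f₂ t
  const : ∀ c, ∀ t ∈ Icc 0 T, I (fun _ => c) t = c * (g t - g 0)
  zero : ∀ f, I f 0 = 0
  bound : ∀ f C s t, ContinuousOn f (Icc 0 T) → 0 ≤ s → s ≤ t → t ≤ T →
    (∀ r ∈ Ioc s t, |f r| ≤ C) → |I f t - I f s| ≤ C * (V t - V s)
  mono : ∀ s t, 0 ≤ s → s ≤ t → t ≤ T → V s ≤ V t

/-- The only properties of the Stieltjes integral that the argument needs. The dominating function
`V` is the variation of the path. -/
theorem exists_isIntegrator_stieltjesIntegral (hT : 0 ≤ T) (hg : BoundedVariationOn g (Icc 0 T))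
    (hgc : ContinuousOn g (Icc 0 T)) :
    ∃ V, IsIntegrator T g (fun f t => stieltjesIntegral T f g t) V := by
  have h := boundedVariationOn_clamp hT hg
  have hc := continuous_clamp hT hgc
  set μ := h.vectorMeasure with hμ
  have hS : ∀ f t, stieltjesIntegral T f g t = ∫ᵛ s in Ioc (0 : ℝ) t, f s ∂•μ := by
    intro f t
    rw [stieltjesIntegral, dif_pos h]
  have hI : ∀ (f : ℝ → ℝ) (s t : ℝ), ContinuousOn f (Icc 0 T) → 0 ≤ s → t ≤ T →
      μ.IntegrableOn f (Ioc s t) := by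
    intro f s t hf hs ht
    have : IntegrableOn f (Icc 0 T) (VectorMeasure.variation μ) :=
      hf.integrableOn_compact isCompact_Icc
    have h2 := this.mono_set (Ioc_subset_Icc_self.trans (Icc_subset_Icc hs ht) : Ioc s t ⊆ _)
    rw [IntegrableOn, ← VectorMeasure.variation_restrict measurableSet_Ioc] at h2
    exact h2
  have hadd : ∀ (f : ℝ → ℝ) (s t : ℝ), ContinuousOn f (Icc 0 T) → 0 ≤ s → s ≤ t → t ≤ T →
      stieltjesIntegral T f g t - stieltjesIntegral T f g s = ∫ᵛ r in Ioc s t, f r ∂•μ := by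
    intro f s t hf hs hst ht
    rw [hS, hS, ← Ioc_union_Ioc_eq_Ioc hs hst, VectorMeasure.setIntegral_union
      (Ioc_disjoint_Ioc_of_le le_rfl) measurableSet_Ioc measurableSet_Ioc
      (hI f 0 s hf le_rfl (hst.trans ht)) (hI f s t hf hs ht)]
    ring
  refine ⟨fun t => (VectorMeasure.variation μ).real (Ioc 0 t), ?_, ?_, ?_, ?_, ?_⟩
  · intro f₁ f₂ h₁ h₂ t ht
    simp only [hS]
    exact VectorMeasure.integral_fun_sub (hI f₁ 0 t h₁ le_rfl ht.2) (hI f₂ 0 t h₂ le_rfl ht.2)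
  · intro c t ht
    simp only [hS]
    rw [VectorMeasure.setIntegral_const, hμ, h.vectorMeasure_Ioc ht.1]
    rw [hc.continuousWithinAt.rightLim_eq, hc.continuousWithinAt.rightLim_eq]
    simp only [clamp_eq ht, clamp_eq (left_mem_Icc.2 hT)]
    simp
  · intro f
    simp [hS]
  · intro f C s t hf hs hst ht hC
    rw [hadd f s t hf hs hst ht, ← Ioc_union_Ioc_eq_Ioc hs hst, measureReal_union
      (Ioc_disjoint_Ioc_of_le le_rfl) measurableSet_Ioc, add_sub_cancel_left]
    have h1 := VectorMeasure.norm_setIntegral_le_of_norm_le_const (μ := μ)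
      (B := ContinuousLinearMap.lsmul ℝ ℝ) (s := Ioc s t) (f := f) (C := C) hC
    rw [ContinuousLinearMap.opNorm_lsmul, mul_one] at h1
    exact h1
  · intro s t hs hst ht
    exact measureReal_mono (Ioc_subset_Ioc_right hst)

end Stieltjes

theorem IsIntegrator.abs_le {T : ℝ} {g : ℝ → ℝ} {I : (ℝ → ℝ) → ℝ → ℝ} {V : ℝ → ℝ}
    (h : IsIntegrator T g I V) {f : ℝ → ℝ} {C t : ℝ} (hf : ContinuousOn f (Icc 0 T))
    (ht : t ∈ Icc 0 T) (hC : ∀ r ∈ Icc 0 T, |f r| ≤ C) : |I f t| ≤ C * (V t - V 0) := by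
  have := h.bound f C 0 t hf le_rfl ht.1 ht.2 fun r hr => hC r ⟨hr.1.le, hr.2.trans ht.2⟩
  rwa [h.zero, sub_zero] at this

/-- Joint continuity along a path of a function which is continuous in time and Lipschitz in space. -/
theorem continuousOn_comp_path {d : ℕ} {T C : ℝ} {β : ℝ → Space d} (hβ : ContinuousOn β (Icc 0 T))
    {K : Set (Space d)} (hK : ∀ s ∈ Icc 0 T, β s ∈ K) {f : ℝ → Space d → ℝ}
    (hfc : ∀ y ∈ K, ContinuousOn (fun s => f s y) (Icc 0 T))
    (hfL : ∀ s ∈ Icc 0 T, ∀ y ∈ K, ∀ z ∈ K, |f s y - f s z| ≤ C * ‖y - z‖) :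
    ContinuousOn (fun s => f s (β s)) (Icc 0 T) := by
  intro s₀ hs₀
  have h1 : Tendsto (fun s => f s (β s₀)) (𝓝[Icc 0 T] s₀) (𝓝 (f s₀ (β s₀))) :=
    hfc _ (hK _ hs₀) s₀ hs₀
  have h2 : Tendsto (fun s => C * ‖β s - β s₀‖) (𝓝[Icc 0 T] s₀) (𝓝 0) := by
    have : Tendsto β (𝓝[Icc 0 T] s₀) (𝓝 (β s₀)) := hβ s₀ hs₀
    simpa using ((this.sub_const (β s₀)).norm).const_mul C
  have h3 : Tendsto (fun s => f s (β s) - f s (β s₀)) (𝓝[Icc 0 T] s₀) (𝓝 0) :=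
    squeeze_zero_norm' (eventually_mem_nhdsWithin.mono fun s hs =>
      hfL s hs _ (hK s hs) _ (hK _ hs₀)) h2
  have := h3.add h1
  simp only [sub_add_cancel, zero_add] at this
  exact this

/-- A chain rule for `t ↦ H(t, β(t))`, where `β` is a continuous path of bounded variation and
`t ↦ H(t,y)` is, for every `y`, the sum of an absolutely continuous function and of Stieltjes
integrals against the coordinates of `β`: the bounded variation form of the Itô–Wentzell formula.
The functions `k i` are the partial derivatives of `H` in `y`. All hypotheses concern only points `y`
of a set `K` in which the path stays. -/
theorem ito_wentzell {d : ℕ} {T : ℝ} {β : ℝ → Space d} (hβ : ContinuousOn β (Icc 0 T))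
    {K : Set (Space d)} (hK : ∀ s ∈ Icc 0 T, β s ∈ K)
    {I : Fin d → (ℝ → ℝ) → ℝ → ℝ} {V : Fin d → ℝ → ℝ}
    (hI : ∀ i, IsIntegrator T (fun s => β s i) (I i) (V i))
    {H g : ℝ → Space d → ℝ} {h k : Fin d → ℝ → Space d → ℝ} {m : ℝ → ℝ} {C : ℝ}
    (hH : ∀ y ∈ K, ∀ t ∈ Icc 0 T,
      H t y = H 0 y + (∫ s in (0 : ℝ)..t, g s y) + ∑ i, I i (fun s => h i s y) t)
    (hm : IntegrableOn m (Icc 0 T)) (hm0 : ∀ s, 0 ≤ m s) (hC : 0 ≤ C)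
    (hgi : ∀ y ∈ K, IntegrableOn (fun s => g s y) (Icc 0 T))
    (hgβ : IntegrableOn (fun s => g s (β s)) (Icc 0 T))
    (hgm : ∀ᵐ s ∂(volume.restrict (Icc 0 T)), ∀ y ∈ K, ∀ z ∈ K,
      |g s y - g s z| ≤ m s * ‖y - z‖)
    (hhc : ∀ i, ∀ y ∈ K, ContinuousOn (fun s => h i s y) (Icc 0 T))
    (hhL : ∀ i, ∀ s ∈ Icc 0 T, ∀ y ∈ K, ∀ z ∈ K, |h i s y - h i s z| ≤ C * ‖y - z‖)
    (hkc : ∀ i, ∀ y ∈ K, ContinuousOn (fun s => k i s y) (Icc 0 T))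
    (hkL : ∀ i, ∀ s ∈ Icc 0 T, ∀ y ∈ K, ∀ z ∈ K, |k i s y - k i s z| ≤ C * ‖y - z‖)
    (hk : ∀ s ∈ Icc 0 T, ∀ y ∈ K, ∀ z ∈ K,
      |H s z - H s y - ∑ i, k i s y * (z i - y i)| ≤ C * ‖z - y‖ ^ 2)
    {t : ℝ} (ht : t ∈ Icc 0 T) :
    H t (β t) = H 0 (β 0) + (∫ s in (0 : ℝ)..t, g s (β s))
      + ∑ i, I i (fun s => h i s (β s) + k i s (β s)) t := by
  have hT : (0 : ℝ) ≤ T := ht.1.trans ht.2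
  have h0m : (0 : ℝ) ∈ Icc 0 T := ⟨le_rfl, hT⟩
  have hhβ : ∀ i, ContinuousOn (fun s => h i s (β s)) (Icc 0 T) := fun i =>
    continuousOn_comp_path hβ hK (hhc i) (hhL i)
  have hkβ : ∀ i, ContinuousOn (fun s => k i s (β s)) (Icc 0 T) := fun i =>
    continuousOn_comp_path hβ hK (hkc i) (hkL i)
  have := eq_of_increments_small (T := T)
    (f := fun t => H t (β t) - (∫ s in (0 : ℝ)..t, g s (β s))
      - ∑ i, I i (fun s => h i s (β s) + k i s (β s)) t)
    (V := fun t => (∫ s in (0 : ℝ)..t, m s) + ∑ i, (2 * C + 1) * V i t) ?_ ht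
  · simp only [intervalIntegral.integral_same, sub_zero, (hI _).zero, Finset.sum_const_zero] at this
    linarith
  intro ε hε
  -- uniform continuity of the path and of the derivatives along it
  have hUβ := isCompact_Icc.uniformContinuousOn_of_continuous hβ
  rw [Metric.uniformContinuousOn_iff] at hUβ
  obtain ⟨δ₁, hδ₁, H₁⟩ := hUβ ε hε
  have hUk : ∃ δ > 0, ∀ i, ∀ x ∈ Icc 0 T, ∀ y ∈ Icc 0 T, dist x y < δ →
      dist (k i x (β x)) (k i y (β y)) < ε := by
    have hU : UniformContinuousOn (fun s => fun i => k i s (β s)) (Icc 0 T) :=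
      isCompact_Icc.uniformContinuousOn_of_continuous (continuousOn_pi.2 hkβ)
    rw [Metric.uniformContinuousOn_iff] at hU
    obtain ⟨δ, hδ, h⟩ := hU ε hε
    exact ⟨δ, hδ, fun i x hx y hy hxy => (dist_le_pi_dist _ _ i).trans_lt (h x hx y hy hxy)⟩
  obtain ⟨δ₂, hδ₂, H₂⟩ := hUk
  refine ⟨min δ₁ δ₂, lt_min hδ₁ hδ₂, fun s t hs hst htT hd => ?_⟩
  have hsm : s ∈ Icc 0 T := ⟨hs, hst.trans htT⟩
  have htm : t ∈ Icc 0 T := ⟨hs.trans hst, htT⟩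
  have hdist : ∀ r ∈ Icc s t, ∀ r' ∈ Icc s t, dist r r' < min δ₁ δ₂ := fun r hr r' hr' =>
    (Real.dist_le_of_mem_Icc hr hr').trans_lt hd
  have hmem : ∀ r ∈ Icc s t, r ∈ Icc 0 T := fun r hr => ⟨hs.trans hr.1, hr.2.trans htT⟩
  have hβc : ∀ r ∈ Icc s t, ∀ r' ∈ Icc s t, ‖β r - β r'‖ ≤ ε := fun r hr r' hr' => by
    rw [← dist_eq_norm]
    exact (H₁ r (hmem r hr) r' (hmem r' hr') ((hdist r hr r' hr').trans_le (min_le_left _ _))).le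
  have hkc' : ∀ i, ∀ r ∈ Icc s t, |k i s (β s) - k i r (β r)| ≤ ε := fun i r hr =>
    (H₂ i s hsm r (hmem r hr)
      ((hdist s ⟨le_rfl, hst⟩ r hr).trans_le (min_le_right _ _))).le
  have hsI : s ∈ Icc s t := ⟨le_rfl, hst⟩
  have htI : t ∈ Icc s t := ⟨hst, le_rfl⟩
  -- the drift part
  have eg : ∀ y ∈ K, (∫ r in (0 : ℝ)..t, g r y) - ∫ r in (0 : ℝ)..s, g r y = ∫ r in s..t, g r y :=
    fun y hy => intervalIntegral.integral_interval_sub_left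
      (intervalIntegrable_of_mem (hgi y hy) h0m htm) (intervalIntegrable_of_mem (hgi y hy) h0m hsm)
  have egβ : (∫ r in (0 : ℝ)..t, g r (β r)) - ∫ r in (0 : ℝ)..s, g r (β r)
      = ∫ r in s..t, g r (β r) :=
    intervalIntegral.integral_interval_sub_left
      (intervalIntegrable_of_mem hgβ h0m htm) (intervalIntegrable_of_mem hgβ h0m hsm)
  have em : (∫ r in (0 : ℝ)..t, m r) - ∫ r in (0 : ℝ)..s, m r = ∫ r in s..t, m r :=
    intervalIntegral.integral_interval_sub_left
      (intervalIntegrable_of_mem hm h0m htm) (intervalIntegrable_of_mem hm h0m hsm)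
  have b1 : |(∫ r in s..t, g r (β t)) - ∫ r in s..t, g r (β r)| ≤ ε * ∫ r in s..t, m r := by
    rw [← intervalIntegral.integral_sub (intervalIntegrable_of_mem (hgi _ (hK t htm)) hsm htm)
      (intervalIntegrable_of_mem hgβ hsm htm), ← intervalIntegral.integral_const_mul,
      ← Real.norm_eq_abs]
    refine intervalIntegral.norm_integral_le_of_norm_le hst ?_
      ((intervalIntegrable_of_mem hm hsm htm).const_mul _)
    rw [ae_restrict_iff' measurableSet_Icc] at hgm
    filter_upwards [hgm] with r hr hrst
    have hrI : r ∈ Icc s t := ⟨hrst.1.le, hrst.2⟩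
    rw [Real.norm_eq_abs]
    refine (hr (hmem r hrI) _ (hK t htm) _ (hK r (hmem r hrI))).trans ?_
    have hle := hβc t htI r hrI
    have := mul_le_mul_of_nonneg_left hle (hm0 r)
    linarith
  -- the Stieltjes parts
  have b2 : ∀ i, |(I i (fun r => h i r (β t)) t - I i (fun r => h i r (β t)) s)
      - (I i (fun r => h i r (β r) + k i r (β r)) t - I i (fun r => h i r (β r) + k i r (β r)) s)
      + k i s (β s) * (β t i - β s i)| ≤ ε * (C + 1) * (V i t - V i s) := by
    intro i
    have c1 : ContinuousOn (fun r => h i r (β r) + k i r (β r)) (Icc 0 T) := (hhβ i).add (hkβ i)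
    have c2 : ContinuousOn (fun r => h i r (β t) - (h i r (β r) + k i r (β r))) (Icc 0 T) :=
      (hhc i _ (hK t htm)).sub c1
    have c3 : ContinuousOn (fun _ : ℝ => - k i s (β s)) (Icc 0 T) := continuousOn_const
    have c4 : ContinuousOn (fun r => h i r (β t) - (h i r (β r) + k i r (β r))
        - (- k i s (β s))) (Icc 0 T) := c2.sub c3
    have e1 : ∀ r ∈ Icc 0 T, I i (fun r => h i r (β t) - (h i r (β r) + k i r (β r))
        - (- k i s (β s))) r = I i (fun r => h i r (β t)) r
          - I i (fun r => h i r (β r) + k i r (β r)) r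
          - (- k i s (β s)) * (β r i - β 0 i) := by
      intro r hr
      rw [(hI i).sub _ _ c2 c3 r hr, (hI i).sub _ _ (hhc i _ (hK t htm)) c1 r hr, (hI i).const _ r hr]
    have := (hI i).bound _ (ε * (C + 1)) s t c4 hs hst htT (fun r hr => by
      have hrI : r ∈ Icc s t := ⟨hr.1.le, hr.2⟩
      have e : h i r (β t) - (h i r (β r) + k i r (β r)) - (- k i s (β s))
        = (h i r (β t) - h i r (β r)) + (k i s (β s) - k i r (β r)) := by ring
      rw [e]
      refine (abs_add_le _ _).trans ?_
      have h1 := hhL i r (hmem r hrI) (β t) (hK t htm) (β r) (hK r (hmem r hrI))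
      have h2 := hβc t htI r hrI
      have h3 := hkc' i r hrI
      nlinarith)
    rw [e1 t htm, e1 s hsm] at this
    refine le_trans (le_of_eq ?_) this
    congr 1
    ring
  have b3 : |H s (β t) - H s (β s) - ∑ i, k i s (β s) * (β t i - β s i)|
      ≤ ε * C * ∑ i, (V i t - V i s) := by
    refine (hk s hsm _ (hK s hsm) _ (hK t htm)).trans ?_
    have h1 : ‖β t - β s‖ ≤ ∑ i, (V i t - V i s) := by
      have e : β t - β s = ∑ i, (β t i - β s i) • EuclideanSpace.single i (1 : ℝ) := by
        ext j
        simp [Finset.sum_apply, Pi.single_apply]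
      rw [e]
      refine (norm_sum_le _ _).trans (Finset.sum_le_sum fun i _ => ?_)
      rw [norm_smul, PiLp.norm_single, norm_one, mul_one, Real.norm_eq_abs]
      have := (hI i).bound (fun _ => 1) 1 s t continuousOn_const hs hst htT (fun _ _ => by simp)
      rw [(hI i).const _ t htm, (hI i).const _ s hsm] at this
      simpa using this
    have h2 := hβc t htI s hsI
    have h3 := norm_nonneg (β t - β s)
    calc C * ‖β t - β s‖ ^ 2 = C * (‖β t - β s‖ * ‖β t - β s‖) := by ring
      _ ≤ C * (ε * ∑ i, (V i t - V i s)) := by gcongr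
      _ = _ := by ring
  have hHt := hH (β t) (hK t htm) t htm
  have hHs := hH (β t) (hK t htm) s hsm
  have etot : (H t (β t) - (∫ s in (0 : ℝ)..t, g s (β s))
        - ∑ i, I i (fun s => h i s (β s) + k i s (β s)) t)
      - (H s (β s) - (∫ s in (0 : ℝ)..s, g s (β s))
        - ∑ i, I i (fun s => h i s (β s) + k i s (β s)) s)
      = ((∫ r in s..t, g r (β t)) - ∫ r in s..t, g r (β r))
        + (H s (β t) - H s (β s) - ∑ i, k i s (β s) * (β t i - β s i))
        + ∑ i, ((I i (fun r => h i r (β t)) t - I i (fun r => h i r (β t)) s)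
          - (I i (fun r => h i r (β r) + k i r (β r)) t
            - I i (fun r => h i r (β r) + k i r (β r)) s)
          + k i s (β s) * (β t i - β s i)) := by
    rw [← eg _ (hK t htm), ← egβ]
    simp only [Finset.sum_add_distrib, Finset.sum_sub_distrib]
    linarith
  rw [etot]
  refine (abs_add_le _ _).trans ((add_le_add (abs_add_le _ _)
    (Finset.abs_sum_le_sum_abs _ _)).trans ?_)
  have b2' := Finset.sum_le_sum fun i (_ : i ∈ Finset.univ) => b2 i
  rw [← Finset.mul_sum] at b2'
  have e5 : (∫ r in (0 : ℝ)..t, m r) + ∑ i, (2 * C + 1) * V i t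
      - ((∫ r in (0 : ℝ)..s, m r) + ∑ i, (2 * C + 1) * V i s)
      = (∫ r in s..t, m r) + (2 * C + 1) * ∑ i, (V i t - V i s) := by
    rw [← em, ← Finset.mul_sum, ← Finset.mul_sum, Finset.sum_sub_distrib]; ring
  rw [e5]
  linarith

/-! ### Mollifiers -/

/-- A smooth compactly supported function, bundled as a test function. -/
def mkTest {d : ℕ} (f : Space d → ℝ) (hf : ContDiff ℝ ∞ f) (hc : HasCompactSupport f) :
    TestFun d :=
  ⟨f, hf, hc, subset_univ _⟩

@[simp]
theorem coe_mkTest {d : ℕ} (f : Space d → ℝ) (hf : ContDiff ℝ ∞ f) (hc : HasCompactSupport f) :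
    ⇑(mkTest f hf hc) = f := rfl

/-- The bump functions from which the mollifiers are built, of radius `1 / (n + 1)`. -/
def bump (d n : ℕ) : ContDiffBump (0 : Space d) where
  rIn := 1 / (2 * (n + 1))
  rOut := 1 / (n + 1)
  rIn_pos := by positivity
  rIn_lt_rOut := by
    apply one_div_lt_one_div_of_lt <;> first | positivity | linarith [n.cast_nonneg (α := ℝ)]

/-- The mollifiers: even, nonnegative, of integral `1`, supported in the ball of radius
`1 / (n + 1)`. -/
def mollifier (d n : ℕ) : Space d → ℝ := (bump d n).normed volume

variable {d : ℕ}

theorem contDiff_mollifier (n : ℕ) : ContDiff ℝ ∞ (mollifier d n) :=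
  (bump d n).contDiff_normed

theorem hasCompactSupport_mollifier (n : ℕ) : HasCompactSupport (mollifier d n) :=
  (bump d n).hasCompactSupport_normed

theorem mollifier_nonneg (n : ℕ) (x : Space d) : 0 ≤ mollifier d n x :=
  (bump d n).nonneg_normed x

theorem mollifier_neg (n : ℕ) (x : Space d) : mollifier d n (-x) = mollifier d n x :=
  (bump d n).normed_neg x

theorem integral_mollifier (n : ℕ) : ∫ x, mollifier d n x = 1 := (bump d n).integral_normed

theorem integrable_mollifier (n : ℕ) : Integrable (mollifier d n) := (bump d n).integrable_normed

theorem tsupport_mollifier (n : ℕ) :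
    tsupport (mollifier d n) = Metric.closedBall 0 (1 / (n + 1)) := (bump d n).tsupport_normed_eq

theorem mollifier_eq_zero (n : ℕ) {x : Space d} (hx : 1 / ((n : ℝ) + 1) < ‖x‖) :
    mollifier d n x = 0 := by
  apply image_eq_zero_of_notMem_tsupport
  rw [tsupport_mollifier]
  simpa using hx

theorem fderiv_mollifier_eq_zero (n : ℕ) {x : Space d} (hx : 1 / ((n : ℝ) + 1) < ‖x‖) :
    fderiv ℝ (mollifier d n) x = 0 := by
  apply image_eq_zero_of_notMem_tsupport
  intro h
  have := tsupport_fderiv_subset ℝ h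
  rw [tsupport_mollifier] at this
  simp only [Metric.mem_closedBall, dist_zero_right] at this
  linarith

theorem continuous_mollifier (n : ℕ) : Continuous (mollifier d n) :=
  (contDiff_mollifier n).continuous

theorem differentiable_mollifier (n : ℕ) : Differentiable ℝ (mollifier d n) :=
  (contDiff_mollifier n).differentiable (by simp)

theorem continuous_fderiv_mollifier (n : ℕ) : Continuous (fderiv ℝ (mollifier d n)) :=
  (contDiff_mollifier n).continuous_fderiv (by simp)

theorem one_div_succ_le_one (n : ℕ) : 1 / ((n : ℝ) + 1) ≤ 1 := by
  rw [div_le_one (by positivity)]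
  linarith [n.cast_nonneg (α := ℝ)]

theorem lintegral_mollifier (n : ℕ) : ∫⁻ x, ‖mollifier d n x‖ₑ = 1 := by
  have := ofReal_integral_norm_eq_lintegral_enorm (integrable_mollifier (d := d) n)
  rw [← this]
  simp_rw [Real.norm_of_nonneg (mollifier_nonneg n _)]
  rw [integral_mollifier, ENNReal.ofReal_one]

/-- All mollifiers are rescalings of the first one. -/
theorem mollifier_eq_scale (n : ℕ) (x : Space d) :
    mollifier d n x = ((n : ℝ) + 1) ^ d * mollifier d 0 (((n : ℝ) + 1) • x) := by
  have hn : (0 : ℝ) < n + 1 := by positivity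
  have h1 : ∀ x, bump d n x = bump d 0 (((n : ℝ) + 1) • x) := by
    intro x
    rw [ContDiffBump.apply, ContDiffBump.apply]
    have e1 : (bump d n).rOut / (bump d n).rIn = (bump d 0).rOut / (bump d 0).rIn := by
      simp only [bump]; field_simp
    have e2 : (bump d n).rIn⁻¹ • (x - 0) = (bump d 0).rIn⁻¹ • (((n : ℝ) + 1) • x - 0) := by
      rw [sub_zero, sub_zero, smul_smul]
      congr 1
      simp only [bump]; field_simp; norm_num
    rw [e1, e2]
  have h2 : ∫ x, bump d n x = (((n : ℝ) + 1) ^ d)⁻¹ * ∫ x, bump d 0 x := by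
    simp_rw [h1]
    rw [Measure.integral_comp_smul volume (fun x => bump d 0 x) ((n : ℝ) + 1)]
    simp [abs_of_pos hn]
  simp only [mollifier, ContDiffBump.normed_def]
  rw [h2, h1]
  field_simp

/-- The first moment of the gradient of the mollifiers is invariant under scaling. It is what makes
the commutators uniformly bounded. -/
theorem exists_moment_mollifier (d : ℕ) : ∃ C : ℝ≥0∞, C ≠ ⊤ ∧ ∀ n,
    ∫⁻ z, ‖fderiv ℝ (mollifier d n) z‖ₑ * ‖z‖ₑ ≤ C := by
  have hint : ∀ n, Integrable fun z : Space d => ‖fderiv ℝ (mollifier d n) z‖ * ‖z‖ := fun n =>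
    ((continuous_fderiv_mollifier n).norm.mul continuous_norm).integrable_of_hasCompactSupport
      (((hasCompactSupport_mollifier n).fderiv ℝ).norm.mul_right)
  refine ⟨ENNReal.ofReal (∫ z, ‖fderiv ℝ (mollifier d 0) z‖ * ‖z‖), ENNReal.ofReal_ne_top,
    fun n => ?_⟩
  have hn : (0 : ℝ) < n + 1 := by positivity
  have e : ∀ z, ‖fderiv ℝ (mollifier d n) z‖ₑ * ‖z‖ₑ
      = ENNReal.ofReal (‖fderiv ℝ (mollifier d n) z‖ * ‖z‖) := by
    intro z
    rw [ENNReal.ofReal_mul (norm_nonneg _), ofReal_norm, ofReal_norm]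
  simp_rw [e]
  rw [← ofReal_integral_eq_lintegral_ofReal (hint n) (ae_of_all _ fun _ => by positivity)]
  apply ENNReal.ofReal_le_ofReal
  have h1 : ∀ z, ‖fderiv ℝ (mollifier d n) z‖ * ‖z‖ = ((n : ℝ) + 1) ^ d *
      (‖fderiv ℝ (mollifier d 0) (((n : ℝ) + 1) • z)‖ * ‖((n : ℝ) + 1) • z‖) := by
    intro z
    have hd : fderiv ℝ (mollifier d n) z = (((n : ℝ) + 1) ^ d * ((n : ℝ) + 1)) •
        fderiv ℝ (mollifier d 0) (((n : ℝ) + 1) • z) := by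
      have h2 := (((differentiable_mollifier 0 (((n : ℝ) + 1) • z)).hasFDerivAt.comp z
        ((hasFDerivAt_id z).const_smul ((n : ℝ) + 1))).const_mul (((n : ℝ) + 1) ^ d))
      have h3 : HasFDerivAt (mollifier d n) _ z := h2.congr_of_eventuallyEq
        (Eventually.of_forall fun x => mollifier_eq_scale n x)
      rw [h3.fderiv]
      ext v
      simp
      ring
    rw [hd, norm_smul, norm_smul, Real.norm_of_nonneg (by positivity), Real.norm_of_nonneg hn.le]
    ring
  simp_rw [h1]
  rw [integral_const_mul, Measure.integral_comp_smul volume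
    (fun z => ‖fderiv ℝ (mollifier d 0) z‖ * ‖z‖) ((n : ℝ) + 1)]
  simp only [finrank_euclideanSpace, Fintype.card_fin, smul_eq_mul]
  rw [abs_of_pos (by positivity), ← mul_assoc, mul_inv_cancel₀ (by positivity), one_mul]

theorem ae_tendsto_mollifier_convolution {F : Type*} [NormedAddCommGroup F] [NormedSpace ℝ F]
    [CompleteSpace F] {f : Space d → F} (hf : LocallyIntegrable f) :
    ∀ᵐ x, Tendsto (fun n => ∫ y, mollifier d n (y - x) • f y) atTop (𝓝 (f x)) := by
  have := ContDiffBump.ae_convolution_tendsto_right_of_locallyIntegrable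
    (φ := fun n => bump d n) (l := atTop) (K := 2) (μ := volume)
    (by simpa [bump] using tendsto_one_div_add_atTop_nhds_zero_nat (𝕜 := ℝ))
    (Eventually.of_forall fun n => by simp only [bump]; field_simp; norm_num) hf
  filter_upwards [this] with x hx
  refine hx.congr fun n => ?_
  rw [convolution_eq_swap]
  refine integral_congr_ae (ae_of_all _ fun y => ?_)
  simp only [ContinuousLinearMap.lsmul_apply]
  rw [← mollifier_neg, neg_sub]
  rfl

/-! ### Difference quotients of Sobolev functions -/

theorem fderiv_mollifier_neg (n : ℕ) (x : Space d) :
    fderiv ℝ (mollifier d n) (-x) = - fderiv ℝ (mollifier d n) x := by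
  have h : HasFDerivAt (mollifier d n) (- fderiv ℝ (mollifier d n) (-x)) x := by
    have h2 := (differentiable_mollifier n (-x)).hasFDerivAt.comp x (hasFDerivAt_id x).neg
    refine (h2.congr_of_eventuallyEq (Eventually.of_forall fun y => ?_)).congr_fderiv ?_
    · exact (mollifier_neg n y).symm
    · ext v; simp
  rw [h.fderiv, neg_neg]

/-- The mollification `ρₙ * f` of a locally integrable function. -/
def mollify {F : Type*} [NormedAddCommGroup F] [NormedSpace ℝ F] (n : ℕ) (f : Space d → F)
    (x : Space d) : F :=
  ∫ y, mollifier d n (y - x) • f y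

theorem mollify_eq_convolution {F : Type*} [NormedAddCommGroup F] [NormedSpace ℝ F]
    (n : ℕ) (f : Space d → F) :
    mollify n f = (mollifier d n ⋆[ContinuousLinearMap.lsmul ℝ ℝ, volume] f) := by
  ext x
  rw [convolution_eq_swap]
  refine integral_congr_ae (ae_of_all _ fun y => ?_)
  simp only [ContinuousLinearMap.lsmul_apply]
  rw [← mollifier_neg, neg_sub]

theorem contDiff_mollify {F : Type*} [NormedAddCommGroup F] [NormedSpace ℝ F]
    [CompleteSpace F] {f : Space d → F} (hf : LocallyIntegrable f) (n : ℕ) :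
    ContDiff ℝ ∞ (mollify n f) := by
  rw [mollify_eq_convolution]
  exact (hasCompactSupport_mollifier n).contDiff_convolution_left _ (contDiff_mollifier n) hf

theorem hasFDerivAt_mollify {F : Type*} [NormedAddCommGroup F] [NormedSpace ℝ F]
    [CompleteSpace F] {f : Space d → F} (hf : LocallyIntegrable f) (n : ℕ) (x : Space d) :
    HasFDerivAt (mollify n f)
      (- ∫ y, (fderiv ℝ (mollifier d n) (y - x)).smulRight (f y)) x := by
  have h := (hasCompactSupport_mollifier n).hasFDerivAt_convolution_left
    (ContinuousLinearMap.lsmul ℝ ℝ : ℝ →L[ℝ] F →L[ℝ] F)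
    ((contDiff_mollifier n).of_le (by simp)) hf x
  rw [← mollify_eq_convolution] at h
  refine h.congr_fderiv ?_
  rw [convolution_eq_swap, ← integral_neg]
  refine integral_congr_ae (ae_of_all _ fun y => ?_)
  ext v
  simp only [ContinuousLinearMap.precompL_apply, ContinuousLinearMap.lsmul_apply]
  rw [← neg_sub y x, fderiv_mollifier_neg]
  simp

theorem integrable_smulRight_mollifier {F : Type*} [NormedAddCommGroup F] [NormedSpace ℝ F]
    {f : Space d → F} (hf : LocallyIntegrable f) (n : ℕ) (x : Space d) :
    Integrable fun y => (fderiv ℝ (mollifier d n) (y - x)).smulRight (f y) := by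
  have hc : Continuous fun y => fderiv ℝ (mollifier d n) (y - x) :=
    (continuous_fderiv_mollifier n).comp (continuous_id.sub continuous_const)
  have hs : HasCompactSupport fun y => fderiv ℝ (mollifier d n) (y - x) :=
    ((hasCompactSupport_mollifier n).fderiv ℝ).comp_homeomorph (Homeomorph.subRight x)
  have h1 : Integrable fun y => ‖fderiv ℝ (mollifier d n) (y - x)‖ • f y :=
    hf.integrable_smul_left_of_hasCompactSupport hc.norm hs.norm
  refine h1.mono ?_ (ae_of_all _ fun y => ?_)
  · exact (ContinuousLinearMap.smulRightL ℝ (Space d) F).aestronglyMeasurable_comp₂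
      hc.aestronglyMeasurable hf.aestronglyMeasurable
  · simp [norm_smul]

/-- The translation of a test function. -/
def translate (φ : TestFun d) (y : Space d) : TestFun d :=
  mkTest (fun x => φ (x - y)) (φ.contDiff.comp (contDiff_id.sub contDiff_const))
    (φ.hasCompactSupport.comp_homeomorph (Homeomorph.subRight y))

@[simp]
theorem translate_apply (φ : TestFun d) (y x : Space d) : translate φ y x = φ (x - y) := rfl

@[simp]
theorem fderiv_translate (φ : TestFun d) (y x : Space d) :
    fderiv ℝ (translate φ y) x = fderiv ℝ φ (x - y) := by
  have : ⇑(translate φ y) = fun x => φ (x - y) := rfl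
  rw [this, fderiv_comp_sub]

/-- The mollifiers as test functions. -/
def mollifierTest (d n : ℕ) : TestFun d :=
  mkTest (mollifier d n) (contDiff_mollifier n) (hasCompactSupport_mollifier n)

@[simp]
theorem coe_mollifierTest (n : ℕ) : ⇑(mollifierTest d n) = mollifier d n := rfl

/-- The derivative of a mollified Sobolev function is the mollified weak derivative. -/
theorem HasWeakFDeriv.fderiv_mollify {f : Space d → Space d}
    {Df : Space d → Space d →L[ℝ] Space d} (h : HasWeakFDeriv f Df) (n : ℕ) (x v : Space d) :
    fderiv ℝ (mollify n f) x v = ∫ y, mollifier d n (y - x) • Df y v := by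
  rw [(hasFDerivAt_mollify h.1 n x).fderiv]
  have h1 := h.2.2 (translate (mollifierTest d n) x) v
  simp only [fderiv_translate, translate_apply, coe_mollifierTest] at h1
  rw [neg_apply, ContinuousLinearMap.integral_apply (integrable_smulRight_mollifier h.1 n x)]
  simp only [ContinuousLinearMap.smulRight_apply]
  rw [h1, neg_neg]

/-- If `Df` is the weak derivative of `f`, then `f(· + z) - f` is bounded by `‖z‖ * ‖Df‖` in any
weighted `L¹` norm, in the sense that the weighted `L¹` norms of all translates of `Df` by vectors
slightly longer than `z` are taken into account. -/
theorem HasWeakFDeriv.lintegral_mul_translate_sub_le {f : Space d → Space d}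
    {Df : Space d → Space d →L[ℝ] Space d} (h : HasWeakFDeriv f Df) (hDf : StronglyMeasurable Df)
    {w : Space d → ℝ≥0∞} (hw : Measurable w) (hw' : ∀ x, w x ≠ ⊤) {S : ℝ≥0∞} {z : Space d}
    (hS : ∀ v, ‖v‖ ≤ ‖z‖ + 1 → ∫⁻ x, w x * ‖Df (x + v)‖ₑ ≤ S) :
    ∫⁻ x, w x * ‖f (x + z) - f x‖ₑ ≤ ‖z‖ₑ * S := by
  set F : ℕ → Space d → Space d := fun n => mollify n f with hF
  have hFs : ∀ n, ContDiff ℝ ∞ (F n) := fun n => contDiff_mollify h.1 n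
  have hFd : ∀ n, Differentiable ℝ (F n) := fun n => (hFs n).differentiable (by simp)
  have hFc : ∀ n, Continuous (F n) := fun n => (hFs n).continuous
  have hDfm : Measurable fun x => ‖Df x‖ₑ := hDf.enorm
  have hae := ae_tendsto_mollifier_convolution h.1
  have hae' : ∀ᵐ x, Tendsto (fun n => F n (x + z)) atTop (𝓝 (f (x + z))) :=
    (measurePreserving_add_right volume z).quasiMeasurePreserving.ae hae
  have hbound : ∀ n, ∫⁻ x, w x * ‖F n (x + z) - F n x‖ₑ ≤ ‖z‖ₑ * S := by
    intro n
    have h1 : ∀ x, ‖fderiv ℝ (F n) x z‖ₑ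
        ≤ ‖z‖ₑ * ∫⁻ v, ‖mollifier d n v‖ₑ * ‖Df (x + v)‖ₑ := by
      intro x
      rw [h.fderiv_mollify n x z]
      refine (enorm_integral_le_lintegral_enorm _).trans ?_
      rw [← lintegral_const_mul' _ _ enorm_ne_top,
        ← lintegral_add_left_eq_self (μ := volume) _ x]
      refine lintegral_mono fun v => ?_
      rw [enorm_smul, add_sub_cancel_left]
      calc ‖mollifier d n v‖ₑ * ‖Df (x + v) z‖ₑ
          ≤ ‖mollifier d n v‖ₑ * (‖Df (x + v)‖ₑ * ‖z‖ₑ) := by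
            gcongr; exact ContinuousLinearMap.le_opENorm _ _
        _ = _ := by ring
    have h2 : ∀ x, ‖F n (x + z) - F n x‖ₑ
        ≤ ∫⁻ θ in Icc (0 : ℝ) 1, ‖fderiv ℝ (F n) (x + θ • z) z‖ₑ := by
      intro x
      have hd : ∀ θ : ℝ, HasDerivAt (fun θ : ℝ => F n (x + θ • z))
          (fderiv ℝ (F n) (x + θ • z) z) θ := by
        intro θ
        have h1 : HasDerivAt (fun θ : ℝ => x + θ • z) z θ := by
          simpa using ((hasDerivAt_id θ).smul_const z).const_add x
        exact (hFd n (x + θ • z)).hasFDerivAt.comp_hasDerivAt θ h1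
      have hc : Continuous fun θ : ℝ => fderiv ℝ (F n) (x + θ • z) z :=
        (((hFs n).continuous_fderiv (by simp)).comp (by fun_prop)).clm_apply continuous_const
      have := intervalIntegral.integral_eq_sub_of_hasDerivAt (a := 0) (b := 1)
        (fun θ _ => hd θ) (hc.intervalIntegrable _ _)
      rw [one_smul, zero_smul, add_zero] at this
      rw [← this, intervalIntegral.integral_of_le zero_le_one]
      exact (enorm_integral_le_lintegral_enorm _).trans (lintegral_mono_set Ioc_subset_Icc_self)
    have h3 : Measurable fun x => ‖mollifier d n x‖ₑ := (continuous_mollifier n).measurable.enorm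
    have hm : Measurable fun p : Space d × ℝ × Space d =>
        ‖z‖ₑ * ‖mollifier d n p.2.2‖ₑ * (w p.1 * ‖Df (p.1 + (p.2.1 • z + p.2.2))‖ₑ) := by
      have h4 : Measurable fun p : Space d × ℝ × Space d => p.1 + (p.2.1 • z + p.2.2) := by
        fun_prop
      exact ((h3.comp (measurable_snd.comp measurable_snd)).const_mul _).mul
        ((hw.comp measurable_fst).mul (hDfm.comp h4))
    calc ∫⁻ x, w x * ‖F n (x + z) - F n x‖ₑ
        ≤ ∫⁻ x, ∫⁻ p : ℝ × Space d, ‖z‖ₑ * ‖mollifier d n p.2‖ₑ *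
            (w x * ‖Df (x + (p.1 • z + p.2))‖ₑ) ∂((volume.restrict (Icc (0 : ℝ) 1)).prod volume) := by
          refine lintegral_mono fun x => ?_
          have hmx : Measurable fun p : ℝ × Space d => ‖z‖ₑ * ‖mollifier d n p.2‖ₑ *
              (w x * ‖Df (x + (p.1 • z + p.2))‖ₑ) := by
            have h4 : Measurable fun p : ℝ × Space d => x + (p.1 • z + p.2) := by fun_prop
            exact ((h3.comp measurable_snd).const_mul _).mul ((hDfm.comp h4).const_mul _)
          rw [lintegral_prod _ hmx.aemeasurable]
          refine (mul_le_mul_right (h2 x) _).trans ?_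
          have hm5 : Measurable fun θ : ℝ => ‖fderiv ℝ (F n) (x + θ • z) z‖ₑ :=
            ((((hFs n).continuous_fderiv (by simp)).comp (by fun_prop)).clm_apply
              continuous_const).measurable.enorm
          rw [← lintegral_const_mul _ hm5]
          refine lintegral_mono fun θ => ?_
          refine (mul_le_mul_right (h1 _) _).trans (le_of_eq ?_)
          have hm6 : Measurable fun v => ‖mollifier d n v‖ₑ * ‖Df (x + θ • z + v)‖ₑ :=
            (continuous_mollifier n).measurable.enorm.mul
              (hDfm.comp (measurable_const.add measurable_id))
          rw [← lintegral_const_mul _ hm6, ← lintegral_const_mul _ (hm6.const_mul _)]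
          refine lintegral_congr fun v => ?_
          rw [add_assoc]
          ring
      _ = ∫⁻ p : ℝ × Space d, ∫⁻ x, ‖z‖ₑ * ‖mollifier d n p.2‖ₑ *
            (w x * ‖Df (x + (p.1 • z + p.2))‖ₑ) ∂volume ∂((volume.restrict (Icc (0 : ℝ) 1)).prod volume) :=
          lintegral_lintegral_swap hm.aemeasurable
      _ ≤ ∫⁻ p : ℝ × Space d, ‖z‖ₑ * ‖mollifier d n p.2‖ₑ * S
            ∂((volume.restrict (Icc (0 : ℝ) 1)).prod volume) := by
          have hmem : ∀ᵐ p : ℝ × Space d ∂((volume.restrict (Icc (0 : ℝ) 1)).prod volume),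
              p.1 ∈ Icc (0 : ℝ) 1 :=
            Measure.quasiMeasurePreserving_fst.ae (ae_restrict_mem measurableSet_Icc)
          refine lintegral_mono_ae (hmem.mono fun p hp => ?_)
          have hm7 : Measurable fun x => w x * ‖Df (x + (p.1 • z + p.2))‖ₑ :=
            hw.mul (hDfm.comp (measurable_id.add measurable_const))
          rw [lintegral_const_mul _ hm7]
          by_cases hp2 : ‖p.2‖ ≤ 1
          · refine mul_le_mul_right (hS _ ((norm_add_le _ _).trans ?_)) _
            rw [norm_smul, Real.norm_of_nonneg hp.1]
            have := mul_le_mul_of_nonneg_right hp.2 (norm_nonneg z)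
            linarith
          · rw [mollifier_eq_zero n ((one_div_succ_le_one n).trans_lt (not_le.1 hp2))]
            simp
      _ = ‖z‖ₑ * S := by
          have hm9 : Measurable fun p : ℝ × Space d => ‖z‖ₑ * ‖mollifier d n p.2‖ₑ * S :=
            ((h3.comp measurable_snd).const_mul _).mul_const _
          rw [lintegral_prod _ hm9.aemeasurable]
          simp only
          rw [lintegral_const, lintegral_mul_const _ (h3.const_mul _), lintegral_const_mul _ h3,
            lintegral_mollifier]
          simp
  calc ∫⁻ x, w x * ‖f (x + z) - f x‖ₑ
      = ∫⁻ x, liminf (fun n => w x * ‖F n (x + z) - F n x‖ₑ) atTop := by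
        refine lintegral_congr_ae ?_
        filter_upwards [hae, hae'] with x hx hx'
        exact (ENNReal.Tendsto.const_mul (hx'.sub hx).enorm (Or.inr (hw' x))).liminf_eq.symm
    _ ≤ liminf (fun n => ∫⁻ x, w x * ‖F n (x + z) - F n x‖ₑ) atTop :=
        lintegral_liminf_le fun n => by
          have := hFc n
          fun_prop
    _ ≤ ‖z‖ₑ * S := by
        refine liminf_le_of_le (by isBoundedDefault) fun b hb => ?_
        obtain ⟨n, hn⟩ := hb.exists
        exact hn.trans (hbound n)

variable {d : ℕ}

/-! ### The commutator of transport and mollification -/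

theorem lintegral_enorm_mul_le {α F G : Type*} [MeasurableSpace α] {μ : Measure α}
    [NormedAddCommGroup F] [NormedAddCommGroup G] {p q : ℝ≥0∞} [ENNReal.HolderConjugate p q]
    {f : α → F} {g : α → G} (hf : AEStronglyMeasurable f μ) (hg : AEStronglyMeasurable g μ) :
    ∫⁻ x, ‖f x‖ₑ * ‖g x‖ₑ ∂μ ≤ eLpNorm f p μ * eLpNorm g q μ := by
  have := eLpNorm_smul_le_mul_eLpNorm (p := p) (q := q) (r := 1) hg.norm hf.norm
  rw [eLpNorm_norm, eLpNorm_norm, eLpNorm_one_eq_lintegral_enorm] at this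
  refine le_trans (le_of_eq (lintegral_congr fun x => ?_)) this
  simp [enorm_mul]

theorem eLpNorm_comp_add_restrict_le {F : Type*} [NormedAddCommGroup F] {f : Space d → F}
    (hf : StronglyMeasurable f) {R : ℝ} {z : Space d} (hz : ‖z‖ ≤ 2) (p : ℝ≥0∞) :
    eLpNorm (fun x => f (x + z)) p (volume.restrict (Metric.closedBall 0 R))
      ≤ eLpNorm f p (volume.restrict (Metric.closedBall 0 (R + 2))) := by
  rw [← eLpNorm_indicator_eq_eLpNorm_restrict (measurableSet_closedBall),
    ← eLpNorm_indicator_eq_eLpNorm_restrict (f := f) (measurableSet_closedBall)]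
  have hmp := measurePreserving_add_right (volume : Measure (Space d)) z
  rw [← eLpNorm_comp_measurePreserving (f := fun x => x + z)
    ((hf.indicator measurableSet_closedBall).aestronglyMeasurable) hmp]
  refine eLpNorm_mono_enorm fun x => ?_
  by_cases hx : x ∈ Metric.closedBall (0 : Space d) R
  · have hx' : x + z ∈ Metric.closedBall (0 : Space d) (R + 2) := by
      simp only [Metric.mem_closedBall, dist_zero_right] at hx ⊢
      exact (norm_add_le _ _).trans (add_le_add hx hz)
    simp [hx, hx']
  · simp [hx]

theorem setLIntegral_translate_mul_le {F G : Type*} [NormedAddCommGroup F] [NormedAddCommGroup G]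
    {p q : ℝ≥0∞} [ENNReal.HolderConjugate p q] {f : Space d → F} {g : Space d → G}
    (hf : StronglyMeasurable f) (hg : StronglyMeasurable g) {R : ℝ} {z v : Space d}
    (hz : ‖z‖ ≤ 2) (hv : ‖v‖ ≤ 2) :
    ∫⁻ x in Metric.closedBall 0 R, ‖f (x + z)‖ₑ * ‖g (x + v)‖ₑ
      ≤ eLpNorm f p (volume.restrict (Metric.closedBall 0 (R + 2)))
        * eLpNorm g q (volume.restrict (Metric.closedBall 0 (R + 2))) := by
  refine (lintegral_enorm_mul_le (p := p) (q := q) ?_ ?_).trans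
    (mul_le_mul' (eLpNorm_comp_add_restrict_le hf hz p) (eLpNorm_comp_add_restrict_le hg hv q))
  · exact (hf.comp_measurable (measurable_add_const z)).aestronglyMeasurable
  · exact (hg.comp_measurable (measurable_add_const v)).aestronglyMeasurable

/-- The commutator `b · ∇(ρₙ * u) - ρₙ * (b · ∇u)`, in the form that makes sense for a function `u`
which is not differentiable. -/
def commutator (b : Space d → Space d) (divb : Space d → ℝ) (u : Space d → ℝ) (n : ℕ)
    (x : Space d) : ℝ :=
  ∫ y, u y * (fderiv ℝ (mollifier d n) (y - x) (b y - b x) + divb y * mollifier d n (y - x))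

/-- An upper bound for the modulus of the commutator. -/
def commutatorBound (b : Space d → Space d) (divb : Space d → ℝ) (u : Space d → ℝ) (n : ℕ)
    (x : Space d) : ℝ≥0∞ :=
  ∫⁻ y, ‖u y‖ₑ * (‖fderiv ℝ (mollifier d n) (y - x)‖ₑ * ‖b y - b x‖ₑ
    + ‖divb y‖ₑ * ‖mollifier d n (y - x)‖ₑ)

section

variable {b : Space d → Space d} {Db : Space d → Space d →L[ℝ] Space d} {divb : Space d → ℝ}

theorem enorm_commutator_integrand_le (u : Space d → ℝ) (n : ℕ) (x y : Space d) :
    ‖u y * (fderiv ℝ (mollifier d n) (y - x) (b y - b x) + divb y * mollifier d n (y - x))‖ₑ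
      ≤ ‖u y‖ₑ * (‖fderiv ℝ (mollifier d n) (y - x)‖ₑ * ‖b y - b x‖ₑ
        + ‖divb y‖ₑ * ‖mollifier d n (y - x)‖ₑ) := by
  rw [enorm_mul]
  refine mul_le_mul_right ((enorm_add_le _ _).trans (add_le_add ?_ ?_)) _
  · exact ContinuousLinearMap.le_opENorm _ _
  · rw [enorm_mul]

theorem enorm_commutator_le (u : Space d → ℝ) (n : ℕ) (x : Space d) :
    ‖commutator b divb u n x‖ₑ ≤ commutatorBound b divb u n x :=
  (enorm_integral_le_lintegral_enorm _).trans
    (lintegral_mono fun y => enorm_commutator_integrand_le u n x y)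

theorem stronglyMeasurable_commutator_integrand (hb : StronglyMeasurable b)
    (hdm : StronglyMeasurable divb) {u : Space d → ℝ} (hu : StronglyMeasurable u) (n : ℕ) :
    StronglyMeasurable fun p : Space d × Space d => u p.2 *
      (fderiv ℝ (mollifier d n) (p.2 - p.1) (b p.2 - b p.1)
        + divb p.2 * mollifier d n (p.2 - p.1)) := by
  have h1 : StronglyMeasurable fun p : Space d × Space d =>
      fderiv ℝ (mollifier d n) (p.2 - p.1) (b p.2 - b p.1) := by
    have hA : StronglyMeasurable fun p : Space d × Space d =>
        fderiv ℝ (mollifier d n) (p.2 - p.1) :=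
      ((continuous_fderiv_mollifier n).comp (continuous_snd.sub continuous_fst)).stronglyMeasurable
    have hB : StronglyMeasurable fun p : Space d × Space d => b p.2 - b p.1 :=
      (hb.comp_measurable measurable_snd).sub (hb.comp_measurable measurable_fst)
    exact (isBoundedBilinearMap_apply (𝕜 := ℝ) (E := Space d) (F := ℝ)).continuous.comp_stronglyMeasurable
      (hA.prodMk hB)
  have h2 : StronglyMeasurable fun p : Space d × Space d => mollifier d n (p.2 - p.1) :=
    ((continuous_mollifier n).comp (continuous_snd.sub continuous_fst)).stronglyMeasurable
  exact (hu.comp_measurable measurable_snd).mul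
    (h1.add ((hdm.comp_measurable measurable_snd).mul h2))

theorem measurable_commutator (hb : StronglyMeasurable b)
    (hdm : StronglyMeasurable divb) {u : Space d → ℝ} (hu : StronglyMeasurable u) (n : ℕ) :
    StronglyMeasurable (commutator b divb u n) :=
  (stronglyMeasurable_commutator_integrand hb hdm hu n).integral_prod_right

theorem measurable_commutatorBound (hb : StronglyMeasurable b)
    (hdm : StronglyMeasurable divb) {u : Space d → ℝ} (hu : StronglyMeasurable u) (n : ℕ) :
    Measurable (commutatorBound b divb u n) := by
  have hsub : Measurable fun p : Space d × Space d => p.2 - p.1 := by fun_prop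
  have hρ : Measurable fun z => ‖mollifier d n z‖ₑ := (continuous_mollifier n).measurable.enorm
  have hDρ : Measurable fun z => ‖fderiv ℝ (mollifier d n) z‖ₑ :=
    (continuous_fderiv_mollifier n).measurable.enorm
  have hm : Measurable fun p : Space d × Space d => ‖u p.2‖ₑ *
      (‖fderiv ℝ (mollifier d n) (p.2 - p.1)‖ₑ * ‖b p.2 - b p.1‖ₑ
        + ‖divb p.2‖ₑ * ‖mollifier d n (p.2 - p.1)‖ₑ) :=
    (hu.enorm.comp measurable_snd).mul (((hDρ.comp hsub).mul
      ((hb.measurable.comp measurable_snd).sub (hb.measurable.comp measurable_fst)).enorm).add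
        ((hdm.enorm.comp measurable_snd).mul (hρ.comp hsub)))
  exact hm.lintegral_prod_right'

/-- The uniform bound of the commutator in `L¹_loc`, by the norm of `u` in `L^p_loc` and of the
derivative of `b` in `L^q_loc`. -/
theorem lintegral_commutatorBound_le (d : ℕ) : ∃ C : ℝ≥0∞, C ≠ ⊤ ∧
    ∀ {p q : ℝ≥0∞} [ENNReal.HolderConjugate p q] {b : Space d → Space d}
      {Db : Space d → Space d →L[ℝ] Space d} {divb : Space d → ℝ} (_ : HasWeakFDeriv b Db)
      (_ : StronglyMeasurable b) (_ : StronglyMeasurable Db) (_ : StronglyMeasurable divb)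
      {u : Space d → ℝ} (_ : StronglyMeasurable u) (n : ℕ) (R : ℝ),
      ∫⁻ x in Metric.closedBall 0 R, commutatorBound b divb u n x
        ≤ C * (eLpNorm u p (volume.restrict (Metric.closedBall 0 (R + 2)))
          * (eLpNorm Db q (volume.restrict (Metric.closedBall 0 (R + 2)))
            + eLpNorm divb q (volume.restrict (Metric.closedBall 0 (R + 2))))) := by
  obtain ⟨C, hC, hmom⟩ := exists_moment_mollifier d
  refine ⟨C + 1, by simp [hC], fun {p q} _ {b Db divb} hw hb hDb hdm {u} hu n R => ?_⟩
  set Nu := eLpNorm u p (volume.restrict (Metric.closedBall 0 (R + 2)))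
  set ND := eLpNorm Db q (volume.restrict (Metric.closedBall 0 (R + 2)))
  set Nd := eLpNorm divb q (volume.restrict (Metric.closedBall 0 (R + 2)))
  have hum := hu.enorm
  have hbm := hb.measurable
  have hdm' := hdm.enorm
  have hρ : Measurable fun z => ‖mollifier d n z‖ₑ := (continuous_mollifier n).measurable.enorm
  have hDρ : Measurable fun z => ‖fderiv ℝ (mollifier d n) z‖ₑ :=
    (continuous_fderiv_mollifier n).measurable.enorm
  have e1 : ∀ x, commutatorBound b divb u n x = ∫⁻ z, ‖u (x + z)‖ₑ *
      (‖fderiv ℝ (mollifier d n) z‖ₑ * ‖b (x + z) - b x‖ₑ + ‖divb (x + z)‖ₑ * ‖mollifier d n z‖ₑ) := by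
    intro x
    rw [commutatorBound, ← lintegral_add_left_eq_self (μ := volume) _ x]
    simp only [add_sub_cancel_left]
  have hadd : Measurable fun p : Space d × Space d => p.1 + p.2 := by fun_prop
  have hm : Measurable fun p : Space d × Space d => ‖u (p.1 + p.2)‖ₑ *
      (‖fderiv ℝ (mollifier d n) p.2‖ₑ * ‖b (p.1 + p.2) - b p.1‖ₑ
        + ‖divb (p.1 + p.2)‖ₑ * ‖mollifier d n p.2‖ₑ) := by
    refine (hum.comp hadd).mul (((hDρ.comp measurable_snd).mul ?_).add
      ((hdm'.comp hadd).mul (hρ.comp measurable_snd)))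
    exact ((hbm.comp hadd).sub (hbm.comp measurable_fst)).enorm
  calc ∫⁻ x in Metric.closedBall 0 R, commutatorBound b divb u n x
      = ∫⁻ z, ∫⁻ x in Metric.closedBall 0 R, ‖u (x + z)‖ₑ *
      (‖fderiv ℝ (mollifier d n) z‖ₑ * ‖b (x + z) - b x‖ₑ
        + ‖divb (x + z)‖ₑ * ‖mollifier d n z‖ₑ) := by
        simp_rw [e1]
        exact lintegral_lintegral_swap hm.aemeasurable
    _ ≤ ∫⁻ z, (‖fderiv ℝ (mollifier d n) z‖ₑ * ‖z‖ₑ * (Nu * ND)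
          + ‖mollifier d n z‖ₑ * (Nu * Nd)) := by
        refine lintegral_mono fun z => ?_
        by_cases hz : ‖z‖ ≤ 1
        · have m1 : Measurable fun x => ‖u (x + z)‖ₑ * ‖b (x + z) - b x‖ₑ :=
            (hum.comp (measurable_add_const z)).mul
              ((hbm.comp (measurable_add_const z)).sub hbm).enorm
          have m2 : Measurable fun x => ‖u (x + z)‖ₑ * ‖divb (x + z)‖ₑ :=
            (hum.comp (measurable_add_const z)).mul (hdm'.comp (measurable_add_const z))
          have b1 : ∫⁻ x in Metric.closedBall 0 R, ‖u (x + z)‖ₑ * ‖b (x + z) - b x‖ₑ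
              ≤ ‖z‖ₑ * (Nu * ND) := by
            rw [← lintegral_indicator measurableSet_closedBall]
            have := hw.lintegral_mul_translate_sub_le hDb
              (w := (Metric.closedBall (0 : Space d) R).indicator fun x => ‖u (x + z)‖ₑ)
              (z := z) (S := Nu * ND)
              ((hum.comp (measurable_add_const z)).indicator measurableSet_closedBall)
              (fun x => by by_cases hx : x ∈ Metric.closedBall (0 : Space d) R <;> simp [hx])
              (fun v hv => ?_)
            · refine le_trans (lintegral_mono fun x => ?_) this
              by_cases hx : x ∈ Metric.closedBall (0 : Space d) R <;> simp [hx]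
            · have h3 := setLIntegral_translate_mul_le (p := p) (q := q) (R := R) hu hDb
                (z := z) (v := v) (by linarith) (by linarith)
              rw [← lintegral_indicator measurableSet_closedBall] at h3
              refine le_trans (lintegral_mono fun x => ?_) h3
              by_cases hx : x ∈ Metric.closedBall (0 : Space d) R <;> simp [hx]
          have b2 := setLIntegral_translate_mul_le (p := p) (q := q) (R := R) hu hdm
                (z := z) (v := z) (by linarith) (by linarith)
          calc ∫⁻ x in Metric.closedBall 0 R, ‖u (x + z)‖ₑ *
              (‖fderiv ℝ (mollifier d n) z‖ₑ * ‖b (x + z) - b x‖ₑ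
                + ‖divb (x + z)‖ₑ * ‖mollifier d n z‖ₑ)
              = ∫⁻ x in Metric.closedBall 0 R, (‖fderiv ℝ (mollifier d n) z‖ₑ *
                  (‖u (x + z)‖ₑ * ‖b (x + z) - b x‖ₑ)
                + ‖mollifier d n z‖ₑ * (‖u (x + z)‖ₑ * ‖divb (x + z)‖ₑ)) := by
                refine lintegral_congr fun x => ?_
                ring
            _ ≤ _ := by
                rw [lintegral_add_left (m1.const_mul _), lintegral_const_mul _ m1,
                  lintegral_const_mul _ m2, mul_assoc]
                gcongr
        · have hz' := (one_div_succ_le_one n).trans_lt (not_le.1 hz)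
          have e0 : ‖fderiv ℝ (mollifier d n) z‖ₑ = 0 := by
            rw [fderiv_mollifier_eq_zero n hz']; exact enorm_zero (E := Space d →L[ℝ] ℝ)
          have e0' : ‖mollifier d n z‖ₑ = 0 := by
            rw [mollifier_eq_zero n hz', enorm_zero]
          simp only [e0, e0', zero_mul, mul_zero, add_zero, lintegral_zero, le_refl]
    _ ≤ (C + 1) * (Nu * (ND + Nd)) := by
        have m3 : Measurable fun z : Space d => ‖fderiv ℝ (mollifier d n) z‖ₑ * ‖z‖ₑ :=
          hDρ.mul measurable_id.enorm
        rw [lintegral_add_left (m3.mul_const _), lintegral_mul_const _ m3, lintegral_mul_const _ hρ,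
          lintegral_mollifier]
        calc _ ≤ C * (Nu * ND) + 1 * (Nu * Nd) := by gcongr; exact hmom n
          _ ≤ (C + 1) * (Nu * ND) + (C + 1) * (Nu * Nd) := by
            gcongr
            · exact le_self_add
            · exact le_add_self
          _ = _ := by ring

theorem hasCompactSupport_fun_smul {F : Type*} [NormedAddCommGroup F] [NormedSpace ℝ F]
    (g : Space d → ℝ) {A : Space d → F} (h : HasCompactSupport A) :
    HasCompactSupport fun y => g y • A y := h.smul_left

theorem LocallyIntegrable.integrable_clm_apply {F : Type*} [NormedAddCommGroup F] [NormedSpace ℝ F]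
    {f : Space d → Space d} (hf : LocallyIntegrable f) {A : Space d → Space d →L[ℝ] F}
    (hA : Continuous A) (hc : HasCompactSupport A) : Integrable fun x => A x (f x) := by
  have h1 : Integrable fun y => ‖A y‖ • f y :=
    hf.integrable_smul_left_of_hasCompactSupport hA.norm hc.norm
  refine h1.mono ?_ (ae_of_all _ fun y => ?_)
  · exact (ContinuousLinearMap.id ℝ (Space d →L[ℝ] F)).aestronglyMeasurable_comp₂
      hA.aestronglyMeasurable hf.aestronglyMeasurable
  · rw [norm_smul, norm_norm]
    exact (A y).le_opNorm _

theorem integral_fderiv_apply_const_eq_zero (φ : TestFun d) (v : Space d) :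
    ∫ x, fderiv ℝ φ x v = 0 := by
  have hφc : Continuous (fderiv ℝ φ) := φ.contDiff.continuous_fderiv (by simp)
  have hi : Integrable fun x => fderiv ℝ φ x v :=
    (hφc.clm_apply continuous_const).integrable_of_hasCompactSupport
      (φ.hasCompactSupport.fderiv_apply ℝ v)
  have := integral_mul_fderiv_eq_neg_fderiv_mul_of_integrable (μ := volume) (v := v)
    (f := fun _ : Space d => (1 : ℝ)) (g := φ) (by simp) (by simpa using hi)
    (by simpa using φ.continuous.integrable_of_hasCompactSupport φ.hasCompactSupport)
    (fun x _ => differentiableAt_const (1 : ℝ))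
    (fun x _ => φ.contDiff.differentiable (by simp) x)
  simpa using this

/-- The product of a smooth function and a test function. -/
def mulTest (g : Space d → ℝ) (hg : ContDiff ℝ ∞ g) (φ : TestFun d) : TestFun d :=
  mkTest (fun y => g y * φ y) (hg.mul φ.contDiff) φ.hasCompactSupport.mul_left

@[simp]
theorem mulTest_apply (g : Space d → ℝ) (hg : ContDiff ℝ ∞ g) (φ : TestFun d) (y : Space d) :
    mulTest g hg φ y = g y * φ y := rfl

theorem differentiable_testFun (φ : TestFun d) : Differentiable ℝ φ :=
  φ.contDiff.differentiable (by simp)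

theorem continuous_fderiv_testFun (φ : TestFun d) : Continuous (fderiv ℝ φ) :=
  φ.contDiff.continuous_fderiv (by simp)

theorem fderiv_mulTest (g : Space d → ℝ) (hg : ContDiff ℝ ∞ g) (φ : TestFun d) (y v : Space d) :
    fderiv ℝ (mulTest g hg φ) y v = g y * fderiv ℝ φ y v + φ y * fderiv ℝ g y v := by
  have h1 : HasFDerivAt (fun y => g y * φ y) _ y :=
    ((hg.differentiable (by simp)) y).hasFDerivAt.mul (differentiable_testFun φ y).hasFDerivAt
  rw [mulTest, coe_mkTest, h1.fderiv]
  simp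

theorem integrable_commutator_integrand (hdiv : HasWeakDiv b divb) {g : Space d → ℝ}
    (hg : Continuous g) (n : ℕ) (x : Space d) :
    Integrable fun y => g y * (fderiv ℝ (mollifier d n) (y - x) (b y - b x)
      + divb y * mollifier d n (y - x)) := by
  have hc : Continuous fun y : Space d => y - x := continuous_sub_right x
  have cl : Topology.IsClosedEmbedding fun y : Space d => y - x :=
    (Homeomorph.subRight x).isClosedEmbedding
  have hbx : LocallyIntegrable fun y => b y - b x := hdiv.1.sub (locallyIntegrable_const _)
  have c1 : Continuous fun y => g y • fderiv ℝ (mollifier d n) (y - x) :=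
    hg.smul ((continuous_fderiv_mollifier n).comp hc)
  have s1 : HasCompactSupport fun y => g y • fderiv ℝ (mollifier d n) (y - x) := by
    have h := hasCompactSupport_fun_smul g
      (((hasCompactSupport_mollifier n).fderiv ℝ).comp_isClosedEmbedding cl)
    exact h
  have c2 : Continuous fun y => g y * mollifier d n (y - x) :=
    hg.mul ((continuous_mollifier n).comp hc)
  have s2 : HasCompactSupport fun y => g y * mollifier d n (y - x) :=
    ((hasCompactSupport_mollifier n).comp_isClosedEmbedding cl).mul_left
  refine ((LocallyIntegrable.integrable_clm_apply hbx c1 s1).add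
    (hdiv.2.1.integrable_smul_left_of_hasCompactSupport c2 s2)).congr (ae_of_all _ fun y => ?_)
  simp only [Pi.add_apply, smul_apply, smul_eq_mul]
  ring

/-- For a smooth function the commutator is `∫ ρₙ(y - x) (b(x) - b(y)) · ∇g(y) dy`. -/
theorem commutator_eq_of_contDiff (hdiv : HasWeakDiv b divb) {g : Space d → ℝ} (hg : ContDiff ℝ ∞ g)
    (n : ℕ) (x : Space d) :
    commutator b divb g n x = ∫ y, mollifier d n (y - x) * fderiv ℝ g y (b x - b y) := by
  obtain ⟨ρ, hρa, hρd⟩ : ∃ ρ : TestFun d, (∀ y, ρ y = mollifier d n (y - x)) ∧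
      ∀ y, fderiv ℝ ρ y = fderiv ℝ (mollifier d n) (y - x) :=
    ⟨translate (mollifierTest d n) x, fun y => by simp, fun y => by simp⟩
  obtain ⟨φ, hφa, hφd⟩ : ∃ φ : TestFun d, (∀ y, φ y = g y * ρ y) ∧
      ∀ y v, fderiv ℝ φ y v = g y * fderiv ℝ ρ y v + ρ y * fderiv ℝ g y v :=
    ⟨mulTest g hg ρ, fun y => by simp, fun y v => fderiv_mulTest g hg ρ y v⟩
  have c1 : Continuous fun y => g y • fderiv ℝ ρ y :=
    hg.continuous.smul (continuous_fderiv_testFun ρ)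
  have s1 : HasCompactSupport fun y => g y • fderiv ℝ ρ y := by
    have h := hasCompactSupport_fun_smul g (ρ.hasCompactSupport.fderiv ℝ)
    exact h
  have c2 : Continuous fun y => ρ y • fderiv ℝ g y :=
    ρ.continuous.smul (hg.continuous_fderiv (by simp))
  have s2 : HasCompactSupport fun y => ρ y • fderiv ℝ g y := ρ.hasCompactSupport.smul_right
  have hbx : LocallyIntegrable fun y => b y - b x := hdiv.1.sub (locallyIntegrable_const _)
  have i1 : Integrable fun y => g y * fderiv ℝ ρ y (b y - b x) :=
    (LocallyIntegrable.integrable_clm_apply hbx c1 s1).congr (ae_of_all _ fun y => by simp)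
  have i2 : Integrable fun y => ρ y * fderiv ℝ g y (b y - b x) :=
    (LocallyIntegrable.integrable_clm_apply hbx c2 s2).congr (ae_of_all _ fun y => by simp)
  have i3 : Integrable fun y => φ y * divb y :=
    hdiv.2.1.integrable_smul_left_of_hasCompactSupport φ.continuous φ.hasCompactSupport
  have hw := hdiv.2.2 φ
  have hz := integral_fderiv_apply_const_eq_zero φ (b x)
  have hφc : Continuous (fderiv ℝ φ) := continuous_fderiv_testFun φ
  have i4 : Integrable fun y => fderiv ℝ φ y (b y) :=
    LocallyIntegrable.integrable_clm_apply hdiv.1 hφc (φ.hasCompactSupport.fderiv ℝ)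
  have i5 : Integrable fun y => fderiv ℝ φ y (b x) :=
    (hφc.clm_apply continuous_const).integrable_of_hasCompactSupport
      (φ.hasCompactSupport.fderiv_apply ℝ _)
  have e1 : ∫ y, (g y * fderiv ℝ ρ y (b y - b x) + ρ y * fderiv ℝ g y (b y - b x))
      = - ∫ y, φ y * divb y := by
    rw [← hw, ← sub_zero (∫ y, fderiv ℝ φ y (b y)), ← hz, ← integral_sub i4 i5]
    refine integral_congr_ae (ae_of_all _ fun y => ?_)
    exact (hφd y (b y - b x)).symm.trans (map_sub _ _ _)
  rw [integral_add i1 i2] at e1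
  have e2 : commutator b divb g n x
      = (∫ y, g y * fderiv ℝ ρ y (b y - b x)) + ∫ y, φ y * divb y := by
    rw [commutator, ← integral_add i1 i3]
    refine integral_congr_ae (ae_of_all _ fun y => ?_)
    simp only [hφa, hρa, hρd]
    ring
  rw [e2]
  have e3 : ∫ y, mollifier d n (y - x) * fderiv ℝ g y (b x - b y)
      = - ∫ y, ρ y * fderiv ℝ g y (b y - b x) := by
    rw [← integral_neg]
    refine integral_congr_ae (ae_of_all _ fun y => ?_)
    simp only [hρa]
    rw [← neg_sub (b y), map_neg]; ring
  rw [e3]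
  linarith

/-- For smooth functions the commutator tends to zero, since then the
gradient of the mollifier can be moved to `g`; only the `L¹` continuity of `b` under translations is
used. The general case follows by density and the uniform bound. -/
theorem tendsto_lintegral_commutator_of_contDiff (hw : HasWeakFDeriv b Db)
    (hdiv : HasWeakDiv b divb) (hb : StronglyMeasurable b) (hDb : StronglyMeasurable Db)
    {g : Space d → ℝ} (hg : ContDiff ℝ ∞ g) (hgc : HasCompactSupport g) (R : ℝ) :
    Tendsto (fun n => ∫⁻ x in Metric.closedBall 0 R, ‖commutator b divb g n x‖ₑ) atTop (𝓝 0) := by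
  obtain ⟨L, hL⟩ := (hg.continuous_fderiv (by simp)).bounded_above_of_compact_support (hgc.fderiv ℝ)
  set S := ∫⁻ x in Metric.closedBall 0 (R + 2), ‖Db x‖ₑ with hS
  have hSf : S ≠ ⊤ := (hw.2.1.integrableOn_isCompact (isCompact_closedBall 0 (R + 2))).2.ne
  have hbm := hb.measurable
  have hρ : ∀ n, Measurable fun z => ‖mollifier d n z‖ₑ := fun n =>
    (continuous_mollifier n).measurable.enorm
  have hLe : ∀ y, ‖fderiv ℝ g y‖ₑ ≤ ENNReal.ofReal L := fun y => by
    rw [← ofReal_norm]; exact ENNReal.ofReal_le_ofReal (hL y)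
  have hbound : ∀ n : ℕ, ∫⁻ x in Metric.closedBall 0 R, ‖commutator b divb g n x‖ₑ
      ≤ ENNReal.ofReal (1 / ((n : ℝ) + 1)) * (ENNReal.ofReal L * S) := by
    intro n
    have h1 : ∀ x, ‖commutator b divb g n x‖ₑ
        ≤ ∫⁻ z, ENNReal.ofReal L * ‖mollifier d n z‖ₑ * ‖b (x + z) - b x‖ₑ := by
      intro x
      rw [commutator_eq_of_contDiff hdiv hg]
      refine (enorm_integral_le_lintegral_enorm _).trans ?_
      rw [← lintegral_add_left_eq_self (μ := volume) _ x]
      refine lintegral_mono fun z => ?_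
      rw [add_sub_cancel_left, enorm_mul]
      calc _ ≤ ‖mollifier d n z‖ₑ * (‖fderiv ℝ g (x + z)‖ₑ * ‖b x - b (x + z)‖ₑ) := by
            gcongr; exact ContinuousLinearMap.le_opENorm _ _
        _ ≤ ‖mollifier d n z‖ₑ * (ENNReal.ofReal L * ‖b (x + z) - b x‖ₑ) := by
            rw [← enorm_neg (b x - b (x + z)), neg_sub]
            gcongr; exact hLe _
        _ = _ := by ring
    have hm : Measurable fun p : Space d × Space d =>
        ENNReal.ofReal L * ‖mollifier d n p.2‖ₑ * ‖b (p.1 + p.2) - b p.1‖ₑ := by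
      have hadd : Measurable fun p : Space d × Space d => p.1 + p.2 := by fun_prop
      exact (((hρ n).comp measurable_snd).const_mul _).mul
        ((hbm.comp hadd).sub (hbm.comp measurable_fst)).enorm
    calc ∫⁻ x in Metric.closedBall 0 R, ‖commutator b divb g n x‖ₑ
        ≤ ∫⁻ x in Metric.closedBall 0 R, ∫⁻ z, ENNReal.ofReal L * ‖mollifier d n z‖ₑ *
            ‖b (x + z) - b x‖ₑ := lintegral_mono h1
      _ = ∫⁻ z, ∫⁻ x in Metric.closedBall 0 R, ENNReal.ofReal L * ‖mollifier d n z‖ₑ *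
            ‖b (x + z) - b x‖ₑ := lintegral_lintegral_swap hm.aemeasurable
      _ ≤ ∫⁻ z, ENNReal.ofReal L * ‖mollifier d n z‖ₑ * (ENNReal.ofReal (1 / ((n : ℝ) + 1)) * S) := by
          refine lintegral_mono fun z => ?_
          have m1 : Measurable fun x => ‖b (x + z) - b x‖ₑ :=
            ((hbm.comp (measurable_add_const z)).sub hbm).enorm
          rw [lintegral_const_mul _ m1]
          by_cases hz : ‖z‖ ≤ 1 / ((n : ℝ) + 1)
          · have hz1 := hz.trans (one_div_succ_le_one n)
            refine mul_le_mul_right ?_ _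
            rw [← lintegral_indicator measurableSet_closedBall]
            have := hw.lintegral_mul_translate_sub_le hDb
              (w := (Metric.closedBall (0 : Space d) R).indicator fun x => 1)
              (z := z) (S := S) (measurable_const.indicator measurableSet_closedBall)
              (fun x => by by_cases hx : x ∈ Metric.closedBall (0 : Space d) R <;> simp [hx])
              (fun v hv => ?_)
            · calc _ = ∫⁻ x, (Metric.closedBall (0 : Space d) R).indicator (fun x => 1) x *
                    ‖b (x + z) - b x‖ₑ := by
                    refine lintegral_congr fun x => ?_
                    by_cases hx : x ∈ Metric.closedBall (0 : Space d) R <;> simp [hx]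
                _ ≤ ‖z‖ₑ * S := this
                _ ≤ _ := by
                    gcongr
                    rw [← ofReal_norm]
                    exact ENNReal.ofReal_le_ofReal hz
            · have h3 := eLpNorm_comp_add_restrict_le hDb (R := R) (z := v) (by linarith) 1
              rw [eLpNorm_one_eq_lintegral_enorm, eLpNorm_one_eq_lintegral_enorm,
                ← lintegral_indicator measurableSet_closedBall] at h3
              refine le_trans (lintegral_mono fun x => ?_) h3
              by_cases hx : x ∈ Metric.closedBall (0 : Space d) R <;> simp [hx]
          · rw [mollifier_eq_zero n (not_le.1 hz), enorm_zero]
            simp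
      _ = _ := by
          rw [lintegral_mul_const _ ((hρ n).const_mul _), lintegral_const_mul _ (hρ n),
            lintegral_mollifier]
          ring
  have hlim : Tendsto (fun n : ℕ => ENNReal.ofReal (1 / ((n : ℝ) + 1)) * (ENNReal.ofReal L * S))
      atTop (𝓝 0) := by
    have h1 : Tendsto (fun n : ℕ => ENNReal.ofReal (1 / ((n : ℝ) + 1))) atTop (𝓝 0) := by
      have := ENNReal.tendsto_ofReal (tendsto_one_div_add_atTop_nhds_zero_nat (𝕜 := ℝ))
      rwa [ENNReal.ofReal_zero] at this
    have := ENNReal.Tendsto.mul_const (b := ENNReal.ofReal L * S) h1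
      (Or.inr (ENNReal.mul_ne_top ENNReal.ofReal_ne_top hSf))
    rwa [zero_mul] at this
  exact tendsto_of_tendsto_of_tendsto_of_le_of_le tendsto_const_nhds hlim (fun _ => bot_le) hbound

/-- The commutator converges to `0` in `L¹_loc`. -/
theorem tendsto_lintegral_commutator {p q : ℝ≥0∞} [ENNReal.HolderConjugate p q] (hp : p ≠ ⊤)
    (hw : HasWeakFDeriv b Db)
    (hdiv : HasWeakDiv b divb) (hb : StronglyMeasurable b) (hDb : StronglyMeasurable Db)
    (hdm : StronglyMeasurable divb) {u : Space d → ℝ} (hu : StronglyMeasurable u) (R : ℝ)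
    (hup : eLpNorm u p (volume.restrict (Metric.closedBall 0 (R + 2))) ≠ ⊤)
    (hDq : eLpNorm Db q (volume.restrict (Metric.closedBall 0 (R + 2))) ≠ ⊤)
    (hdq : eLpNorm divb q (volume.restrict (Metric.closedBall 0 (R + 2))) ≠ ⊤) :
    Tendsto (fun n => ∫⁻ x in Metric.closedBall 0 R, ‖commutator b divb u n x‖ₑ) atTop (𝓝 0) := by
  obtain ⟨C, hC, hbd⟩ := lintegral_commutatorBound_le d
  set N := eLpNorm Db q (volume.restrict (Metric.closedBall 0 (R + 2)))
    + eLpNorm divb q (volume.restrict (Metric.closedBall 0 (R + 2))) with hN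
  have hNf : N ≠ ⊤ := ENNReal.add_ne_top.2 ⟨hDq, hdq⟩
  set U : Space d → ℝ := (Metric.closedBall 0 (R + 2)).indicator u with hU
  have hUm : StronglyMeasurable U := hu.indicator measurableSet_closedBall
  have hUp : MemLp U p volume :=
    ⟨hUm.aestronglyMeasurable, by
      rw [hU, eLpNorm_indicator_eq_eLpNorm_restrict measurableSet_closedBall]
      exact hup.lt_top⟩
  have hcU : ∀ n, ∀ x ∈ Metric.closedBall (0 : Space d) R,
      commutator b divb u n x = commutator b divb U n x := by
    intro n x hx
    refine integral_congr_ae (ae_of_all _ fun y => ?_)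
    by_cases hy : y ∈ Metric.closedBall (0 : Space d) (R + 2)
    · simp [hU, hy]
    · have hyx : 1 / ((n : ℝ) + 1) < ‖y - x‖ := by
        refine (one_div_succ_le_one n).trans_lt ?_
        simp only [Metric.mem_closedBall, dist_zero_right, not_le] at hx hy
        linarith [norm_sub_norm_le y x]
      simp [mollifier_eq_zero n hyx, fderiv_mollifier_eq_zero n hyx]
  rw [ENNReal.tendsto_nhds_zero]
  intro ε hε
  obtain ⟨δ, hδ, hδε⟩ := ENNReal.exists_nnreal_pos_mul_lt (a := C * N) (b := ε / 2)
    (ENNReal.mul_ne_top hC hNf) (ENNReal.half_pos hε.ne').ne'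
  obtain ⟨g, hgc, hgs, hgε⟩ := hUp.exist_eLpNorm_sub_le hp
    (ENNReal.HolderConjugate.one_le p q) (ε := δ) (by exact_mod_cast hδ)
  have hgm : StronglyMeasurable g := hgs.continuous.stronglyMeasurable
  have hsplit : ∀ n, ∫⁻ x in Metric.closedBall 0 R, ‖commutator b divb u n x‖ₑ
      ≤ (∫⁻ x in Metric.closedBall 0 R, ‖commutator b divb g n x‖ₑ) + ε / 2 := by
    intro n
    have hb1 := hbd (p := p) (q := q) hw hb hDb hdm (hUm.sub hgm) n R
    have hb2 : ∫⁻ x in Metric.closedBall 0 R, commutatorBound b divb (U - g) n x ≤ ε / 2 := by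
      refine hb1.trans ?_
      have h1 : eLpNorm (U - g) p (volume.restrict (Metric.closedBall 0 (R + 2))) ≤ δ := by
        refine (eLpNorm_mono_measure _ Measure.restrict_le_self).trans (hgε.trans ?_)
        simp
      calc _ ≤ C * (δ * N) := by gcongr
        _ = δ * (C * N) := by ring
        _ ≤ ε / 2 := hδε.le
    have hfin : ∫⁻ x in Metric.closedBall 0 R, commutatorBound b divb (U - g) n x ≠ ⊤ := by
      refine ne_top_of_le_ne_top ?_ hb1
      refine ENNReal.mul_ne_top hC (ENNReal.mul_ne_top ?_ hNf)
      exact ne_top_of_le_ne_top (hgε.trans_lt ENNReal.ofReal_lt_top).ne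
        (eLpNorm_mono_measure _ Measure.restrict_le_self)
    have hmB : Measurable fun x => commutatorBound b divb (U - g) n x :=
      measurable_commutatorBound hb hdm (hUm.sub hgm) n
    have hae : ∀ᵐ x ∂(volume.restrict (Metric.closedBall 0 R)),
        ‖commutator b divb u n x‖ₑ ≤ ‖commutator b divb g n x‖ₑ
          + commutatorBound b divb (U - g) n x := by
      filter_upwards [ae_lt_top hmB hfin, ae_restrict_mem measurableSet_closedBall] with x hx hxK
      rw [hcU n x hxK]
      have i1 : Integrable fun y => (U - g) y * (fderiv ℝ (mollifier d n) (y - x) (b y - b x)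
          + divb y * mollifier d n (y - x)) := by
        refine ⟨?_, lt_of_le_of_lt (lintegral_mono fun y => enorm_commutator_integrand_le _ n x y) hx⟩
        exact ((stronglyMeasurable_commutator_integrand hb hdm (hUm.sub hgm) n).comp_measurable
          measurable_prodMk_left).aestronglyMeasurable
      have i2 : Integrable fun y => g y * (fderiv ℝ (mollifier d n) (y - x) (b y - b x)
          + divb y * mollifier d n (y - x)) :=
        integrable_commutator_integrand hdiv hgs.continuous n x
      have e : commutator b divb U n x = commutator b divb g n x
          + commutator b divb (U - g) n x := by
        rw [commutator, commutator, commutator, ← integral_add i2 i1]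
        refine integral_congr_ae (ae_of_all _ fun y => ?_)
        simp only [Pi.sub_apply]; ring
      rw [e]
      exact (enorm_add_le _ _).trans (add_le_add_right (enorm_commutator_le _ n x) _)
    calc _ ≤ ∫⁻ x in Metric.closedBall 0 R, (‖commutator b divb g n x‖ₑ
          + commutatorBound b divb (U - g) n x) := lintegral_mono_ae hae
      _ ≤ _ := by
        rw [lintegral_add_right _ hmB]
        gcongr
  have hlim := tendsto_lintegral_commutator_of_contDiff hw hdiv hb hDb hgs hgc R
  rw [ENNReal.tendsto_nhds_zero] at hlim
  filter_upwards [hlim (ε / 2) (ENNReal.half_pos hε.ne')] with n hn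
  calc _ ≤ _ := hsplit n
    _ ≤ ε / 2 + ε / 2 := by gcongr
    _ = ε := ENNReal.add_halves ε

end

variable {d : ℕ}

/-! ### Renormalization at a fixed time -/

instance isFiniteMeasure_restrict_closedBall (x : Space d) (R : ℝ) :
    IsFiniteMeasure ((volume : Measure (Space d)).restrict (Metric.closedBall x R)) :=
  ⟨by rw [Measure.restrict_apply_univ]; exact measure_closedBall_lt_top⟩

/-- Strongly measurable functions which are in `Lᵖ` on every ball. -/
structure MemLpLoc {F : Type*} [NormedAddCommGroup F] (p : ℝ≥0∞) (f : Space d → F) : Prop where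
  stronglyMeasurable : StronglyMeasurable f
  eLpNorm_ne_top : ∀ R : ℝ, eLpNorm f p (volume.restrict (Metric.closedBall 0 R)) ≠ ⊤

theorem locallyIntegrable_of_closedBall {F : Type*} [NormedAddCommGroup F] {f : Space d → F}
    (hf : StronglyMeasurable f)
    (h : ∀ R : ℝ, ∫⁻ x in Metric.closedBall 0 R, ‖f x‖ₑ ≠ ⊤) : LocallyIntegrable f := by
  rw [locallyIntegrable_iff]
  intro K hK
  obtain ⟨R, hR⟩ := hK.isBounded.subset_closedBall 0
  exact IntegrableOn.mono_set ⟨hf.aestronglyMeasurable, (h R).lt_top⟩ hR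

theorem MemLpLoc.locallyIntegrable_smul {F : Type*} [NormedAddCommGroup F] [NormedSpace ℝ F]
    {p q : ℝ≥0∞} [ENNReal.HolderConjugate p q] {u : Space d → ℝ} {f : Space d → F}
    (hu : MemLpLoc p u) (hf : MemLpLoc q f) : LocallyIntegrable fun x => u x • f x := by
  refine locallyIntegrable_of_closedBall (hu.1.smul hf.1) fun R => ?_
  simp_rw [enorm_smul]
  exact ne_top_of_le_ne_top (ENNReal.mul_ne_top (hu.2 R) (hf.2 R))
    (lintegral_enorm_mul_le (p := p) (q := q) hu.1.aestronglyMeasurable hf.1.aestronglyMeasurable)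

theorem memLpLoc_of_bound {p : ℝ≥0∞} {F : Type*} [NormedAddCommGroup F] {f : Space d → F}
    (hf : StronglyMeasurable f) (C : ℝ) (h : ∀ x, ‖f x‖ ≤ C) : MemLpLoc p f := by
  refine ⟨hf, fun R => ?_⟩
  exact (MemLp.of_bound hf.aestronglyMeasurable C (ae_of_all _ h)).2.ne

theorem MemLpLoc.locallyIntegrable {F : Type*} [NormedAddCommGroup F] [NormedSpace ℝ F]
    {p : ℝ≥0∞} (hp : 1 ≤ p) {f : Space d → F} (hf : MemLpLoc p f) : LocallyIntegrable f := by
  refine locallyIntegrable_of_closedBall hf.1 fun R => ?_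
  have : MemLp f p (volume.restrict (Metric.closedBall 0 R)) :=
    ⟨hf.1.aestronglyMeasurable, (hf.2 R).lt_top⟩
  exact (this.integrable hp).2.ne

/-- A Sobolev vector field with its weak derivative and its weak divergence, all in `L^q_loc`. -/
structure RegularField (q : ℝ≥0∞) (b : Space d → Space d) (divb : Space d → ℝ)
    (Db : Space d → Space d →L[ℝ] Space d) : Prop where
  weakDiv : HasWeakDiv b divb
  weakFDeriv : HasWeakFDeriv b Db
  mem : MemLpLoc q b
  mem_div : MemLpLoc q divb
  mem_fderiv : MemLpLoc q Db

/-- The pairing of a function `u` with `div (b ρₙ(· - x))`: the weak form of `-b · ∇u`, mollified. -/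
def mollifiedTransport (b : Space d → Space d) (divb : Space d → ℝ) (u : Space d → ℝ) (n : ℕ)
    (x : Space d) : ℝ :=
  ∫ y, u y * (fderiv ℝ (mollifier d n) (y - x) (b y) + divb y * mollifier d n (y - x))

section

variable {p q : ℝ≥0∞} [ENNReal.HolderConjugate p q]
  {b : Space d → Space d} {divb : Space d → ℝ} {Db : Space d → Space d →L[ℝ] Space d}
  {u : Space d → ℝ}

theorem continuous_mollifier_sub (n : ℕ) (x : Space d) :
    Continuous fun y => mollifier d n (y - x) :=
  (continuous_mollifier n).comp (continuous_sub_right x)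

theorem continuous_fderiv_mollifier_sub (n : ℕ) (x : Space d) :
    Continuous fun y => fderiv ℝ (mollifier d n) (y - x) :=
  (continuous_fderiv_mollifier n).comp (continuous_sub_right x)

theorem hasCompactSupport_mollifier_sub (n : ℕ) (x : Space d) :
    HasCompactSupport fun y => mollifier d n (y - x) :=
  (hasCompactSupport_mollifier n).comp_homeomorph (Homeomorph.subRight x)

theorem hasCompactSupport_fderiv_mollifier_sub (n : ℕ) (x : Space d) :
    HasCompactSupport fun y => fderiv ℝ (mollifier d n) (y - x) :=
  ((hasCompactSupport_mollifier n).fderiv ℝ).comp_homeomorph (Homeomorph.subRight x)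

theorem integrable_mollifiedTransport (hr : RegularField q b divb Db) (hu : MemLpLoc p u) (n : ℕ)
    (x : Space d) : Integrable fun y =>
      u y * (fderiv ℝ (mollifier d n) (y - x) (b y) + divb y * mollifier d n (y - x)) := by
  have h1 := LocallyIntegrable.integrable_clm_apply (hu.locallyIntegrable_smul hr.mem)
    (continuous_fderiv_mollifier_sub n x) (hasCompactSupport_fderiv_mollifier_sub n x)
  have h2 := (hu.locallyIntegrable_smul hr.mem_div).integrable_smul_left_of_hasCompactSupport
    (continuous_mollifier_sub n x) (hasCompactSupport_mollifier_sub n x)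
  refine (h1.add h2).congr (ae_of_all _ fun y => ?_)
  simp only [Pi.add_apply, map_smul, smul_eq_mul]
  ring

theorem mollifiedTransport_eq (hr : RegularField q b divb Db) (hu : MemLpLoc p u) (n : ℕ)
    (x : Space d) : mollifiedTransport b divb u n x
      = commutator b divb u n x - fderiv ℝ (mollify n u) x (b x) := by
  have hul := hu.locallyIntegrable (ENNReal.HolderConjugate.one_le p q)
  have hi := integrable_smulRight_mollifier hul n x
  have hi2 : Integrable fun y => u y * fderiv ℝ (mollifier d n) (y - x) (b x) := by
    refine (hi.apply_continuousLinearMap (b x)).congr (ae_of_all _ fun y => ?_)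
    simp [mul_comm]
  rw [(hasFDerivAt_mollify hul n x).fderiv, neg_apply, ContinuousLinearMap.integral_apply hi]
  have e : ∫ y, ((fderiv ℝ (mollifier d n) (y - x)).smulRight (u y)) (b x)
      = ∫ y, u y * fderiv ℝ (mollifier d n) (y - x) (b x) :=
    integral_congr_ae (ae_of_all _ fun y => by simp [mul_comm])
  rw [e, commutator, mollifiedTransport, sub_neg_eq_add]
  have e2 : ∫ y, u y * (fderiv ℝ (mollifier d n) (y - x) (b y - b x)
        + divb y * mollifier d n (y - x))
      = (∫ y, u y * (fderiv ℝ (mollifier d n) (y - x) (b y) + divb y * mollifier d n (y - x)))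
        - ∫ y, u y * fderiv ℝ (mollifier d n) (y - x) (b x) := by
    rw [← integral_sub (integrable_mollifiedTransport hr hu n x) hi2]
    refine integral_congr_ae (ae_of_all _ fun y => ?_)
    simp only [map_sub]
    ring
  rw [e2]; ring

theorem locallyIntegrable_commutator (hr : RegularField q b divb Db) (hu : MemLpLoc p u) (n : ℕ) :
    LocallyIntegrable (commutator b divb u n) := by
  refine locallyIntegrable_of_closedBall
    (measurable_commutator hr.mem.1 hr.mem_div.1 hu.1 n) fun R => ?_
  obtain ⟨C, hC, h⟩ := lintegral_commutatorBound_le d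
  refine ne_top_of_le_ne_top ?_ ((lintegral_mono fun x => enorm_commutator_le u n x).trans
    (h (p := p) (q := q) hr.weakFDeriv hr.mem.1 hr.mem_fderiv.1 hr.mem_div.1 hu.1 n R))
  exact ENNReal.mul_ne_top hC (ENNReal.mul_ne_top (hu.2 _)
    (ENNReal.add_ne_top.2 ⟨hr.mem_fderiv.2 _, hr.mem_div.2 _⟩))

theorem HasWeakDiv.integrable_transport (hr : HasWeakDiv b divb) (ψ : TestFun d) :
    Integrable fun x => fderiv ℝ ψ x (b x) + divb x * ψ x := by
  have h1 := LocallyIntegrable.integrable_clm_apply hr.1 (continuous_fderiv_testFun ψ)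
    (ψ.hasCompactSupport.fderiv ℝ)
  have h2 := hr.2.1.integrable_smul_left_of_hasCompactSupport ψ.continuous ψ.hasCompactSupport
  refine (h1.add h2).congr (ae_of_all _ fun y => ?_)
  simp only [Pi.add_apply, smul_eq_mul]
  ring

/-- The product rule for a smooth function of a smooth function: `∇(j ∘ h) = j'(h) ∇h` is
integrated by parts against `ψ b`. -/
theorem HasWeakDiv.integral_deriv_comp_mul (hr : HasWeakDiv b divb) {h : Space d → ℝ}
    (hh : ContDiff ℝ ∞ h) {j : ℝ → ℝ} (hj : ContDiff ℝ ∞ j) (ψ : TestFun d) :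
    (Integrable fun x => deriv j (h x) * fderiv ℝ h x (b x) * ψ x) ∧
    ∫ x, deriv j (h x) * fderiv ℝ h x (b x) * ψ x
      = - ∫ x, j (h x) * (fderiv ℝ ψ x (b x) + divb x * ψ x) := by
  have hjh : ContDiff ℝ ∞ fun x => j (h x) := hj.comp hh
  have hfd : ∀ x v, fderiv ℝ (fun x => j (h x)) x v = deriv j (h x) * fderiv ℝ h x v := by
    intro x v
    have h1 := ((hj.differentiable (by simp)) (h x)).hasDerivAt.comp_hasFDerivAt x
      ((hh.differentiable (by simp)) x).hasFDerivAt
    have h2 : HasFDerivAt (fun x => j (h x)) (deriv j (h x) • fderiv ℝ h x) x := h1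
    rw [h2.fderiv]; rfl
  have c1 : Continuous fun x => ψ x • fderiv ℝ (fun x => j (h x)) x :=
    ψ.continuous.smul (hjh.continuous_fderiv (by simp))
  have s1 : HasCompactSupport fun x => ψ x • fderiv ℝ (fun x => j (h x)) x :=
    ψ.hasCompactSupport.smul_right
  have i1 : Integrable fun x => deriv j (h x) * fderiv ℝ h x (b x) * ψ x := by
    refine (LocallyIntegrable.integrable_clm_apply hr.1 c1 s1).congr (ae_of_all _ fun x => ?_)
    show ψ x • fderiv ℝ (fun x => j (h x)) x (b x) = _
    rw [hfd, smul_eq_mul]; ring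
  refine ⟨i1, ?_⟩
  have c2 : Continuous fun x => j (h x) • fderiv ℝ ψ x :=
    hjh.continuous.smul (continuous_fderiv_testFun ψ)
  have s2 := hasCompactSupport_fun_smul (fun x => j (h x)) (ψ.hasCompactSupport.fderiv ℝ)
  have i2 : Integrable fun x => j (h x) * fderiv ℝ ψ x (b x) :=
    LocallyIntegrable.integrable_clm_apply hr.1 c2 s2
  have i3 : Integrable fun x => j (h x) * ψ x * divb x :=
    hr.2.1.integrable_smul_left_of_hasCompactSupport (hjh.continuous.mul ψ.continuous)
      ψ.hasCompactSupport.mul_left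
  have hw := hr.2.2 (mulTest _ hjh ψ)
  simp only [fderiv_mulTest, mulTest_apply, hfd] at hw
  have e1 : ∫ x, (j (h x) * fderiv ℝ ψ x (b x) + ψ x * (deriv j (h x) * fderiv ℝ h x (b x)))
      = (∫ x, j (h x) * fderiv ℝ ψ x (b x)) + ∫ x, deriv j (h x) * fderiv ℝ h x (b x) * ψ x := by
    rw [← integral_add i2 i1]
    exact integral_congr_ae (ae_of_all _ fun x => by ring)
  have e2 : ∫ x, j (h x) * (fderiv ℝ ψ x (b x) + divb x * ψ x)
      = (∫ x, j (h x) * fderiv ℝ ψ x (b x)) + ∫ x, j (h x) * ψ x * divb x := by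
    rw [← integral_add i2 i3]
    exact integral_congr_ae (ae_of_all _ fun x => by ring)
  rw [e1] at hw
  rw [e2]
  linarith

theorem integral_deriv_mollify_mul (hr : RegularField q b divb Db) (hu : MemLpLoc p u) {j : ℝ → ℝ}
    (hj : ContDiff ℝ ∞ j) (ψ : TestFun d) (n : ℕ) :
    ∫ x, deriv j (mollify n u x) * mollifiedTransport b divb u n x * ψ x
      = (∫ x, j (mollify n u x) * (fderiv ℝ ψ x (b x) + divb x * ψ x))
        + ∫ x, deriv j (mollify n u x) * commutator b divb u n x * ψ x := by
  have hul := hu.locallyIntegrable (ENNReal.HolderConjugate.one_le p q)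
  have hh : ContDiff ℝ ∞ (mollify n u) := contDiff_mollify hul n
  obtain ⟨i1, e1⟩ := hr.weakDiv.integral_deriv_comp_mul hh hj ψ
  have hjc : Continuous fun x => deriv j (mollify n u x) :=
    (hj.continuous_deriv (by simp)).comp hh.continuous
  have i2 : Integrable fun x => deriv j (mollify n u x) * commutator b divb u n x * ψ x := by
    refine ((locallyIntegrable_commutator hr hu n).integrable_smul_left_of_hasCompactSupport
      (hjc.mul ψ.continuous) ψ.hasCompactSupport.mul_left).congr (ae_of_all _ fun x => ?_)
    simp only [smul_eq_mul, Pi.mul_apply]; ring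
  rw [← sub_eq_iff_eq_add', ← neg_eq_iff_eq_neg.2 e1, sub_eq_add_neg, ← sub_eq_add_neg]
  have e3 : ∫ x, deriv j (mollify n u x) * mollifiedTransport b divb u n x * ψ x
      = (∫ x, deriv j (mollify n u x) * commutator b divb u n x * ψ x)
        - ∫ x, deriv j (mollify n u x) * fderiv ℝ (mollify n u) x (b x) * ψ x := by
    rw [← integral_sub i2 i1]
    refine integral_congr_ae (ae_of_all _ fun x => ?_)
    simp only [mollifiedTransport_eq hr hu]; ring
  rw [e3]; ring

theorem enorm_integral_commutator_le {L C₀ R : ℝ} {j : ℝ → ℝ}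
    (hjL : ∀ s, |deriv j s| ≤ L) {ψ : TestFun d} (hψ : ∀ x, |ψ x| ≤ C₀)
    (hψR : ∀ x, R < ‖x‖ → ψ x = 0) (n : ℕ) :
    ‖∫ x, deriv j (mollify n u x) * commutator b divb u n x * ψ x‖ₑ
      ≤ ENNReal.ofReal (L * C₀) * ∫⁻ x in Metric.closedBall 0 R, ‖commutator b divb u n x‖ₑ := by
  refine (enorm_integral_le_lintegral_enorm _).trans ?_
  rw [← lintegral_const_mul' _ _ ENNReal.ofReal_ne_top,
    ← lintegral_indicator measurableSet_closedBall]
  refine lintegral_mono fun x => ?_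
  by_cases hx : x ∈ Metric.closedBall (0 : Space d) R
  · rw [indicator_of_mem hx]
    have h1 : ‖deriv j (mollify n u x) * commutator b divb u n x * ψ x‖ₑ
        = ‖deriv j (mollify n u x) * ψ x‖ₑ * ‖commutator b divb u n x‖ₑ := by
      rw [← enorm_mul]; congr 1; ring
    rw [h1]
    gcongr
    rw [← ofReal_norm]
    refine ENNReal.ofReal_le_ofReal ?_
    rw [norm_mul, Real.norm_eq_abs, Real.norm_eq_abs]
    have := hjL (mollify n u x)
    have := abs_nonneg (deriv j (mollify n u x))
    gcongr
    · linarith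
    · exact hψ x
  · have : ψ x = 0 := hψR x (by simpa using hx)
    simp [this]

/-- At a fixed time, the mollified equation for `j(ρₙ * u)` converges to the equation for `j(u)`. -/
theorem tendsto_integral_deriv_mollify_mul (hp : p ≠ ⊤) (hr : RegularField q b divb Db)
    (hu : MemLpLoc p u) {L : ℝ} {j : ℝ → ℝ} (hj : ContDiff ℝ ∞ j) (hj1 : ∀ s, |j s| ≤ 1)
    (hjL : ∀ s, |deriv j s| ≤ L) (ψ : TestFun d) :
    Tendsto (fun n => ∫ x, deriv j (mollify n u x) * mollifiedTransport b divb u n x * ψ x) atTop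
      (𝓝 (∫ x, j (u x) * (fderiv ℝ ψ x (b x) + divb x * ψ x))) := by
  have hul := hu.locallyIntegrable (ENNReal.HolderConjugate.one_le p q)
  simp_rw [integral_deriv_mollify_mul hr hu hj ψ]
  rw [← add_zero (∫ x, j (u x) * (fderiv ℝ ψ x (b x) + divb x * ψ x))]
  refine Tendsto.add ?_ ?_
  · have hi := hr.weakDiv.integrable_transport ψ
    refine tendsto_integral_of_dominated_convergence
      (fun x => ‖fderiv ℝ ψ x (b x) + divb x * ψ x‖) (fun n => ?_) hi.norm (fun n => ?_) ?_
    · exact (hj.continuous.comp (contDiff_mollify hul n).continuous).aestronglyMeasurable.mul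
        hi.aestronglyMeasurable
    · refine ae_of_all _ fun x => ?_
      rw [norm_mul]
      exact mul_le_of_le_one_left (norm_nonneg _) (hj1 _)
    · filter_upwards [ae_tendsto_mollifier_convolution hul] with x hx
      exact ((hj.continuous.tendsto _).comp hx).mul_const _
  · obtain ⟨C₀, hC₀⟩ := ψ.continuous.bounded_above_of_compact_support ψ.hasCompactSupport
    obtain ⟨R, hR⟩ := ψ.hasCompactSupport.isCompact.isBounded.subset_closedBall 0
    have h0 := tendsto_lintegral_commutator hp hr.weakFDeriv hr.weakDiv hr.mem.1 hr.mem_fderiv.1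
      hr.mem_div.1 hu.1 R (hu.2 _) (hr.mem_fderiv.2 _) (hr.mem_div.2 _)
    have h1 := ENNReal.Tendsto.const_mul (a := ENNReal.ofReal (L * C₀)) h0
      (Or.inr ENNReal.ofReal_ne_top)
    rw [mul_zero] at h1
    rw [tendsto_iff_enorm_sub_tendsto_zero]
    refine tendsto_of_tendsto_of_tendsto_of_le_of_le tendsto_const_nhds h1 (fun _ => bot_le)
      fun n => ?_
    simp only [sub_zero]
    refine enorm_integral_commutator_le hjL hC₀ (fun x hx => ?_) n
    by_contra h
    have := hR (subset_tsupport _ h)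
    rw [Metric.mem_closedBall, dist_zero_right] at this
    linarith

end

/-- The bound that dominates the mollified equations, uniformly in `n`. -/
theorem exists_enorm_integral_deriv_mollify_mul_le (d : ℕ) (p : ℝ≥0∞) {M : ℝ≥0∞} (hM : M ≠ ⊤)
    (L C₀ R : ℝ) : ∃ K : ℝ≥0∞, K ≠ ⊤ ∧
    ∀ {q : ℝ≥0∞} [ENNReal.HolderConjugate p q] {b : Space d → Space d} {divb : Space d → ℝ}
      {Db : Space d → Space d →L[ℝ] Space d} {u : Space d → ℝ} (_ : RegularField q b divb Db)
      (_ : MemLpLoc p u) (_ : eLpNorm u p (volume.restrict (Metric.closedBall 0 (R + 2))) ≤ M)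
      {j : ℝ → ℝ} (_ : ContDiff ℝ ∞ j) (_ : ∀ s, |j s| ≤ 1) (_ : ∀ s, |deriv j s| ≤ L)
      {ψ : TestFun d} (_ : ∀ x, |ψ x| ≤ C₀) (_ : ∀ x, ‖fderiv ℝ ψ x‖ ≤ C₀)
      (_ : ∀ x, R < ‖x‖ → ψ x = 0) (n : ℕ),
      ‖∫ x, deriv j (mollify n u x) * mollifiedTransport b divb u n x * ψ x‖ₑ
        ≤ K * (eLpNorm b q (volume.restrict (Metric.closedBall 0 (R + 2)))
          + eLpNorm divb q (volume.restrict (Metric.closedBall 0 (R + 2)))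
          + eLpNorm Db q (volume.restrict (Metric.closedBall 0 (R + 2)))) := by
  obtain ⟨C, hC, hbd⟩ := lintegral_commutatorBound_le d
  set V := eLpNorm (fun _ : Space d => (1 : ℝ)) p (volume.restrict (Metric.closedBall 0 (R + 2)))
  have hV : V ≠ ⊤ := (memLp_const (1 : ℝ)).2.ne
  refine ⟨ENNReal.ofReal C₀ * V + ENNReal.ofReal (L * C₀) * (C * M), ?_, ?_⟩
  · exact ENNReal.add_ne_top.2 ⟨ENNReal.mul_ne_top ENNReal.ofReal_ne_top hV,
      ENNReal.mul_ne_top ENNReal.ofReal_ne_top (ENNReal.mul_ne_top hC hM)⟩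
  intro q _ b divb Db u hr hu huM j hj hj1 hjL ψ hψ hDψ hψR n
  rw [integral_deriv_mollify_mul hr hu hj ψ]
  set Nb := eLpNorm b q (volume.restrict (Metric.closedBall 0 (R + 2)))
  set Nd := eLpNorm divb q (volume.restrict (Metric.closedBall 0 (R + 2)))
  set ND := eLpNorm Db q (volume.restrict (Metric.closedBall 0 (R + 2)))
  have hsub : Metric.closedBall (0 : Space d) R ⊆ Metric.closedBall 0 (R + 2) :=
    Metric.closedBall_subset_closedBall (by linarith)
  have hL : ∀ {F : Type} [NormedAddCommGroup F] {f : Space d → F} (_ : StronglyMeasurable f),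
      ∫⁻ x in Metric.closedBall 0 R, ‖f x‖ₑ
        ≤ V * eLpNorm f q (volume.restrict (Metric.closedBall 0 (R + 2))) := by
    intro F _ f hf
    refine (lintegral_mono_set hsub).trans ?_
    have := lintegral_enorm_mul_le (p := p) (q := q)
      (μ := volume.restrict (Metric.closedBall (0 : Space d) (R + 2)))
      (f := fun _ : Space d => (1 : ℝ)) (g := f) aestronglyMeasurable_const hf.aestronglyMeasurable
    simpa using this
  have hD0 : ∀ x, R < ‖x‖ → fderiv ℝ ψ x = 0 := by
    intro x hx
    have : ∀ᶠ y in 𝓝 x, ψ y = 0 := by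
      filter_upwards [(isOpen_lt continuous_const continuous_norm).mem_nhds hx] with y hy
      exact hψR y hy
    have h2 : ⇑ψ =ᶠ[𝓝 x] fun _ => (0 : ℝ) := this
    rw [h2.fderiv_eq, fderiv_fun_const]; rfl
  have p1 : ‖∫ x, j (mollify n u x) * (fderiv ℝ ψ x (b x) + divb x * ψ x)‖ₑ
      ≤ ENNReal.ofReal C₀ * V * (Nb + Nd) := by
    refine (enorm_integral_le_lintegral_enorm _).trans ?_
    calc _ ≤ ∫⁻ x in Metric.closedBall 0 R, ENNReal.ofReal C₀ * (‖b x‖ₑ + ‖divb x‖ₑ) := by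
          rw [← lintegral_indicator measurableSet_closedBall]
          refine lintegral_mono fun x => ?_
          by_cases hx : x ∈ Metric.closedBall (0 : Space d) R
          · rw [indicator_of_mem hx, enorm_mul]
            have h1 : ‖j (mollify n u x)‖ₑ ≤ 1 := by
              rw [← ofReal_norm, ← ENNReal.ofReal_one]
              exact ENNReal.ofReal_le_ofReal (hj1 _)
            have h2 : ‖fderiv ℝ ψ x‖ₑ ≤ ENNReal.ofReal C₀ := by
              rw [← ofReal_norm]; exact ENNReal.ofReal_le_ofReal (hDψ x)
            have h3 : ‖ψ x‖ₑ ≤ ENNReal.ofReal C₀ := by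
              rw [← ofReal_norm]; exact ENNReal.ofReal_le_ofReal (hψ x)
            calc _ ≤ 1 * (‖fderiv ℝ ψ x (b x)‖ₑ + ‖divb x * ψ x‖ₑ) := by
                  gcongr; exact enorm_add_le _ _
              _ ≤ 1 * (ENNReal.ofReal C₀ * ‖b x‖ₑ + ‖divb x‖ₑ * ENNReal.ofReal C₀) := by
                  rw [enorm_mul]
                  gcongr
                  exact (ContinuousLinearMap.le_opENorm _ _).trans (by gcongr)
              _ = _ := by ring
          · have hx' : R < ‖x‖ := by simpa using hx
            have e : j (mollify n u x) * (fderiv ℝ ψ x (b x) + divb x * ψ x) = 0 := by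
              rw [hψR x hx', hD0 x hx']; simp
            rw [e]; simp
      _ = ENNReal.ofReal C₀ * ((∫⁻ x in Metric.closedBall 0 R, ‖b x‖ₑ)
            + ∫⁻ x in Metric.closedBall 0 R, ‖divb x‖ₑ) := by
          rw [lintegral_const_mul' _ _ ENNReal.ofReal_ne_top, lintegral_add_left hr.mem.1.enorm]
      _ ≤ ENNReal.ofReal C₀ * (V * Nb + V * Nd) := by
          gcongr
          · exact hL hr.mem.1
          · exact hL hr.mem_div.1
      _ = _ := by ring
  have p2 : ‖∫ x, deriv j (mollify n u x) * commutator b divb u n x * ψ x‖ₑ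
      ≤ ENNReal.ofReal (L * C₀) * (C * M) * (ND + Nd) := by
    refine (enorm_integral_commutator_le hjL hψ hψR n).trans ?_
    calc _ ≤ ENNReal.ofReal (L * C₀) * (C * (M * (ND + Nd))) := by
          gcongr
          refine (lintegral_mono fun x => enorm_commutator_le u n x).trans
            ((hbd (p := p) (q := q) hr.weakFDeriv hr.mem.1 hr.mem_fderiv.1 hr.mem_div.1
              hu.1 n R).trans ?_)
          gcongr
      _ = _ := by ring
  calc _ ≤ _ := enorm_add_le _ _
    _ ≤ ENNReal.ofReal C₀ * V * (Nb + Nd) + ENNReal.ofReal (L * C₀) * (C * M) * (ND + Nd) :=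
        add_le_add p1 p2
    _ ≤ ENNReal.ofReal C₀ * V * (Nb + Nd + ND)
          + ENNReal.ofReal (L * C₀) * (C * M) * (Nb + Nd + ND) := by
        refine add_le_add (mul_le_mul_right le_self_add _) (mul_le_mul_right ?_ _)
        rw [add_comm ND]
        exact add_le_add le_add_self le_rfl
    _ = _ := by ring

/-! ### Renormalization along a path -/

theorem measurable_eLpNorm_uncurry {α β F : Type*} [MeasurableSpace α] [MeasurableSpace β]
    [NormedAddCommGroup F] {μ : Measure β} [SFinite μ] {f : α → β → F}
    (hf : StronglyMeasurable (Function.uncurry f)) (r : ℝ≥0∞) :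
    Measurable fun a => eLpNorm (f a) r μ := by
  have hm : Measurable fun z : α × β => ‖f z.1 z.2‖ₑ := hf.enorm
  rcases eq_or_ne r 0 with rfl | h0
  · simp
  rcases eq_or_ne r ⊤ with rfl | ht
  · refine measurable_of_Iic fun c => ?_
    have e : (fun a => eLpNorm (f a) ⊤ μ) ⁻¹' Iic c
        = (fun a => μ (Prod.mk a ⁻¹' {z : α × β | c < ‖f z.1 z.2‖ₑ})) ⁻¹' {0} := by
      ext a
      simp only [mem_preimage, mem_Iic, mem_singleton_iff, eLpNorm_exponent_top, eLpNormEssSup]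
      have h1 : (essSup (fun x => ‖f a x‖ₑ) μ ≤ c) ↔ ∀ᵐ x ∂μ, ‖f a x‖ₑ ≤ c :=
        ⟨fun h => (ENNReal.ae_le_essSup _).mono fun x hx => hx.trans h,
          fun h => essSup_le_of_ae_le c h⟩
      rw [h1, ae_iff]
      simp only [not_le]
      rfl
    rw [e]
    exact (measurable_measure_prodMk_left (measurableSet_lt measurable_const hm))
      (measurableSet_singleton 0)
  · simp_rw [eLpNorm_eq_lintegral_rpow_enorm_toReal h0 ht]
    have : Measurable fun z : α × β => ‖f z.1 z.2‖ₑ ^ r.toReal := hm.pow_const _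
    exact this.lintegral_prod_right'.pow_const _

variable {d : ℕ}

/-- A time-dependent vector field to which the renormalization argument applies. All the data are
measurable functions defined everywhere; `D` and `F` bound the divergence and the growth at
infinity, up to the part of the growth that is integrable and bounded by `f`. -/
structure RegularDrift (T : ℝ) (q : ℝ≥0∞) (b : ℝ → Space d → Space d) (divb : ℝ → Space d → ℝ)
    (Db : ℝ → Space d → Space d →L[ℝ] Space d) (f : ℝ → Space d → ℝ) (D F : ℝ → ℝ) : Prop where
  meas : StronglyMeasurable (Function.uncurry b)
  meas_div : StronglyMeasurable (Function.uncurry divb)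
  meas_fderiv : StronglyMeasurable (Function.uncurry Db)
  meas_f : StronglyMeasurable (Function.uncurry f)
  regular : ∀ᵐ t ∂(volume.restrict (Icc (0 : ℝ) T)), RegularField q (b t) (divb t) (Db t)
  lintegral_ne_top : ∀ R : ℝ, ∫⁻ t in Icc 0 T,
    (eLpNorm (b t) q (volume.restrict (Metric.closedBall 0 R))
      + eLpNorm (divb t) q (volume.restrict (Metric.closedBall 0 R))
      + eLpNorm (Db t) q (volume.restrict (Metric.closedBall 0 R))) ≠ ⊤
  integrable_D : IntegrableOn D (Icc 0 T)
  integrable_F : IntegrableOn F (Icc 0 T)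
  D_nonneg : ∀ t, 0 ≤ D t
  F_nonneg : ∀ t, 0 ≤ F t
  f_nonneg : ∀ t x, 0 ≤ f t x
  lintegral_f : ∫⁻ t in Icc 0 T, ∫⁻ x, ‖f t x‖ₑ ≠ ⊤
  div_le : ∀ᵐ t ∂(volume.restrict (Icc (0 : ℝ) T)), ∀ᵐ x, |divb t x| ≤ D t
  growth : ∀ᵐ t ∂(volume.restrict (Icc (0 : ℝ) T)), ∀ᵐ x, ‖b t x‖ ≤ (1 + ‖x‖) * (f t x + F t)

/-- The equation at time `t`, in the coordinates moving along `B`, tested against mollifiers: a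
function `v` is the value at time `t` of the solution with earlier values `u` and initial value
`u₀`. -/
def ShiftedEquation (b : ℝ → Space d → Space d) (divb : ℝ → Space d → ℝ) (B : ℝ → Space d)
    (u₀ : Space d → ℝ) (u : ℝ → Space d → ℝ) (t : ℝ) (v : Space d → ℝ) : Prop :=
  ∀ n x, mollify n v (x + B t) = mollify n u₀ (x + B 0)
    + ∫ s in (0 : ℝ)..t, mollifiedTransport (b s) (divb s) (u s) n (x + B s)

/-- Measurable functions of `(t, x)` which are bounded in `Lᵖ_loc`, uniformly in `t`. -/
structure BoundedLpLoc (T : ℝ) (p : ℝ≥0∞) (u : ℝ → Space d → ℝ) : Prop where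
  meas : StronglyMeasurable (Function.uncurry u)
  bound : ∀ R : ℝ, ∃ M : ℝ≥0∞, M ≠ ⊤ ∧ ∀ᵐ t ∂(volume.restrict (Icc (0 : ℝ) T)),
    eLpNorm (u t) p (volume.restrict (Metric.closedBall 0 R)) ≤ M

theorem BoundedLpLoc.memLpLoc {T : ℝ} {p : ℝ≥0∞} {u : ℝ → Space d → ℝ}
    (h : BoundedLpLoc T p u) : ∀ᵐ t ∂(volume.restrict (Icc (0 : ℝ) T)), MemLpLoc p (u t) := by
  choose M hM hb using fun n : ℕ => h.bound n
  filter_upwards [ae_all_iff.2 hb] with t ht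
  refine ⟨h.meas.comp_measurable measurable_prodMk_left, fun R => ?_⟩
  obtain ⟨n, hn⟩ := exists_nat_ge R
  refine ne_top_of_le_ne_top (hM n) (le_trans (eLpNorm_mono_measure _ ?_) (ht n))
  exact Measure.restrict_mono (Metric.closedBall_subset_closedBall hn) le_rfl

section

variable {T : ℝ} {p q : ℝ≥0∞} [ENNReal.HolderConjugate p q]
  {b : ℝ → Space d → Space d} {divb : ℝ → Space d → ℝ}
  {Db : ℝ → Space d → Space d →L[ℝ] Space d} {f : ℝ → Space d → ℝ} {D F : ℝ → ℝ}
  {u : ℝ → Space d → ℝ} {B : ℝ → Space d} {u₀ : Space d → ℝ}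

/-- The norms of the drift that dominate the mollified equations. -/
def driftNorm (q : ℝ≥0∞) (b : ℝ → Space d → Space d) (divb : ℝ → Space d → ℝ)
    (Db : ℝ → Space d → Space d →L[ℝ] Space d) (R t : ℝ) : ℝ≥0∞ :=
  eLpNorm (b t) q (volume.restrict (Metric.closedBall 0 R))
    + eLpNorm (divb t) q (volume.restrict (Metric.closedBall 0 R))
    + eLpNorm (Db t) q (volume.restrict (Metric.closedBall 0 R))

theorem RegularDrift.measurable_driftNorm (hr : RegularDrift T q b divb Db f D F) (R : ℝ) :
    Measurable (driftNorm q b divb Db R) :=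
  ((measurable_eLpNorm_uncurry hr.meas q).add (measurable_eLpNorm_uncurry hr.meas_div q)).add
    (measurable_eLpNorm_uncurry hr.meas_fderiv q)

theorem stronglyMeasurable_mollify_path (hB : Continuous B)
    (hu : StronglyMeasurable (Function.uncurry u)) (n : ℕ) :
    StronglyMeasurable fun z : ℝ × Space d => mollify n (u z.1) (z.2 + B z.1) := by
  have h1 : StronglyMeasurable fun z : (ℝ × Space d) × Space d =>
      mollifier d n (z.2 - (z.1.2 + B z.1.1)) :=
    ((continuous_mollifier n).comp (by fun_prop)).stronglyMeasurable
  have h2 : StronglyMeasurable fun z : (ℝ × Space d) × Space d => u z.1.1 z.2 :=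
    hu.comp_measurable (measurable_fst.fst.prodMk measurable_snd)
  exact (h1.smul h2).integral_prod_right'

theorem stronglyMeasurable_mollifiedTransport_path (hB : Continuous B)
    (hb : StronglyMeasurable (Function.uncurry b)) (hd : StronglyMeasurable (Function.uncurry divb))
    (hu : StronglyMeasurable (Function.uncurry u)) (n : ℕ) :
    StronglyMeasurable fun z : ℝ × Space d =>
      mollifiedTransport (b z.1) (divb z.1) (u z.1) n (z.2 + B z.1) := by
  have hp : Measurable fun z : (ℝ × Space d) × Space d => (z.1.1, z.2) :=
    measurable_fst.fst.prodMk measurable_snd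
  have h1 : StronglyMeasurable fun z : (ℝ × Space d) × Space d =>
      mollifier d n (z.2 - (z.1.2 + B z.1.1)) :=
    ((continuous_mollifier n).comp (by fun_prop)).stronglyMeasurable
  have h2 : StronglyMeasurable fun z : (ℝ × Space d) × Space d => u z.1.1 z.2 :=
    hu.comp_measurable hp
  have h3 : StronglyMeasurable fun z : (ℝ × Space d) × Space d => divb z.1.1 z.2 :=
    hd.comp_measurable hp
  have h4 : StronglyMeasurable fun z : (ℝ × Space d) × Space d => b z.1.1 z.2 :=
    hb.comp_measurable hp
  have h5 : StronglyMeasurable fun z : (ℝ × Space d) × Space d =>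
      fderiv ℝ (mollifier d n) (z.2 - (z.1.2 + B z.1.1)) :=
    ((continuous_fderiv_mollifier n).comp (by fun_prop)).stronglyMeasurable
  have h6 : StronglyMeasurable fun z : (ℝ × Space d) × Space d =>
      fderiv ℝ (mollifier d n) (z.2 - (z.1.2 + B z.1.1)) (b z.1.1 z.2) :=
    (isBoundedBilinearMap_apply (𝕜 := ℝ) (E := Space d) (F := ℝ)).continuous.comp_stronglyMeasurable
      (h5.prodMk h4)
  exact (h2.mul (h6.add (h3.mul h1))).integral_prod_right'

/-- For a fixed scale `n` the mollified transport term is bounded locally uniformly in space by the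
local norms of the field. One constant `K` serves all fields, hence all times. -/
theorem exists_enorm_mollifiedTransport_le (p : ℝ≥0∞) {M : ℝ≥0∞} (hM : M ≠ ⊤) (n : ℕ) (R : ℝ) :
    ∃ K : ℝ≥0∞, K ≠ ⊤ ∧ ∀ {q : ℝ≥0∞} [ENNReal.HolderConjugate p q] {b : Space d → Space d}
      {divb : Space d → ℝ} {Db : Space d → Space d →L[ℝ] Space d} {u : Space d → ℝ}
      (_ : RegularField q b divb Db) (_ : MemLpLoc p u)
      (_ : eLpNorm u p (volume.restrict (Metric.closedBall 0 (R + 1))) ≤ M) (x : Space d)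
      (_ : ‖x‖ ≤ R),
      ‖mollifiedTransport b divb u n x‖ₑ
        ≤ K * (eLpNorm b q (volume.restrict (Metric.closedBall 0 (R + 1)))
          + eLpNorm divb q (volume.restrict (Metric.closedBall 0 (R + 1)))) := by
  obtain ⟨C₁, hC₁⟩ := (continuous_mollifier (d := d) n).bounded_above_of_compact_support
    (hasCompactSupport_mollifier n)
  obtain ⟨C₂, hC₂⟩ := (continuous_fderiv_mollifier (d := d) n).bounded_above_of_compact_support
    ((hasCompactSupport_mollifier n).fderiv ℝ)
  have e1 : ∀ x, ‖mollifier d n x‖ₑ ≤ ENNReal.ofReal (max C₁ C₂) := fun x => by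
    rw [← ofReal_norm]; exact ENNReal.ofReal_le_ofReal ((hC₁ x).trans (le_max_left _ _))
  have e2 : ∀ x, ‖fderiv ℝ (mollifier d n) x‖ₑ ≤ ENNReal.ofReal (max C₁ C₂) := fun x => by
    rw [← ofReal_norm]; exact ENNReal.ofReal_le_ofReal ((hC₂ x).trans (le_max_right _ _))
  refine ⟨ENNReal.ofReal (max C₁ C₂) * M, ENNReal.mul_ne_top ENNReal.ofReal_ne_top hM, ?_⟩
  intro q _ b divb Db u hr hu huM x hx
  refine (enorm_integral_le_lintegral_enorm _).trans ?_
  have m1 : Measurable fun y => ‖u y‖ₑ * ‖b y‖ₑ := hu.1.enorm.mul hr.mem.1.enorm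
  have m2 : Measurable fun y => ‖u y‖ₑ * ‖divb y‖ₑ := hu.1.enorm.mul hr.mem_div.1.enorm
  calc _ ≤ ∫⁻ y in Metric.closedBall 0 (R + 1),
        ENNReal.ofReal (max C₁ C₂) * (‖u y‖ₑ * ‖b y‖ₑ + ‖u y‖ₑ * ‖divb y‖ₑ) := by
        rw [← lintegral_indicator measurableSet_closedBall]
        refine lintegral_mono fun y => ?_
        by_cases hy : y ∈ Metric.closedBall (0 : Space d) (R + 1)
        · rw [indicator_of_mem hy, enorm_mul]
          calc _ ≤ ‖u y‖ₑ * (‖fderiv ℝ (mollifier d n) (y - x) (b y)‖ₑ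
                + ‖divb y * mollifier d n (y - x)‖ₑ) := by gcongr; exact enorm_add_le _ _
            _ ≤ ‖u y‖ₑ * (ENNReal.ofReal (max C₁ C₂) * ‖b y‖ₑ
                + ‖divb y‖ₑ * ENNReal.ofReal (max C₁ C₂)) := by
                rw [enorm_mul]
                gcongr
                · exact (ContinuousLinearMap.le_opENorm _ _).trans (by gcongr; exact e2 _)
                · exact e1 _
            _ = _ := by ring
        · have hyx : 1 / ((n : ℝ) + 1) < ‖y - x‖ := by
            refine (one_div_succ_le_one n).trans_lt ?_
            simp only [Metric.mem_closedBall, dist_zero_right, not_le] at hy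
            linarith [norm_sub_norm_le y x]
          have e : u y * (fderiv ℝ (mollifier d n) (y - x) (b y)
              + divb y * mollifier d n (y - x)) = 0 := by
            rw [mollifier_eq_zero n hyx, fderiv_mollifier_eq_zero n hyx]; simp
          rw [e]; simp
    _ = ENNReal.ofReal (max C₁ C₂) * ((∫⁻ y in Metric.closedBall 0 (R + 1), ‖u y‖ₑ * ‖b y‖ₑ)
          + ∫⁻ y in Metric.closedBall 0 (R + 1), ‖u y‖ₑ * ‖divb y‖ₑ) := by
        rw [lintegral_const_mul' _ _ ENNReal.ofReal_ne_top, lintegral_add_left m1]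
    _ ≤ ENNReal.ofReal (max C₁ C₂)
          * (M * eLpNorm b q (volume.restrict (Metric.closedBall 0 (R + 1)))
            + M * eLpNorm divb q (volume.restrict (Metric.closedBall 0 (R + 1)))) := by
        gcongr
        · exact (lintegral_enorm_mul_le (p := p) (q := q) hu.1.aestronglyMeasurable
            hr.mem.1.aestronglyMeasurable).trans (by gcongr)
        · exact (lintegral_enorm_mul_le (p := p) (q := q) hu.1.aestronglyMeasurable
            hr.mem_div.1.aestronglyMeasurable).trans (by gcongr)
    _ = _ := by ring

theorem exists_norm_le_path (hB : Continuous B) (T : ℝ) :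
    ∃ β : ℝ, 0 ≤ β ∧ ∀ s ∈ Icc 0 T, ‖B s‖ ≤ β := by
  obtain ⟨β, hβ⟩ := (isCompact_Icc (a := (0 : ℝ)) (b := T)).exists_bound_of_continuousOn
    hB.continuousOn
  exact ⟨max β 0, le_max_right _ _, fun s hs => (hβ s hs).trans (le_max_left _ _)⟩

/-- The mollified equations are dominated, locally uniformly in `x` and uniformly on bounded sets of
`Lᵖ_loc`, by an integrable function of time. -/
theorem RegularDrift.exists_path_bound_of_eLpNorm_le (p : ℝ≥0∞) [ENNReal.HolderConjugate p q]
    (hr : RegularDrift T q b divb Db f D F) (hB : Continuous B) (n : ℕ) (r : ℝ) :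
    ∃ R : ℝ, ∀ {M : ℝ≥0∞}, M ≠ ⊤ → ∃ A : ℝ → ℝ≥0∞, Measurable A ∧ ∫⁻ s in Icc 0 T, A s ≠ ⊤ ∧
      ∀ᵐ s ∂(volume.restrict (Icc (0 : ℝ) T)), ∀ v, MemLpLoc p v →
        eLpNorm v p (volume.restrict (Metric.closedBall 0 R)) ≤ M → ∀ x : Space d, ‖x‖ ≤ r →
          ‖mollifiedTransport (b s) (divb s) v n (x + B s)‖ₑ ≤ A s := by
  obtain ⟨β, hβ0, hβ⟩ := exists_norm_le_path hB T
  refine ⟨r + β + 1, fun {M} hM => ?_⟩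
  obtain ⟨K, hK, hKb⟩ := exists_enorm_mollifiedTransport_le (d := d) p hM n (r + β)
  refine ⟨fun s => K * driftNorm q b divb Db (r + β + 1) s,
    (hr.measurable_driftNorm _).const_mul _, ?_, ?_⟩
  · rw [lintegral_const_mul _ (hr.measurable_driftNorm _)]
    exact ENNReal.mul_ne_top hK (hr.lintegral_ne_top _)
  · filter_upwards [hr.regular, ae_restrict_mem measurableSet_Icc] with s h1 h4 v h2 h3 x hx
    refine (hKb h1 h2 h3 (x + B s) ((norm_add_le _ _).trans (add_le_add hx (hβ s h4)))).trans ?_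
    gcongr
    exact le_self_add

theorem RegularDrift.exists_path_bound (hr : RegularDrift T q b divb Db f D F)
    (hu : BoundedLpLoc T p u) (hB : Continuous B) (n : ℕ) (r : ℝ) :
    ∃ A : ℝ → ℝ≥0∞, Measurable A ∧ ∫⁻ s in Icc 0 T, A s ≠ ⊤ ∧
      ∀ᵐ s ∂(volume.restrict (Icc (0 : ℝ) T)), ∀ x : Space d, ‖x‖ ≤ r →
        ‖mollifiedTransport (b s) (divb s) (u s) n (x + B s)‖ₑ ≤ A s := by
  obtain ⟨R, hR⟩ := hr.exists_path_bound_of_eLpNorm_le p hB n r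
  obtain ⟨M, hM, hMu⟩ := hu.bound R
  obtain ⟨A, hAm, hA, h⟩ := hR hM
  refine ⟨A, hAm, hA, ?_⟩
  filter_upwards [h, hu.memLpLoc, hMu] with s h1 h2 h3 using h1 _ h2 h3

theorem RegularDrift.integrableOn_mollifiedTransport (hr : RegularDrift T q b divb Db f D F)
    (hu : BoundedLpLoc T p u) (hB : Continuous B) (n : ℕ) (x : Space d) :
    IntegrableOn (fun s => mollifiedTransport (b s) (divb s) (u s) n (x + B s)) (Icc 0 T) := by
  obtain ⟨A, hAm, hA, hAb⟩ := hr.exists_path_bound hu hB n ‖x‖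
  refine ⟨?_, lt_of_le_of_lt (lintegral_mono_ae (hAb.mono fun s hs => hs x le_rfl)) hA.lt_top⟩
  have := (stronglyMeasurable_mollifiedTransport_path hB hr.meas hr.meas_div hu.meas
    n).comp_measurable (g := fun s : ℝ => (s, x)) (measurable_id.prodMk measurable_const)
  exact this.aestronglyMeasurable

/-- The equation for `j(ρₙ * u)`, tested against `ψ` in the moving coordinates. -/
theorem RegularDrift.mollified_renormalized (hr : RegularDrift T q b divb Db f D F)
    (hu : BoundedLpLoc T p u) (hB : Continuous B) (hu₀ : MemLpLoc p u₀)
    (hsf : ∀ᵐ s ∂(volume.restrict (Icc (0 : ℝ) T)), ShiftedEquation b divb B u₀ u s (u s))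
    {t : ℝ} (ht : t ∈ Icc 0 T) {v : Space d → ℝ}
    (hvt : ShiftedEquation b divb B u₀ u t v) {j : ℝ → ℝ} (hj : ContDiff ℝ ∞ j) {L : ℝ}
    (hjL : ∀ s, |deriv j s| ≤ L) (ψ : TestFun d) (n : ℕ) :
    ∫ x, j (mollify n v x) * translate ψ (B t) x
      = (∫ x, j (mollify n u₀ x) * translate ψ (B 0) x)
        + ∫ s in (0 : ℝ)..t, ∫ x, deriv j (mollify n (u s) x)
            * mollifiedTransport (b s) (divb s) (u s) n x * translate ψ (B s) x := by
  have hp1 : 1 ≤ p := ENNReal.HolderConjugate.one_le p q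
  set H : ℝ → Space d → ℝ := fun s x => mollify n (u s) (x + B s) with hH
  set G : ℝ → Space d → ℝ := fun s x =>
    mollifiedTransport (b s) (divb s) (u s) n (x + B s) with hG
  have hHm : StronglyMeasurable fun z : ℝ × Space d => H z.1 z.2 :=
    stronglyMeasurable_mollify_path hB hu.meas n
  have hGm : StronglyMeasurable fun z : ℝ × Space d => G z.1 z.2 :=
    stronglyMeasurable_mollifiedTransport_path hB hr.meas hr.meas_div hu.meas n
  have hGi : ∀ x, IntegrableOn (fun s => G s x) (Icc 0 T) := fun x =>
    hr.integrableOn_mollifiedTransport hu hB n x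
  have hjc : Continuous (deriv j) := hj.continuous_deriv (by simp)
  have hIoc : Ioc (0 : ℝ) t ⊆ Icc 0 T := Ioc_subset_Icc_self.trans (Icc_subset_Icc le_rfl ht.2)
  -- the chain rule, for every point `x`
  have hchain : ∀ x, j (mollify n v (x + B t)) = j (mollify n u₀ (x + B 0))
      + ∫ s in (0 : ℝ)..t, deriv j (H s x) * G s x := by
    intro x
    set Fx : ℝ → ℝ := fun s => mollify n u₀ (x + B 0) + ∫ r in (0 : ℝ)..s, G r x with hFx
    have hF0 : Fx 0 = mollify n u₀ (x + B 0) := by simp [hFx]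
    have hF : ∀ s ∈ Icc 0 T, Fx s = Fx 0 + ∫ r in (0 : ℝ)..s, G r x := fun s _ => by
      rw [hF0]
    obtain ⟨C, hC⟩ := (isCompact_Icc (a := (0 : ℝ)) (b := T)).exists_bound_of_continuousOn
      (continuousOn_of_eq_primitive (hGi x) hF)
    obtain ⟨-, h⟩ := comp_eq_integral_of_eq_primitive (m := -C) (M := C) (j := j) (j' := deriv j)
      (hGi x) hF (fun s hs => abs_le.1 (hC s hs))
      (fun z _ => ((hj.differentiable (by simp)) z).hasDerivAt.hasDerivWithinAt)
      hjc.continuousOn ht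
    have hFt : Fx t = mollify n v (x + B t) := (hvt n x).symm
    rw [hFt, hF0] at h
    rw [h]
    congr 1
    rw [intervalIntegral.integral_of_le ht.1, intervalIntegral.integral_of_le ht.1]
    refine integral_congr_ae ?_
    filter_upwards [ae_restrict_of_ae_restrict_of_subset hIoc hsf] with s hs
    have : Fx s = H s x := (hs n x).symm
    rw [this]
  -- the integrability that allows the exchange of the integrals in time and space
  have hint : Integrable (fun z : Space d × ℝ => deriv j (H z.2 z.1) * G z.2 z.1 * ψ z.1)
      ((volume : Measure (Space d)).prod (volume.restrict (Icc 0 T))) := by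
    obtain ⟨C₀, hC₀⟩ := ψ.continuous.bounded_above_of_compact_support ψ.hasCompactSupport
    obtain ⟨R, hR⟩ := ψ.hasCompactSupport.isCompact.isBounded.subset_closedBall 0
    obtain ⟨A, hAm, hA, hAb⟩ := hr.exists_path_bound hu hB n R
    have hsw : Measurable fun z : Space d × ℝ => (z.2, z.1) := measurable_swap
    have hm : StronglyMeasurable fun z : Space d × ℝ =>
        deriv j (H z.2 z.1) * G z.2 z.1 * ψ z.1 :=
      ((hjc.comp_stronglyMeasurable (hHm.comp_measurable hsw)).mul
        (hGm.comp_measurable hsw)).mul (ψ.continuous.comp continuous_fst).stronglyMeasurable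
    refine ⟨hm.aestronglyMeasurable, ?_⟩
    rw [HasFiniteIntegral, lintegral_prod _ hm.enorm.aemeasurable]
    have hL0 : 0 ≤ L := (abs_nonneg _).trans (hjL 0)
    calc _ ≤ ∫⁻ x, (Metric.closedBall (0 : Space d) R).indicator
          (fun _ => ENNReal.ofReal (L * C₀) * ∫⁻ s in Icc 0 T, A s) x := by
          refine lintegral_mono fun x => ?_
          by_cases hx : x ∈ Metric.closedBall (0 : Space d) R
          · rw [indicator_of_mem hx, ← lintegral_const_mul' _ _ ENNReal.ofReal_ne_top]
            refine lintegral_mono_ae (hAb.mono fun s hs => ?_)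
            have e : ‖deriv j (H s x) * G s x * ψ x‖ₑ
                = ‖deriv j (H s x) * ψ x‖ₑ * ‖G s x‖ₑ := by
              rw [← enorm_mul]; congr 1; ring
            show ‖deriv j (H s x) * G s x * ψ x‖ₑ ≤ _
            rw [e]
            refine mul_le_mul' ?_ (hs x (by simpa using hx))
            rw [← ofReal_norm, norm_mul]
            exact ENNReal.ofReal_le_ofReal (mul_le_mul (hjL _) (hC₀ x) (norm_nonneg _) hL0)
          · have : ψ x = 0 := by
              by_contra h
              exact hx (hR (subset_tsupport _ h))
            simp [this]
      _ < ⊤ := by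
          rw [lintegral_indicator measurableSet_closedBall, setLIntegral_const]
          exact ENNReal.mul_lt_top (ENNReal.mul_lt_top ENNReal.ofReal_lt_top hA.lt_top)
            measure_closedBall_lt_top
  have hint' : Integrable (fun z : Space d × ℝ => deriv j (H z.2 z.1) * G z.2 z.1 * ψ z.1)
      ((volume : Measure (Space d)).prod (volume.restrict (Ioc 0 t))) :=
    hint.mono_measure (Measure.prod_mono le_rfl (Measure.restrict_mono hIoc le_rfl))
  have hcont : ∀ {w : Space d → ℝ}, MemLpLoc p w → ∀ a : Space d,
      Integrable fun x => j (mollify n w (x + a)) * ψ x := by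
    intro w hw a
    have hc : Continuous fun x => j (mollify n w (x + a)) :=
      hj.continuous.comp ((contDiff_mollify (hw.locallyIntegrable hp1) n).continuous.comp
        (continuous_add_const a))
    exact (hc.mul ψ.continuous).integrable_of_hasCompactSupport ψ.hasCompactSupport.mul_left
  have hshift : ∀ (w : Space d → ℝ) (a : Space d), ∫ x, j (mollify n w (x + a)) * ψ x
      = ∫ x, j (mollify n w x) * translate ψ a x := by
    intro w a
    rw [← integral_add_right_eq_self (fun x => j (mollify n w x) * translate ψ a x) a]
    simp
  rw [← hshift, ← hshift]
  have hmain : ∫ x, j (mollify n v (x + B t)) * ψ x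
      = (∫ x, j (mollify n u₀ (x + B 0)) * ψ x)
        + ∫ x, ∫ s in Ioc 0 t, deriv j (H s x) * G s x * ψ x := by
    rw [← integral_add (hcont hu₀ (B 0)) hint'.integral_prod_left]
    refine integral_congr_ae (ae_of_all _ fun x => ?_)
    simp only
    rw [hchain x, add_mul, intervalIntegral.integral_of_le ht.1, integral_mul_const]
  rw [hmain, integral_integral_swap hint', intervalIntegral.integral_of_le ht.1]
  congr 1
  refine integral_congr_ae (ae_of_all _ fun s => ?_)
  simp only
  rw [← integral_add_right_eq_self (μ := volume) (fun x => deriv j (mollify n (u s) x)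
    * mollifiedTransport (b s) (divb s) (u s) n x * translate ψ (B s) x) (B s)]
  simp [hH, hG]

/-- Renormalization: bounded smooth functions `j(u)` of a solution satisfy the equation as well. -/
theorem RegularDrift.renormalized (hp : p ≠ ⊤) (hr : RegularDrift T q b divb Db f D F)
    (hu : BoundedLpLoc T p u) (hB : Continuous B) (hu₀ : MemLpLoc p u₀)
    (hsf : ∀ᵐ s ∂(volume.restrict (Icc (0 : ℝ) T)), ShiftedEquation b divb B u₀ u s (u s))
    {t : ℝ} (ht : t ∈ Icc 0 T) {v : Space d → ℝ} (hv : MemLpLoc p v)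
    (hvt : ShiftedEquation b divb B u₀ u t v) {j : ℝ → ℝ} (hj : ContDiff ℝ ∞ j)
    (hj1 : ∀ s, |j s| ≤ 1) {L : ℝ} (hjL : ∀ s, |deriv j s| ≤ L) (ψ : TestFun d) :
    IntegrableOn (fun s => ∫ x, j (u s x) *
      (fderiv ℝ (translate ψ (B s)) x (b s x) + divb s x * translate ψ (B s) x)) (Icc 0 T) ∧
    ∫ x, j (v x) * translate ψ (B t) x
      = (∫ x, j (u₀ x) * translate ψ (B 0) x)
        + ∫ s in (0 : ℝ)..t, ∫ x, j (u s x) *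
          (fderiv ℝ (translate ψ (B s)) x (b s x) + divb s x * translate ψ (B s) x) := by
  have hp1 : 1 ≤ p := ENNReal.HolderConjugate.one_le p q
  obtain ⟨β, hβ0, hβ⟩ := exists_norm_le_path hB T
  obtain ⟨C₁, hC₁⟩ := ψ.continuous.bounded_above_of_compact_support ψ.hasCompactSupport
  obtain ⟨C₂, hC₂⟩ := (continuous_fderiv_testFun ψ).bounded_above_of_compact_support
    (ψ.hasCompactSupport.fderiv ℝ)
  obtain ⟨R, hR⟩ := ψ.hasCompactSupport.isCompact.isBounded.subset_closedBall 0
  obtain ⟨M, hM, hMu⟩ := hu.bound (R + β + 2)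
  obtain ⟨K, hK, hKb⟩ := exists_enorm_integral_deriv_mollify_mul_le d p hM L (max C₁ C₂) (R + β)
  have hψ0 : ∀ s ∈ Icc 0 T, ∀ x, R + β < ‖x‖ → translate ψ (B s) x = 0 := by
    intro s hs x hx
    rw [translate_apply]
    by_contra h
    have h1 := hR (subset_tsupport _ h)
    rw [Metric.mem_closedBall, dist_zero_right] at h1
    linarith [norm_sub_norm_le x (B s), hβ s hs]
  set I : ℕ → ℝ → ℝ := fun n s => ∫ x, deriv j (mollify n (u s) x)
    * mollifiedTransport (b s) (divb s) (u s) n x * translate ψ (B s) x with hI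
  set bound : ℝ → ℝ≥0∞ := fun s => K * driftNorm q b divb Db (R + β + 2) s with hbound
  have hbm : Measurable bound := (hr.measurable_driftNorm _).const_mul _
  have hbf : ∫⁻ s in Icc 0 T, bound s ≠ ⊤ := by
    rw [lintegral_const_mul _ (hr.measurable_driftNorm _)]
    exact ENNReal.mul_ne_top hK (hr.lintegral_ne_top _)
  have hbi : IntegrableOn (fun s => (bound s).toReal) (Icc 0 T) :=
    integrable_toReal_of_lintegral_ne_top hbm.aemeasurable hbf
  have hIb : ∀ n, ∀ᵐ s ∂(volume.restrict (Icc (0 : ℝ) T)), ‖I n s‖ ≤ (bound s).toReal := by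
    intro n
    filter_upwards [hr.regular, hu.memLpLoc, hMu, ae_restrict_mem measurableSet_Icc,
      ae_lt_top hbm hbf] with s h1 h2 h3 h4 h5
    rw [← toReal_enorm]
    refine ENNReal.toReal_mono h5.ne ?_
    exact hKb h1 h2 h3 hj hj1 hjL (fun x => by
        rw [translate_apply]; exact (hC₁ _).trans (le_max_left _ _))
      (fun x => by rw [fderiv_translate]; exact (hC₂ _).trans (le_max_right _ _)) (hψ0 s h4) n
  have hIm : ∀ n, AEStronglyMeasurable (I n) (volume.restrict (Icc (0 : ℝ) T)) := by
    intro n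
    have h1 := stronglyMeasurable_mollify_path (B := fun _ => 0) continuous_const hu.meas n
    have h2 := stronglyMeasurable_mollifiedTransport_path (B := fun _ => 0) continuous_const
      hr.meas hr.meas_div hu.meas n
    simp only [add_zero] at h1 h2
    have h3 : StronglyMeasurable fun z : ℝ × Space d => translate ψ (B z.1) z.2 := by
      have : Continuous fun z : ℝ × Space d => ψ (z.2 - B z.1) :=
        ψ.continuous.comp (by fun_prop)
      exact this.stronglyMeasurable
    have h4 := (((hj.continuous_deriv (by simp)).comp_stronglyMeasurable h1).mul h2).mul h3
    exact h4.integral_prod_right'.aestronglyMeasurable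
  have hlim : ∀ᵐ s ∂(volume.restrict (Icc (0 : ℝ) T)), Tendsto (fun n => I n s) atTop
      (𝓝 (∫ x, j (u s x) *
        (fderiv ℝ (translate ψ (B s)) x (b s x) + divb s x * translate ψ (B s) x))) := by
    filter_upwards [hr.regular, hu.memLpLoc] with s h1 h2
    exact tendsto_integral_deriv_mollify_mul hp h1 h2 hj hj1 hjL _
  have hIoc : Ioc (0 : ℝ) t ⊆ Icc 0 T := Ioc_subset_Icc_self.trans (Icc_subset_Icc le_rfl ht.2)
  have hconv : ∀ {w : Space d → ℝ}, MemLpLoc p w → ∀ a : Space d,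
      Tendsto (fun n => ∫ x, j (mollify n w x) * translate ψ a x) atTop
        (𝓝 (∫ x, j (w x) * translate ψ a x)) := by
    intro w hw a
    have hwl := hw.locallyIntegrable hp1
    have hi : Integrable (translate ψ a) :=
      (translate ψ a).continuous.integrable_of_hasCompactSupport (translate ψ a).hasCompactSupport
    refine tendsto_integral_of_dominated_convergence (fun x => ‖translate ψ a x‖)
      (fun n => ?_) hi.norm (fun n => ae_of_all _ fun x => ?_) ?_
    · exact (hj.continuous.comp (contDiff_mollify hwl n).continuous).aestronglyMeasurable.mul
        hi.aestronglyMeasurable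
    · rw [norm_mul]
      exact mul_le_of_le_one_left (norm_nonneg _) (hj1 _)
    · filter_upwards [ae_tendsto_mollifier_convolution hwl] with x hx
      exact ((hj.continuous.tendsto _).comp hx).mul_const _
  refine ⟨?_, ?_⟩
  · refine Integrable.mono' hbi (aestronglyMeasurable_of_tendsto_ae atTop hIm hlim) ?_
    filter_upwards [hlim, ae_all_iff.2 hIb] with s h1 h2
    exact le_of_tendsto h1.norm (Eventually.of_forall h2)
  · have h1 := hconv hv (B t)
    have h2 : Tendsto (fun n => (∫ x, j (mollify n u₀ x) * translate ψ (B 0) x)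
        + ∫ s in (0 : ℝ)..t, I n s) atTop (𝓝 ((∫ x, j (u₀ x) * translate ψ (B 0) x)
        + ∫ s in (0 : ℝ)..t, ∫ x, j (u s x) *
          (fderiv ℝ (translate ψ (B s)) x (b s x) + divb s x * translate ψ (B s) x))) := by
      refine (hconv hu₀ (B 0)).add ?_
      simp_rw [intervalIntegral.integral_of_le ht.1]
      refine tendsto_integral_of_dominated_convergence (fun s => (bound s).toReal)
        (fun n => (hIm n).mono_measure (Measure.restrict_mono hIoc le_rfl)) (hbi.mono_set hIoc)
        (fun n => ae_restrict_of_ae_restrict_of_subset hIoc (hIb n))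
        (ae_restrict_of_ae_restrict_of_subset hIoc hlim)
    refine tendsto_nhds_unique h1 (h2.congr fun n => ?_)
    exact (hr.mollified_renormalized hu hB hu₀ hsf ht hvt hj hjL ψ n).symm

end

variable {d : ℕ}

/-! ### Weights and cutoff functions -/

/-- An integrable weight which is nearly `1` on balls that are small compared with `R`. -/
def weight (d : ℕ) (R : ℝ) (z : Space d) : ℝ := ((1 + ‖z‖ ^ 2 / R ^ 2) ^ (d + 1))⁻¹

theorem one_le_weight_base (R : ℝ) (z : Space d) : 1 ≤ 1 + ‖z‖ ^ 2 / R ^ 2 := by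
  have : 0 ≤ ‖z‖ ^ 2 / R ^ 2 := by positivity
  linarith

theorem weight_pos (R : ℝ) (z : Space d) : 0 < weight d R z := by
  have := one_le_weight_base R z
  unfold weight; positivity

theorem weight_le_one (R : ℝ) (z : Space d) : weight d R z ≤ 1 :=
  inv_le_one_of_one_le₀ (one_le_pow₀ (one_le_weight_base R z))

theorem contDiff_weight (R : ℝ) : ContDiff ℝ ∞ (weight d R) := by
  unfold weight
  refine ContDiff.inv ?_ fun z => ?_
  · exact (contDiff_const.add ((contDiff_norm_sq ℝ).div_const _)).pow _
  · have := one_le_weight_base R z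
    positivity

theorem norm_fderiv_weight_le {R : ℝ} (hR : 0 < R) (z : Space d) :
    ‖fderiv ℝ (weight d R) z‖ ≤ 2 * (d + 1) * (‖z‖ / (R ^ 2 + ‖z‖ ^ 2)) * weight d R z := by
  set g : ℝ := 1 + ‖z‖ ^ 2 / R ^ 2 with hg
  have hg1 : 1 ≤ g := one_le_weight_base R z
  have hg0 : 0 < g := by linarith
  have h1 : HasFDerivAt (fun z : Space d => 1 + ‖z‖ ^ 2 / R ^ 2)
      ((1 / R ^ 2) • (2 • innerSL ℝ z)) z := by
    have := ((hasStrictFDerivAt_norm_sq z).hasFDerivAt.const_mul (1 / R ^ 2)).const_add 1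
    refine this.congr_of_eventuallyEq (Eventually.of_forall fun y => ?_)
    simp only []
    ring
  have h2 : HasDerivAt (fun s : ℝ => (s ^ (d + 1))⁻¹)
      (-(((d + 1 : ℕ) : ℝ) * g ^ d) / (g ^ (d + 1)) ^ 2) g :=
    (hasDerivAt_pow (d + 1) g).fun_inv (by positivity)
  have h3 := h2.comp_hasFDerivAt z h1
  rw [show ((fun s : ℝ => (s ^ (d + 1))⁻¹) ∘ fun z : Space d => 1 + ‖z‖ ^ 2 / R ^ 2) = weight d R
    from rfl] at h3
  rw [h3.fderiv, norm_smul, norm_smul]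
  have h4 : ‖(2 : ℕ) • innerSL ℝ z‖ ≤ 2 * ‖z‖ := by
    refine (norm_nsmul_le).trans ?_
    rw [innerSL_apply_norm]; simp
  have h5 : weight d R z = (g ^ (d + 1))⁻¹ := rfl
  rw [h5, Real.norm_eq_abs, Real.norm_eq_abs, abs_div, abs_neg, abs_of_nonneg (by positivity),
    abs_of_nonneg (by positivity : 0 ≤ (g ^ (d + 1)) ^ 2),
    abs_of_nonneg (by positivity : 0 ≤ 1 / R ^ 2)]
  have h6 : R ^ 2 + ‖z‖ ^ 2 = g * R ^ 2 := by
    rw [hg]; field_simp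
  rw [h6]
  calc _ ≤ ((d + 1 : ℕ) : ℝ) * g ^ d / (g ^ (d + 1)) ^ 2 * (1 / R ^ 2 * (2 * ‖z‖)) := by gcongr
    _ = _ := by
      push_cast
      field_simp
      ring

theorem integrable_weight {R : ℝ} (hR : 0 < R) : Integrable (weight d R) := by
  have h1 : Integrable fun z : Space d => (1 + ‖z‖ ^ 2) ^ (-(2 * ((d : ℝ) + 1)) / 2) :=
    integrable_rpow_neg_one_add_norm_sq (by simp; linarith [d.cast_nonneg (α := ℝ)])
  have h2 := h1.comp_smul (inv_ne_zero hR.ne')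
  refine h2.congr (ae_of_all _ fun z => ?_)
  have e : ‖R⁻¹ • z‖ ^ 2 = ‖z‖ ^ 2 / R ^ 2 := by
    rw [norm_smul, Real.norm_eq_abs, abs_of_pos (by positivity)]
    field_simp
  simp only [e]
  rw [weight, ← Real.rpow_natCast (1 + ‖z‖ ^ 2 / R ^ 2) (d + 1),
    ← Real.rpow_neg (by linarith [one_le_weight_base R z])]
  congr 1
  push_cast
  ring

/-- A smooth function which is `1` on the unit ball and `0` outside the ball of radius `2`. -/
def unitCutoff (d : ℕ) : ContDiffBump (0 : Space d) where
  rIn := 1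
  rOut := 2
  rIn_pos := one_pos
  rIn_lt_rOut := one_lt_two

/-- The cutoff function at scale `S`. -/
def cutoff (d : ℕ) (S : ℝ) (z : Space d) : ℝ := unitCutoff d (S⁻¹ • z)

theorem cutoff_nonneg (S : ℝ) (z : Space d) : 0 ≤ cutoff d S z := (unitCutoff d).nonneg

theorem cutoff_le_one (S : ℝ) (z : Space d) : cutoff d S z ≤ 1 := (unitCutoff d).le_one

theorem contDiff_cutoff (S : ℝ) : ContDiff ℝ ∞ (cutoff d S) :=
  (unitCutoff d).contDiff.comp (contDiff_const_smul _)

theorem norm_inv_smul {S : ℝ} (hS : 0 < S) (z : Space d) : ‖S⁻¹ • z‖ = ‖z‖ / S := by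
  rw [norm_smul, Real.norm_eq_abs, abs_of_pos (inv_pos.2 hS), inv_mul_eq_div]

theorem cutoff_eq_one {S : ℝ} (hS : 0 < S) {z : Space d} (hz : ‖z‖ ≤ S) : cutoff d S z = 1 := by
  refine (unitCutoff d).one_of_mem_closedBall ?_
  rw [Metric.mem_closedBall, dist_zero_right, norm_inv_smul hS]
  exact (div_le_one hS).2 hz

theorem cutoff_eq_zero {S : ℝ} (hS : 0 < S) {z : Space d} (hz : 2 * S ≤ ‖z‖) :
    cutoff d S z = 0 := by
  refine (unitCutoff d).zero_of_le_dist ?_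
  rw [dist_zero_right, norm_inv_smul hS]
  exact (le_div_iff₀ hS).2 hz

theorem hasCompactSupport_cutoff {S : ℝ} (hS : 0 < S) : HasCompactSupport (cutoff d S) := by
  refine HasCompactSupport.intro (isCompact_closedBall 0 (2 * S)) fun z hz => ?_
  refine cutoff_eq_zero hS ?_
  simp only [Metric.mem_closedBall, dist_zero_right, not_le] at hz
  exact hz.le

/-- The derivative of the cutoff function at scale `S` is of order `1 / S`, in an annulus. -/
theorem exists_norm_fderiv_cutoff_le (d : ℕ) : ∃ C : ℝ, 0 ≤ C ∧ ∀ S : ℝ, 0 < S → ∀ z : Space d,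
    ‖fderiv ℝ (cutoff d S) z‖ ≤ C / S ∧ (‖z‖ < S → fderiv ℝ (cutoff d S) z = 0) ∧
      (2 * S < ‖z‖ → fderiv ℝ (cutoff d S) z = 0) := by
  have hcd : ContDiff ℝ ∞ (unitCutoff d) := (unitCutoff d).contDiff
  obtain ⟨C, hC⟩ := (hcd.continuous_fderiv (by simp)).bounded_above_of_compact_support
    ((unitCutoff d).hasCompactSupport.fderiv ℝ)
  refine ⟨C, (norm_nonneg _).trans (hC 0), fun S hS z => ⟨?_, fun hz => ?_, fun hz => ?_⟩⟩
  · have h1 : HasFDerivAt (fun z : Space d => S⁻¹ • z)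
        (S⁻¹ • ContinuousLinearMap.id ℝ (Space d)) z := (hasFDerivAt_id z).const_smul S⁻¹
    have h2 : HasFDerivAt (cutoff d S) _ z :=
      ((hcd.differentiable (by simp)) (S⁻¹ • z)).hasFDerivAt.comp z h1
    rw [h2.fderiv]
    refine (ContinuousLinearMap.opNorm_comp_le _ _).trans ?_
    rw [div_eq_mul_inv]
    refine mul_le_mul (hC _) ?_ (norm_nonneg _) ((norm_nonneg _).trans (hC 0))
    rw [norm_smul, Real.norm_eq_abs, abs_of_pos (inv_pos.2 hS)]
    exact mul_le_of_le_one_right (inv_pos.2 hS).le ContinuousLinearMap.norm_id_le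
  · have h : cutoff d S =ᶠ[𝓝 z] fun _ => (1 : ℝ) := by
      filter_upwards [(isOpen_lt continuous_norm continuous_const).mem_nhds hz] with y hy
      exact cutoff_eq_one hS (le_of_lt hy)
    rw [h.fderiv_eq, fderiv_fun_const]; rfl
  · have h : cutoff d S =ᶠ[𝓝 z] fun _ => (0 : ℝ) := by
      filter_upwards [(isOpen_lt continuous_const continuous_norm).mem_nhds hz] with y hy
      exact cutoff_eq_zero hS (le_of_lt hy)
    rw [h.fderiv_eq, fderiv_fun_const]; rfl

/-- The weight, cut off at scale `S`. -/
def weightTest (d : ℕ) (R : ℝ) {S : ℝ} (hS : 0 < S) : TestFun d :=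
  mulTest (weight d R) (contDiff_weight R)
    (mkTest (cutoff d S) (contDiff_cutoff S) (hasCompactSupport_cutoff hS))

theorem weightTest_apply (R : ℝ) {S : ℝ} (hS : 0 < S) (z : Space d) :
    weightTest d R hS z = weight d R z * cutoff d S z := rfl

theorem weightTest_nonneg (R : ℝ) {S : ℝ} (hS : 0 < S) (z : Space d) :
    0 ≤ weightTest d R hS z := mul_nonneg (weight_pos R z).le (cutoff_nonneg S z)

theorem weightTest_le_one (R : ℝ) {S : ℝ} (hS : 0 < S) (z : Space d) :
    weightTest d R hS z ≤ 1 :=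
  mul_le_one₀ (weight_le_one R z) (cutoff_nonneg S z) (cutoff_le_one S z)

/-- The factor of the error due to the gradient of the weight. It is bounded and tends to `0` as
`R → ∞`. -/
def gradientFactor (β R r : ℝ) : ℝ := (1 + β + r) * (r / (R ^ 2 + r ^ 2))

theorem gradientFactor_nonneg {β R r : ℝ} (hβ : 0 ≤ β) (hr : 0 ≤ r) : 0 ≤ gradientFactor β R r := by
  unfold gradientFactor; positivity

theorem gradientFactor_le {β R r : ℝ} (hβ : 0 ≤ β) (hR : 1 + β ≤ R) (hr : 0 ≤ r) :
    gradientFactor β R r ≤ 2 := by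
  unfold gradientFactor
  have hR0 : 0 < R := by linarith
  rw [← mul_div_assoc, div_le_iff₀ (by positivity)]
  nlinarith [sq_nonneg (R - r), mul_le_mul_of_nonneg_right hR hr]

theorem tendsto_gradientFactor (β r : ℝ) :
    Tendsto (fun R : ℝ => gradientFactor β R r) atTop (𝓝 0) := by
  unfold gradientFactor
  have h1 : Tendsto (fun R : ℝ => R ^ 2 + r ^ 2) atTop atTop :=
    tendsto_atTop_add_const_right _ _ (tendsto_pow_atTop two_ne_zero)
  have := (h1.const_div_atTop r).const_mul (1 + β + r)
  rwa [mul_zero] at this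

/-- The gradient of the cut off weight, against a vector of at most linear growth. -/
theorem exists_abs_fderiv_weightTest_le (d : ℕ) : ∃ C : ℝ, 0 ≤ C ∧
    ∀ (β R S : ℝ) (hS : 0 < S), 0 ≤ β → 1 + β ≤ R → 1 + β ≤ S → ∀ (x z w : Space d) (c₁ c₂ : ℝ),
      0 ≤ c₁ → 0 ≤ c₂ → ‖x‖ ≤ ‖z‖ + β → ‖w‖ ≤ (1 + ‖x‖) * (c₁ + c₂) →
      |fderiv ℝ (weightTest d R hS) z w| ≤ 4 * (d + 1) * c₂ * weightTest d R hS z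
        + (2 * (d + 1) * gradientFactor β R ‖z‖ * c₁
          + C * ({z : Space d | S ≤ ‖z‖}.indicator (fun _ => 1) z) * (c₁ + c₂ * weight d R z)) := by
  obtain ⟨C, hC0, hC⟩ := exists_norm_fderiv_cutoff_le d
  refine ⟨3 * C, by positivity, ?_⟩
  intro β R S hS hβ hR hSβ x z w c₁ c₂ hc₁ hc₂ hx hw
  obtain ⟨k1, k2, k3⟩ := hC S hS z
  have hW0 := (weight_pos (d := d) R z).le
  have hW1 := weight_le_one (d := d) R z
  have hχ0 := cutoff_nonneg (d := d) S z
  have hχ1 := cutoff_le_one (d := d) S z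
  have hR0 : 0 < R := by linarith
  have hw' : ‖w‖ ≤ (1 + β + ‖z‖) * (c₁ + c₂) :=
    hw.trans (mul_le_mul_of_nonneg_right (by linarith) (by positivity))
  have hsplit : fderiv ℝ (weightTest d R hS) z w = weight d R z * fderiv ℝ (cutoff d S) z w
      + cutoff d S z * fderiv ℝ (weight d R) z w := by
    rw [weightTest, fderiv_mulTest, coe_mkTest]
  have hg0 := gradientFactor_nonneg (R := R) hβ (norm_nonneg z)
  have hg2 := gradientFactor_le hβ hR (norm_nonneg z)
  have p1 : |cutoff d S z * fderiv ℝ (weight d R) z w|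
      ≤ 4 * (d + 1) * c₂ * weightTest d R hS z + 2 * (d + 1) * gradientFactor β R ‖z‖ * c₁ := by
    rw [abs_mul, abs_of_nonneg hχ0]
    have h1 : |fderiv ℝ (weight d R) z w|
        ≤ 2 * (d + 1) * gradientFactor β R ‖z‖ * (c₁ + c₂) * weight d R z := by
      refine ((fderiv ℝ (weight d R) z).le_opNorm w).trans ?_
      calc _ ≤ 2 * (d + 1) * (‖z‖ / (R ^ 2 + ‖z‖ ^ 2)) * weight d R z
            * ((1 + β + ‖z‖) * (c₁ + c₂)) :=
            mul_le_mul (norm_fderiv_weight_le hR0 z) hw' (norm_nonneg _) (by positivity)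
        _ = _ := by unfold gradientFactor; ring
    rw [weightTest_apply]
    have hd : (0 : ℝ) ≤ d := d.cast_nonneg
    have h2 : cutoff d S z * weight d R z ≤ 1 := mul_le_one₀ hχ1 hW0 hW1
    calc cutoff d S z * |fderiv ℝ (weight d R) z w|
        ≤ cutoff d S z * (2 * (d + 1) * gradientFactor β R ‖z‖ * (c₁ + c₂) * weight d R z) := by
          gcongr
      _ = 2 * (d + 1) * gradientFactor β R ‖z‖ * c₁ * (cutoff d S z * weight d R z)
          + 2 * (d + 1) * gradientFactor β R ‖z‖ * c₂ * (weight d R z * cutoff d S z) := by ring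
      _ ≤ 2 * (d + 1) * gradientFactor β R ‖z‖ * c₁ * 1
          + 2 * (d + 1) * 2 * c₂ * (weight d R z * cutoff d S z) := by gcongr
      _ = _ := by ring
  have p2 : |weight d R z * fderiv ℝ (cutoff d S) z w|
      ≤ 3 * C * ({z : Space d | S ≤ ‖z‖}.indicator (fun _ => 1) z)
        * (c₁ + c₂ * weight d R z) := by
    rw [abs_mul, abs_of_nonneg hW0]
    rcases lt_or_ge ‖z‖ S with h | h
    · rw [k2 h, indicator_of_notMem (by simpa using h)]; simp
    · rw [indicator_of_mem (by simpa using h)]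
      rcases lt_or_ge (2 * S) ‖z‖ with h' | h'
      · rw [k3 h']; simp; positivity
      · have h1 : |fderiv ℝ (cutoff d S) z w| ≤ 3 * C * (c₁ + c₂) := by
          refine ((fderiv ℝ (cutoff d S) z).le_opNorm w).trans ?_
          calc _ ≤ C / S * ((3 * S) * (c₁ + c₂)) := by
                refine mul_le_mul k1 (hw'.trans ?_) (norm_nonneg _) (by positivity)
                gcongr; linarith
            _ = _ := by field_simp
        calc _ ≤ weight d R z * (3 * C * (c₁ + c₂)) := by gcongr
          _ = 3 * C * 1 * (weight d R z * c₁ + c₂ * weight d R z) := by ring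
          _ ≤ _ := by
              gcongr
              exact mul_le_of_le_one_left hc₁ hW1
  rw [hsplit]
  calc _ ≤ _ := abs_add_le _ _
    _ ≤ _ := add_le_add p2 p1
    _ = _ := by ring

theorem tendsto_weight (z : Space d) : Tendsto (fun R : ℝ => weight d R z) atTop (𝓝 1) := by
  unfold weight
  have h1 : Tendsto (fun R : ℝ => R ^ 2) atTop atTop := tendsto_pow_atTop two_ne_zero
  have h2 := (((h1.const_div_atTop (‖z‖ ^ 2)).const_add 1).pow (d + 1)).inv₀ (by simp)
  simpa using h2

variable {d : ℕ}

/-! ### The estimate of the superlevel sets -/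

section

variable {T : ℝ} {p q : ℝ≥0∞} [ENNReal.HolderConjugate p q]
  {b : ℝ → Space d → Space d} {divb : ℝ → Space d → ℝ}
  {Db : ℝ → Space d → Space d →L[ℝ] Space d} {f : ℝ → Space d → ℝ} {D F : ℝ → ℝ}
  {u : ℝ → Space d → ℝ} {B : ℝ → Space d} {u₀ : Space d → ℝ}

/-- The error made by replacing the constant function `1` by a cut off weight. -/
def weightError (f : ℝ → Space d → ℝ) (F : ℝ → ℝ) (B : ℝ → Space d) (β C R S : ℝ)
    (z : ℝ × Space d) : ℝ :=
  2 * (d + 1) * gradientFactor β R ‖z.2 - B z.1‖ * f z.1 z.2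
    + C * ({z : Space d | S ≤ ‖z‖}.indicator (fun _ => 1) (z.2 - B z.1))
      * (f z.1 z.2 + F z.1 * weight d R (z.2 - B z.1))

theorem RegularDrift.integrable_f (hr : RegularDrift T q b divb Db f D F) :
    Integrable (fun z : ℝ × Space d => f z.1 z.2)
      ((volume.restrict (Icc (0 : ℝ) T)).prod volume) := by
  refine ⟨hr.meas_f.aestronglyMeasurable, ?_⟩
  have hm : Measurable fun z : ℝ × Space d => ‖f z.1 z.2‖ₑ := hr.meas_f.enorm
  rw [HasFiniteIntegral, lintegral_prod _ hm.aemeasurable]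
  exact hr.lintegral_f.lt_top

theorem RegularDrift.integrable_F_weight (hr : RegularDrift T q b divb Db f D F)
    (hB : Continuous B) {R : ℝ} (hR : 0 < R) :
    Integrable (fun z : ℝ × Space d => F z.1 * weight d R (z.2 - B z.1))
      ((volume.restrict (Icc (0 : ℝ) T)).prod volume) := by
  have hw : Continuous fun z : ℝ × Space d => weight d R (z.2 - B z.1) :=
    (contDiff_weight R).continuous.comp (by fun_prop)
  have hm : AEStronglyMeasurable (fun z : ℝ × Space d => F z.1 * weight d R (z.2 - B z.1))
      ((volume.restrict (Icc (0 : ℝ) T)).prod volume) :=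
    hr.integrable_F.aestronglyMeasurable.comp_fst.mul hw.aestronglyMeasurable
  rw [integrable_prod_iff hm]
  refine ⟨ae_of_all _ fun s => ((integrable_weight hR).comp_sub_right (B s)).const_mul (F s), ?_⟩
  have e : ∀ s, ∫ x, ‖F s * weight d R (x - B s)‖ = F s * ∫ x, weight d R x := by
    intro s
    rw [← integral_sub_right_eq_self (weight d R) (B s), ← integral_const_mul]
    refine integral_congr_ae (ae_of_all _ fun x => ?_)
    simp only
    rw [Real.norm_of_nonneg (mul_nonneg (hr.F_nonneg s) (weight_pos _ _).le)]
  simp_rw [e]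
  exact hr.integrable_F.mul_const _

theorem weightError_nonneg (hr : RegularDrift T q b divb Db f D F) {β C R S : ℝ} (hβ : 0 ≤ β)
    (hC : 0 ≤ C) (z : ℝ × Space d) : 0 ≤ weightError f F B β C R S z := by
  have h1 := hr.f_nonneg z.1 z.2
  have h2 := hr.F_nonneg z.1
  have h3 := (weight_pos R (z.2 - B z.1)).le
  have h4 := gradientFactor_nonneg (R := R) hβ (norm_nonneg (z.2 - B z.1))
  have h5 : (0 : ℝ) ≤ {z : Space d | S ≤ ‖z‖}.indicator (fun _ => 1) (z.2 - B z.1) :=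
    indicator_nonneg (fun _ _ => zero_le_one) _
  unfold weightError
  positivity

theorem indicator_one_le {s : Set (Space d)} (x : Space d) :
    (0 : ℝ) ≤ s.indicator (fun _ => 1) x ∧ s.indicator (fun _ => (1 : ℝ)) x ≤ 1 :=
  ⟨indicator_nonneg (fun _ _ => zero_le_one) _, indicator_le_self' (fun _ _ => zero_le_one) _⟩

theorem aestronglyMeasurable_weightError (hr : RegularDrift T q b divb Db f D F)
    (hB : Continuous B) {β C R S : ℝ} (hR : 0 < R) :
    AEStronglyMeasurable (fun z => 2 * (d + 1) * gradientFactor β R ‖z.2 - B z.1‖ * f z.1 z.2)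
      ((volume.restrict (Icc (0 : ℝ) T)).prod (volume : Measure (Space d))) ∧
    AEStronglyMeasurable (fun z => C * ({z : Space d | S ≤ ‖z‖}.indicator (fun _ => 1) (z.2 - B z.1))
      * (f z.1 z.2 + F z.1 * weight d R (z.2 - B z.1)))
      ((volume.restrict (Icc (0 : ℝ) T)).prod (volume : Measure (Space d))) := by
  have hc : Continuous fun z : ℝ × Space d => z.2 - B z.1 := by fun_prop
  have hg : Continuous fun z : ℝ × Space d => gradientFactor β R ‖z.2 - B z.1‖ := by
    unfold gradientFactor
    refine Continuous.mul (by fun_prop) (Continuous.div (by fun_prop) (by fun_prop) fun z => ?_)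
    positivity
  have hi : Measurable fun z : ℝ × Space d =>
      ({z : Space d | S ≤ ‖z‖}.indicator (fun _ => (1 : ℝ)) (z.2 - B z.1)) :=
    (measurable_const.indicator (measurableSet_le measurable_const measurable_norm)).comp
      hc.measurable
  exact ⟨(aestronglyMeasurable_const.mul hg.aestronglyMeasurable).mul
      hr.integrable_f.aestronglyMeasurable,
    (aestronglyMeasurable_const.mul hi.aestronglyMeasurable).mul
      (hr.integrable_f.add (hr.integrable_F_weight hB hR)).aestronglyMeasurable⟩

theorem integrable_weightError (hr : RegularDrift T q b divb Db f D F) (hB : Continuous B)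
    {β C R S : ℝ} (hβ : 0 ≤ β) (hR : 1 + β ≤ R) (hC : 0 ≤ C) :
    Integrable (weightError f F B β C R S)
      ((volume.restrict (Icc (0 : ℝ) T)).prod (volume : Measure (Space d))) := by
  have hR0 : 0 < R := by linarith
  obtain ⟨m1, m2⟩ := aestronglyMeasurable_weightError (β := β) (C := C) (S := S) hr hB hR0
  have i1 := hr.integrable_f
  have i2 := hr.integrable_F_weight hB hR0
  refine Integrable.add (Integrable.mono' (i1.const_mul (2 * (d + 1) * 2)) m1
    (ae_of_all _ fun z => ?_)) (Integrable.mono' ((i1.add i2).const_mul C) m2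
    (ae_of_all _ fun z => ?_))
  · have h4 := gradientFactor_nonneg (R := R) hβ (norm_nonneg (z.2 - B z.1))
    have h5 := gradientFactor_le hβ hR (norm_nonneg (z.2 - B z.1))
    have h1 := hr.f_nonneg z.1 z.2
    rw [Real.norm_of_nonneg (by positivity)]
    gcongr
  · have h1 := hr.f_nonneg z.1 z.2
    have h2 := hr.F_nonneg z.1
    have h3 := (weight_pos R (z.2 - B z.1)).le
    obtain ⟨h5, h6⟩ := indicator_one_le (s := {z : Space d | S ≤ ‖z‖}) (z.2 - B z.1)
    rw [Real.norm_of_nonneg (by positivity)]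
    simp only [Pi.add_apply]
    calc _ ≤ C * 1 * (f z.1 z.2 + F z.1 * weight d R (z.2 - B z.1)) := by gcongr
      _ = _ := by ring

/-- The error is small for a suitable choice of the scales. -/
theorem exists_integral_weightError_le (hr : RegularDrift T q b divb Db f D F) (hB : Continuous B)
    {β C : ℝ} (hβ : 0 ≤ β) (hC : 0 ≤ C) {ε : ℝ} (hε : 0 < ε) (m : ℝ) :
    ∃ R S : ℝ, 1 + β ≤ R ∧ 1 + β ≤ S ∧ m ≤ R ∧ m ≤ S ∧
      ∫ z, weightError f F B β C R S z ∂((volume.restrict (Icc (0 : ℝ) T)).prod volume) ≤ ε := by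
  have i1 := hr.integrable_f
  have t1 : Tendsto (fun n : ℕ => ∫ z : ℝ × Space d,
      2 * (d + 1) * gradientFactor β (max n (1 + β)) ‖z.2 - B z.1‖ * f z.1 z.2
        ∂((volume.restrict (Icc (0 : ℝ) T)).prod volume)) atTop (𝓝 0) := by
    have : ∫ z : ℝ × Space d, (0 : ℝ) ∂((volume.restrict (Icc (0 : ℝ) T)).prod volume) = 0 := by
      simp
    suffices h : Tendsto _ atTop (𝓝 (∫ z : ℝ × Space d, (0 : ℝ)
        ∂((volume.restrict (Icc (0 : ℝ) T)).prod volume))) by rwa [this] at h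
    have hmax : Tendsto (fun n : ℕ => max (n : ℝ) (1 + β)) atTop atTop :=
      tendsto_atTop_mono (fun n => le_max_left _ _) tendsto_natCast_atTop_atTop
    refine tendsto_integral_of_dominated_convergence _ (fun n =>
      (aestronglyMeasurable_weightError (β := β) (C := C) (S := 1) hr hB
        (lt_of_lt_of_le (by linarith) (le_max_right (n : ℝ) (1 + β)))).1)
      (i1.const_mul (2 * (d + 1) * 2)) (fun n => ae_of_all _ fun z => ?_)
      (ae_of_all _ fun z => ?_)
    · have h4 := gradientFactor_nonneg (R := max n (1 + β)) hβ (norm_nonneg (z.2 - B z.1))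
      have h5 := gradientFactor_le hβ (le_max_right (n : ℝ) _) (norm_nonneg (z.2 - B z.1))
      have h1 := hr.f_nonneg z.1 z.2
      rw [Real.norm_of_nonneg (by positivity)]
      gcongr
    · have := (((tendsto_gradientFactor β ‖z.2 - B z.1‖).comp hmax).const_mul
        (2 * ((d : ℝ) + 1))).mul_const (f z.1 z.2)
      simpa using this
  obtain ⟨n, hn1, hn2⟩ := ((t1.eventually (gt_mem_nhds (half_pos hε))).and
    (eventually_ge_atTop ⌈m⌉₊)).exists
  set R : ℝ := max n (1 + β) with hR
  have hRβ : 1 + β ≤ R := le_max_right _ _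
  have hR0 : 0 < R := by linarith
  have hmR : m ≤ R := (Nat.le_ceil m).trans ((Nat.cast_le.2 hn2).trans (le_max_left _ _))
  have i2 := hr.integrable_F_weight hB hR0
  have t2 : Tendsto (fun n : ℕ => ∫ z : ℝ × Space d,
      C * ({z : Space d | (n : ℝ) ≤ ‖z‖}.indicator (fun _ => 1) (z.2 - B z.1))
        * (f z.1 z.2 + F z.1 * weight d R (z.2 - B z.1))
        ∂((volume.restrict (Icc (0 : ℝ) T)).prod volume)) atTop (𝓝 0) := by
    have : ∫ z : ℝ × Space d, (0 : ℝ) ∂((volume.restrict (Icc (0 : ℝ) T)).prod volume) = 0 := by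
      simp
    suffices h : Tendsto _ atTop (𝓝 (∫ z : ℝ × Space d, (0 : ℝ)
        ∂((volume.restrict (Icc (0 : ℝ) T)).prod volume))) by rwa [this] at h
    refine tendsto_integral_of_dominated_convergence _ (fun n =>
      (aestronglyMeasurable_weightError (β := β) (C := C) (S := n) hr hB hR0).2)
      ((i1.add i2).const_mul C) (fun n => ae_of_all _ fun z => ?_)
      (ae_of_all _ fun z => ?_)
    · have h1 := hr.f_nonneg z.1 z.2
      have h2 := hr.F_nonneg z.1
      have h3 := (weight_pos R (z.2 - B z.1)).le
      obtain ⟨h5, h6⟩ := indicator_one_le (s := {z : Space d | (n : ℝ) ≤ ‖z‖}) (z.2 - B z.1)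
      rw [Real.norm_of_nonneg (by positivity)]
      simp only [Pi.add_apply]
      calc _ ≤ C * 1 * (f z.1 z.2 + F z.1 * weight d R (z.2 - B z.1)) := by gcongr
        _ = _ := by ring
    · refine tendsto_const_nhds.congr' ?_
      filter_upwards [tendsto_natCast_atTop_atTop.eventually_gt_atTop ‖z.2 - B z.1‖] with n hn
      rw [indicator_of_notMem (by simpa using hn)]; simp
  obtain ⟨k, hk1, hk2⟩ := ((t2.eventually (gt_mem_nhds (half_pos hε))).and
    (eventually_ge_atTop (max ⌈m⌉₊ ⌈1 + β⌉₊))).exists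
  refine ⟨R, k, hRβ, (Nat.le_ceil _).trans (Nat.cast_le.2 ((le_max_right _ _).trans hk2)), hmR,
    (Nat.le_ceil m).trans (Nat.cast_le.2 ((le_max_left _ _).trans hk2)), ?_⟩
  have j1 : Integrable (fun z : ℝ × Space d =>
      2 * (d + 1) * gradientFactor β R ‖z.2 - B z.1‖ * f z.1 z.2)
      ((volume.restrict (Icc (0 : ℝ) T)).prod volume) := by
    refine Integrable.mono' (i1.const_mul (2 * (d + 1) * 2))
      (aestronglyMeasurable_weightError (β := β) (C := C) (S := 1) hr hB hR0).1
      (ae_of_all _ fun z => ?_)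
    have h4 := gradientFactor_nonneg (R := R) hβ (norm_nonneg (z.2 - B z.1))
    have h5 := gradientFactor_le hβ hRβ (norm_nonneg (z.2 - B z.1))
    have h1 := hr.f_nonneg z.1 z.2
    rw [Real.norm_of_nonneg (by positivity)]
    gcongr
  have j2 := (integrable_weightError (S := k) hr hB hβ hRβ hC).sub j1
  have e : ∫ z, weightError f F B β C R k z ∂((volume.restrict (Icc (0 : ℝ) T)).prod volume)
      = (∫ z : ℝ × Space d, 2 * (d + 1) * gradientFactor β R ‖z.2 - B z.1‖ * f z.1 z.2
          ∂((volume.restrict (Icc (0 : ℝ) T)).prod volume))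
        + ∫ z : ℝ × Space d, C * ({z : Space d | (k : ℝ) ≤ ‖z‖}.indicator (fun _ => 1) (z.2 - B z.1))
        * (f z.1 z.2 + F z.1 * weight d R (z.2 - B z.1))
        ∂((volume.restrict (Icc (0 : ℝ) T)).prod volume) := by
    rw [← integral_add j1]
    · rfl
    · refine j2.congr (ae_of_all _ fun z => ?_)
      simp only [Pi.sub_apply, weightError]; ring
  rw [e]
  linarith

/-- The weighted integral of `j(u)` is controlled, up to the error, by Gronwall's lemma. -/
theorem RegularDrift.integral_weightTest_le (hp : p ≠ ⊤) (hr : RegularDrift T q b divb Db f D F)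
    (hu : BoundedLpLoc T p u) (hB : Continuous B) (hu₀ : MemLpLoc p u₀)
    (hsf : ∀ᵐ s ∂(volume.restrict (Icc (0 : ℝ) T)), ShiftedEquation b divb B u₀ u s (u s))
    {t : ℝ} (ht : t ∈ Icc 0 T) {v : Space d → ℝ} (hv : MemLpLoc p v)
    (hvt : ShiftedEquation b divb B u₀ u t v) {j : ℝ → ℝ} (hj : ContDiff ℝ ∞ j)
    (hj0 : ∀ s, 0 ≤ j s) (hj1 : ∀ s, j s ≤ 1) {L : ℝ} (hjL : ∀ s, |deriv j s| ≤ L)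
    {β : ℝ} (hβ0 : 0 ≤ β) (hβ : ∀ s ∈ Icc 0 T, ‖B s‖ ≤ β) {C : ℝ} (hC0 : 0 ≤ C)
    (hC : ∀ (β R S : ℝ) (hS : 0 < S), 0 ≤ β → 1 + β ≤ R → 1 + β ≤ S →
      ∀ (x z w : Space d) (c₁ c₂ : ℝ),
      0 ≤ c₁ → 0 ≤ c₂ → ‖x‖ ≤ ‖z‖ + β → ‖w‖ ≤ (1 + ‖x‖) * (c₁ + c₂) →
      |fderiv ℝ (weightTest d R hS) z w| ≤ 4 * (d + 1) * c₂ * weightTest d R hS z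
        + (2 * (d + 1) * gradientFactor β R ‖z‖ * c₁
          + C * ({z : Space d | S ≤ ‖z‖}.indicator (fun _ => 1) z) * (c₁ + c₂ * weight d R z)))
    {R S : ℝ} (hR : 1 + β ≤ R) (hSβ : 1 + β ≤ S) (hS : 0 < S) {A : ℝ}
    (hA : ∫ x, j (u₀ x) * weightTest d R hS (x - B 0) ≤ A) :
    ∫ x, j (v x) * weightTest d R hS (x - B t)
      ≤ (A + ∫ z, weightError f F B β C R S z ∂((volume.restrict (Icc (0 : ℝ) T)).prod volume))
        * Real.exp (∫ s in (0 : ℝ)..T, (D s + 4 * (d + 1) * F s)) := by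
  have hT : 0 ≤ T := ht.1.trans ht.2
  set ψ := weightTest d R hS with hψ
  set E := fun s => ∫ x, weightError f F B β C R S (s, x) with hE
  have hEi := integrable_weightError (S := S) hr hB hβ0 hR hC0
  have hEint : IntegrableOn E (Icc 0 T) := hEi.integral_prod_left
  have hE0 : ∀ s, 0 ≤ E s := fun s => integral_nonneg fun x => weightError_nonneg hr hβ0 hC0 _
  have hEeq : ∫ z, weightError f F B β C R S z ∂((volume.restrict (Icc (0 : ℝ) T)).prod volume)
      = ∫ s in Icc 0 T, E s := integral_prod _ hEi
  set a : ℝ → ℝ := fun s => D s + 4 * (d + 1) * F s with ha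
  have ha0 : ∀ s, 0 ≤ a s := fun s => by
    have := hr.D_nonneg s; have := hr.F_nonneg s; simp only [ha]; positivity
  have hai : IntegrableOn a (Icc 0 T) := hr.integrable_D.add (hr.integrable_F.const_mul _)
  set y : ℝ → ℝ := fun s => ∫ x, j (u s x) * ψ (x - B s) with hy
  have hψi : ∀ c : Space d, Integrable fun x => ψ (x - c) := fun c =>
    (ψ.continuous.integrable_of_hasCompactSupport ψ.hasCompactSupport).comp_sub_right c
  have hψ0 : ∀ x, 0 ≤ ψ x := weightTest_nonneg R hS
  have hjψ : ∀ {w : Space d → ℝ} (_ : StronglyMeasurable w) (c : Space d),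
      Integrable fun x => j (w x) * ψ (x - c) := by
    intro w hw c
    refine (hψi c).mono' ((hj.continuous.comp_stronglyMeasurable hw).aestronglyMeasurable.mul
      (hψi c).aestronglyMeasurable) (ae_of_all _ fun x => ?_)
    rw [Real.norm_of_nonneg (mul_nonneg (hj0 _) (hψ0 _))]
    exact mul_le_of_le_one_left (hψ0 _) (hj1 _)
  have hus : ∀ s, StronglyMeasurable (u s) := fun s =>
    hu.meas.comp_measurable measurable_prodMk_left
  have hy0 : ∀ s, 0 ≤ y s := fun s => integral_nonneg fun x => mul_nonneg (hj0 _) (hψ0 _)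
  have hyle : ∀ s, y s ≤ ∫ x, ψ x := by
    intro s
    rw [← integral_sub_right_eq_self ψ (B s)]
    exact integral_mono (hjψ (hus s) _) (hψi _) fun x => mul_le_of_le_one_left (hψ0 _) (hj1 _)
  have hym : StronglyMeasurable y := by
    have h1 : StronglyMeasurable fun z : ℝ × Space d => ψ (z.2 - B z.1) :=
      (ψ.continuous.comp (by fun_prop : Continuous fun z : ℝ × Space d =>
        z.2 - B z.1)).stronglyMeasurable
    have h2 : StronglyMeasurable fun z : ℝ × Space d => j (u z.1 z.2) :=
      hj.continuous.comp_stronglyMeasurable hu.meas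
    exact (h2.mul h1).integral_prod_right'
  have hayi : IntegrableOn (fun s => a s * y s) (Icc 0 T) := by
    refine Integrable.mono' (hai.mul_const (∫ x, ψ x))
      (hai.aestronglyMeasurable.mul hym.aestronglyMeasurable) (ae_of_all _ fun s => ?_)
    rw [Real.norm_of_nonneg (mul_nonneg (ha0 s) (hy0 s))]
    exact mul_le_mul_of_nonneg_left (hyle s) (ha0 s)
  -- the integrand of the renormalized equation
  set J : ℝ → ℝ := fun s => ∫ x, j (u s x) *
    (fderiv ℝ (translate ψ (B s)) x (b s x) + divb s x * translate ψ (B s) x) with hJ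
  have hJle : ∀ᵐ s ∂(volume.restrict (Icc (0 : ℝ) T)), J s ≤ a s * y s + E s := by
    filter_upwards [hr.regular, hr.div_le, hr.growth, hEi.prod_right_ae,
      ae_restrict_mem measurableSet_Icc] with s h1 h2 h3 h4 hs
    have i1 : Integrable fun x => j (u s x) *
        (fderiv ℝ (translate ψ (B s)) x (b s x) + divb s x * translate ψ (B s) x) := by
      have hi := h1.weakDiv.integrable_transport (translate ψ (B s))
      refine hi.norm.mono' ((hj.continuous.comp_stronglyMeasurable
        (hus s)).aestronglyMeasurable.mul hi.aestronglyMeasurable) (ae_of_all _ fun x => ?_)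
      rw [norm_mul]
      refine mul_le_of_le_one_left (norm_nonneg _) ?_
      rw [Real.norm_of_nonneg (hj0 _)]; exact hj1 _
    have i2 : Integrable fun x => a s * (j (u s x) * ψ (x - B s)) :=
      (hjψ (hus s) (B s)).const_mul _
    have e : a s * y s + E s
        = ∫ x, (a s * (j (u s x) * ψ (x - B s)) + weightError f F B β C R S (s, x)) := by
      rw [integral_add i2 h4, integral_const_mul]
    rw [e]
    refine integral_mono_ae i1 (i2.add h4) ?_
    filter_upwards [h2, h3] with x h5 h6
    have hk := hC β R S hS hβ0 hR hSβ x (x - B s) (b s x) (f s x) (F s) (hr.f_nonneg s x)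
      (hr.F_nonneg s) (by
        have := norm_add_le (x - B s) (B s)
        rw [sub_add_cancel] at this
        linarith [hβ s hs]) h6
    simp only [fderiv_translate, translate_apply]
    have hj0' := hj0 (u s x)
    have hj1' := hj1 (u s x)
    have hψ' := hψ0 (x - B s)
    have hWE := weightError_nonneg (B := B) (R := R) (S := S) hr hβ0 hC0 (s, x)
    have q1 : divb s x * ψ (x - B s) ≤ D s * ψ (x - B s) :=
      mul_le_mul_of_nonneg_right (le_of_abs_le h5) hψ'
    have q2 : fderiv ℝ ψ (x - B s) (b s x)
        ≤ 4 * (d + 1) * F s * ψ (x - B s) + weightError f F B β C R S (s, x) :=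
      (le_abs_self _).trans hk
    calc _ ≤ j (u s x) * ((4 * (d + 1) * F s * ψ (x - B s) + weightError f F B β C R S (s, x))
            + D s * ψ (x - B s)) := by gcongr
      _ = a s * (j (u s x) * ψ (x - B s)) + j (u s x) * weightError f F B β C R S (s, x) := by
          simp only [ha]; ring
      _ ≤ _ := by
          gcongr
          exact mul_le_of_le_one_left hWE hj1'
  have hA0 : 0 ≤ A := le_trans (integral_nonneg fun x => mul_nonneg (hj0 _) (hψ0 _)) hA
  have hjabs : ∀ s, |j s| ≤ 1 := fun s => by rw [abs_of_nonneg (hj0 s)]; exact hj1 s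
  have hstep : ∀ {s : ℝ}, s ∈ Icc 0 T → ∀ {w : Space d → ℝ}, MemLpLoc p w →
      ShiftedEquation b divb B u₀ u s w →
      ∫ x, j (w x) * ψ (x - B s) ≤ (A + ∫ s in Icc 0 T, E s) + ∫ r in (0 : ℝ)..s, a r * y r := by
    intro s hs w hw hws
    obtain ⟨hJi, h⟩ := hr.renormalized hp hu hB hu₀ hsf hs hw hws hj hjabs hjL ψ
    simp only [translate_apply] at h
    rw [h]
    have hIoc : Ioc (0 : ℝ) s ⊆ Icc 0 T := Ioc_subset_Icc_self.trans (Icc_subset_Icc le_rfl hs.2)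
    have h1 : ∫ r in (0 : ℝ)..s, J r ≤ (∫ r in (0 : ℝ)..s, a r * y r) + ∫ r in Icc 0 T, E r := by
      rw [intervalIntegral.integral_of_le hs.1, intervalIntegral.integral_of_le hs.1]
      calc _ ≤ ∫ r in Ioc 0 s, (a r * y r + E r) :=
            integral_mono_ae (hJi.mono_set hIoc) ((hayi.add hEint).mono_set hIoc)
              (ae_restrict_of_ae_restrict_of_subset hIoc hJle)
        _ = (∫ r in Ioc 0 s, a r * y r) + ∫ r in Ioc 0 s, E r :=
            integral_add (hayi.mono_set hIoc) (hEint.mono_set hIoc)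
        _ ≤ _ := by
            gcongr
            exact ae_of_all _ hE0
    simp only [hJ, translate_apply] at h1
    linarith
  have hg := gronwall_integral (A := A + ∫ s in Icc 0 T, E s) (y := y)
    (add_nonneg hA0 (integral_nonneg hE0)) hai hayi ha0 hy0 (by
      filter_upwards [hsf, hu.memLpLoc, ae_restrict_mem measurableSet_Icc] with s h1 h2 h3
      exact hstep h3 h2 h1) ht
  rw [hEeq]
  exact (hstep ht hv hvt).trans hg

end

variable {d : ℕ}

/-! ### Stability in `Lᵖ` -/

/-- Smooth approximations from below of the indicator function of `{s | l < |s|}`. -/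
def levelCutoff (l : ℝ) (n : ℕ) (s : ℝ) : ℝ := Real.smoothTransition ((n + 1) * (s ^ 2 - l ^ 2))

theorem levelCutoff_nonneg (l : ℝ) (n : ℕ) (s : ℝ) : 0 ≤ levelCutoff l n s :=
  Real.smoothTransition.nonneg _

theorem levelCutoff_le_one (l : ℝ) (n : ℕ) (s : ℝ) : levelCutoff l n s ≤ 1 :=
  Real.smoothTransition.le_one _

theorem contDiff_levelCutoff (l : ℝ) (n : ℕ) : ContDiff ℝ ∞ (levelCutoff l n) :=
  Real.smoothTransition.contDiff.comp (by fun_prop)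

theorem levelCutoff_le_indicator (l : ℝ) (n : ℕ) (s : ℝ) :
    levelCutoff l n s ≤ {s : ℝ | l < |s|}.indicator (fun _ => 1) s := by
  by_cases h : l < |s|
  · rw [indicator_of_mem (by exact h)]
    exact Real.smoothTransition.le_one _
  · rw [indicator_of_notMem (by exact h)]
    refine (Real.smoothTransition.zero_of_nonpos ?_).le
    refine mul_nonpos_of_nonneg_of_nonpos (by positivity) ?_
    rw [← sq_abs s]
    have := pow_le_pow_left₀ (abs_nonneg s) (not_lt.1 h) 2
    linarith

theorem tendsto_levelCutoff {l : ℝ} (hl : 0 ≤ l) (s : ℝ) :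
    Tendsto (fun n => levelCutoff l n s) atTop (𝓝 ({s : ℝ | l < |s|}.indicator (fun _ => 1) s)) := by
  by_cases h : l < |s|
  · rw [indicator_of_mem (by exact h)]
    refine tendsto_const_nhds.congr' ?_
    have hpos : 0 < s ^ 2 - l ^ 2 := by
      rw [← sq_abs s]
      have := pow_lt_pow_left₀ h hl two_ne_zero
      linarith
    filter_upwards [eventually_ge_atTop ⌈1 / (s ^ 2 - l ^ 2)⌉₊] with n hn
    refine (Real.smoothTransition.one_of_one_le ?_).symm
    have h1 : 1 / (s ^ 2 - l ^ 2) ≤ n := (Nat.le_ceil _).trans (Nat.cast_le.2 hn)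
    rw [div_le_iff₀ hpos] at h1
    nlinarith
  · have h0 : ∀ n, levelCutoff l n s = 0 := fun n => le_antisymm
      ((levelCutoff_le_indicator l n s).trans_eq (indicator_of_notMem (by exact h) _))
      (Real.smoothTransition.nonneg _)
    rw [indicator_of_notMem (by exact h)]
    simp only [h0, tendsto_const_nhds_iff]

theorem exists_abs_deriv_levelCutoff_le (l : ℝ) (n : ℕ) :
    ∃ L : ℝ, ∀ s, |deriv (levelCutoff l n) s| ≤ L := by
  have hc : Continuous (deriv (levelCutoff l n)) :=
    (contDiff_levelCutoff l n).continuous_deriv (by simp)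
  refine hc.bounded_above_of_compact_support (HasCompactSupport.intro
    (isCompact_closedBall (0 : ℝ) (l ^ 2 + 2)) fun s hs => ?_)
  rw [Metric.mem_closedBall, dist_zero_right, not_le, Real.norm_eq_abs] at hs
  have h : levelCutoff l n =ᶠ[𝓝 s] fun _ => (1 : ℝ) := by
    filter_upwards [(isOpen_lt continuous_const continuous_abs).mem_nhds hs] with y hy
    refine Real.smoothTransition.one_of_one_le ?_
    have hy' : l ^ 2 + 2 < |y| := hy
    have h1 : 1 ≤ y ^ 2 - l ^ 2 := by
      rw [← sq_abs y]
      nlinarith [sq_nonneg l]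
    nlinarith [n.cast_nonneg (α := ℝ)]
  rw [h.deriv_eq, deriv_const]

section

variable {T : ℝ} {p q : ℝ≥0∞} [ENNReal.HolderConjugate p q]
  {b : ℝ → Space d → Space d} {divb : ℝ → Space d → ℝ}
  {Db : ℝ → Space d → Space d →L[ℝ] Space d} {f : ℝ → Space d → ℝ} {D F : ℝ → ℝ}
  {u : ℝ → Space d → ℝ} {B : ℝ → Space d} {u₀ : Space d → ℝ}

/-- The superlevel sets of a solution are controlled by those of its initial value, with a constant
that does not depend on the path. -/
theorem RegularDrift.volume_superlevel_le (hp : p ≠ ⊤) (hr : RegularDrift T q b divb Db f D F)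
    (hu : BoundedLpLoc T p u) (hB : Continuous B) (hu₀ : MemLpLoc p u₀)
    (hsf : ∀ᵐ s ∂(volume.restrict (Icc (0 : ℝ) T)), ShiftedEquation b divb B u₀ u s (u s))
    {t : ℝ} (ht : t ∈ Icc 0 T) {v : Space d → ℝ} (hv : MemLpLoc p v)
    (hvt : ShiftedEquation b divb B u₀ u t v) {l : ℝ} (hl : 0 ≤ l) :
    volume {x | l < |v x|}
      ≤ ENNReal.ofReal (Real.exp (∫ s in (0 : ℝ)..T, (D s + 4 * (d + 1) * F s)))
        * volume {x | l < |u₀ x|} := by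
  set K := Real.exp (∫ s in (0 : ℝ)..T, (D s + 4 * (d + 1) * F s)) with hK
  have hK0 : 0 < K := Real.exp_pos _
  rcases eq_or_ne (volume {x | l < |u₀ x|}) ⊤ with htop | htop
  · rw [htop, ENNReal.mul_top (by simpa using hK0)]
    exact le_top
  obtain ⟨β, hβ0, hβ⟩ := exists_norm_le_path hB T
  obtain ⟨C, hC0, hC⟩ := exists_abs_fderiv_weightTest_le d
  choose R S hRβ hSβ hmR hmS hE using fun m : ℕ =>
    exists_integral_weightError_le hr hB hβ0 hC0 (ε := 1 / ((m : ℝ) + 1)) (by positivity) m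
  have hS0 : ∀ m, 0 < S m := fun m => by linarith [hSβ m]
  set ψ : ℕ → Space d → ℝ := fun m => weightTest d (R m) (hS0 m) with hψ
  have hψ0 : ∀ m x, 0 ≤ ψ m x := fun m x => weightTest_nonneg _ _ x
  have hψ1 : ∀ m x, ψ m x ≤ 1 := fun m x => weightTest_le_one _ _ x
  set A : ℝ := (volume {x | l < |u₀ x|}).toReal with hA
  have hset : MeasurableSet {x | l < |u₀ x|} :=
    measurableSet_lt measurable_const hu₀.1.measurable.abs
  have hind : Integrable ({x | l < |u₀ x|}.indicator fun _ => (1 : ℝ)) :=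
    (integrable_indicator_iff hset).2 (integrableOn_const htop)
  have hA' : ∀ m, ∫ x, levelCutoff l m (u₀ x) * ψ m (x - B 0) ≤ A := by
    intro m
    have hle : ∀ x, levelCutoff l m (u₀ x) * ψ m (x - B 0)
        ≤ {x | l < |u₀ x|}.indicator (fun _ => (1 : ℝ)) x := fun x =>
      (mul_le_of_le_one_right (levelCutoff_nonneg l m _) (hψ1 _ _)).trans
        (levelCutoff_le_indicator l m (u₀ x))
    have h1 : ∫ x, levelCutoff l m (u₀ x) * ψ m (x - B 0)
        ≤ ∫ x, {x | l < |u₀ x|}.indicator (fun _ => (1 : ℝ)) x :=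
      integral_mono_of_nonneg (ae_of_all _ fun x => mul_nonneg (levelCutoff_nonneg l m _)
        (hψ0 _ _)) hind (ae_of_all _ hle)
    refine h1.trans_eq ?_
    rw [integral_indicator_const _ hset]
    simp [hA, Measure.real]
  have hbound : ∀ m : ℕ, ∫⁻ x, ENNReal.ofReal (levelCutoff l m (v x) * ψ m (x - B t))
      ≤ ENNReal.ofReal ((A + 1 / ((m : ℝ) + 1)) * K) := by
    intro m
    obtain ⟨L, hL⟩ := exists_abs_deriv_levelCutoff_le l m
    have h := hr.integral_weightTest_le hp hu hB hu₀ hsf ht hv hvt (contDiff_levelCutoff l m)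
      (levelCutoff_nonneg l m) (levelCutoff_le_one l m) hL hβ0 hβ
      hC0 hC (hRβ m) (hSβ m) (hS0 m) (hA' m)
    have hi : Integrable fun x => ψ m (x - B t) :=
      ((weightTest d (R m) (hS0 m)).continuous.integrable_of_hasCompactSupport
        (weightTest d (R m) (hS0 m)).hasCompactSupport).comp_sub_right (B t)
    have hi2 : Integrable fun x => levelCutoff l m (v x) * ψ m (x - B t) := by
      refine hi.mono' (((contDiff_levelCutoff l m).continuous.comp_stronglyMeasurable
        hv.1).aestronglyMeasurable.mul hi.aestronglyMeasurable) (ae_of_all _ fun x => ?_)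
      rw [Real.norm_of_nonneg (mul_nonneg (levelCutoff_nonneg l m _) (hψ0 _ _))]
      exact mul_le_of_le_one_left (hψ0 _ _) (levelCutoff_le_one l m _)
    rw [← ofReal_integral_eq_lintegral_ofReal hi2 (ae_of_all _ fun x =>
      mul_nonneg (levelCutoff_nonneg l m _) (hψ0 _ _))]
    refine ENNReal.ofReal_le_ofReal (h.trans ?_)
    gcongr
    exact hE m
  have hlim : ∀ x, Tendsto (fun m => ENNReal.ofReal (levelCutoff l m (v x) * ψ m (x - B t))) atTop
      (𝓝 ({x | l < |v x|}.indicator (fun _ => 1) x)) := by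
    intro x
    have hRt : Tendsto R atTop atTop := tendsto_atTop_mono hmR tendsto_natCast_atTop_atTop
    have h1 : Tendsto (fun m => ψ m (x - B t)) atTop (𝓝 1) := by
      refine ((tendsto_weight (x - B t)).comp hRt).congr' ?_
      filter_upwards [tendsto_natCast_atTop_atTop.eventually_ge_atTop ‖x - B t‖] with m hm
      rw [hψ]
      simp only [weightTest_apply, Function.comp]
      rw [cutoff_eq_one (hS0 m) (hm.trans (hmS m)), mul_one]
    have h2 := ENNReal.tendsto_ofReal ((tendsto_levelCutoff hl (v x)).mul h1)
    convert h2 using 2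
    by_cases hx : l < |v x|
    · rw [indicator_of_mem (by exact hx), indicator_of_mem (by exact hx)]; simp
    · rw [indicator_of_notMem (by exact hx), indicator_of_notMem (by exact hx)]; simp
  have hmeas : ∀ m, Measurable fun x => ENNReal.ofReal (levelCutoff l m (v x) * ψ m (x - B t)) := by
    intro m
    refine (((contDiff_levelCutoff l m).continuous.comp_stronglyMeasurable hv.1).measurable.mul
      ?_).ennreal_ofReal
    exact ((weightTest d (R m) (hS0 m)).continuous.comp (continuous_sub_right (B t))).measurable
  have hsetv : MeasurableSet {x | l < |v x|} :=
    measurableSet_lt measurable_const hv.1.measurable.abs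
  calc volume {x | l < |v x|} = ∫⁻ x, {x | l < |v x|}.indicator (fun _ => 1) x := by
        rw [lintegral_indicator_const hsetv, one_mul]
    _ = ∫⁻ x, liminf (fun m => ENNReal.ofReal (levelCutoff l m (v x) * ψ m (x - B t))) atTop :=
        lintegral_congr fun x => (hlim x).liminf_eq.symm
    _ ≤ liminf (fun m => ∫⁻ x, ENNReal.ofReal (levelCutoff l m (v x) * ψ m (x - B t))) atTop :=
        lintegral_liminf_le hmeas
    _ ≤ liminf (fun m : ℕ => ENNReal.ofReal ((A + 1 / ((m : ℝ) + 1)) * K)) atTop :=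
        liminf_le_liminf (Eventually.of_forall hbound)
    _ = ENNReal.ofReal ((A + 0) * K) :=
        (ENNReal.tendsto_ofReal (((tendsto_one_div_add_atTop_nhds_zero_nat).const_add A).mul_const
          K)).liminf_eq
    _ = _ := by
        rw [add_zero, mul_comm, ENNReal.ofReal_mul hK0.le, hA, ENNReal.ofReal_toReal htop]

/-- The stability constant in `Lᵖ`. -/
def stabilityConst (d : ℕ) (T : ℝ) (D F : ℝ → ℝ) (p : ℝ≥0∞) : ℝ≥0∞ :=
  ENNReal.ofReal (Real.exp (∫ s in (0 : ℝ)..T, (D s + 4 * (d + 1) * F s))) ^ (1 / p.toReal)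

theorem stabilityConst_ne_top (T : ℝ) (D F : ℝ → ℝ) (p : ℝ≥0∞) :
    stabilityConst d T D F p ≠ ⊤ :=
  ENNReal.rpow_ne_top_of_nonneg (by positivity) ENNReal.ofReal_ne_top

/-- The layer cake formula turns a comparison of superlevel sets into one of `Lᵖ` norms. -/
theorem eLpNorm_le_of_superlevel_le {c : ℝ≥0∞} {v w : Space d → ℝ} (hv : StronglyMeasurable v)
    (hw : StronglyMeasurable w) (h : ∀ l : ℝ, 0 ≤ l → volume {x | l < |v x|}
      ≤ c * volume {x | l < |w x|}) (hp0 : p ≠ 0) (hp : p ≠ ⊤) :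
    eLpNorm v p volume ≤ c ^ (1 / p.toReal) * eLpNorm w p volume := by
  have hp' : 0 < p.toReal := ENNReal.toReal_pos hp0 hp
  rw [eLpNorm_eq_lintegral_rpow_enorm_toReal hp0 hp, eLpNorm_eq_lintegral_rpow_enorm_toReal hp0 hp,
    ← ENNReal.mul_rpow_of_nonneg _ _ (by positivity)]
  refine ENNReal.rpow_le_rpow ?_ (by positivity)
  have e : ∀ {g : Space d → ℝ}, StronglyMeasurable g → ∫⁻ x, ‖g x‖ₑ ^ p.toReal
      = ENNReal.ofReal p.toReal * ∫⁻ t in Ioi (0 : ℝ), volume {x | t < |g x|}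
          * ENNReal.ofReal (t ^ (p.toReal - 1)) := by
    intro g hg
    rw [← lintegral_rpow_eq_lintegral_meas_lt_mul volume (ae_of_all _ fun x => abs_nonneg (g x))
      hg.measurable.abs.aemeasurable hp']
    refine lintegral_congr fun x => ?_
    rw [← ofReal_norm, Real.norm_eq_abs, ENNReal.ofReal_rpow_of_nonneg (abs_nonneg _) hp'.le]
  rw [e hv, e hw, mul_left_comm]
  refine mul_le_mul_right ?_ _
  have hm : Measurable fun t : ℝ => volume {x | t < |w x|} := by
    have : Antitone fun t : ℝ => volume {x | t < |w x|} := fun s t hst =>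
      measure_mono fun x hx => lt_of_le_of_lt hst hx
    exact this.measurable
  have hm2 : Measurable fun t : ℝ => volume {x | t < |w x|}
      * ENNReal.ofReal (t ^ (p.toReal - 1)) := hm.mul (by fun_prop)
  rw [← lintegral_const_mul _ hm2]
  refine setLIntegral_mono' measurableSet_Ioi fun t ht => ?_
  rw [← mul_assoc]
  exact mul_le_mul_left (h t (le_of_lt ht)) _

/-- The `Lᵖ` estimate for solutions. -/
theorem RegularDrift.eLpNorm_le (hp : p ≠ ⊤) (hr : RegularDrift T q b divb Db f D F)
    (hu : BoundedLpLoc T p u) (hB : Continuous B) (hu₀ : MemLpLoc p u₀)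
    (hsf : ∀ᵐ s ∂(volume.restrict (Icc (0 : ℝ) T)), ShiftedEquation b divb B u₀ u s (u s))
    {t : ℝ} (ht : t ∈ Icc 0 T) {v : Space d → ℝ} (hv : MemLpLoc p v)
    (hvt : ShiftedEquation b divb B u₀ u t v) :
    eLpNorm v p volume ≤ stabilityConst d T D F p * eLpNorm u₀ p volume :=
  eLpNorm_le_of_superlevel_le hv.1 hu₀.1
    (fun _ hl => hr.volume_superlevel_le hp hu hB hu₀ hsf ht hv hvt hl)
    (zero_lt_one.trans_le (ENNReal.HolderConjugate.one_le p q)).ne' hp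

end

/-! ### Representation of functionals bounded in `L¹` -/

section

variable {α : Type*} [MeasurableSpace α]

/-- The dual of `L¹` of a finite measure, deduced from the Riesz representation theorem in `L²`. -/
theorem exists_bounded_density_of_dual {κ : Measure α} [IsFiniteMeasure κ] {M : ℝ} (hM : 0 ≤ M)
    (L : Lp ℝ 1 κ →L[ℝ] ℝ) (hL : ∀ f, |L f| ≤ M * ‖f‖) :
    ∃ U : α → ℝ, StronglyMeasurable U ∧ (∀ z, |U z| ≤ M) ∧ ∀ f : Lp ℝ 1 κ, L f = ∫ z, U z * f z ∂κ := by
  have hmem : ∀ f : Lp ℝ 2 κ, MemLp f 1 κ := fun f => (Lp.memLp f).mono_exponent one_le_two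
  set C : ℝ := (κ univ ^ (1 / (1 : ℝ≥0∞).toReal - 1 / (2 : ℝ≥0∞).toReal)).toReal with hC
  have hCtop : κ univ ^ (1 / (1 : ℝ≥0∞).toReal - 1 / (2 : ℝ≥0∞).toReal) ≠ ⊤ :=
    ENNReal.rpow_ne_top_of_nonneg (by norm_num) (measure_ne_top _ _)
  let J₀ : Lp ℝ 2 κ →ₗ[ℝ] ℝ :=
    { toFun := fun f => L ((hmem f).toLp f)
      map_add' := fun f g => by
        rw [← map_add, ← MemLp.toLp_add]
        congr 1
        exact MemLp.toLp_congr _ _ (Lp.coeFn_add f g)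
      map_smul' := fun c f => by
        rw [RingHom.id_apply, ← map_smul, ← MemLp.toLp_const_smul]
        congr 1
        exact MemLp.toLp_congr _ _ (Lp.coeFn_smul c f) }
  have hJb : ∀ f, ‖J₀ f‖ ≤ M * C * ‖f‖ := by
    intro f
    refine (hL _).trans ?_
    rw [mul_assoc]
    refine mul_le_mul_of_nonneg_left ?_ hM
    rw [Lp.norm_toLp, Lp.norm_def, mul_comm C, ← ENNReal.toReal_mul]
    exact ENNReal.toReal_mono (ENNReal.mul_ne_top (Lp.eLpNorm_ne_top f) hCtop)
      (eLpNorm_le_eLpNorm_mul_rpow_measure_univ one_le_two (Lp.aestronglyMeasurable f))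
  set g : Lp ℝ 2 κ := (InnerProductSpace.toDual ℝ (Lp ℝ 2 κ)).symm (J₀.mkContinuous (M * C) hJb)
    with hg
  have hgi : Integrable g κ := (hmem g).integrable le_rfl
  have hset : ∀ {s : Set α} (hs : MeasurableSet s),
      ∫ z in s, g z ∂κ = L (indicatorConstLp 1 hs (measure_ne_top κ s) 1) := by
    intro s hs
    rw [← L2.inner_indicatorConstLp_one (𝕜 := ℝ) hs (measure_ne_top κ s) g, real_inner_comm, hg,
      InnerProductSpace.toDual_symm_apply]
    show L _ = L _
    congr 1
    exact MemLp.toLp_congr _ _ indicatorConstLp_coeFn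
  have hsetle : ∀ {s : Set α} (_ : MeasurableSet s), |∫ z in s, g z ∂κ| ≤ M * κ.real s := by
    intro s hs
    rw [hset hs]
    refine (hL _).trans_eq ?_
    rw [norm_indicatorConstLp one_ne_zero ENNReal.one_ne_top]
    simp
  have hup : ∀ᵐ z ∂κ, g z ≤ M := by
    refine ae_le_of_forall_setIntegral_le hgi (integrable_const M) fun s hs _ => ?_
    refine (le_abs_self _).trans ((hsetle hs).trans_eq ?_)
    simp [mul_comm]
  have hlow : ∀ᵐ z ∂κ, -M ≤ g z := by
    refine ae_le_of_forall_setIntegral_le (integrable_const (-M)) hgi fun s hs _ => ?_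
    refine le_trans ?_ (neg_le_of_abs_le (hsetle hs))
    simp [mul_comm]
  set U : α → ℝ := fun z => max (-M) (min M ((Lp.aestronglyMeasurable g).mk g z)) with hU
  have hUm : StronglyMeasurable U :=
    stronglyMeasurable_const.sup (stronglyMeasurable_const.inf
      (Lp.aestronglyMeasurable g).stronglyMeasurable_mk)
  have hUb : ∀ z, |U z| ≤ M := fun z => abs_le.2 ⟨le_max_left _ _,
    max_le (by linarith) (min_le_left _ _)⟩
  have hUg : U =ᵐ[κ] g := by
    filter_upwards [hup, hlow, (Lp.aestronglyMeasurable g).ae_eq_mk] with z h1 h2 h3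
    rw [hU]
    simp only [← h3]
    rw [min_eq_right h1, max_eq_right h2]
  have hUi : ∀ f : Lp ℝ 1 κ, Integrable (fun z => U z * f z) κ := fun f =>
    (L1.integrable_coeFn f).bdd_mul (c := M) hUm.aestronglyMeasurable (ae_of_all _ hUb)
  let I₀ : Lp ℝ 1 κ →ₗ[ℝ] ℝ :=
    { toFun := fun f => ∫ z, U z * f z ∂κ
      map_add' := fun f h => by
        rw [← integral_add (hUi f) (hUi h)]
        refine integral_congr_ae ?_
        filter_upwards [Lp.coeFn_add f h] with z hz
        rw [hz, Pi.add_apply]; ring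
      map_smul' := fun c f => by
        rw [RingHom.id_apply, smul_eq_mul, ← integral_const_mul]
        refine integral_congr_ae ?_
        filter_upwards [Lp.coeFn_smul c f] with z hz
        rw [hz, Pi.smul_apply, smul_eq_mul]; ring }
  have hIb : ∀ f, ‖I₀ f‖ ≤ M * ‖f‖ := by
    intro f
    rw [L1.norm_eq_integral_norm, ← integral_const_mul]
    refine norm_integral_le_of_norm_le ((L1.integrable_coeFn f).norm.const_mul M)
      (ae_of_all _ fun z => ?_)
    rw [norm_mul]
    exact mul_le_mul_of_nonneg_right (hUb z) (norm_nonneg _)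
  refine ⟨U, hUm, hUb, fun f => ?_⟩
  have key : ∀ f, L f = I₀.mkContinuous M hIb f := by
    refine Lp.induction ENNReal.one_ne_top _ (fun c s hs hμs => ?_) (fun f h hf hh _ e1 e2 => ?_) ?_
    · rw [Lp.simpleFunc.coe_indicatorConst]
      have e : indicatorConstLp 1 hs hμs.ne c = c • indicatorConstLp 1 hs hμs.ne (1 : ℝ) := by
        rw [indicatorConstLp, indicatorConstLp, ← MemLp.toLp_const_smul]
        refine MemLp.toLp_congr _ _ (ae_of_all _ fun z => ?_)
        by_cases hz : z ∈ s <;> simp [hz]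
      rw [e, map_smul, map_smul, ← hset hs]
      congr 1
      show _ = ∫ z, U z * indicatorConstLp 1 hs hμs.ne (1 : ℝ) z ∂κ
      rw [← integral_indicator hs]
      refine integral_congr_ae ?_
      filter_upwards [hUg, indicatorConstLp_coeFn (p := 1) (hs := hs) (hμs := hμs.ne) (c := (1 : ℝ))]
        with z h1 h2
      rw [h2, h1]
      by_cases hz : z ∈ s <;> simp [hz]
    · rw [map_add, map_add, e1, e2]
    · exact isClosed_eq L.continuous (I₀.mkContinuous M hIb).continuous
  exact key f

/-- A functional on the span of a family of integrable functions, which is bounded in `L¹`, is given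
by a bounded function. The family and the functional are given by their values `τ i` and `a i`. -/
theorem exists_bounded_density_of_isFiniteMeasure {κ : Measure α} [IsFiniteMeasure κ] {ι : Type*}
    {τ : ι → α → ℝ} (hτ : ∀ i, Integrable (τ i) κ) {a : ι → ℝ} {M : ℝ} (hM : 0 ≤ M)
    (h : ∀ (s : Finset ι) (c : ι → ℝ),
      |∑ i ∈ s, c i * a i| ≤ M * ∫ z, |∑ i ∈ s, c i * τ i z| ∂κ) :
    ∃ U : α → ℝ, StronglyMeasurable U ∧ (∀ z, |U z| ≤ M) ∧ ∀ i, a i = ∫ z, U z * τ i z ∂κ := by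
  set t : ι → Lp ℝ 1 κ := fun i => (memLp_one_iff_integrable.2 (hτ i)).toLp (τ i) with ht
  have htc : ∀ i, t i =ᵐ[κ] τ i := fun i => MemLp.coeFn_toLp _
  set S : (ι →₀ ℝ) →ₗ[ℝ] Lp ℝ 1 κ := Finsupp.linearCombination ℝ t with hS
  set ℓ : (ι →₀ ℝ) →ₗ[ℝ] ℝ := Finsupp.linearCombination ℝ a with hℓ
  have hcoe : ∀ (s : Finset ι) (c : ι → ℝ),
      (∑ i ∈ s, c i • t i : Lp ℝ 1 κ) =ᵐ[κ] fun z => ∑ i ∈ s, c i * τ i z := by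
    intro s c
    classical
    induction s using Finset.induction_on with
    | empty =>
      simp only [Finset.sum_empty]
      exact Lp.coeFn_zero _ _ _
    | insert i s hi ih =>
      simp only [Finset.sum_insert hi]
      filter_upwards [ih, Lp.coeFn_add (c i • t i) (∑ i ∈ s, c i • t i), Lp.coeFn_smul (c i) (t i),
        htc i] with z h1 h2 h3 h4
      rw [h2, Pi.add_apply, h1, h3, Pi.smul_apply, h4, smul_eq_mul]
  have hb : ∀ v, |ℓ v| ≤ M * ‖S v‖ := by
    intro v
    rw [hℓ, hS, Finsupp.linearCombination_apply, Finsupp.linearCombination_apply, Finsupp.sum,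
      Finsupp.sum, L1.norm_eq_integral_norm]
    refine (h v.support v).trans_eq ?_
    congr 1
    refine integral_congr_ae ?_
    filter_upwards [hcoe v.support v] with z hz
    rw [hz, Real.norm_eq_abs]
  -- the functional on the range of `S`
  obtain ⟨r, hr⟩ := S.rangeRestrict.exists_rightInverse_of_surjective (LinearMap.range_rangeRestrict S)
  have hSr : ∀ w : LinearMap.range S, S (r w) = w := fun w => by
    have := LinearMap.congr_fun hr w
    simpa using congrArg Subtype.val this
  have hℓr : ∀ v, ℓ (r (S.rangeRestrict v)) = ℓ v := by
    intro v
    have h1 : |ℓ (r (S.rangeRestrict v) - v)| ≤ 0 := by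
      refine (hb _).trans_eq ?_
      rw [map_sub, hSr]
      simp
    rw [abs_nonpos_iff, map_sub, sub_eq_zero] at h1
    exact h1
  have hbr : ∀ w : LinearMap.range S, ‖(ℓ ∘ₗ r) w‖ ≤ M * ‖w‖ := by
    intro w
    refine (hb (r w)).trans_eq ?_
    rw [hSr]; rfl
  obtain ⟨L, hLe, hLn⟩ := exists_extension_norm_eq (𝕜 := ℝ) (LinearMap.range S)
    ((ℓ ∘ₗ r).mkContinuous M hbr)
  have hLM : ‖L‖ ≤ M := by
    rw [hLn]
    exact LinearMap.mkContinuous_norm_le _ hM _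
  obtain ⟨U, hUm, hUb, hU⟩ := exists_bounded_density_of_dual hM L fun f =>
    (L.le_opNorm f).trans (mul_le_mul_of_nonneg_right hLM (norm_nonneg f))
  refine ⟨U, hUm, hUb, fun i => ?_⟩
  have h1 : a i = ℓ (Finsupp.single i 1) := by simp [hℓ]
  have h2 : S (Finsupp.single i 1) = t i := by simp [hS]
  have h3 : L (t i) = a i := by
    rw [h1, ← hℓr, ← h2]
    exact hLe (S.rangeRestrict (Finsupp.single i 1))
  rw [← h3, hU]
  refine integral_congr_ae ?_
  filter_upwards [htc i] with z hz
  rw [hz]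

/-- A family of scalars bounded by the `L¹` norms of the combinations of `τ` consists of the integrals
of `τ` against one bounded function, by the Hahn-Banach theorem. The `σ`-finite case reduces to that
of a finite measure. -/
theorem exists_bounded_density {κ : Measure α} [SigmaFinite κ] {ι : Type*}
    {τ : ι → α → ℝ} (hτ : ∀ i, Integrable (τ i) κ) {a : ι → ℝ} {M : ℝ} (hM : 0 ≤ M)
    (h : ∀ (s : Finset ι) (c : ι → ℝ),
      |∑ i ∈ s, c i * a i| ≤ M * ∫ z, |∑ i ∈ s, c i * τ i z| ∂κ) :
    ∃ U : α → ℝ, StronglyMeasurable U ∧ (∀ z, |U z| ≤ M) ∧ ∀ i, a i = ∫ z, U z * τ i z ∂κ := by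
  obtain ⟨w, hw0, hwm, hw⟩ := exists_pos_lintegral_lt_of_sigmaFinite κ one_ne_zero
  have hfin : IsFiniteMeasure (κ.withDensity fun z => (w z : ℝ≥0∞)) :=
    isFiniteMeasure_withDensity (hw.trans ENNReal.one_lt_top).ne
  have hcancel : ∀ z (x : ℝ), w z • ((w z : ℝ)⁻¹ * x) = x := fun z x => by
    rw [NNReal.smul_def, smul_eq_mul]
    exact mul_inv_cancel_left₀ (NNReal.coe_pos.2 (hw0 z)).ne' x
  obtain ⟨U, hUm, hUb, hU⟩ := exists_bounded_density_of_isFiniteMeasure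
    (κ := κ.withDensity fun z => (w z : ℝ≥0∞)) (τ := fun i z => (w z : ℝ)⁻¹ * τ i z) (a := a)
    (fun i => by
      rw [integrable_withDensity_iff_integrable_smul hwm]
      simpa only [hcancel] using hτ i) hM (fun s c => by
      rw [integral_withDensity_eq_integral_smul hwm]
      refine (h s c).trans_eq ?_
      congr 1
      refine integral_congr_ae (ae_of_all _ fun z => ?_)
      have e : ∑ i ∈ s, c i * ((w z : ℝ)⁻¹ * τ i z) = (w z : ℝ)⁻¹ * ∑ i ∈ s, c i * τ i z := by
        rw [Finset.mul_sum]
        exact Finset.sum_congr rfl fun i _ => by ring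
      simp only
      rw [e, abs_mul, abs_of_pos (inv_pos.2 (NNReal.coe_pos.2 (hw0 z))), hcancel])
  refine ⟨U, hUm, hUb, fun i => ?_⟩
  rw [hU i, integral_withDensity_eq_integral_smul hwm]
  refine integral_congr_ae (ae_of_all _ fun z => ?_)
  simp only
  rw [mul_left_comm, hcancel]

end

/-! ### Measurability of processes and of `Lᵖ`-valued functions -/

/-- A process with almost surely continuous paths on `[0,T]` coincides there, almost surely, with a
process on `ℝ` which has continuous paths everywhere and is strongly measurable at every time. -/
theorem exists_continuous_version {Ω E : Type*} [MeasurableSpace Ω] {P : Measure Ω}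
    [NormedAddCommGroup E] {T : ℝ} (hT : 0 ≤ T) {X : ℝ → Ω → E}
    (hm : ∀ t ∈ Icc 0 T, AEStronglyMeasurable (X t) P)
    (hc : ∀ᵐ w ∂P, ContinuousOn (fun t => X t w) (Icc 0 T)) :
    ∃ Y : ℝ → Ω → E, (∀ w, Continuous fun t => Y t w) ∧ (∀ t, StronglyMeasurable (Y t)) ∧
      ∀ᵐ w ∂P, ∀ t ∈ Icc 0 T, Y t w = X t w := by
  set c : ℝ → ℝ := fun t => max 0 (min T t) with hc_def
  have hcm : ∀ t, c t ∈ Icc 0 T := fun t => ⟨le_max_left _ _, max_le hT (min_le_left _ _)⟩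
  have hq : ∀ᵐ w ∂P, ∀ q : ℚ, X (c q) w = (hm _ (hcm q)).mk _ w :=
    ae_all_iff.2 fun q => (hm _ (hcm q)).ae_eq_mk
  obtain ⟨G, hG, hGm, hGp⟩ := (hc.and hq).exists_measurable_mem
  set Y : ℝ → Ω → E := fun t => G.indicator fun w => X (c t) w with hY
  have hYc : ∀ w, Continuous fun t => Y t w := by
    intro w
    by_cases hw : w ∈ G
    · simp only [hY, indicator_of_mem hw]
      exact continuous_clamp hT (hGp w hw).1
    · simp only [hY, indicator_of_notMem hw]
      exact continuous_const
  refine ⟨Y, hYc, fun t => ?_, ?_⟩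
  · have ht : t ∈ closure (range ((↑) : ℚ → ℝ)) := Rat.denseRange_cast t
    obtain ⟨x, hx, hxt⟩ := mem_closure_iff_seq_limit.1 ht
    choose q hq using hx
    refine stronglyMeasurable_of_tendsto atTop (f := fun n => Y (q n)) (fun n => ?_) ?_
    · have e : Y (q n) = G.indicator ((hm _ (hcm (q n))).mk _) := by
        ext w
        by_cases hw : w ∈ G
        · simp only [hY, indicator_of_mem hw]
          exact (hGp w hw).2 (q n)
        · simp only [hY, indicator_of_notMem hw]
      rw [e]
      exact (hm _ (hcm (q n))).stronglyMeasurable_mk.indicator hGm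
    · rw [tendsto_pi_nhds]
      intro w
      have : Tendsto (fun n => ((q n : ℚ) : ℝ)) atTop (𝓝 t) := by simpa only [hq] using hxt
      exact ((hYc w).tendsto t).comp this
  · filter_upwards [hG] with w hw t ht
    simp only [hY, indicator_of_mem hw, hc_def, clamp_eq ht]

section

variable {d : ℕ}

theorem memLp_testFun (φ : TestFun d) (q : ℝ≥0∞) : MemLp φ q volume :=
  φ.continuous.memLp_of_hasCompactSupport φ.hasCompactSupport

theorem continuous_integral_mul_of_memLp {p q : ℝ≥0∞} [Fact (1 ≤ p)] [ENNReal.HolderConjugate p q]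
    {g : Space d → ℝ} (hg : MemLp g q volume) :
    Continuous fun f : Lp ℝ p (volume : Measure (Space d)) => ∫ x, f x * g x := by
  have : Fact (1 ≤ q) := ⟨ENNReal.HolderConjugate.one_le q p⟩
  have h := (((ContinuousLinearMap.mul ℝ ℝ).lpPairing (volume : Measure (Space d)) p q).flip
    (hg.toLp g)).continuous
  refine h.congr fun f => ?_
  rw [ContinuousLinearMap.flip_apply, ContinuousLinearMap.lpPairing_eq_integral]
  refine integral_congr_ae ?_
  filter_upwards [hg.coeFn_toLp] with x hx
  rw [hx]; rfl

theorem stronglyMeasurable_limUnder_atTop {Z : Type*} [MeasurableSpace Z] {f : ℕ → Z → ℝ}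
    (hf : ∀ n, StronglyMeasurable (f n)) :
    StronglyMeasurable fun z => limUnder atTop fun n => f n z :=
  StronglyMeasurable.limUnder hf

/-- A measurable function with values in `Lᵖ` has a representative which is jointly measurable. -/
theorem exists_jointly_measurable {α : Type*} [MeasurableSpace α] {p q : ℝ≥0∞} [Fact (1 ≤ p)]
    [ENNReal.HolderConjugate p q] {g : α → Lp ℝ p (volume : Measure (Space d))}
    (hg : StronglyMeasurable g) :
    ∃ U : α → Space d → ℝ, StronglyMeasurable (Function.uncurry U) ∧ ∀ a, U a =ᵐ[volume] g a := by
  have hl : ∀ a, LocallyIntegrable (g a) := fun a =>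
    (Lp.memLp (g a)).locallyIntegrable (Fact.out : 1 ≤ p)
  have hm : ∀ n, StronglyMeasurable fun z : Space d × α => mollify n (g z.2) z.1 := by
    intro n
    refine stronglyMeasurable_uncurry_of_continuous_of_stronglyMeasurable
      (u := fun x a => mollify n (g a) x) (fun a => (contDiff_mollify (hl a) n).continuous)
      fun x => ?_
    have hc := continuous_integral_mul_of_memLp (p := p) (q := q)
      (memLp_testFun (translate (mollifierTest d n) x) q)
    have e : (fun a => mollify n (g a) x)
        = fun a => ∫ y, g a y * translate (mollifierTest d n) x y := by
      funext a
      rw [mollify]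
      refine integral_congr_ae (ae_of_all _ fun y => ?_)
      simp [translate, mul_comm, coe_mollifierTest]
    change StronglyMeasurable fun a => mollify n (g a) x
    rw [e]
    exact hc.comp_stronglyMeasurable hg
  refine ⟨fun a x => limUnder atTop fun n => mollify n (g a) x, ?_, fun a => ?_⟩
  · have h := stronglyMeasurable_limUnder_atTop hm
    have e : (Function.uncurry fun a x => limUnder atTop fun n => mollify n (g a) x)
        = (fun z : Space d × α => limUnder atTop fun n => mollify n (g z.2) z.1) ∘ Prod.swap := rfl
    rw [e]
    exact h.comp_measurable measurable_swap
  · filter_upwards [ae_tendsto_mollifier_convolution (hl a)] with x hx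
    exact hx.limUnder_eq

theorem stronglyMeasurable_toLp {α : Type*} [MeasurableSpace α] {p : ℝ≥0∞} [Fact (1 ≤ p)]
    (hp : p ≠ ⊤) {U : α → Space d → ℝ} (hU : StronglyMeasurable (Function.uncurry U))
    (h : ∀ a, MemLp (U a) p volume) : StronglyMeasurable fun a => (h a).toLp (U a) := by
  have : Fact (p ≠ ⊤) := ⟨hp⟩
  set f : α → Lp ℝ p (volume : Measure (Space d)) := fun a => (h a).toLp (U a) with hf
  borelize ↥(Lp ℝ p (volume : Measure (Space d)))
  have hdist : ∀ v : Lp ℝ p (volume : Measure (Space d)), Measurable fun a => dist (f a) v := by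
    intro v
    have e : ∀ a, dist (f a) v = (eLpNorm (fun x => U a x - (Lp.aestronglyMeasurable v).mk v x)
        p volume).toReal := by
      intro a
      rw [Lp.dist_def]
      congr 1
      refine eLpNorm_congr_ae ?_
      filter_upwards [(h a).coeFn_toLp, (Lp.aestronglyMeasurable v).ae_eq_mk] with x h1 h2
      rw [Pi.sub_apply, h1, h2]
    simp_rw [e]
    refine (measurable_eLpNorm_uncurry (f := fun a x => U a x - (Lp.aestronglyMeasurable v).mk v x)
      ?_ p).ennreal_toReal
    exact hU.sub ((Lp.aestronglyMeasurable v).stronglyMeasurable_mk.comp_measurable measurable_snd)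
  refine Measurable.stronglyMeasurable (measurable_of_isOpen fun O hO => ?_)
  set v := TopologicalSpace.denseSeq (Lp ℝ p (volume : Measure (Space d)))
  have e : f ⁻¹' O = ⋃ (n : ℕ) (m : ℕ) (_ : Metric.ball (v n) (1 / ((m : ℝ) + 1)) ⊆ O),
      {a | dist (f a) (v n) < 1 / ((m : ℝ) + 1)} := by
    ext a
    simp only [mem_preimage, mem_iUnion, mem_ofPred_eq, exists_prop]
    constructor
    · intro ha
      obtain ⟨ε, hε, hεO⟩ := Metric.isOpen_iff.1 hO _ ha
      obtain ⟨m, hm⟩ := exists_nat_one_div_lt (half_pos hε)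
      obtain ⟨n, hn⟩ := (TopologicalSpace.denseRange_denseSeq
        (Lp ℝ p (volume : Measure (Space d)))).exists_dist_lt (f a)
        (ε := 1 / ((m : ℝ) + 1)) (by positivity)
      refine ⟨n, m, fun w hw => hεO ?_, hn⟩
      rw [Metric.mem_ball] at hw ⊢
      calc dist w (f a) ≤ dist w (v n) + dist (f a) (v n) := dist_triangle_right _ _ _
        _ < ε / 2 + ε / 2 := add_lt_add (hw.trans hm) (hn.trans hm)
        _ = ε := add_halves ε
    · rintro ⟨n, m, h1, h2⟩
      exact h1 h2
  rw [e]
  refine MeasurableSet.iUnion fun n => MeasurableSet.iUnion fun m => MeasurableSet.iUnion fun _ => ?_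
  exact measurableSet_lt (hdist _) measurable_const

end

/-- Fubini's theorem on a triangle. -/
theorem integral_tail_mul {T : ℝ} {θ k : ℝ → ℝ} (hθ : IntegrableOn θ (Icc 0 T))
    (hk : IntegrableOn k (Icc 0 T)) :
    ∫ t in Icc 0 T, (∫ r in t..T, θ r) * k t
      = ∫ r in Icc 0 T, θ r * ∫ t in (0 : ℝ)..r, k t := by
  have h1 : ∀ t ∈ Icc 0 T, (∫ r in t..T, θ r) * k t
      = ∫ r in Icc 0 T, {z : ℝ × ℝ | z.1 < z.2}.indicator (fun z => k z.1 * θ z.2) (t, r) := by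
    intro t ht
    have e : ∀ r, {z : ℝ × ℝ | z.1 < z.2}.indicator (fun z => k z.1 * θ z.2) (t, r)
        = k t * (Ioi t).indicator θ r := by
      intro r
      by_cases h : t < r <;> simp [h]
    simp_rw [e]
    rw [integral_const_mul, setIntegral_indicator measurableSet_Ioi,
      intervalIntegral.integral_of_le ht.2, mul_comm]
    congr 3
    ext r
    simp only [mem_inter_iff, mem_Icc, mem_Ioi, mem_Ioc]
    exact ⟨fun h => ⟨⟨ht.1.trans h.1.le, h.2⟩, h.1⟩, fun h => ⟨h.2, h.1.2⟩⟩
  have h2 : ∀ r ∈ Icc 0 T, θ r * ∫ t in (0 : ℝ)..r, k t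
      = ∫ t in Icc 0 T, {z : ℝ × ℝ | z.1 < z.2}.indicator (fun z => k z.1 * θ z.2) (t, r) := by
    intro r hr
    have e : ∀ t, {z : ℝ × ℝ | z.1 < z.2}.indicator (fun z => k z.1 * θ z.2) (t, r)
        = θ r * (Iio r).indicator k t := by
      intro t
      by_cases h : t < r <;> simp [h, mul_comm]
    simp_rw [e]
    rw [integral_const_mul, setIntegral_indicator measurableSet_Iio,
      intervalIntegral.integral_of_le hr.1, integral_Ioc_eq_integral_Ioo,
      ← integral_Ico_eq_integral_Ioo]
    congr 3
    ext t
    simp only [mem_inter_iff, mem_Icc, mem_Iio, mem_Ico]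
    exact ⟨fun h => ⟨⟨h.1, h.2.le.trans hr.2⟩, h.2⟩, fun h => ⟨h.1.1, h.2⟩⟩
  have hint : Integrable ({z : ℝ × ℝ | z.1 < z.2}.indicator fun z => k z.1 * θ z.2)
      ((volume.restrict (Icc 0 T)).prod (volume.restrict (Icc 0 T))) :=
    (Integrable.mul_prod hk hθ).indicator (measurableSet_lt measurable_fst measurable_snd)
  rw [setIntegral_congr_fun measurableSet_Icc h1, setIntegral_congr_fun measurableSet_Icc h2]
  exact integral_integral_swap (f := fun t r => {z : ℝ × ℝ | z.1 < z.2}.indicator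
    (fun z => k z.1 * θ z.2) (t, r)) hint

/-! ### The weak form of the transport operator -/

section

variable {d : ℕ} {p q : ℝ≥0∞} [ENNReal.HolderConjugate p q]

/-- The pairing of `u` with `div (b φ)`: the weak form of `-b · ∇u`. -/
def transport (b : Space d → Space d) (divb : Space d → ℝ) (u : Space d → ℝ) (φ : TestFun d) : ℝ :=
  ∫ x, u x * (fderiv ℝ φ x (b x) + divb x * φ x)

theorem mollifiedTransport_eq_transport (b : Space d → Space d) (divb : Space d → ℝ)
    (u : Space d → ℝ) (n : ℕ) (x : Space d) :
    mollifiedTransport b divb u n x = transport b divb u (translate (mollifierTest d n) x) := by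
  simp only [mollifiedTransport, transport, fderiv_translate, translate_apply, coe_mollifierTest]

theorem mollify_eq_integral_translate (u : Space d → ℝ) (n : ℕ) (x : Space d) :
    mollify n u x = ∫ y, u y * translate (mollifierTest d n) x y := by
  rw [mollify]
  refine integral_congr_ae (ae_of_all _ fun y => ?_)
  simp [mul_comm, coe_mollifierTest]

/-- The mass on the ball of radius `R` of the functions against which the weak form of the transport
operator integrates test functions and their derivatives. -/
def localMass (R : ℝ) (b : Space d → Space d) (divb : Space d → ℝ) (u : Space d → ℝ) : ℝ≥0∞ :=
  ∫⁻ x in Metric.closedBall 0 R, ‖u x‖ₑ * (‖b x‖ₑ + ‖divb x‖ₑ)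

theorem localMass_le {b : Space d → Space d} {divb : Space d → ℝ} {u : Space d → ℝ}
    (hu : StronglyMeasurable u) (hb : StronglyMeasurable b) (hd : StronglyMeasurable divb) (R : ℝ) :
    localMass R b divb u ≤ eLpNorm u p (volume.restrict (Metric.closedBall 0 R))
      * (eLpNorm b q (volume.restrict (Metric.closedBall 0 R))
        + eLpNorm divb q (volume.restrict (Metric.closedBall 0 R))) := by
  simp_rw [localMass, mul_add]
  have m1 : Measurable fun x => ‖u x‖ₑ * ‖b x‖ₑ := hu.enorm.mul hb.enorm
  rw [lintegral_add_left m1]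
  exact add_le_add
    (lintegral_enorm_mul_le hu.aestronglyMeasurable hb.aestronglyMeasurable)
    (lintegral_enorm_mul_le hu.aestronglyMeasurable hd.aestronglyMeasurable)

theorem lintegral_enorm_pairing_le {b : Space d → Space d} {divb : Space d → ℝ} (u : Space d → ℝ)
    {A : Space d → Space d →L[ℝ] ℝ} {a : Space d → ℝ} {C R : ℝ} (hA : ∀ x, ‖A x‖ ≤ C)
    (ha : ∀ x, ‖a x‖ ≤ C) (h0 : ∀ x, R < ‖x‖ → A x = 0 ∧ a x = 0) :
    ∫⁻ x, ‖u x * (A x (b x) + divb x * a x)‖ₑ ≤ ENNReal.ofReal C * localMass R b divb u := by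
  rw [localMass, ← lintegral_const_mul' _ _ ENNReal.ofReal_ne_top,
    ← lintegral_indicator measurableSet_closedBall]
  have e1 : ∀ x, ‖a x‖ₑ ≤ ENNReal.ofReal C := fun x => by
    rw [← ofReal_norm]; exact ENNReal.ofReal_le_ofReal (ha x)
  have e2 : ∀ x, ‖A x‖ₑ ≤ ENNReal.ofReal C := fun x => by
    rw [← ofReal_norm]; exact ENNReal.ofReal_le_ofReal (hA x)
  refine lintegral_mono fun x => ?_
  by_cases hx : x ∈ Metric.closedBall (0 : Space d) R
  · rw [indicator_of_mem hx, enorm_mul]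
    calc _ ≤ ‖u x‖ₑ * (‖A x (b x)‖ₑ + ‖divb x * a x‖ₑ) := by gcongr; exact enorm_add_le _ _
      _ ≤ ‖u x‖ₑ * (ENNReal.ofReal C * ‖b x‖ₑ + ‖divb x‖ₑ * ENNReal.ofReal C) := by
          rw [enorm_mul (divb x)]
          gcongr
          · exact (ContinuousLinearMap.le_opENorm _ _).trans (by gcongr; exact e2 _)
          · exact e1 _
      _ = _ := by ring
  · simp only [Metric.mem_closedBall, dist_zero_right, not_le] at hx
    rw [(h0 x hx).1, (h0 x hx).2]
    simp

theorem abs_integral_pairing_le {b : Space d → Space d} {divb : Space d → ℝ} {u : Space d → ℝ}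
    {A : Space d → Space d →L[ℝ] ℝ} {a : Space d → ℝ} {C R : ℝ} (hA : ∀ x, ‖A x‖ ≤ C)
    (ha : ∀ x, ‖a x‖ ≤ C) (h0 : ∀ x, R < ‖x‖ → A x = 0 ∧ a x = 0)
    (hfin : localMass R b divb u ≠ ⊤) :
    |∫ x, u x * (A x (b x) + divb x * a x)| ≤ C * (localMass R b divb u).toReal := by
  have hC : 0 ≤ C := (norm_nonneg _).trans (ha 0)
  rw [← Real.norm_eq_abs, ← toReal_enorm, ← ENNReal.toReal_ofReal hC, ← ENNReal.toReal_mul]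
  exact ENNReal.toReal_mono (ENNReal.mul_ne_top ENNReal.ofReal_ne_top hfin)
    ((enorm_integral_le_lintegral_enorm _).trans (lintegral_enorm_pairing_le u hA ha h0))

/-- Test functions, their derivatives and their supports are uniformly controlled. -/
theorem exists_testFun_bound (φ : TestFun d) : ∃ C R : ℝ, 0 ≤ C ∧ 0 ≤ R ∧ (∀ x, ‖φ x‖ ≤ C) ∧
    (∀ x, ‖fderiv ℝ φ x‖ ≤ C) ∧ ∀ x, R < ‖x‖ → fderiv ℝ φ x = 0 ∧ φ x = 0 := by
  obtain ⟨C₁, hC₁⟩ := φ.continuous.bounded_above_of_compact_support φ.hasCompactSupport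
  obtain ⟨C₂, hC₂⟩ := (continuous_fderiv_testFun φ).bounded_above_of_compact_support
    (φ.hasCompactSupport.fderiv ℝ)
  obtain ⟨R, hR⟩ := φ.hasCompactSupport.isCompact.isBounded.subset_closedBall 0
  refine ⟨max C₁ C₂, max R 0, (norm_nonneg _).trans ((hC₁ 0).trans (le_max_left _ _)),
    le_max_right _ _, fun x => (hC₁ x).trans (le_max_left _ _),
    fun x => (hC₂ x).trans (le_max_right _ _), fun x hx => ?_⟩
  have hn : x ∉ tsupport φ := fun h => by
    have h1 := hR h
    rw [Metric.mem_closedBall, dist_zero_right] at h1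
    exact absurd hx (not_lt.2 (h1.trans (le_max_left _ _)))
  refine ⟨?_, image_eq_zero_of_notMem_tsupport hn⟩
  by_contra h
  exact hn (tsupport_fderiv_subset ℝ (subset_tsupport _ h))

theorem integrable_mul_testFun {u : Space d → ℝ} (hu : LocallyIntegrable u) (φ : TestFun d) :
    Integrable fun x => u x * φ x := by
  have h := hu.integrable_smul_left_of_hasCompactSupport φ.continuous φ.hasCompactSupport
  refine h.congr (ae_of_all _ fun x => ?_)
  simp [mul_comm]

variable {b : Space d → Space d} {divb : Space d → ℝ} {Db : Space d → Space d →L[ℝ] Space d}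
  {u : Space d → ℝ}

theorem RegularField.integrable_mul_fderiv (hr : RegularField q b divb Db) (hu : MemLpLoc p u)
    (φ : TestFun d) : Integrable fun x => u x * fderiv ℝ φ x (b x) := by
  have h := LocallyIntegrable.integrable_clm_apply (hu.locallyIntegrable_smul hr.mem)
    (continuous_fderiv_testFun φ) (φ.hasCompactSupport.fderiv ℝ)
  simpa using h

theorem RegularField.integrable_mul_div (hr : RegularField q b divb Db) (hu : MemLpLoc p u)
    (φ : TestFun d) : Integrable fun x => u x * (divb x * φ x) := by
  have h := integrable_mul_testFun (hu.locallyIntegrable_smul hr.mem_div) φ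
  simpa [mul_assoc] using h

theorem RegularField.integrable_transport (hr : RegularField q b divb Db) (hu : MemLpLoc p u)
    (φ : TestFun d) : Integrable fun x => u x * (fderiv ℝ φ x (b x) + divb x * φ x) := by
  simp_rw [mul_add]
  exact (hr.integrable_mul_fderiv hu φ).add (hr.integrable_mul_div hu φ)

theorem RegularField.localMass_ne_top (hr : RegularField q b divb Db) (hu : MemLpLoc p u) (R : ℝ) :
    localMass R b divb u ≠ ⊤ :=
  ne_top_of_le_ne_top (ENNReal.mul_ne_top (hu.2 R) (ENNReal.add_ne_top.2 ⟨hr.mem.2 R,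
    hr.mem_div.2 R⟩)) (localMass_le hu.1 hr.mem.1 hr.mem_div.1 R)

end

section

variable {d : ℕ} {p q : ℝ≥0∞} [ENNReal.HolderConjugate p q] {T : ℝ}
  {b : ℝ → Space d → Space d} {divb : ℝ → Space d → ℝ} {Db : ℝ → Space d → Space d →L[ℝ] Space d}
  {f : ℝ → Space d → ℝ} {D F : ℝ → ℝ} {B : ℝ → Space d} {u₀ : Space d → ℝ}
  {u : ℝ → Space d → ℝ}

theorem RegularDrift.measurable_localMass (hr : RegularDrift T q b divb Db f D F)
    (hu : StronglyMeasurable (Function.uncurry u)) (R : ℝ) :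
    Measurable fun s => localMass R (b s) (divb s) (u s) := by
  have h : Measurable fun z : ℝ × Space d => ‖u z.1 z.2‖ₑ * (‖b z.1 z.2‖ₑ + ‖divb z.1 z.2‖ₑ) :=
    hu.enorm.mul (hr.meas.enorm.add hr.meas_div.enorm)
  exact h.lintegral_prod_right'

theorem RegularDrift.lintegral_localMass_ne_top (hr : RegularDrift T q b divb Db f D F)
    (hu : BoundedLpLoc T p u) (R : ℝ) :
    ∫⁻ s in Icc 0 T, localMass R (b s) (divb s) (u s) ≠ ⊤ := by
  obtain ⟨M, hM, hMu⟩ := hu.bound R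
  refine ne_top_of_le_ne_top (b := ∫⁻ s in Icc 0 T, M * driftNorm q b divb Db R s) ?_ ?_
  · rw [lintegral_const_mul _ (hr.measurable_driftNorm _)]
    exact ENNReal.mul_ne_top hM (hr.lintegral_ne_top _)
  · refine lintegral_mono_ae ?_
    filter_upwards [hr.regular, hu.memLpLoc, hMu] with s h1 h2 h3
    refine (localMass_le (p := p) (q := q) h2.1 h1.mem.1 h1.mem_div.1 R).trans ?_
    gcongr
    exact le_self_add

theorem RegularDrift.integrableOn_localMass (hr : RegularDrift T q b divb Db f D F)
    (hu : BoundedLpLoc T p u) (R : ℝ) :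
    IntegrableOn (fun s => (localMass R (b s) (divb s) (u s)).toReal) (Icc 0 T) :=
  integrable_toReal_of_lintegral_ne_top (hr.measurable_localMass hu.meas R).aemeasurable
    (hr.lintegral_localMass_ne_top hu R)

theorem stronglyMeasurable_transport_path (hr : RegularDrift T q b divb Db f D F)
    (hu : StronglyMeasurable (Function.uncurry u)) {β : ℝ → Space d} (hβ : Continuous β)
    (φ : TestFun d) :
    StronglyMeasurable fun s => transport (b s) (divb s) (u s) (translate φ (β s)) := by
  have h1 : StronglyMeasurable fun z : ℝ × Space d => fderiv ℝ φ (z.2 - β z.1) (b z.1 z.2) := by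
    have hc : Continuous fun z : ℝ × Space d => fderiv ℝ φ (z.2 - β z.1) :=
      (continuous_fderiv_testFun φ).comp (by fun_prop)
    exact (isBoundedBilinearMap_apply (𝕜 := ℝ) (E := Space d)
      (F := ℝ)).continuous.comp_stronglyMeasurable (hc.stronglyMeasurable.prodMk hr.meas)
  have h2 : StronglyMeasurable fun z : ℝ × Space d => φ (z.2 - β z.1) := by
    have hc : Continuous fun z : ℝ × Space d => φ (z.2 - β z.1) := φ.continuous.comp (by fun_prop)
    exact hc.stronglyMeasurable
  have h3 := (hu.mul (h1.add (hr.meas_div.mul h2))).integral_prod_right' (ν := volume)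
  simp only [transport, fderiv_translate, translate_apply]
  exact h3

theorem RegularDrift.integrableOn_transport (hr : RegularDrift T q b divb Db f D F)
    (hu : BoundedLpLoc T p u) {β : ℝ → Space d} (hβ : Continuous β) (φ : TestFun d) :
    IntegrableOn (fun s => transport (b s) (divb s) (u s) (translate φ (β s))) (Icc 0 T) := by
  obtain ⟨ρ, hρ0, hρ⟩ := exists_norm_le_path hβ T
  obtain ⟨C, R, hC, hR, h1, h2, h3⟩ := exists_testFun_bound φ
  refine Integrable.mono' ((hr.integrableOn_localMass hu (R + ρ)).const_mul C)
    (stronglyMeasurable_transport_path hr hu.meas hβ φ).aestronglyMeasurable ?_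
  filter_upwards [hr.regular, hu.memLpLoc, ae_restrict_mem measurableSet_Icc] with s g1 g2 g3
  refine abs_integral_pairing_le (fun x => ?_) (fun x => ?_) (fun x hx => ?_)
    (g1.localMass_ne_top g2 _)
  · rw [fderiv_translate]; exact h2 _
  · exact h1 _
  · rw [fderiv_translate, translate_apply]
    exact h3 _ (by linarith [norm_sub_norm_le x (β s), hρ s g3])

theorem tendsto_nat_mul_sin_div (s : ℝ) :
    Tendsto (fun k : ℕ => ((k : ℝ) + 1) * Real.sin (s / ((k : ℝ) + 1))) atTop (𝓝 s) := by
  have h := (Real.hasDerivAt_sin 0).hasFDerivAt.lim_real s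
  have h' := h.comp (tendsto_natCast_atTop_atTop.atTop_add (tendsto_const_nhds (x := (1 : ℝ))))
  simpa [Function.comp_def, div_eq_inv_mul] using h'

theorem abs_mul_sin_div_le (s : ℝ) {k : ℝ} (hk : 0 < k) : |k * Real.sin (s / k)| ≤ |s| := by
  rw [abs_mul, abs_of_pos hk]
  calc k * |Real.sin (s / k)| ≤ k * |s / k| :=
        mul_le_mul_of_nonneg_left Real.abs_sin_le_abs hk.le
    _ = |s| := by rw [abs_div, abs_of_pos hk]; field_simp

/-- The equation in moving coordinates, tested against an arbitrary test function. It follows from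
the renormalized equations for the bounded functions `k sin(s/k)`, which tend to the identity. -/
theorem RegularDrift.integral_mul_translate_eq (hp : p ≠ ⊤)
    (hr : RegularDrift T q b divb Db f D F)
    (hu : BoundedLpLoc T p u) (hB : Continuous B) (hu₀ : MemLpLoc p u₀)
    (hsf : ∀ᵐ s ∂(volume.restrict (Icc (0 : ℝ) T)), ShiftedEquation b divb B u₀ u s (u s))
    {t : ℝ} (ht : t ∈ Icc 0 T) {v : Space d → ℝ} (hv : MemLpLoc p v)
    (hvt : ShiftedEquation b divb B u₀ u t v) (φ : TestFun d) :
    ∫ x, v x * translate φ (B t) x = (∫ x, u₀ x * translate φ (B 0) x)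
      + ∫ s in (0 : ℝ)..t, transport (b s) (divb s) (u s) (translate φ (B s)) := by
  have hp1 : 1 ≤ p := ENNReal.HolderConjugate.one_le p q
  have hk0 : ∀ k : ℕ, (0 : ℝ) < (k : ℝ) + 1 := fun k => by positivity
  have key : ∀ k : ℕ, ∫ x, (((k : ℝ) + 1) * Real.sin (v x / ((k : ℝ) + 1))) * translate φ (B t) x
      = (∫ x, (((k : ℝ) + 1) * Real.sin (u₀ x / ((k : ℝ) + 1))) * translate φ (B 0) x)
        + ∫ s in (0 : ℝ)..t, transport (b s) (divb s)
          (fun x => ((k : ℝ) + 1) * Real.sin (u s x / ((k : ℝ) + 1))) (translate φ (B s)) := by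
    intro k
    have hd : ∀ s : ℝ, HasDerivAt (fun s : ℝ => Real.sin (s / ((k : ℝ) + 1)))
        (Real.cos (s / ((k : ℝ) + 1)) * (1 / ((k : ℝ) + 1))) s := fun s =>
      ((hasDerivAt_id s).div_const _).sin
    have h := (hr.renormalized hp hu hB hu₀ hsf ht hv hvt
      (j := fun s => Real.sin (s / ((k : ℝ) + 1)))
      (Real.contDiff_sin.comp (contDiff_id.div_const _)) (fun s => Real.abs_sin_le_one _) (L := 1)
      (fun s => by
        rw [(hd s).deriv, abs_mul, abs_of_pos (one_div_pos.2 (hk0 k))]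
        refine mul_le_one₀ (Real.abs_cos_le_one _) (one_div_pos.2 (hk0 k)).le ?_
        rw [div_le_one (hk0 k)]
        linarith [k.cast_nonneg (α := ℝ)]) φ).2
    have h' := congrArg (fun z => ((k : ℝ) + 1) * z) h
    simp only [mul_add, ← integral_const_mul, ← intervalIntegral.integral_const_mul] at h'
    simp only [transport, mul_assoc]
    simpa only [mul_add] using h'
  have hconv : ∀ {w : Space d → ℝ}, MemLpLoc p w → ∀ ψ : TestFun d,
      Tendsto (fun k : ℕ => ∫ x, (((k : ℝ) + 1) * Real.sin (w x / ((k : ℝ) + 1))) * ψ x) atTop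
        (𝓝 (∫ x, w x * ψ x)) := by
    intro w hw ψ
    have hi := integrable_mul_testFun (hw.locallyIntegrable hp1) ψ
    refine tendsto_integral_of_dominated_convergence (fun x => ‖w x * ψ x‖)
      (fun k => ?_) hi.norm (fun k => ae_of_all _ fun x => ?_) (ae_of_all _ fun x => ?_)
    · have hc : Continuous fun s : ℝ => ((k : ℝ) + 1) * Real.sin (s / ((k : ℝ) + 1)) := by fun_prop
      exact ((hc.comp_stronglyMeasurable hw.1).mul
        ψ.continuous.stronglyMeasurable).aestronglyMeasurable
    · rw [norm_mul, norm_mul (w x)]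
      exact mul_le_mul_of_nonneg_right (abs_mul_sin_div_le _ (hk0 k)) (norm_nonneg _)
    · exact (tendsto_nat_mul_sin_div _).mul_const _
  have hIoc : Ioc (0 : ℝ) t ⊆ Icc 0 T := Ioc_subset_Icc_self.trans (Icc_subset_Icc le_rfl ht.2)
  obtain ⟨ρ, hρ0, hρ⟩ := exists_norm_le_path hB T
  obtain ⟨C, R, hC, hR, h1, h2, h3⟩ := exists_testFun_bound φ
  refine tendsto_nhds_unique (hconv hv _) (Tendsto.congr (fun k => (key k).symm) ?_)
  refine (hconv hu₀ _).add ?_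
  simp_rw [intervalIntegral.integral_of_le ht.1]
  refine tendsto_integral_of_dominated_convergence
    (fun s => C * (localMass (R + ρ) (b s) (divb s) (u s)).toReal) (fun k => ?_)
    (IntegrableOn.mono_set ((hr.integrableOn_localMass hu (R + ρ)).const_mul C) hIoc)
    (fun k => ?_) ?_
  · have hc : Continuous fun s : ℝ => ((k : ℝ) + 1) * Real.sin (s / ((k : ℝ) + 1)) := by fun_prop
    exact (stronglyMeasurable_transport_path hr
      (u := fun s x => ((k : ℝ) + 1) * Real.sin (u s x / ((k : ℝ) + 1)))
      (hc.comp_stronglyMeasurable hu.meas) hB φ).aestronglyMeasurable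
  · filter_upwards [ae_restrict_of_ae_restrict_of_subset hIoc hr.regular,
      ae_restrict_of_ae_restrict_of_subset hIoc hu.memLpLoc, ae_restrict_mem measurableSet_Ioc]
      with s g1 g2 g3
    have hle : localMass (R + ρ) (b s) (divb s)
        (fun x => ((k : ℝ) + 1) * Real.sin (u s x / ((k : ℝ) + 1)))
        ≤ localMass (R + ρ) (b s) (divb s) (u s) := by
      refine lintegral_mono fun x => ?_
      gcongr
      rw [enorm_le_iff_norm_le]
      exact abs_mul_sin_div_le _ (hk0 k)
    have hfin := g1.localMass_ne_top g2 (R + ρ)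
    refine (abs_integral_pairing_le (C := C) (R := R + ρ) (fun x => ?_) (fun x => ?_)
      (fun x hx => ?_) (ne_top_of_le_ne_top hfin hle)).trans
      (mul_le_mul_of_nonneg_left (ENNReal.toReal_mono hfin hle) hC)
    · rw [fderiv_translate]; exact h2 _
    · exact h1 _
    · rw [fderiv_translate, translate_apply]
      exact h3 _ (by linarith [norm_sub_norm_le x (B s), hρ s (hIoc g3)])
  · filter_upwards [ae_restrict_of_ae_restrict_of_subset hIoc hr.regular,
      ae_restrict_of_ae_restrict_of_subset hIoc hu.memLpLoc] with s g1 g2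
    have hi := g1.integrable_transport g2 (translate φ (B s))
    refine tendsto_integral_of_dominated_convergence (fun x => ‖u s x *
      (fderiv ℝ (translate φ (B s)) x (b s x) + divb s x * translate φ (B s) x)‖)
      (fun k => ?_) hi.norm (fun k => ae_of_all _ fun x => ?_) (ae_of_all _ fun x => ?_)
    · have hc : Continuous fun s : ℝ => ((k : ℝ) + 1) * Real.sin (s / ((k : ℝ) + 1)) := by fun_prop
      exact (hc.comp_stronglyMeasurable g2.1).aestronglyMeasurable.mul
        (g1.weakDiv.integrable_transport _).aestronglyMeasurable
    · rw [norm_mul, norm_mul (u s x)]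
      exact mul_le_mul_of_nonneg_right (abs_mul_sin_div_le _ (hk0 k)) (norm_nonneg _)
    · exact (tendsto_nat_mul_sin_div _).mul_const _

end

/-! ### From moving coordinates to Stieltjes integrals -/

section

variable {d : ℕ}

theorem lineDeriv_testFun_apply (φ : TestFun d) (v x : Space d) :
    (∂_{v} φ) x = fderiv ℝ φ x v := by
  rw [TestFunction.lineDerivOp_eq_lineDerivCLM (𝕜 := ℝ), TestFunction.lineDerivCLM_apply (𝕜 := ℝ)]
  simp [(differentiable_testFun φ x).lineDeriv_eq_fderiv]

theorem translate_translate (φ : TestFun d) (a c : Space d) :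
    translate (translate φ a) c = translate φ (a + c) := by
  ext x
  simp only [translate_apply]
  congr 1
  abel

theorem translate_zero (φ : TestFun d) : translate φ 0 = φ := by
  ext x
  simp

theorem lineDeriv_translate (φ : TestFun d) (v a : Space d) :
    ∂_{v} (translate φ a) = translate (∂_{v} φ) a := by
  ext x
  rw [translate_apply, lineDeriv_testFun_apply, lineDeriv_testFun_apply, fderiv_translate]

theorem clm_apply_eq_sum (A : Space d →L[ℝ] ℝ) (v : Space d) :
    A v = ∑ i, A (EuclideanSpace.single i (1 : ℝ)) * v i := by
  have e : v = ∑ i, v i • EuclideanSpace.single i (1 : ℝ) := by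
    ext j
    simp [Finset.sum_apply, Pi.single_apply]
  conv_lhs => rw [e]
  simp [mul_comm]

/-- First and second order estimates for the translates of a test function. -/
theorem exists_taylor_bound (φ : TestFun d) : ∃ C : ℝ, 0 ≤ C ∧
    (∀ x y, ‖φ x - φ y‖ ≤ C * ‖x - y‖) ∧
    (∀ x y, ‖fderiv ℝ φ x - fderiv ℝ φ y‖ ≤ C * ‖x - y‖) ∧
    ∀ x y, ‖φ y - φ x - fderiv ℝ φ x (y - x)‖ ≤ C * ‖y - x‖ ^ 2 := by
  obtain ⟨C₁, R, hC₁, -, -, h1, -⟩ := exists_testFun_bound φ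
  have hD : ContDiff ℝ ∞ (fderiv ℝ φ) := φ.contDiff.fderiv_right (by simp)
  obtain ⟨C₂, hC₂⟩ := (hD.continuous_fderiv (by simp)).bounded_above_of_compact_support
    ((φ.hasCompactSupport.fderiv ℝ).fderiv ℝ)
  have l1 : ∀ x y, ‖φ x - φ y‖ ≤ C₁ * ‖x - y‖ := fun x y =>
    convex_univ.norm_image_sub_le_of_norm_fderiv_le (𝕜 := ℝ)
      (fun z _ => differentiable_testFun φ z) (fun z _ => h1 z) (mem_univ _) (mem_univ _)
  have l2 : ∀ x y, ‖fderiv ℝ φ x - fderiv ℝ φ y‖ ≤ C₂ * ‖x - y‖ := fun x y =>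
    convex_univ.norm_image_sub_le_of_norm_fderiv_le (𝕜 := ℝ)
      (fun z _ => hD.differentiable (by simp) z) (fun z _ => hC₂ z) (mem_univ _) (mem_univ _)
  have hC₂0 : 0 ≤ C₂ := (norm_nonneg _).trans (hC₂ 0)
  refine ⟨max C₁ C₂, hC₁.trans (le_max_left _ _), fun x y => (l1 x y).trans ?_,
    fun x y => (l2 x y).trans ?_, fun x y => ?_⟩
  · exact mul_le_mul_of_nonneg_right (le_max_left _ _) (norm_nonneg _)
  · exact mul_le_mul_of_nonneg_right (le_max_right _ _) (norm_nonneg _)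
  · have h := (convex_segment x y).norm_image_sub_le_of_norm_hasFDerivWithin_le' (𝕜 := ℝ) (f := φ)
      (f' := fderiv ℝ φ) (φ := fderiv ℝ φ x) (C := C₂ * ‖y - x‖)
      (fun z _ => (differentiable_testFun φ z).hasFDerivAt.hasFDerivWithinAt)
      (fun z hz => (l2 z x).trans (mul_le_mul_of_nonneg_left
        (by simpa using norm_sub_le_of_mem_segment hz) hC₂0))
      (left_mem_segment ℝ x y) (right_mem_segment ℝ x y)
    refine h.trans ?_
    rw [mul_assoc, ← sq]
    exact mul_le_mul_of_nonneg_right (le_max_right _ _) (by positivity)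

theorem abs_integral_mul_le {u a : Space d → ℝ} {C R : ℝ} (ha : ∀ x, ‖a x‖ ≤ C)
    (h0 : ∀ x, R < ‖x‖ → a x = 0)
    (hfin : ∫⁻ x in Metric.closedBall 0 R, ‖u x‖ₑ ≠ ⊤) :
    |∫ x, u x * a x| ≤ C * (∫⁻ x in Metric.closedBall 0 R, ‖u x‖ₑ).toReal := by
  have e : localMass R (fun _ => 0) (fun _ => 1) u = ∫⁻ x in Metric.closedBall 0 R, ‖u x‖ₑ := by
    simp [localMass]
  have h := abs_integral_pairing_le (b := fun _ => 0) (divb := fun _ => 1) (u := u)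
    (A := fun _ => 0) (a := a) (C := C) (R := R)
    (fun x => by simpa using (norm_nonneg _).trans (ha 0)) ha (fun x hx => ⟨rfl, h0 x hx⟩)
    (by rwa [e])
  rw [e] at h
  simpa using h

theorem lintegral_closedBall_le {p q : ℝ≥0∞} [ENNReal.HolderConjugate p q] {u : Space d → ℝ}
    (hu : StronglyMeasurable u) (R : ℝ) : ∫⁻ x in Metric.closedBall 0 R, ‖u x‖ₑ
      ≤ eLpNorm u p volume
        * eLpNorm (fun _ : Space d => (1 : ℝ)) q (volume.restrict (Metric.closedBall 0 R)) := by
  have h := lintegral_enorm_mul_le (p := p) (q := q) (f := u)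
    (μ := volume.restrict (Metric.closedBall (0 : Space d) R)) (g := fun _ => (1 : ℝ))
    hu.aestronglyMeasurable aestronglyMeasurable_const
  simp only [enorm_one, mul_one] at h
  refine h.trans ?_
  gcongr
  exact Measure.restrict_le_self

theorem integral_mul_sub {u : Space d → ℝ} (hu : LocallyIntegrable u) (φ ψ : TestFun d) :
    (∫ x, u x * φ x) - ∫ x, u x * ψ x = ∫ x, u x * (φ x - ψ x) := by
  rw [← integral_sub (integrable_mul_testFun hu φ) (integrable_mul_testFun hu ψ)]
  simp_rw [mul_sub]

/-- The pairings of a function bounded in `Lᵖ` with the translates of a test function are a function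
with uniformly Lipschitz derivatives. -/
theorem exists_pairing_taylor_bound {p q : ℝ≥0∞} [ENNReal.HolderConjugate p q] (φ : TestFun d)
    (r : ℝ) {M : ℝ≥0∞} (hM : M ≠ ⊤) : ∃ C : ℝ, 0 ≤ C ∧
    ∀ {w : Space d → ℝ}, StronglyMeasurable w → eLpNorm w p volume ≤ M →
      ∀ a ∈ Metric.closedBall (0 : Space d) r, ∀ c ∈ Metric.closedBall (0 : Space d) r,
        |(∫ x, w x * translate φ a x) - ∫ x, w x * translate φ c x| ≤ C * ‖a - c‖ ∧
        |(∫ x, w x * translate φ c x) - (∫ x, w x * translate φ a x)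
          - ∑ i, (- ∫ x, w x * translate (∂_{EuclideanSpace.single i (1 : ℝ)} φ) a x)
            * (c i - a i)| ≤ C * ‖c - a‖ ^ 2 := by
  obtain ⟨C, hC, h1, h2, h3⟩ := exists_taylor_bound φ
  obtain ⟨-, R, -, hR, -, -, h0⟩ := exists_testFun_bound φ
  set N : ℝ≥0∞ := M * eLpNorm (fun _ : Space d => (1 : ℝ)) q
    (volume.restrict (Metric.closedBall 0 (R + r))) with hN
  have hNt : N ≠ ⊤ := ENNReal.mul_ne_top hM (memLp_const _).2.ne
  refine ⟨C * N.toReal, by positivity, fun {w} hw hwM a ha c hc => ?_⟩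
  have hp1 : 1 ≤ p := ENNReal.HolderConjugate.one_le p q
  have hle : ∫⁻ x in Metric.closedBall 0 (R + r), ‖w x‖ₑ ≤ N :=
    (lintegral_closedBall_le (p := p) (q := q) hw _).trans (by rw [hN]; gcongr)
  have hfin := ne_top_of_le_ne_top hNt hle
  have hto := ENNReal.toReal_mono hNt hle
  have hwl : LocallyIntegrable w :=
    MemLp.locallyIntegrable (p := p) ⟨hw.aestronglyMeasurable, hwM.trans_lt hM.lt_top⟩ hp1
  have hv : ∀ y ∈ Metric.closedBall (0 : Space d) r, ∀ x, R + r < ‖x‖ →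
      fderiv ℝ φ (x - y) = 0 ∧ φ (x - y) = 0 := fun y hy x hx => h0 _ (by
    rw [Metric.mem_closedBall, dist_zero_right] at hy
    linarith [norm_sub_norm_le x y])
  constructor
  · rw [integral_mul_sub hwl]
    refine (abs_integral_mul_le (C := C * ‖a - c‖) (R := R + r) (fun x => ?_) (fun x hx => ?_)
      hfin).trans ?_
    · refine (h1 _ _).trans_eq ?_
      rw [sub_sub_sub_cancel_left, norm_sub_rev]
    · rw [translate_apply, translate_apply, (hv a ha x hx).2, (hv c hc x hx).2, sub_zero]
    · calc _ ≤ C * ‖a - c‖ * N.toReal := by gcongr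
        _ = _ := by ring
  · have e : (∑ i, (- ∫ x, w x * translate (∂_{EuclideanSpace.single i (1 : ℝ)} φ) a x)
        * (c i - a i)) = - ∫ x, w x * fderiv ℝ φ (x - a) (c - a) := by
      have hi : ∀ i ∈ (Finset.univ : Finset (Fin d)), Integrable fun x =>
          (w x * translate (∂_{EuclideanSpace.single i (1 : ℝ)} φ) a x) * (c i - a i) :=
        fun i _ => (integrable_mul_testFun hwl _).mul_const _
      simp_rw [neg_mul, Finset.sum_neg_distrib, ← integral_mul_const]
      rw [← integral_finsetSum _ hi]
      congr 1
      refine integral_congr_ae (ae_of_all _ fun x => ?_)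
      simp only [translate_apply, lineDeriv_testFun_apply]
      rw [clm_apply_eq_sum (fderiv ℝ φ (x - a)), Finset.mul_sum]
      simp [mul_assoc]
    have hi2 : Integrable fun x => w x * fderiv ℝ φ (x - a) (c - a) := by
      have := integrable_mul_testFun hwl (∂_{c - a} (translate φ a))
      simpa only [lineDeriv_testFun_apply, fderiv_translate] using this
    have hi1 : Integrable fun x => w x * (translate φ c x - translate φ a x) := by
      simp_rw [mul_sub]
      exact (integrable_mul_testFun hwl (translate φ c)).sub
        (integrable_mul_testFun hwl (translate φ a))
    rw [e, integral_mul_sub hwl, sub_neg_eq_add, ← integral_add hi1 hi2]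
    simp_rw [← mul_add]
    refine (abs_integral_mul_le (C := C * ‖c - a‖ ^ 2) (R := R + r) (fun x => ?_) (fun x hx => ?_)
      hfin).trans ?_
    · have h := h3 (x - a) (x - c)
      rw [sub_sub_sub_cancel_left, ← neg_sub c a, map_neg, norm_neg, sub_neg_eq_add] at h
      exact h
    · rw [translate_apply, translate_apply, (hv a ha x hx).2, (hv a ha x hx).1, (hv c hc x hx).2]
      simp
    · calc _ ≤ C * ‖c - a‖ ^ 2 * N.toReal := by gcongr
        _ = _ := by ring

/-- The transport term is Lipschitz in the translation of the test function, with a constant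
given by the local mass. -/
theorem exists_transport_lipschitz (φ : TestFun d) (r : ℝ) : ∃ C R : ℝ, 0 ≤ C ∧
    ∀ {p q : ℝ≥0∞} [ENNReal.HolderConjugate p q] {b : Space d → Space d} {divb : Space d → ℝ}
      {Db : Space d → Space d →L[ℝ] Space d} {u : Space d → ℝ} (_ : RegularField q b divb Db)
      (_ : MemLpLoc p u),
      ∀ a ∈ Metric.closedBall (0 : Space d) r, ∀ c ∈ Metric.closedBall (0 : Space d) r,
        |transport b divb u (translate φ a) - transport b divb u (translate φ c)|
          ≤ C * (localMass R b divb u).toReal * ‖a - c‖ := by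
  obtain ⟨C, hC, h1, h2, h3⟩ := exists_taylor_bound φ
  obtain ⟨-, R, -, hR, -, -, h0⟩ := exists_testFun_bound φ
  refine ⟨C, R + r, hC, ?_⟩
  intro p q _ b divb Db u hr hu a ha c hc
  have hv : ∀ y ∈ Metric.closedBall (0 : Space d) r, ∀ x, R + r < ‖x‖ →
      fderiv ℝ φ (x - y) = 0 ∧ φ (x - y) = 0 := fun y hy x hx => h0 _ (by
    rw [Metric.mem_closedBall, dist_zero_right] at hy
    linarith [norm_sub_norm_le x y])
  rw [transport, transport, ← integral_sub (hr.integrable_transport hu _)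
    (hr.integrable_transport hu _)]
  have e : ∀ x, u x * (fderiv ℝ (translate φ a) x (b x) + divb x * translate φ a x)
      - u x * (fderiv ℝ (translate φ c) x (b x) + divb x * translate φ c x)
      = u x * ((fderiv ℝ φ (x - a) - fderiv ℝ φ (x - c)) (b x)
        + divb x * (φ (x - a) - φ (x - c))) := by
    intro x
    simp only [fderiv_translate, translate_apply, sub_apply]
    ring
  simp_rw [e]
  refine (abs_integral_pairing_le (C := C * ‖a - c‖) (R := R + r) (fun x => ?_) (fun x => ?_)
    (fun x hx => ?_) (hr.localMass_ne_top hu _)).trans_eq (by ring)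
  · refine (h2 _ _).trans_eq ?_
    rw [sub_sub_sub_cancel_left, norm_sub_rev]
  · refine (h1 _ _).trans_eq ?_
    rw [sub_sub_sub_cancel_left, norm_sub_rev]
  · rw [(hv a ha x hx).1, (hv c hc x hx).1, (hv a ha x hx).2, (hv c hc x hx).2]
    simp

theorem IsIntegrator.neg {T : ℝ} {g : ℝ → ℝ} {I : (ℝ → ℝ) → ℝ → ℝ} {V : ℝ → ℝ}
    (h : IsIntegrator T g I V) : IsIntegrator T (fun s => - g s) (fun f t => - I f t) V where
  sub f₁ f₂ h₁ h₂ t ht := by rw [h.sub f₁ f₂ h₁ h₂ t ht]; ring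
  const c t ht := by rw [h.const c t ht]; ring
  zero f := by rw [h.zero, neg_zero]
  bound f C s t hf hs hst ht hC := by
    have := h.bound f C s t hf hs hst ht hC
    rwa [neg_sub_neg, abs_sub_comm]
  mono := h.mono

theorem IsIntegrator.apply_neg {T : ℝ} {g : ℝ → ℝ} {I : (ℝ → ℝ) → ℝ → ℝ} {V : ℝ → ℝ}
    (h : IsIntegrator T g I V) {f : ℝ → ℝ} (hf : ContinuousOn f (Icc 0 T)) {t : ℝ}
    (ht : t ∈ Icc 0 T) : I (fun s => - f s) t = - I f t := by
  have h1 := h.sub (fun _ => 0) f continuousOn_const hf t ht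
  rw [h.const 0 t ht] at h1
  simpa using h1

theorem boundedVariationOn_coord {s : Set ℝ} {β : ℝ → Space d} (h : BoundedVariationOn β s)
    (i : Fin d) : BoundedVariationOn (fun t => β t i) s :=
  (EuclideanSpace.proj i : Space d →L[ℝ] ℝ).lipschitz.comp_boundedVariationOn h

end

section

variable {d : ℕ} {p q : ℝ≥0∞} [ENNReal.HolderConjugate p q] {T : ℝ}
  {b : ℝ → Space d → Space d} {divb : ℝ → Space d → ℝ} {Db : ℝ → Space d → Space d →L[ℝ] Space d}
  {f : ℝ → Space d → ℝ} {D F : ℝ → ℝ} {B : ℝ → Space d} {u₀ : Space d → ℝ}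
  {u : ℝ → Space d → ℝ}

theorem RegularDrift.integrableOn_div (hr : RegularDrift T q b divb Db f D F)
    (hu : BoundedLpLoc T p u) (φ : TestFun d) :
    IntegrableOn (fun s => ∫ x, divb s x * φ x * u s x) (Icc 0 T) := by
  obtain ⟨C, R, hC, hR, h1, h2, h3⟩ := exists_testFun_bound φ
  refine Integrable.mono' ((hr.integrableOn_localMass hu R).const_mul C) ?_ ?_
  · have : StronglyMeasurable fun z : ℝ × Space d => divb z.1 z.2 * φ z.2 * u z.1 z.2 :=
      (hr.meas_div.mul (φ.continuous.comp continuous_snd).stronglyMeasurable).mul hu.meas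
    exact this.integral_prod_right'.aestronglyMeasurable
  · filter_upwards [hr.regular, hu.memLpLoc] with s g1 g2
    have h := abs_integral_pairing_le (A := fun _ => 0) (fun x => by simpa using hC) h1
      (fun x hx => ⟨rfl, (h3 x hx).2⟩) (g1.localMass_ne_top g2 R)
    refine le_trans (le_of_eq ?_) h
    rw [Real.norm_eq_abs]
    congr 2
    funext x
    simp only [zero_apply]
    ring

/-- The drift term of the weak formulation, split into its two parts. -/
theorem RegularDrift.integral_transport (hr : RegularDrift T q b divb Db f D F)
    (hu : BoundedLpLoc T p u) (φ : TestFun d) {t : ℝ} (ht : t ∈ Icc 0 T) :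
    IntegrableOn (fun s => ∫ x, fderiv ℝ φ x (b s x) * u s x) (Icc 0 T) ∧
    ∫ s in (0 : ℝ)..t, transport (b s) (divb s) (u s) φ
      = (∫ s in (0 : ℝ)..t, ∫ x, fderiv ℝ φ x (b s x) * u s x)
        + ∫ s in (0 : ℝ)..t, ∫ x, divb s x * φ x * u s x := by
  have h0 : (0 : ℝ) ∈ Icc 0 T := ⟨le_rfl, ht.1.trans ht.2⟩
  have hi := hr.integrableOn_transport hu (β := fun _ => 0) continuous_const φ
  simp only [translate_zero] at hi
  have hd := hr.integrableOn_div hu φ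
  have e : ∀ᵐ s ∂(volume.restrict (Icc (0 : ℝ) T)), transport (b s) (divb s) (u s) φ
      = (∫ x, fderiv ℝ φ x (b s x) * u s x) + ∫ x, divb s x * φ x * u s x := by
    filter_upwards [hr.regular, hu.memLpLoc] with s g1 g2
    have i1 := g1.integrable_mul_fderiv g2 φ
    have i2 := g1.integrable_mul_div g2 φ
    simp_rw [transport, mul_add]
    rw [integral_add i1 i2]
    congr 1 <;> exact integral_congr_ae (ae_of_all _ fun x => by ring)
  have hf : IntegrableOn (fun s => ∫ x, fderiv ℝ φ x (b s x) * u s x) (Icc 0 T) := by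
    refine (hi.sub hd).congr ?_
    filter_upwards [e] with s hs
    rw [Pi.sub_apply, hs]; ring
  refine ⟨hf, ?_⟩
  rw [← intervalIntegral.integral_add (intervalIntegrable_of_mem hf h0 ht)
    (intervalIntegrable_of_mem hd h0 ht), intervalIntegral.integral_of_le ht.1,
    intervalIntegral.integral_of_le ht.1]
  exact integral_congr_ae (ae_restrict_of_ae_restrict_of_subset
    (Ioc_subset_Icc_self.trans (Icc_subset_Icc le_rfl ht.2)) e)

/-- A solution in moving coordinates is a weak solution, with the noise as a Stieltjes integral. -/
theorem RegularDrift.stieltjes_equation (hp : p ≠ ⊤) (hr : RegularDrift T q b divb Db f D F)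
    (hu : BoundedLpLoc T p u) (hB : Continuous B) (hBV : BoundedVariationOn B (Icc 0 T))
    (hu₀ : MemLpLoc p u₀) (hu₀n : eLpNorm u₀ p volume ≠ ⊤)
    (hsf : ∀ t ∈ Icc 0 T, MemLpLoc p (u t) ∧ ShiftedEquation b divb B u₀ u t (u t))
    (φ : TestFun d) :
    ContinuousOn (fun t => ∫ x, u t x * φ x) (Icc 0 T) ∧
    ∀ t ∈ Icc 0 T, ∫ x, u t x * φ x = (∫ x, u₀ x * φ x)
      + (∫ s in (0 : ℝ)..t, ∫ x, fderiv ℝ φ x (b s x) * u s x)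
      + (∫ s in (0 : ℝ)..t, ∫ x, divb s x * φ x * u s x)
      + ∑ i : Fin d, stieltjesIntegral T
          (fun s => ∫ x, u s x * (∂_{EuclideanSpace.single i (1 : ℝ)} φ) x) (fun s => B s i) t := by
  have hae : ∀ᵐ s ∂(volume.restrict (Icc (0 : ℝ) T)), ShiftedEquation b divb B u₀ u s (u s) :=
    (ae_restrict_mem measurableSet_Icc).mono fun s hs => (hsf s hs).2
  set M : ℝ≥0∞ := stabilityConst d T D F p * eLpNorm u₀ p volume with hM
  have hMt : M ≠ ⊤ := ENNReal.mul_ne_top (stabilityConst_ne_top T D F p) hu₀n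
  have hnorm : ∀ t ∈ Icc 0 T, eLpNorm (u t) p volume ≤ M := fun t ht =>
    hr.eLpNorm_le hp hu hB hu₀ hae ht (hsf t ht).1 (hsf t ht).2
  obtain ⟨ρ, hρ0, hρ⟩ := exists_norm_le_path hB T
  set K : Set (Space d) := Metric.closedBall 0 ρ with hK
  have hyB : ∀ y ∈ K, ∀ s ∈ Icc 0 T, y + B s ∈ Metric.closedBall (0 : Space d) (2 * ρ) := by
    intro y hy s hs
    rw [hK, Metric.mem_closedBall, dist_zero_right] at hy
    rw [Metric.mem_closedBall, dist_zero_right]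
    linarith [norm_add_le y (B s), hρ s hs]
  have hnB : ∀ s ∈ Icc 0 T, - B s ∈ K := fun s hs => by simpa [hK] using hρ s hs
  -- the equation for the translates of an arbitrary test function
  have heq : ∀ (ψ : TestFun d) (y : Space d), ∀ t ∈ Icc 0 T,
      ∫ x, u t x * translate ψ (y + B t) x = (∫ x, u₀ x * translate ψ (y + B 0) x)
        + ∫ s in (0 : ℝ)..t, transport (b s) (divb s) (u s) (translate ψ (y + B s)) := by
    intro ψ y t ht
    have h := hr.integral_mul_translate_eq hp hu hB hu₀ hae ht (hsf t ht).1 (hsf t ht).2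
      (translate ψ y)
    simpa only [translate_translate] using h
  have hint : ∀ (ψ : TestFun d) (y : Space d), IntegrableOn (fun s =>
      transport (b s) (divb s) (u s) (translate ψ (y + B s))) (Icc 0 T) := fun ψ y =>
    hr.integrableOn_transport hu (continuous_const.add hB) ψ
  have hcont : ∀ (ψ : TestFun d) (y : Space d),
      ContinuousOn (fun t => ∫ x, u t x * translate ψ (y + B t) x) (Icc 0 T) := by
    intro ψ y
    refine continuousOn_of_eq_primitive (hint ψ y) fun t ht => ?_
    rw [heq ψ y t ht, heq ψ y 0 ⟨le_rfl, ht.1.trans ht.2⟩, intervalIntegral.integral_same, add_zero]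
  -- estimates which are uniform in time
  have hlip : ∀ ψ : TestFun d, ∃ C : ℝ, 0 ≤ C ∧ ∀ s ∈ Icc 0 T, ∀ y ∈ K, ∀ z ∈ K,
      |(∫ x, u s x * translate ψ (y + B s) x) - ∫ x, u s x * translate ψ (z + B s) x|
        ≤ C * ‖y - z‖ ∧
      |(∫ x, u s x * translate ψ (z + B s) x) - (∫ x, u s x * translate ψ (y + B s) x)
        - ∑ i, (- ∫ x, u s x * translate (∂_{EuclideanSpace.single i (1 : ℝ)} ψ) (y + B s) x)
          * (z i - y i)| ≤ C * ‖z - y‖ ^ 2 := by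
    intro ψ
    obtain ⟨C, hC, h⟩ := exists_pairing_taylor_bound (p := p) (q := q) ψ (2 * ρ) hMt
    refine ⟨C, hC, fun s hs y hy z hz => ?_⟩
    have := h (hsf s hs).1.1 (hnorm s hs) _ (hyB y hy s hs) _ (hyB z hz s hs)
    simpa only [add_sub_add_right_eq_sub, PiLp.add_apply] using this
  obtain ⟨C₀, hC₀, hL₀⟩ := hlip φ
  choose C₁ hC₁ hL₁ using fun i : Fin d => hlip (∂_{EuclideanSpace.single i (1 : ℝ)} φ)
  obtain ⟨C, hC, hCi⟩ : ∃ C : ℝ, C₀ ≤ C ∧ ∀ i, C₁ i ≤ C :=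
    ⟨C₀ + ∑ i, C₁ i, le_add_of_nonneg_right (Finset.sum_nonneg fun i _ => hC₁ i), fun i =>
      (Finset.single_le_sum (f := C₁) (fun i _ => hC₁ i) (Finset.mem_univ i)).trans
        (le_add_of_nonneg_left hC₀)⟩
  have hpath : ∀ ψ : TestFun d, ContinuousOn (fun t => ∫ x, u t x * ψ x) (Icc 0 T) := by
    intro ψ
    obtain ⟨C', -, hL'⟩ := hlip ψ
    have h := continuousOn_comp_path (β := fun s => - B s) hB.neg.continuousOn hnB
      (f := fun s y => ∫ x, u s x * translate ψ (y + B s) x) (fun y _ => hcont ψ y)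
      (fun s hs y hy z hz => (hL' s hs y hy z hz).1)
    simpa only [neg_add_cancel, translate_zero] using h
  refine ⟨hpath φ, fun t ht => ?_⟩
  have hT : 0 ≤ T := ht.1.trans ht.2
  choose V hV using fun i : Fin d => exists_isIntegrator_stieltjesIntegral hT
    (boundedVariationOn_coord hBV i) (g := fun s => B s i)
    (Continuous.continuousOn (by fun_prop))
  obtain ⟨Cg, Rg, hCg, hLg⟩ := exists_transport_lipschitz φ (2 * ρ)
  have h := ito_wentzell (T := T) (β := fun s => - B s) hB.neg.continuousOn hnB
    (I := fun i f t => - stieltjesIntegral T f (fun s => B s i) t) (V := V)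
    (fun i => by simpa only [PiLp.neg_apply] using (hV i).neg)
    (H := fun s y => ∫ x, u s x * translate φ (y + B s) x)
    (g := fun s y => transport (b s) (divb s) (u s) (translate φ (y + B s)))
    (h := fun _ _ _ => 0)
    (k := fun i s y => - ∫ x, u s x *
      translate (∂_{EuclideanSpace.single i (1 : ℝ)} φ) (y + B s) x)
    (m := fun s => Cg * (localMass Rg (b s) (divb s) (u s)).toReal) (C := C)
    (fun y hy t ht => by
      rw [heq φ y t ht, heq φ y 0 ⟨le_rfl, hT⟩, intervalIntegral.integral_same, add_zero]
      have : ∀ i, stieltjesIntegral T (fun _ => 0) (fun s => B s i) t = 0 := fun i => by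
        have := (hV i).const 0 t ht
        simpa using this
      simp [this])
    ((hr.integrableOn_localMass hu Rg).const_mul Cg)
    (fun s => mul_nonneg hCg ENNReal.toReal_nonneg) (hC₀.trans hC)
    (fun y _ => hint φ y)
    (by
      have := hr.integrableOn_transport hu (β := fun _ => 0) continuous_const φ
      simpa only [neg_add_cancel] using this)
    (by
      filter_upwards [hr.regular, hu.memLpLoc, ae_restrict_mem measurableSet_Icc]
        with s g1 g2 g3 y hy z hz
      have := hLg g1 g2 _ (hyB y hy s g3) _ (hyB z hz s g3)
      rwa [add_sub_add_right_eq_sub] at this)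
    (fun _ _ _ => continuousOn_const)
    (fun _ _ _ y _ z _ => by simpa using mul_nonneg (hC₀.trans hC) (norm_nonneg (y - z)))
    (fun i y _ => (hcont _ y).neg)
    (fun i s hs y hy z hz => by
      have := (hL₁ i s hs z hz y hy).1
      rw [neg_sub_neg]
      refine this.trans ?_
      rw [norm_sub_rev]
      exact mul_le_mul_of_nonneg_right (hCi i) (norm_nonneg _))
    (fun s hs y hy z hz => (hL₀ s hs y hy z hz).2.trans
      (mul_le_mul_of_nonneg_right hC (by positivity))) ht
  simp only [neg_add_cancel, translate_zero, zero_add] at h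
  rw [h, (hr.integral_transport hu φ ht).2]
  have e0 : ∫ x, u 0 x * φ x = ∫ x, u₀ x * φ x := by
    have := heq φ (- B 0) 0 ⟨le_rfl, hT⟩
    simpa only [neg_add_cancel, translate_zero, intervalIntegral.integral_same, add_zero] using this
  rw [e0, ← add_assoc]
  congr 1
  refine Finset.sum_congr rfl fun i _ => ?_
  rw [(hV i).apply_neg (hpath _) ht, neg_neg]

end

/-! ### From Stieltjes integrals to moving coordinates -/

section

variable {d : ℕ}

theorem le_of_ae_le_of_continuousOn {T : ℝ} (hT : 0 < T) {g : ℝ → ℝ} {c : ℝ}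
    (hg : ContinuousOn g (Icc 0 T)) (h : ∀ᵐ s ∂(volume.restrict (Icc (0 : ℝ) T)), g s ≤ c) :
    ∀ s ∈ Icc 0 T, g s ≤ c := by
  have h1 : (fun s => max (g s) c) =ᵐ[volume.restrict (Icc (0 : ℝ) T)] fun _ => c :=
    h.mono fun s hs => max_eq_right hs
  have h2 := Measure.eqOn_Icc_of_ae_eq volume hT.ne h1 (hg.sup continuousOn_const)
    continuousOn_const
  intro s hs
  exact max_eq_right_iff.1 (h2 hs)

theorem eq_zero_of_forall_abs_le {Q : Set (Space d)} {y : Space d} (hy : y ∈ closure Q) {a L : ℝ}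
    (hL : 0 ≤ L) (h : ∀ z ∈ Q, |a| ≤ L * ‖y - z‖) : a = 0 := by
  rw [← abs_nonpos_iff]
  refine le_of_forall_pos_le_add fun ε hε => ?_
  obtain ⟨z, hz, hyz⟩ := Metric.mem_closure_iff.1 hy (ε / (L + 1)) (by positivity)
  rw [dist_eq_norm] at hyz
  calc |a| ≤ L * ‖y - z‖ := h z hz
    _ ≤ (L + 1) * (ε / (L + 1)) := by
        gcongr
        linarith
    _ = 0 + ε := by field_simp; ring

/-- A family of continuous functions of time, indexed by a set of points of space, which agrees at
almost all times with a function that is Lipschitz in space, extends to the closure of the set. -/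
theorem exists_lipschitz_extension {T : ℝ} (hT : 0 < T) {C : ℝ} (hC : 0 ≤ C) {Q K : Set (Space d)}
    (hQK : Q ⊆ K) (hKQ : K ⊆ closure Q) {Y : Space d → ℝ → ℝ} {W : ℝ → Space d → ℝ}
    (hYc : ∀ y ∈ Q, ContinuousOn (Y y) (Icc 0 T))
    (hYW : ∀ᵐ s ∂(volume.restrict (Icc (0 : ℝ) T)), ∀ y ∈ Q, Y y s = W s y)
    (hW : ∀ᵐ s ∂(volume.restrict (Icc (0 : ℝ) T)), ∀ y ∈ K, ∀ z ∈ K,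
      |W s y - W s z| ≤ C * ‖y - z‖) :
    ∃ G : ℝ → Space d → ℝ, (∀ y ∈ K, ContinuousOn (fun s => G s y) (Icc 0 T)) ∧
      (∀ s ∈ Icc 0 T, ∀ y ∈ K, ∀ z ∈ K, |G s y - G s z| ≤ C * ‖y - z‖) ∧
      (∀ᵐ s ∂(volume.restrict (Icc (0 : ℝ) T)), ∀ y ∈ K, G s y = W s y) ∧
      ∀ y ∈ Q, ∀ s ∈ Icc 0 T, G s y = Y y s := by
  have hL : ∀ s ∈ Icc 0 T, ∀ y ∈ Q, ∀ z ∈ Q, |Y y s - Y z s| ≤ C * ‖y - z‖ := by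
    intro s hs y hy z hz
    refine le_of_ae_le_of_continuousOn hT ((hYc y hy).sub (hYc z hz)).abs ?_ s hs
    filter_upwards [hYW, hW] with s h1 h2
    rw [Pi.sub_apply, h1 y hy, h1 z hz]
    exact h2 y (hQK hy) z (hQK hz)
  have hex : ∀ s, ∃ g : Space d → ℝ, s ∈ Icc 0 T →
      (∀ y z, |g y - g z| ≤ C * ‖y - z‖) ∧ ∀ y ∈ Q, g y = Y y s := by
    intro s
    by_cases hs : s ∈ Icc 0 T
    · have hl : LipschitzOnWith ⟨C, hC⟩ (fun y => Y y s) Q :=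
        LipschitzOnWith.of_dist_le_mul fun y hy z hz => by
          rw [Real.dist_eq, dist_eq_norm]; exact hL s hs y hy z hz
      obtain ⟨g, hg, hgQ⟩ := hl.extend_real
      refine ⟨g, fun _ => ⟨fun y z => ?_, fun y hy => (hgQ hy).symm⟩⟩
      have := hg.dist_le_mul y z
      rwa [Real.dist_eq, dist_eq_norm] at this
    · exact ⟨0, fun h => absurd h hs⟩
  choose G hG using hex
  refine ⟨G, fun y hy => ?_, fun s hs y _ z _ => (hG s hs).1 y z, ?_, fun y hy s hs =>
    (hG s hs).2 y hy⟩
  · refine continuousOn_of_uniform_approx_of_continuousOn fun U hU => ?_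
    obtain ⟨ε, hε, hεU⟩ := Metric.mem_uniformity_dist.1 hU
    obtain ⟨z, hz, hyz⟩ := Metric.mem_closure_iff.1 (hKQ hy) (ε / (C + 1)) (by positivity)
    refine ⟨Y z, hYc z hz, fun s hs => hεU ?_⟩
    rw [← (hG s hs).2 z hz, Real.dist_eq]
    rw [dist_eq_norm] at hyz
    calc _ ≤ C * ‖y - z‖ := (hG s hs).1 y z
      _ ≤ C * (ε / (C + 1)) := by gcongr
      _ < ε := by
        rw [← mul_div_assoc, div_lt_iff₀ (by positivity)]
        linarith
  · filter_upwards [hYW, hW, ae_restrict_mem measurableSet_Icc] with s h1 h2 h3 y hy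
    rw [← sub_eq_zero]
    refine eq_zero_of_forall_abs_le (hKQ hy) (L := 2 * C) (by positivity) fun z hz => ?_
    have e : G s y - W s y = (G s y - G s z) + (W s z - W s y) := by
      rw [(hG s h3).2 z hz, h1 z hz]; ring
    rw [e]
    have k1 := (hG s h3).1 y z
    have k2 := h2 z (hQK hz) y hy
    rw [norm_sub_rev] at k2
    linarith [abs_add_le (G s y - G s z) (W s z - W s y)]

theorem IsIntegrator.const_add {T : ℝ} {g : ℝ → ℝ} {I : (ℝ → ℝ) → ℝ → ℝ} {V : ℝ → ℝ}
    (h : IsIntegrator T g I V) (a : ℝ) : IsIntegrator T (fun s => a + g s) I V where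
  sub := h.sub
  const c t ht := by rw [h.const c t ht]; ring
  zero := h.zero
  bound := h.bound
  mono := h.mono

end

section

variable {d : ℕ} {p q : ℝ≥0∞} [ENNReal.HolderConjugate p q] {T : ℝ}
  {b : ℝ → Space d → Space d} {divb : ℝ → Space d → ℝ} {Db : ℝ → Space d → Space d →L[ℝ] Space d}
  {f : ℝ → Space d → ℝ} {D F : ℝ → ℝ} {B : ℝ → Space d} {u₀ : Space d → ℝ}
  {u : ℝ → Space d → ℝ}

/-- A weak solution, given for the translates of a test function `ψ` by the points of a dense set,
solves the equation in moving coordinates. -/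
theorem RegularDrift.integral_mul_translate_eq_of_stieltjes (hT : 0 < T)
    (hr : RegularDrift T q b divb Db f D F) (hu : BoundedLpLoc T p u) {M : ℝ≥0∞} (hM : M ≠ ⊤)
    (huM : ∀ᵐ s ∂(volume.restrict (Icc (0 : ℝ) T)), eLpNorm (u s) p volume ≤ M)
    (hB : Continuous B) (hBV : BoundedVariationOn B (Icc 0 T))
    (hu₀ : StronglyMeasurable u₀) (hu₀n : eLpNorm u₀ p volume ≠ ⊤) (ψ : TestFun d)
    {Q : Set (Space d)} (hQ : Dense Q) {X : TestFun d → ℝ → ℝ}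
    (hXc : ∀ y ∈ Q, ContinuousOn (X (translate ψ y)) (Icc 0 T))
    (hXc' : ∀ i : Fin d, ∀ y ∈ Q, ContinuousOn
      (X (∂_{EuclideanSpace.single i (1 : ℝ)} (translate ψ y))) (Icc 0 T))
    (hXu : ∀ᵐ s ∂(volume.restrict (Icc (0 : ℝ) T)), ∀ y ∈ Q,
      X (translate ψ y) s = ∫ x, u s x * translate ψ y x)
    (hXu' : ∀ i : Fin d, ∀ᵐ s ∂(volume.restrict (Icc (0 : ℝ) T)), ∀ y ∈ Q,
      X (∂_{EuclideanSpace.single i (1 : ℝ)} (translate ψ y)) s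
        = ∫ x, u s x * (∂_{EuclideanSpace.single i (1 : ℝ)} (translate ψ y)) x)
    (heq : ∀ y ∈ Q, ∀ t ∈ Icc 0 T, X (translate ψ y) t = (∫ x, u₀ x * translate ψ y x)
      + (∫ s in (0 : ℝ)..t, ∫ x, fderiv ℝ (translate ψ y) x (b s x) * u s x)
      + (∫ s in (0 : ℝ)..t, ∫ x, divb s x * translate ψ y x * u s x)
      + ∑ i : Fin d, stieltjesIntegral T
          (X (∂_{EuclideanSpace.single i (1 : ℝ)} (translate ψ y))) (fun s => B s i) t)
    {t : ℝ} (ht : t ∈ Icc 0 T) {v : Space d → ℝ} (hv : StronglyMeasurable v)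
    (hvn : eLpNorm v p volume ≠ ⊤)
    (hvX : ∀ y ∈ Q, X (translate ψ y) t = ∫ x, v x * translate ψ y x) (x₀ : Space d) :
    ∫ x, v x * translate ψ (x₀ + B t) x = (∫ x, u₀ x * translate ψ (x₀ + B 0) x)
      + ∫ s in (0 : ℝ)..t, transport (b s) (divb s) (u s) (translate ψ (x₀ + B s)) := by
  have h0m : (0 : ℝ) ∈ Icc 0 T := ⟨le_rfl, hT.le⟩
  obtain ⟨ρ, hρ0, hρ⟩ := exists_norm_le_path hB T
  set r : ℝ := ‖x₀‖ + ρ + 1 with hr_def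
  set K : Set (Space d) := Metric.ball 0 r with hK
  have hKc : ∀ y ∈ K, y ∈ Metric.closedBall (0 : Space d) r := fun y hy =>
    Metric.ball_subset_closedBall hy
  have hKQ : K ⊆ closure (K ∩ Q) := hQ.open_subset_closure_inter Metric.isOpen_ball
  have hQK : K ∩ Q ⊆ K := inter_subset_left
  have hβK : ∀ s ∈ Icc 0 T, x₀ + B s ∈ K := by
    intro s hs
    rw [hK, Metric.mem_ball, dist_zero_right]
    linarith [norm_add_le x₀ (B s), hρ s hs]
  have hum : ∀ s, StronglyMeasurable (u s) := fun s => hu.meas.comp_measurable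
    measurable_prodMk_left
  -- the pairings with the translates, extended to all translates and all times
  have hext : ∀ φ : TestFun d, ∀ Y : Space d → ℝ → ℝ, (∀ y ∈ Q, ContinuousOn (Y y) (Icc 0 T)) →
      (∀ᵐ s ∂(volume.restrict (Icc (0 : ℝ) T)), ∀ y ∈ Q, Y y s = ∫ x, u s x * translate φ y x) →
      ∃ C : ℝ, 0 ≤ C ∧ (∀ᵐ s ∂(volume.restrict (Icc (0 : ℝ) T)), ∀ a ∈ K, ∀ c ∈ K,
        |(∫ x, u s x * translate φ c x) - (∫ x, u s x * translate φ a x)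
          - ∑ i, (- ∫ x, u s x * translate (∂_{EuclideanSpace.single i (1 : ℝ)} φ) a x)
            * (c i - a i)| ≤ C * ‖c - a‖ ^ 2) ∧
      ∃ G : ℝ → Space d → ℝ, (∀ y ∈ K, ContinuousOn (fun s => G s y) (Icc 0 T)) ∧
      (∀ s ∈ Icc 0 T, ∀ y ∈ K, ∀ z ∈ K, |G s y - G s z| ≤ C * ‖y - z‖) ∧
      (∀ᵐ s ∂(volume.restrict (Icc (0 : ℝ) T)), ∀ y ∈ K, G s y = ∫ x, u s x * translate φ y x) ∧
      ∀ y ∈ K ∩ Q, ∀ s ∈ Icc 0 T, G s y = Y y s := by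
    intro φ Y hYc hYu
    obtain ⟨C, hC, h⟩ := exists_pairing_taylor_bound (p := p) (q := q) φ r hM
    refine ⟨C, hC, ?_, ?_⟩
    · filter_upwards [huM] with s hs a ha c hc
      exact (h (hum s) hs a (hKc a ha) c (hKc c hc)).2
    · refine exists_lipschitz_extension hT hC hQK hKQ (fun y hy => hYc y hy.2)
        (hYu.mono fun s hs y hy => hs y hy.2) ?_
      filter_upwards [huM] with s hs a ha c hc
      exact (h (hum s) hs a (hKc a ha) c (hKc c hc)).1
  obtain ⟨C₀, hC₀, hTay, G, hGc, hGL, hGu, hGX⟩ := hext ψ (fun y => X (translate ψ y)) hXc hXu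
  have hexti := fun i : Fin d => hext (∂_{EuclideanSpace.single i (1 : ℝ)} ψ)
    (fun y => X (∂_{EuclideanSpace.single i (1 : ℝ)} (translate ψ y))) (hXc' i)
    ((hXu' i).mono fun s hs y hy => by rw [hs y hy, lineDeriv_translate])
  choose C₁ hC₁ _ G' hGc' hGL' hGu' hGX' using hexti
  obtain ⟨C, hC, hC0, hCi⟩ : ∃ C : ℝ, 0 ≤ C ∧ C₀ ≤ C ∧ ∀ i, C₁ i ≤ C :=
    ⟨C₀ + ∑ i, C₁ i, add_nonneg hC₀ (Finset.sum_nonneg fun i _ => hC₁ i),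
      le_add_of_nonneg_right (Finset.sum_nonneg fun i _ => hC₁ i), fun i =>
      (Finset.single_le_sum (f := C₁) (fun i _ => hC₁ i) (Finset.mem_univ i)).trans
        (le_add_of_nonneg_left hC₀)⟩
  choose V hV using fun i : Fin d => exists_isIntegrator_stieltjesIntegral hT.le
    (boundedVariationOn_coord hBV i) (g := fun s => B s i)
    (Continuous.continuousOn (by fun_prop))
  obtain ⟨Cg, Rg, hCg, hLg⟩ := exists_transport_lipschitz ψ r
  set g : ℝ → Space d → ℝ := fun s y => transport (b s) (divb s) (u s) (translate ψ y) with hg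
  set m : ℝ → ℝ := fun s => Cg * (localMass Rg (b s) (divb s) (u s)).toReal with hm
  have hmi : IntegrableOn m (Icc 0 T) := (hr.integrableOn_localMass hu Rg).const_mul Cg
  have hm0 : ∀ s, 0 ≤ m s := fun s => mul_nonneg hCg ENNReal.toReal_nonneg
  have hgi : ∀ y, IntegrableOn (fun s => g s y) (Icc 0 T) := fun y =>
    hr.integrableOn_transport hu (β := fun _ => y) continuous_const ψ
  have hgm : ∀ᵐ s ∂(volume.restrict (Icc (0 : ℝ) T)), ∀ y ∈ K, ∀ z ∈ K,
      |g s y - g s z| ≤ m s * ‖y - z‖ := by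
    filter_upwards [hr.regular, hu.memLpLoc] with s g1 g2 y hy z hz
    exact hLg g1 g2 y (hKc y hy) z (hKc z hz)
  -- the initial value
  have hinit : ∀ y ∈ K, G 0 y = ∫ x, u₀ x * translate ψ y x := by
    intro y hy
    obtain ⟨C', hC', h⟩ := exists_pairing_taylor_bound (p := p) (q := q) ψ r hu₀n
    rw [← sub_eq_zero]
    refine eq_zero_of_forall_abs_le (hKQ hy) (L := C₀ + C') (by positivity) fun z hz => ?_
    have e : G 0 z = ∫ x, u₀ x * translate ψ z x := by
      rw [hGX z hz 0 h0m, heq z hz.2 0 h0m]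
      simp [(hV _).zero]
    have k1 := hGL 0 h0m y hy z hz.1
    have k2 := (h hu₀ le_rfl y (hKc y hy) z (hKc z hz.1)).1
    rw [show G 0 y - ∫ x, u₀ x * translate ψ y x = (G 0 y - G 0 z)
      - ((∫ x, u₀ x * translate ψ y x) - ∫ x, u₀ x * translate ψ z x) by rw [e]; ring]
    linarith [abs_sub (G 0 y - G 0 z)
      ((∫ x, u₀ x * translate ψ y x) - ∫ x, u₀ x * translate ψ z x)]
  -- the value at time `t`
  have hfinal : ∀ y ∈ K, G t y = ∫ x, v x * translate ψ y x := by
    intro y hy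
    obtain ⟨C', hC', h⟩ := exists_pairing_taylor_bound (p := p) (q := q) ψ r hvn
    rw [← sub_eq_zero]
    refine eq_zero_of_forall_abs_le (hKQ hy) (L := C₀ + C') (by positivity) fun z hz => ?_
    have e : G t z = ∫ x, v x * translate ψ z x := by
      rw [hGX z hz t ht, hvX z hz.2]
    have k1 := hGL t ht y hy z hz.1
    have k2 := (h hv le_rfl y (hKc y hy) z (hKc z hz.1)).1
    rw [show G t y - ∫ x, v x * translate ψ y x = (G t y - G t z)
      - ((∫ x, v x * translate ψ y x) - ∫ x, v x * translate ψ z x) by rw [e]; ring]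
    linarith [abs_sub (G t y - G t z)
      ((∫ x, v x * translate ψ y x) - ∫ x, v x * translate ψ z x)]
  -- the equation at all points of the ball, by density
  have hH : ∀ y ∈ K, ∀ t ∈ Icc 0 T, G t y = G 0 y + (∫ s in (0 : ℝ)..t, g s y)
      + ∑ i, stieltjesIntegral T (fun s => G' i s y) (fun s => B s i) t := by
    intro y hy t ht
    rw [← sub_eq_zero]
    have hm' : 0 ≤ ∫ s in (0 : ℝ)..t, m s :=
      intervalIntegral.integral_nonneg ht.1 fun s _ => hm0 s
    have hV' : 0 ≤ ∑ i, C₁ i * (V i t - V i 0) := Finset.sum_nonneg fun i _ =>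
      mul_nonneg (hC₁ i) (sub_nonneg.2 ((hV i).mono 0 t le_rfl ht.1 ht.2))
    refine eq_zero_of_forall_abs_le (hKQ hy)
      (L := C₀ + C₀ + (∫ s in (0 : ℝ)..t, m s) + ∑ i, C₁ i * (V i t - V i 0)) (by positivity)
      fun z hz => ?_
    have ez : G t z = G 0 z + (∫ s in (0 : ℝ)..t, g s z)
        + ∑ i, stieltjesIntegral T (fun s => G' i s z) (fun s => B s i) t := by
      have es : ∀ i, stieltjesIntegral T (fun s => G' i s z) (fun s => B s i) t
          = stieltjesIntegral T (X (∂_{EuclideanSpace.single i (1 : ℝ)} (translate ψ z)))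
            (fun s => B s i) t := by
        intro i
        have h1 := (hV i).sub (fun s => G' i s z)
          (X (∂_{EuclideanSpace.single i (1 : ℝ)} (translate ψ z))) (hGc' i z hz.1)
          (hXc' i z hz.2) t ht
        have h2 := (hV i).abs_le (f := fun s => G' i s z
          - X (∂_{EuclideanSpace.single i (1 : ℝ)} (translate ψ z)) s) (C := 0)
          ((hGc' i z hz.1).sub (hXc' i z hz.2)) ht (fun s hs => by
            rw [hGX' i z hz s hs, sub_self, abs_zero])
        rw [h1, zero_mul, abs_nonpos_iff, sub_eq_zero] at h2
        exact h2
      rw [hGX z hz t ht, hinit z hz.1, heq z hz.2 t ht, (hr.integral_transport hu _ ht).2]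
      simp only [es]
      ring
    have k1 := hGL t ht y hy z hz.1
    have k2 := hGL 0 h0m y hy z hz.1
    have k3 : |(∫ s in (0 : ℝ)..t, g s y) - ∫ s in (0 : ℝ)..t, g s z|
        ≤ (∫ s in (0 : ℝ)..t, m s) * ‖y - z‖ := by
      rw [← intervalIntegral.integral_sub (intervalIntegrable_of_mem (hgi y) h0m ht)
        (intervalIntegrable_of_mem (hgi z) h0m ht), ← intervalIntegral.integral_mul_const,
        ← Real.norm_eq_abs]
      refine intervalIntegral.norm_integral_le_of_norm_le ht.1 ?_
        ((intervalIntegrable_of_mem hmi h0m ht).mul_const _)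
      rw [ae_restrict_iff' measurableSet_Icc] at hgm
      filter_upwards [hgm] with s hs hst
      exact hs ⟨hst.1.le, hst.2.trans ht.2⟩ y hy z hz.1
    have k4 : |(∑ i, stieltjesIntegral T (fun s => G' i s y) (fun s => B s i) t)
        - ∑ i, stieltjesIntegral T (fun s => G' i s z) (fun s => B s i) t|
        ≤ (∑ i, C₁ i * (V i t - V i 0)) * ‖y - z‖ := by
      rw [← Finset.sum_sub_distrib, Finset.sum_mul]
      refine (Finset.abs_sum_le_sum_abs _ _).trans (Finset.sum_le_sum fun i _ => ?_)
      rw [← (hV i).sub _ _ (hGc' i y hy) (hGc' i z hz.1) t ht]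
      refine ((hV i).abs_le ((hGc' i y hy).sub (hGc' i z hz.1)) ht
        (fun s hs => hGL' i s hs y hy z hz.1)).trans_eq (by ring)
    rw [abs_le] at k1 k2 k3 k4 ⊢
    constructor <;> nlinarith
  have hcont : ∀ i, ∀ y ∈ K, ContinuousOn (fun s => - G' i s y) (Icc 0 T) := fun i y hy =>
    (hGc' i y hy).neg
  have h := ito_wentzell (T := T) (β := fun s => x₀ + B s)
    (continuous_const.add hB).continuousOn hβK
    (I := fun i f t => stieltjesIntegral T f (fun s => B s i) t) (V := V)
    (fun i => by simpa only [PiLp.add_apply] using (hV i).const_add (x₀ i))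
    (H := G) (g := g) (h := G') (k := fun i s y => - G' i s y) (m := m) (C := C)
    hH hmi hm0 hC (fun y _ => hgi y)
    (hr.integrableOn_transport hu (continuous_const.add hB) ψ) hgm hGc'
    (fun i s hs y hy z hz => (hGL' i s hs y hy z hz).trans
      (mul_le_mul_of_nonneg_right (hCi i) (norm_nonneg _)))
    hcont
    (fun i s hs y hy z hz => by
      rw [neg_sub_neg, abs_sub_comm]
      exact (hGL' i s hs y hy z hz).trans
        (mul_le_mul_of_nonneg_right (hCi i) (norm_nonneg _)))
    (fun s hs y hy z hz => by
      refine le_of_ae_le_of_continuousOn hT (g := fun s => |G s z - G s y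
        - ∑ i, (- G' i s y) * (z i - y i)|) ?_ ?_ s hs
      · exact (((hGc z hz).sub (hGc y hy)).sub (continuousOn_finsetSum _ fun i _ =>
          (hcont i y hy).mul continuousOn_const)).abs
      · filter_upwards [hTay, hGu, ae_all_iff.2 hGu'] with s h1 h2 h3
        simp only [h2 y hy, h2 z hz, h3 _ y hy]
        exact (h1 y hy z hz).trans (mul_le_mul_of_nonneg_right hC0 (by positivity)))
    ht
  rw [hfinal _ (hβK t ht), hinit _ (hβK 0 h0m)] at h
  rw [h]
  have e : ∀ i, stieltjesIntegral T (fun s => G' i s (x₀ + B s) + - G' i s (x₀ + B s))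
      (fun s => B s i) t = 0 := by
    intro i
    simp only [add_neg_cancel]
    simpa using (hV i).const 0 t ht
  rw [Finset.sum_congr rfl fun i _ => e i, Finset.sum_const_zero, add_zero]

end

/-! ### An `L¹` a priori estimate for the dual problem -/

/-- A smooth approximation of the absolute value. -/
def smoothAbs (δ s : ℝ) : ℝ := √(s ^ 2 + δ ^ 2) - δ

theorem hasDerivAt_smoothAbs {δ : ℝ} (hδ : 0 < δ) (s : ℝ) :
    HasDerivAt (smoothAbs δ) (s / √(s ^ 2 + δ ^ 2)) s := by
  have h : HasDerivAt (fun s : ℝ => s ^ 2 + δ ^ 2) (2 * s) s := by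
    simpa using (hasDerivAt_pow 2 s).add_const (δ ^ 2)
  have h2 := (h.sqrt (by positivity)).sub_const δ
  rw [mul_div_mul_left _ _ two_ne_zero] at h2
  exact h2

theorem contDiff_smoothAbs {δ : ℝ} (hδ : 0 < δ) : ContDiff ℝ ∞ (smoothAbs δ) :=
  ((contDiff_id.pow 2).add contDiff_const).sqrt (fun s => by
    have : 0 < id s ^ 2 + δ ^ 2 := by positivity
    exact this.ne') |>.sub contDiff_const

theorem smoothAbs_zero {δ : ℝ} (hδ : 0 < δ) : smoothAbs δ 0 = 0 := by
  simp [smoothAbs, Real.sqrt_sq hδ.le]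

theorem abs_sub_le_smoothAbs {δ : ℝ} (s : ℝ) : |s| - δ ≤ smoothAbs δ s := by
  rw [smoothAbs]
  have : |s| ≤ √(s ^ 2 + δ ^ 2) := Real.abs_le_sqrt (by nlinarith [sq_nonneg δ])
  linarith

theorem abs_deriv_smoothAbs_le {δ : ℝ} (hδ : 0 < δ) (s : ℝ) : |s / √(s ^ 2 + δ ^ 2)| ≤ 1 := by
  have h0 : 0 < √(s ^ 2 + δ ^ 2) := Real.sqrt_pos.2 (by positivity)
  rw [abs_div, abs_of_pos h0, div_le_one h0]
  exact Real.abs_le_sqrt (by nlinarith [sq_nonneg δ])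

theorem abs_smoothAbs_sub_le {δ : ℝ} (hδ : 0 < δ) (s : ℝ) :
    |s / √(s ^ 2 + δ ^ 2) * s - smoothAbs δ s| ≤ δ := by
  have h0 : 0 < √(s ^ 2 + δ ^ 2) := Real.sqrt_pos.2 (by positivity)
  have hs : √(s ^ 2 + δ ^ 2) ^ 2 = s ^ 2 + δ ^ 2 := Real.sq_sqrt (by positivity)
  have hle : δ ≤ √(s ^ 2 + δ ^ 2) := Real.le_sqrt_of_sq_le (by nlinarith [sq_nonneg s])
  have e : s / √(s ^ 2 + δ ^ 2) * s - smoothAbs δ s = δ - δ ^ 2 / √(s ^ 2 + δ ^ 2) := by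
    rw [smoothAbs]
    field_simp
    nlinarith
  have h1 : δ ^ 2 / √(s ^ 2 + δ ^ 2) ≤ δ := by
    rw [div_le_iff₀ h0]
    nlinarith
  have h2 : 0 ≤ δ ^ 2 / √(s ^ 2 + δ ^ 2) := by positivity
  rw [e, abs_le]
  constructor <;> linarith

section

variable {d : ℕ}

/-- The transport operator in divergence form is accretive in `L¹`, up to an error of order `δ`: this
is the integrated form of `sign G * div (b * G) = div (b * |G|)`. -/
theorem HasWeakDiv.integral_deriv_smoothAbs_mul_le {b : Space d → Space d} {divb : Space d → ℝ}
    (h : HasWeakDiv b divb) {D : ℝ} (hD : ∀ᵐ x, |divb x| ≤ D)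
    {δ : ℝ} (hδ : 0 < δ) (G : TestFun d) {R : ℝ} {a : Space d} (hG : ∀ x, R < ‖x - a‖ → G x = 0)
    {k : Space d → ℝ} (hk : Integrable k) :
    ∫ x, G x / √(G x ^ 2 + δ ^ 2) * k x
      ≤ (∫ x, |k x - (fderiv ℝ G x (b x) + divb x * G x)|)
        + δ * (D * volume.real (Metric.closedBall (0 : Space d) R)) := by
  set j' : ℝ → ℝ := fun s => s / √(s ^ 2 + δ ^ 2) with hj'
  have hj'c : Continuous j' := by
    refine continuous_id.div (by fun_prop) fun s => ?_
    exact (Real.sqrt_pos.2 (by positivity)).ne'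
  have hj'm : AEStronglyMeasurable (fun x => j' (G x)) volume :=
    (hj'c.comp G.continuous).aestronglyMeasurable
  have hL := h.integrable_transport G
  have hbd : ∀ {w : Space d → ℝ}, Integrable w → Integrable fun x => j' (G x) * w x :=
    fun hw => hw.bdd_mul hj'm (ae_of_all _ fun x => abs_deriv_smoothAbs_le hδ (G x))
  have i1 : Integrable fun x => j' (G x) * (k x - (fderiv ℝ G x (b x) + divb x * G x)) :=
    hbd (hk.sub hL)
  have i2 := hbd hL
  have e1 : ∫ x, j' (G x) * k x = (∫ x, j' (G x) * (k x - (fderiv ℝ G x (b x) + divb x * G x)))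
      + ∫ x, j' (G x) * (fderiv ℝ G x (b x) + divb x * G x) := by
    rw [← integral_add i1 i2]
    refine integral_congr_ae (ae_of_all _ fun x => ?_)
    simp only
    ring
  have b1 : ∫ x, j' (G x) * (k x - (fderiv ℝ G x (b x) + divb x * G x))
      ≤ ∫ x, |k x - (fderiv ℝ G x (b x) + divb x * G x)| := by
    refine integral_mono i1 (hk.sub hL).abs fun x => ?_
    refine (le_abs_self _).trans ?_
    rw [abs_mul]
    exact mul_le_of_le_one_left (abs_nonneg _) (abs_deriv_smoothAbs_le hδ (G x))
  -- the weak divergence, tested against the composition of the smoothed absolute value with `G`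
  set Ψ : TestFun d := mkTest (fun x => smoothAbs δ (G x))
    ((contDiff_smoothAbs hδ).comp G.contDiff)
    (G.hasCompactSupport.comp_left (smoothAbs_zero hδ)) with hΨ
  have hΨx : ∀ x, Ψ x = smoothAbs δ (G x) := fun x => rfl
  have hΨd : ∀ x v, fderiv ℝ Ψ x v = j' (G x) * fderiv ℝ G x v := by
    intro x v
    have h1 := (hasDerivAt_smoothAbs hδ (G x)).comp_hasFDerivAt x
      (differentiable_testFun G x).hasFDerivAt
    have h2 : ⇑Ψ = smoothAbs δ ∘ G := rfl
    rw [h2, h1.fderiv]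
    simp [hj']
  have i3 : Integrable fun x => j' (G x) * fderiv ℝ G x (b x) := by
    have := LocallyIntegrable.integrable_clm_apply h.1 (continuous_fderiv_testFun Ψ)
      (Ψ.hasCompactSupport.fderiv ℝ)
    simpa only [hΨd] using this
  have i4 : Integrable fun x => divb x * Ψ x := integrable_mul_testFun h.2.1 Ψ
  have i5 : Integrable fun x => j' (G x) * (divb x * G x) := hbd (integrable_mul_testFun h.2.1 G)
  have e2 : ∫ x, j' (G x) * (fderiv ℝ G x (b x) + divb x * G x)
      = ∫ x, divb x * (j' (G x) * G x - smoothAbs δ (G x)) := by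
    have := h.2.2 Ψ
    simp only [hΨd] at this
    simp_rw [mul_add]
    rw [integral_add i3 i5, this, ← integral_neg, ← integral_add]
    · refine integral_congr_ae (ae_of_all _ fun x => ?_)
      simp only [hΨx]
      ring
    · have i6 : Integrable fun x => Ψ x * divb x := by simpa only [mul_comm] using i4
      exact i6.neg
    · exact i5
  have b2 : ∫ x, divb x * (j' (G x) * G x - smoothAbs δ (G x))
      ≤ δ * (D * volume.real (Metric.closedBall (0 : Space d) R)) := by
    have hvol : volume.real (Metric.closedBall (0 : Space d) R)
        = volume.real (Metric.closedBall a R) := by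
      simp only [Measure.real, Measure.addHaar_closedBall_center volume a R]
    rw [hvol]
    have hi : Integrable fun x => divb x * (j' (G x) * G x - smoothAbs δ (G x)) := by
      refine (i5.sub i4).congr (ae_of_all _ fun x => ?_)
      simp only [Pi.sub_apply, hΨx]
      ring
    calc _ ≤ ∫ x, (Metric.closedBall a R).indicator (fun _ => D * δ) x := by
          refine integral_mono_ae hi ((integrable_indicator_iff measurableSet_closedBall).2
            (integrableOn_const measure_closedBall_lt_top.ne)) ?_
          filter_upwards [hD] with x hx
          by_cases hxa : x ∈ Metric.closedBall a R
          · simp only [indicator_of_mem hxa]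
            refine (le_abs_self _).trans ?_
            rw [abs_mul]
            exact mul_le_mul hx (abs_smoothAbs_sub_le hδ _) (abs_nonneg _)
              ((abs_nonneg _).trans hx)
          · simp only [indicator_of_notMem hxa]
            rw [Metric.mem_closedBall, dist_eq_norm, not_le] at hxa
            rw [hG x hxa, smoothAbs_zero hδ]
            simp
      _ = _ := by
          rw [integral_indicator measurableSet_closedBall, setIntegral_const]
          simp
          ring
  rw [e1, e2]
  exact add_le_add b1 b2

variable {p q : ℝ≥0∞} [ENNReal.HolderConjugate p q] {T : ℝ}
  {b : ℝ → Space d → Space d} {divb : ℝ → Space d → ℝ} {Db : ℝ → Space d → Space d →L[ℝ] Space d}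
  {f : ℝ → Space d → ℝ} {D F : ℝ → ℝ}

/-- The integrand of the dual problem: `θ ψ - η div (b ψ)` in moving coordinates. -/
def dualTerm (b : ℝ → Space d → Space d) (divb : ℝ → Space d → ℝ) (B : ℝ → Space d)
    (θ η : ℝ → ℝ) (ψ : TestFun d) (t : ℝ) (y : Space d) : ℝ :=
  θ t * ψ (y - B t) - η t * (fderiv ℝ ψ (y - B t) (b t y) + divb t y * ψ (y - B t))

theorem abs_le_of_bound_interval {θ : ℝ → ℝ} (hm : StronglyMeasurable θ) {K : ℝ}
    (hK : ∀ t, |θ t| ≤ K) (s t : ℝ) : IntervalIntegrable θ volume s t :=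
  (intervalIntegrable_const (c := K)).mono_fun' hm.aestronglyMeasurable (ae_of_all _ hK)

set_option maxHeartbeats 1000000 in
/-- The `L¹` estimate for the dual problem: along the solution of the dual transport equation with
right hand side, the `L¹` norm is controlled by that of the right hand side, with constant one. -/
theorem RegularDrift.integral_abs_le_of_dual (hT : 0 ≤ T) (hr : RegularDrift T q b divb Db f D F)
    {B : ℝ → Space d} {ι : Type*} (s : Finset ι) {θ η : ι → ℝ → ℝ}
    (hθ : ∀ i, StronglyMeasurable (θ i)) {K : ι → ℝ} (hK : ∀ i t, |θ i t| ≤ K i)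
    (hη : ∀ i, ∀ t ∈ Icc 0 T, η i t = ∫ r in t..T, θ i r) (ψ : ι → TestFun d)
    (hint : Integrable (fun z : ℝ × Space d =>
      ∑ i ∈ s, dualTerm b divb B (θ i) (η i) (ψ i) z.1 z.2)
      ((volume.restrict (Icc 0 T)).prod volume)) :
    ∫ x, |∑ i ∈ s, η i 0 * ψ i x|
      ≤ ∫ t in Icc 0 T, ∫ y, |∑ i ∈ s, dualTerm b divb B (θ i) (η i) (ψ i) t y| := by
  have h0m : (0 : ℝ) ∈ Icc 0 T := ⟨le_rfl, hT⟩
  have hTm : T ∈ Icc 0 T := ⟨hT, le_rfl⟩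
  have hθi : ∀ i, IntegrableOn (θ i) (Icc 0 T) := fun i => by
    rw [integrableOn_Icc_iff_integrableOn_Ioc, ← intervalIntegrable_iff_integrableOn_Ioc_of_le hT]
    exact abs_le_of_bound_interval (hθ i) (hK i) 0 T
  -- a common support
  choose C R hC hR hψC hψD hψR using fun i => exists_testFun_bound (ψ i)
  obtain ⟨R₀, hR₀0, hR₀⟩ : ∃ R₀ : ℝ, 0 ≤ R₀ ∧ ∀ i ∈ s, R i ≤ R₀ :=
    ⟨∑ i ∈ s, R i, Finset.sum_nonneg fun i _ => hR i, fun i hi =>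
      Finset.single_le_sum (f := R) (fun i _ => hR i) hi⟩
  have hz : ∀ (c : ι → ℝ) x, R₀ < ‖x‖ → ∑ i ∈ s, c i * ψ i x = 0 := fun c x hx =>
    Finset.sum_eq_zero fun i hi => by rw [(hψR i x ((hR₀ i hi).trans_lt hx)).2, mul_zero]
  set G : ℝ → TestFun d := fun t => mkTest (fun x => ∑ i ∈ s, η i t * ψ i x)
    (ContDiff.sum fun i _ => contDiff_const.mul (ψ i).contDiff)
    (HasCompactSupport.intro (isCompact_closedBall 0 R₀) fun x hx => hz _ x (by simpa using hx))
    with hG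
  have hGx : ∀ t x, G t x = ∑ i ∈ s, η i t * ψ i x := fun t x => rfl
  have hGd : ∀ t x v, fderiv ℝ (G t) x v = ∑ i ∈ s, η i t * fderiv ℝ (ψ i) x v := by
    intro t x v
    have e : ⇑(G t) = fun x => ∑ i ∈ s, η i t * ψ i x := rfl
    rw [e, fderiv_fun_sum fun i _ => (differentiable_testFun (ψ i) x).const_mul _, sum_apply]
    refine Finset.sum_congr rfl fun i _ => ?_
    rw [fderiv_const_mul (differentiable_testFun (ψ i) x)]
    rfl
  set k : ℝ → Space d → ℝ := fun t x => ∑ i ∈ s, θ i t * ψ i x with hk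
  have hki : ∀ t, Integrable (k t) := fun t => integrable_finsetSum _ fun i _ =>
    ((ψ i).continuous.integrable_of_hasCompactSupport (ψ i).hasCompactSupport).const_mul _
  have hGc : ContinuousOn (fun t => (fun x => G t x : Space d → ℝ)) (Icc 0 T) := by
    refine continuousOn_pi.2 fun x => ?_
    simp only [hGx]
    refine continuousOn_finsetSum _ fun i _ => ContinuousOn.mul ?_ continuousOn_const
    have h1 : Continuous fun t => ∫ r in (0 : ℝ)..t, θ i r :=
      intervalIntegral.continuous_primitive (abs_le_of_bound_interval (hθ i) (hK i)) 0
    have h2 : Continuous fun t => (∫ r in (0 : ℝ)..T, θ i r) - ∫ r in (0 : ℝ)..t, θ i r :=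
      continuous_const.sub h1
    refine h2.continuousOn.congr fun t ht => ?_
    simp only
    rw [hη i t ht, intervalIntegral.integral_interval_sub_left
      (abs_le_of_bound_interval (hθ i) (hK i) 0 T) (abs_le_of_bound_interval (hθ i) (hK i) 0 t)]
  refine le_of_forall_pos_le_add fun ε hε => ?_
  set v₀ : ℝ := volume.real (Metric.closedBall (0 : Space d) R₀) with hv₀
  set A : ℝ := v₀ + v₀ * ∫ t in Icc 0 T, D t with hA
  have hv₀0 : 0 ≤ v₀ := measureReal_nonneg
  have hA0 : 0 ≤ A := add_nonneg hv₀0 (mul_nonneg hv₀0 (integral_nonneg fun t => hr.D_nonneg t))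
  set δ : ℝ := ε / (A + 1) with hδ_def
  have hδ : 0 < δ := by positivity
  set j' : ℝ → ℝ := fun s => s / √(s ^ 2 + δ ^ 2) with hj'
  have hj'c : Continuous j' := by
    refine continuous_id.div (by fun_prop) fun s => ?_
    exact (Real.sqrt_pos.2 (by positivity)).ne'
  -- the chain rule in time, at every point
  have hchain : ∀ x, smoothAbs δ (G 0 x) = ∫ t in Icc 0 T, j' (G t x) * k t x := by
    intro x
    have hgi : IntegrableOn (fun t => - k t x) (Icc 0 T) :=
      Integrable.neg (integrable_finsetSum _ fun i _ => (hθi i).mul_const _)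
    have hF : ∀ t ∈ Icc 0 T, G t x = G 0 x + ∫ r in (0 : ℝ)..t, - k r x := by
      intro t ht
      have e : ∫ r in (0 : ℝ)..t, - k r x = ∑ i ∈ s, - ((∫ r in (0 : ℝ)..t, θ i r) * ψ i x) := by
        rw [intervalIntegral.integral_neg, hk, intervalIntegral.integral_finsetSum fun i _ =>
          (abs_le_of_bound_interval (hθ i) (hK i) 0 t).mul_const _, ← Finset.sum_neg_distrib]
        refine Finset.sum_congr rfl fun i _ => ?_
        rw [intervalIntegral.integral_mul_const]
      rw [e, hGx, hGx, ← Finset.sum_add_distrib]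
      refine Finset.sum_congr rfl fun i _ => ?_
      rw [hη i t ht, hη i 0 h0m, ← intervalIntegral.integral_add_adjacent_intervals
        (abs_le_of_bound_interval (hθ i) (hK i) 0 t) (abs_le_of_bound_interval (hθ i) (hK i) t T)]
      ring
    have hFc : ContinuousOn (fun t => G t x) (Icc 0 T) := continuousOn_pi.1 hGc x
    obtain ⟨c, hc⟩ := (isCompact_Icc (a := (0 : ℝ)) (b := T)).exists_bound_of_continuousOn hFc
    obtain ⟨-, h⟩ := comp_eq_integral_of_eq_primitive (m := -c) (M := c) (j := smoothAbs δ)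
      (j' := j') hgi hF (fun t ht => abs_le.1 (hc t ht))
      (fun z _ => (hasDerivAt_smoothAbs hδ z).hasDerivWithinAt) hj'c.continuousOn hTm
    have hGT : G T x = 0 := by
      rw [hGx]
      refine Finset.sum_eq_zero fun i _ => ?_
      rw [hη i T hTm, intervalIntegral.integral_same, zero_mul]
    simp only [hGT, smoothAbs_zero hδ, mul_neg, intervalIntegral.integral_neg] at h
    rw [integral_Icc_eq_integral_Ioc, ← intervalIntegral.integral_of_le hT]
    linarith
  -- Fubini
  have hGm : AEStronglyMeasurable (fun z : ℝ × Space d => G z.1 z.2)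
      ((volume.restrict (Icc 0 T)).prod volume) := by
    have : AEStronglyMeasurable (fun z : ℝ × Space d => ∑ i ∈ s, η i z.1 * ψ i z.2)
        ((volume.restrict (Icc 0 T)).prod volume) := by
      refine Finset.aestronglyMeasurable_fun_sum _ fun i _ => ?_
      have hηm : AEStronglyMeasurable (η i) (volume.restrict (Icc 0 T)) := by
        have h1 : Continuous fun t => ∫ r in t..T, θ i r := by
          have := (intervalIntegral.continuous_primitive
            (abs_le_of_bound_interval (hθ i) (hK i)) T).neg
          exact this.congr fun t => (intervalIntegral.integral_symm T t).symm
        refine h1.aestronglyMeasurable.congr ?_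
        filter_upwards [ae_restrict_mem measurableSet_Icc] with t ht
        exact (hη i t ht).symm
      exact (hηm.comp_fst).mul ((ψ i).continuous.comp continuous_snd).aestronglyMeasurable
    exact this
  have hfub : Integrable (fun z : ℝ × Space d => j' (G z.1 z.2) * k z.1 z.2)
      ((volume.restrict (Icc 0 T)).prod volume) := by
    have hkI : Integrable (fun z : ℝ × Space d => k z.1 z.2)
        ((volume.restrict (Icc 0 T)).prod volume) :=
      integrable_finsetSum _ fun i _ => (hθi i).mul_prod
        ((ψ i).continuous.integrable_of_hasCompactSupport (ψ i).hasCompactSupport)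
    exact hkI.bdd_mul (hj'c.comp_aestronglyMeasurable hGm)
      (ae_of_all _ fun z => abs_deriv_smoothAbs_le hδ _)
  have hsw : ∫ x, smoothAbs δ (G 0 x) = ∫ t in Icc 0 T, ∫ x, j' (G t x) * k t x := by
    simp_rw [hchain]
    exact (integral_integral_swap hfub).symm
  -- the estimate at almost every time
  have htime : ∀ᵐ t ∂(volume.restrict (Icc (0 : ℝ) T)), ∫ x, j' (G t x) * k t x
      ≤ (∫ y, |∑ i ∈ s, dualTerm b divb B (θ i) (η i) (ψ i) t y|) + δ * (D t * v₀) := by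
    filter_upwards [hr.regular, hr.div_le] with t h1 h2
    have h := h1.weakDiv.integral_deriv_smoothAbs_mul_le h2 hδ (translate (G t) (B t))
      (R := R₀) (a := B t) (fun x hx => hz _ _ hx) (k := fun x => k t (x - B t))
      ((hki t).comp_sub_right (B t))
    simp only [fderiv_translate, translate_apply] at h
    rw [integral_sub_right_eq_self (fun x => G t x / √(G t x ^ 2 + δ ^ 2) * k t x) (B t)] at h
    refine h.trans_eq ?_
    congr 1
    refine integral_congr_ae (ae_of_all _ fun x => ?_)
    simp only [dualTerm, Finset.sum_sub_distrib, hGd, hGx, hk, mul_add, Finset.sum_add_distrib,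
      Finset.mul_sum]
    congr 3
    refine Finset.sum_congr rfl fun i _ => ?_
    ring
  have hDi := hr.integrable_D
  have hdi := hint.abs.integral_prod_left
  have hj : Integrable fun x => smoothAbs δ (G 0 x) :=
    Continuous.integrable_of_hasCompactSupport
      ((contDiff_smoothAbs hδ).continuous.comp (G 0).continuous)
      ((G 0).hasCompactSupport.comp_left (smoothAbs_zero hδ))
  have hlow : ∫ x, |G 0 x| ≤ (∫ x, smoothAbs δ (G 0 x)) + δ * v₀ := by
    have hball : Integrable ((Metric.closedBall (0 : Space d) R₀).indicator fun _ => δ) :=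
      (integrable_indicator_iff measurableSet_closedBall).2
        (integrableOn_const measure_closedBall_lt_top.ne)
    have e : δ * v₀ = ∫ x, (Metric.closedBall (0 : Space d) R₀).indicator (fun _ => δ) x := by
      rw [integral_indicator measurableSet_closedBall, setIntegral_const, smul_eq_mul, mul_comm]
    rw [e, ← integral_add hj hball]
    refine integral_mono ((G 0).continuous.integrable_of_hasCompactSupport
      (G 0).hasCompactSupport).abs (hj.add hball) fun x => ?_
    by_cases hx : x ∈ Metric.closedBall (0 : Space d) R₀
    · simp only [indicator_of_mem hx]
      linarith [abs_sub_le_smoothAbs (δ := δ) (G 0 x)]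
    · simp only [indicator_of_notMem hx]
      have : G 0 x = 0 := hz _ x (by simpa using hx)
      rw [this, smoothAbs_zero hδ]
      simp
  calc ∫ x, |G 0 x| ≤ (∫ x, smoothAbs δ (G 0 x)) + δ * v₀ := hlow
    _ ≤ (∫ t in Icc 0 T, ((∫ y, |∑ i ∈ s, dualTerm b divb B (θ i) (η i) (ψ i) t y|)
          + δ * (D t * v₀))) + δ * v₀ := by
        rw [hsw]
        gcongr ?_ + _
        exact integral_mono_ae hfub.integral_prod_left
          (hdi.add ((hDi.mul_const _).const_mul _)) htime
    _ = (∫ t in Icc 0 T, ∫ y, |∑ i ∈ s, dualTerm b divb B (θ i) (η i) (ψ i) t y|) + δ * A := by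
        rw [integral_add hdi ((hDi.mul_const _).const_mul _), integral_const_mul,
          integral_mul_const, hA]
        ring
    _ ≤ _ := by
        gcongr
        rw [hδ_def, div_mul_eq_mul_div, div_le_iff₀ (by positivity)]
        nlinarith

end

/-! ### Solutions by duality -/

section

variable {Ω : Type*} {T : ℝ}

/-- The integral of `θ(w, ·)` over `(t, T]`, for `t ∈ [0,T]`. -/
def tailIntegral (T : ℝ) (θ : Ω × ℝ → ℝ) (z : Ω × ℝ) : ℝ :=
  ∫ r in Icc 0 T, (Ioi z.2).indicator (fun r => θ (z.1, r)) r

/-- The integral of `k(w, ·)` over `[0, t]`, for `t ∈ [0,T]`. -/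
def headIntegral (T : ℝ) (k : Ω × ℝ → ℝ) (z : Ω × ℝ) : ℝ :=
  ∫ r in Icc 0 T, (Iic z.2).indicator (fun r => k (z.1, r)) r

theorem tailIntegral_eq (θ : Ω × ℝ → ℝ) (w : Ω) {t : ℝ} (ht : t ∈ Icc 0 T) :
    tailIntegral T θ (w, t) = ∫ r in t..T, θ (w, r) := by
  rw [tailIntegral, setIntegral_indicator measurableSet_Ioi, intervalIntegral.integral_of_le ht.2]
  congr 2
  ext r
  simp only [mem_inter_iff, mem_Icc, mem_Ioi, mem_Ioc]
  exact ⟨fun h => ⟨h.2, h.1.2⟩, fun h => ⟨⟨ht.1.trans h.1.le, h.2⟩, h.1⟩⟩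

theorem headIntegral_eq (k : Ω × ℝ → ℝ) (w : Ω) {t : ℝ} (ht : t ∈ Icc 0 T) :
    headIntegral T k (w, t) = ∫ r in (0 : ℝ)..t, k (w, r) := by
  rw [headIntegral, setIntegral_indicator measurableSet_Iic, intervalIntegral.integral_of_le ht.1,
    ← integral_Icc_eq_integral_Ioc]
  congr 2
  ext r
  simp only [mem_inter_iff, mem_Icc, mem_Iic]
  exact ⟨fun h => ⟨h.1.1, h.2⟩, fun h => ⟨⟨h.1, h.2.trans ht.2⟩, h.2⟩⟩

theorem abs_tailIntegral_le (hT : 0 ≤ T) {θ : Ω × ℝ → ℝ} {w : Ω} {K : ℝ}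
    (h : ∀ r, |θ (w, r)| ≤ K) (t : ℝ) : |tailIntegral T θ (w, t)| ≤ T * K := by
  rw [← Real.norm_eq_abs]
  refine (norm_setIntegral_le_of_norm_le_const (C := K) (by simp) fun r _ => ?_).trans ?_
  · refine (norm_indicator_le_norm_self _ _).trans ?_
    exact h r
  · rw [Real.volume_real_Icc_of_le hT, sub_zero, mul_comm]

end

section

variable {d : ℕ} {Ω : Type*} [MeasurableSpace Ω] {P : Measure Ω} [IsProbabilityMeasure P]
  {p q : ℝ≥0∞} [ENNReal.HolderConjugate p q] {T : ℝ}
  {b : ℝ → Space d → Space d} {divb : ℝ → Space d → ℝ} {Db : ℝ → Space d → Space d →L[ℝ] Space d}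
  {f : ℝ → Space d → ℝ} {D F : ℝ → ℝ} {B : ℝ → Ω → Space d} {u₀ : Space d → ℝ}

theorem stronglyMeasurable_tailIntegral {θ : Ω × ℝ → ℝ} (hθ : StronglyMeasurable θ) :
    StronglyMeasurable (tailIntegral T θ) := by
  have h : StronglyMeasurable fun y : (Ω × ℝ) × ℝ =>
      (Ioi y.1.2).indicator (fun r => θ (y.1.1, r)) y.2 := by
    have h1 : StronglyMeasurable fun y : (Ω × ℝ) × ℝ => θ (y.1.1, y.2) :=
      hθ.comp_measurable (by fun_prop)
    have h2 : MeasurableSet {y : (Ω × ℝ) × ℝ | y.1.2 < y.2} :=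
      measurableSet_lt (by fun_prop) (by fun_prop)
    exact h1.indicator h2
  exact h.integral_prod_right'

theorem stronglyMeasurable_headIntegral {k : Ω × ℝ → ℝ} (hk : StronglyMeasurable k) :
    StronglyMeasurable (headIntegral T k) := by
  have h : StronglyMeasurable fun y : (Ω × ℝ) × ℝ =>
      (Iic y.1.2).indicator (fun r => k (y.1.1, r)) y.2 := by
    have h1 : StronglyMeasurable fun y : (Ω × ℝ) × ℝ => k (y.1.1, y.2) :=
      hk.comp_measurable (by fun_prop)
    have h2 : MeasurableSet {y : (Ω × ℝ) × ℝ | y.2 ≤ y.1.2} :=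
      measurableSet_le (by fun_prop) (by fun_prop)
    exact h1.indicator h2
  exact h.integral_prod_right'

theorem stronglyMeasurable_process (hBc : ∀ w, Continuous fun t => B t w)
    (hBm : ∀ t, StronglyMeasurable (B t)) : StronglyMeasurable fun z : Ω × ℝ => B z.2 z.1 := by
  have h := stronglyMeasurable_uncurry_of_continuous_of_stronglyMeasurable (u := B) hBc hBm
  exact h.comp_measurable measurable_swap

theorem stronglyMeasurable_testFun_process (hBj : StronglyMeasurable fun z : Ω × ℝ => B z.2 z.1)
    (ψ : TestFun d) :
    StronglyMeasurable fun z : Ω × (ℝ × Space d) => ψ (z.2.2 - B z.2.1 z.1) := by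
  have h1 : StronglyMeasurable fun z : Ω × (ℝ × Space d) => B z.2.1 z.1 :=
    hBj.comp_measurable (g := fun z : Ω × (ℝ × Space d) => (z.1, z.2.1)) (by fun_prop)
  have h2 : StronglyMeasurable fun z : Ω × (ℝ × Space d) => z.2.2 :=
    (measurable_snd.comp measurable_snd).stronglyMeasurable
  exact ψ.continuous.comp_stronglyMeasurable (h2.sub h1)

theorem RegularDrift.stronglyMeasurable_transport_process (hr : RegularDrift T q b divb Db f D F)
    (hBj : StronglyMeasurable fun z : Ω × ℝ => B z.2 z.1) (ψ : TestFun d) :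
    StronglyMeasurable fun z : Ω × (ℝ × Space d) =>
      fderiv ℝ ψ (z.2.2 - B z.2.1 z.1) (b z.2.1 z.2.2) + divb z.2.1 z.2.2 *
        ψ (z.2.2 - B z.2.1 z.1) := by
  have h1 : StronglyMeasurable fun z : Ω × (ℝ × Space d) => B z.2.1 z.1 :=
    hBj.comp_measurable (g := fun z : Ω × (ℝ × Space d) => (z.1, z.2.1)) (by fun_prop)
  have h2 : StronglyMeasurable fun z : Ω × (ℝ × Space d) => z.2.2 :=
    (measurable_snd.comp measurable_snd).stronglyMeasurable
  have h3 := (continuous_fderiv_testFun ψ).comp_stronglyMeasurable (h2.sub h1)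
  have h4 : StronglyMeasurable fun z : Ω × (ℝ × Space d) => b z.2.1 z.2.2 :=
    hr.meas.comp_measurable measurable_snd
  have h5 : StronglyMeasurable fun z : Ω × (ℝ × Space d) => divb z.2.1 z.2.2 :=
    hr.meas_div.comp_measurable measurable_snd
  exact ((isBoundedBilinearMap_apply (𝕜 := ℝ) (E := Space d)
    (F := ℝ)).continuous.comp_stronglyMeasurable (h3.prodMk h4)).add
    (h5.mul (stronglyMeasurable_testFun_process hBj ψ))

theorem dualTerm_const_mul (b : ℝ → Space d → Space d) (divb : ℝ → Space d → ℝ) (β : ℝ → Space d)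
    (c : ℝ) (θ η : ℝ → ℝ) (ψ : TestFun d) (t : ℝ) (y : Space d) :
    dualTerm b divb β (fun t => c * θ t) (fun t => c * η t) ψ t y
      = c * dualTerm b divb β θ η ψ t y := by
  simp only [dualTerm]
  ring

/-- The dual integrand along the paths of the process `B`. -/
def dualProcess (T : ℝ) (b : ℝ → Space d → Space d) (divb : ℝ → Space d → ℝ)
    (B : ℝ → Ω → Space d) (θ : Ω × ℝ → ℝ) (ψ : TestFun d) (z : Ω × (ℝ × Space d)) : ℝ :=
  dualTerm b divb (fun t => B t z.1) (fun t => θ (z.1, t)) (fun t => tailIntegral T θ (z.1, t)) ψ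
    z.2.1 z.2.2

theorem abs_integral_mul_testFun_le {M : ℝ} (hM : ∀ x, |u₀ x| ≤ M) {k : Space d → ℝ}
    (hk : Integrable k) : |∫ x, u₀ x * k x| ≤ M * ∫ x, |k x| := by
  rw [← integral_const_mul, ← Real.norm_eq_abs]
  refine norm_integral_le_of_norm_le (hk.abs.const_mul M) (ae_of_all _ fun x => ?_)
  rw [norm_mul]
  exact mul_le_mul_of_nonneg_right (hM x) (abs_nonneg _)

theorem integrable_testFun_sub (ψ : TestFun d) (a : Space d) : Integrable fun y => ψ (y - a) :=
  ((ψ.continuous.integrable_of_hasCompactSupport ψ.hasCompactSupport).comp_sub_right a)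

theorem stronglyMeasurable_initial (hu₀ : StronglyMeasurable u₀)
    (hBm : ∀ t, StronglyMeasurable (B t)) (ψ : TestFun d) :
    StronglyMeasurable fun w => ∫ x, u₀ x * ψ (x - B 0 w) := by
  have h : StronglyMeasurable fun z : Ω × Space d => u₀ z.2 * ψ (z.2 - B 0 z.1) :=
    (hu₀.comp_measurable measurable_snd).mul (ψ.continuous.comp_stronglyMeasurable
      (measurable_snd.stronglyMeasurable.sub ((hBm 0).comp_measurable measurable_fst)))
  exact h.integral_prod_right'

/-- The functional defined by the initial condition on the dual integrands is represented by a
bounded function. -/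
theorem RegularDrift.exists_dual_density (hT : 0 ≤ T) (hr : RegularDrift T q b divb Db f D F)
    (hBm : ∀ t, StronglyMeasurable (B t)) (hu₀ : StronglyMeasurable u₀) {M : ℝ}
    (hM : ∀ x, |u₀ x| ≤ M) : ∃ U : Ω × (ℝ × Space d) → ℝ, StronglyMeasurable U ∧
      (∀ z, |U z| ≤ M) ∧ ∀ (θ : Ω × ℝ → ℝ) (ψ : TestFun d), StronglyMeasurable θ →
        (∀ z, |θ z| ≤ 1) →
        Integrable (dualProcess T b divb B θ ψ) (P.prod ((volume.restrict (Icc 0 T)).prod volume)) →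
        ∫ w, tailIntegral T θ (w, 0) * (∫ x, u₀ x * ψ (x - B 0 w)) ∂P
          = ∫ z, U z * dualProcess T b divb B θ ψ z
            ∂(P.prod ((volume.restrict (Icc 0 T)).prod volume)) := by
  set κ : Measure (Ω × (ℝ × Space d)) := P.prod ((volume.restrict (Icc 0 T)).prod volume) with hκ
  have hM0 : 0 ≤ M := (abs_nonneg _).trans (hM 0)
  set ι : Type _ := {i : (Ω × ℝ → ℝ) × TestFun d // StronglyMeasurable i.1 ∧ (∀ z, |i.1 z| ≤ 1) ∧
    Integrable (dualProcess T b divb B i.1 i.2) κ} with hι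
  set a : ι → ℝ := fun i => ∫ w, tailIntegral T i.1.1 (w, 0) * (∫ x, u₀ x * i.1.2 (x - B 0 w)) ∂P
    with ha
  have hai : ∀ i : ι, Integrable (fun w => tailIntegral T i.1.1 (w, 0)
      * ∫ x, u₀ x * i.1.2 (x - B 0 w)) P := by
    intro i
    refine Integrable.of_bound (C := T * 1 * (M * ∫ x, |i.1.2 x|)) ?_ (ae_of_all _ fun w => ?_)
    · exact (((stronglyMeasurable_tailIntegral i.2.1).comp_measurable
        (measurable_id.prodMk measurable_const)).mul
        (stronglyMeasurable_initial hu₀ hBm i.1.2)).aestronglyMeasurable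
    · rw [norm_mul]
      refine mul_le_mul (abs_tailIntegral_le hT (fun r => i.2.2.1 _) 0) ?_
        (norm_nonneg _) (by positivity)
      refine (abs_integral_mul_testFun_le hM (integrable_testFun_sub _ _)).trans_eq ?_
      rw [integral_sub_right_eq_self (fun x => |i.1.2 x|) (B 0 w)]
  obtain ⟨U, hUm, hUM, hU⟩ := exists_bounded_density (κ := κ)
    (τ := fun i : ι => dualProcess T b divb B i.1.1 i.1.2) (fun i => i.2.2.2) (a := a) hM0 (by
    intro s c
    have hsum : Integrable (fun z => ∑ i ∈ s, c i * dualProcess T b divb B i.1.1 i.1.2 z) κ :=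
      integrable_finsetSum _ fun i _ => i.2.2.2.const_mul _
    have e1 : ∑ i ∈ s, c i * a i = ∫ w, (∫ x, u₀ x *
        ∑ i ∈ s, (c i * tailIntegral T i.1.1 (w, 0)) * i.1.2 (x - B 0 w)) ∂P := by
      have e0 : ∑ i ∈ s, c i * a i = ∑ i ∈ s, ∫ w, c i * (tailIntegral T i.1.1 (w, 0)
          * ∫ x, u₀ x * i.1.2 (x - B 0 w)) ∂P :=
        Finset.sum_congr rfl fun i _ => (integral_const_mul _ _).symm
      rw [e0, ← integral_finsetSum _ fun i _ => (hai i).const_mul (c i)]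
      refine integral_congr_ae (ae_of_all _ fun w => ?_)
      simp only [Finset.mul_sum]
      rw [integral_finsetSum]
      · refine Finset.sum_congr rfl fun i _ => ?_
        rw [← mul_assoc, ← integral_const_mul]
        refine integral_congr_ae (ae_of_all _ fun x => ?_)
        simp only
        ring
      · intro i _
        have := ((integrable_testFun_sub i.1.2 (B 0 w)).bdd_mul hu₀.aestronglyMeasurable
          (ae_of_all _ hM)).const_mul (c i * tailIntegral T i.1.1 (w, 0))
        refine this.congr (ae_of_all _ fun x => ?_)
        simp only
        ring
    have hpath : ∀ᵐ w ∂P, ‖∫ x, u₀ x *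
        ∑ i ∈ s, (c i * tailIntegral T i.1.1 (w, 0)) * i.1.2 (x - B 0 w)‖
        ≤ M * ∫ y, |∑ i ∈ s, c i * dualProcess T b divb B i.1.1 i.1.2 (w, y)|
          ∂((volume.restrict (Icc 0 T)).prod volume) := by
      filter_upwards [hsum.prod_right_ae] with w hw
      have hi : Integrable fun x => ∑ i ∈ s,
          (c i * tailIntegral T i.1.1 (w, 0)) * i.1.2 (x - B 0 w) :=
        integrable_finsetSum _ fun i _ => (integrable_testFun_sub _ _).const_mul _
      refine (abs_integral_mul_testFun_le hM hi).trans (mul_le_mul_of_nonneg_left ?_ hM0)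
      rw [integral_sub_right_eq_self (fun x => |∑ i ∈ s,
        (c i * tailIntegral T i.1.1 (w, 0)) * i.1.2 x|) (B 0 w), integral_prod _ hw.abs]
      have hs : (fun z : ℝ × Space d => ∑ i ∈ s, dualTerm b divb (fun t => B t w)
          (fun t => c i * i.1.1 (w, t)) (fun t => c i * tailIntegral T i.1.1 (w, t)) i.1.2 z.1 z.2)
          = fun y => ∑ i ∈ s, c i * dualProcess T b divb B i.1.1 i.1.2 (w, y) := by
        funext z
        simp only [dualTerm_const_mul, dualProcess]
      have h := hr.integral_abs_le_of_dual hT (B := fun t => B t w) s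
        (θ := fun i t => c i * i.1.1 (w, t)) (η := fun i t => c i * tailIntegral T i.1.1 (w, t))
        (fun i => (i.2.1.comp_measurable measurable_prodMk_left).const_mul (c i))
        (K := fun i => |c i| * 1)
        (fun i t => by
          rw [abs_mul]; exact mul_le_mul_of_nonneg_left (i.2.2.1 _) (abs_nonneg _))
        (fun i t ht => by rw [tailIntegral_eq _ _ ht, intervalIntegral.integral_const_mul])
        (fun i => i.1.2) (by rw [hs]; exact hw)
      refine h.trans_eq ?_
      simp only [dualTerm_const_mul, dualProcess]
    rw [e1, ← Real.norm_eq_abs, integral_prod _ hsum.abs, ← integral_const_mul]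
    exact norm_integral_le_of_norm_le (hsum.abs.integral_prod_left.const_mul M) hpath)
  exact ⟨U, hUm, hUM, fun θ ψ h1 h2 h3 => hU ⟨(θ, ψ), h1, h2, h3⟩⟩

end

section

variable {d : ℕ} {Ω : Type*} [MeasurableSpace Ω] {P : Measure Ω} [IsProbabilityMeasure P]
  {p q : ℝ≥0∞} [ENNReal.HolderConjugate p q] {T : ℝ}
  {b : ℝ → Space d → Space d} {divb : ℝ → Space d → ℝ} {Db : ℝ → Space d → Space d →L[ℝ] Space d}
  {f : ℝ → Space d → ℝ} {D F : ℝ → ℝ} {B : ℝ → Ω → Space d} {u₀ : Space d → ℝ}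

theorem boundedLpLoc_of_bound {u : ℝ → Space d → ℝ} (hu : StronglyMeasurable (Function.uncurry u))
    {M : ℝ} (hM : ∀ t x, |u t x| ≤ M) : BoundedLpLoc T p u := by
  refine ⟨hu, fun R => ⟨eLpNorm (fun _ : Space d => M) p (volume.restrict (Metric.closedBall 0 R)),
    (memLp_const _).2.ne, ae_of_all _ fun t => eLpNorm_mono fun x => ?_⟩⟩
  exact (hM t x).trans (le_abs_self M)

/-- The transport term, in moving coordinates, is integrable along every path. -/
theorem RegularDrift.lintegral_transport_path_ne_top (p : ℝ≥0∞) [ENNReal.HolderConjugate p q]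
    (hr : RegularDrift T q b divb Db f D F) {β : ℝ → Space d} (hβ : Continuous β) (ψ : TestFun d) :
    ∫⁻ t in Icc 0 T, ∫⁻ y, ‖fderiv ℝ ψ (y - β t) (b t y) + divb t y * ψ (y - β t)‖ₑ ≠ ⊤ := by
  obtain ⟨ρ, hρ0, hρ⟩ := exists_norm_le_path hβ T
  obtain ⟨C, R, hC, hR, h1, h2, h3⟩ := exists_testFun_bound ψ
  have hu : BoundedLpLoc T p fun (_ : ℝ) (_ : Space d) => (1 : ℝ) :=
    boundedLpLoc_of_bound stronglyMeasurable_const (M := 1) fun _ _ => by simp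
  refine ne_top_of_le_ne_top (b := ∫⁻ t in Icc 0 T, ENNReal.ofReal C *
    localMass (R + ρ) (b t) (divb t) (fun _ => 1)) ?_ ?_
  · rw [lintegral_const_mul _ (hr.measurable_localMass hu.meas _)]
    exact ENNReal.mul_ne_top ENNReal.ofReal_ne_top (hr.lintegral_localMass_ne_top hu _)
  · refine lintegral_mono_ae ?_
    filter_upwards [ae_restrict_mem measurableSet_Icc] with t ht
    have h := lintegral_enorm_pairing_le (b := b t) (divb := divb t) (R := R + ρ) (C := C)
      (fun _ => 1) (A := fun y => fderiv ℝ ψ (y - β t)) (a := fun y => ψ (y - β t))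
      (fun x => h2 _) (fun x => h1 _)
      (fun x hx => h3 _ (by linarith [norm_sub_norm_le x (β t), hρ t ht]))
    simpa using h

/-- The function which represents the dual functional solves, almost everywhere in the probability
space and in time, the equation in moving coordinates. -/
theorem RegularDrift.ae_integral_eq_of_dual (p : ℝ≥0∞) [ENNReal.HolderConjugate p q] (hT : 0 ≤ T)
    (hr : RegularDrift T q b divb Db f D F)
    (hBc : ∀ w, Continuous fun t => B t w) (hBm : ∀ t, StronglyMeasurable (B t))
    (hu₀ : StronglyMeasurable u₀) {M : ℝ} (hM : ∀ x, |u₀ x| ≤ M)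
    {U : Ω × (ℝ × Space d) → ℝ} (hU : StronglyMeasurable U) (hUM : ∀ z, |U z| ≤ M)
    (hrep : ∀ (θ : Ω × ℝ → ℝ) (ψ : TestFun d), StronglyMeasurable θ →
        (∀ z, |θ z| ≤ 1) →
        Integrable (dualProcess T b divb B θ ψ) (P.prod ((volume.restrict (Icc 0 T)).prod volume)) →
        ∫ w, tailIntegral T θ (w, 0) * (∫ x, u₀ x * ψ (x - B 0 w)) ∂P
          = ∫ z, U z * dualProcess T b divb B θ ψ z
            ∂(P.prod ((volume.restrict (Icc 0 T)).prod volume))) (ψ : TestFun d) :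
    ∀ᵐ z ∂(P.prod (volume.restrict (Icc 0 T))), ∫ y, U (z.1, (z.2, y)) * ψ (y - B z.2 z.1)
      = (∫ x, u₀ x * ψ (x - B 0 z.1)) + ∫ s in (0 : ℝ)..z.2, transport (b s) (divb s)
          (fun y => U (z.1, (s, y))) (translate ψ (B s z.1)) := by
  set ν : Measure ℝ := volume.restrict (Icc 0 T) with hν
  have hM0 : 0 ≤ M := (abs_nonneg _).trans (hM 0)
  have hBj := stronglyMeasurable_process hBc hBm
  have hψi : ∀ a : Space d, Integrable fun y => ψ (y - a) := integrable_testFun_sub ψ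
  have hΦm := stronglyMeasurable_testFun_process hBj ψ
  set L : Ω × (ℝ × Space d) → ℝ := fun z => fderiv ℝ ψ (z.2.2 - B z.2.1 z.1) (b z.2.1 z.2.2)
    + divb z.2.1 z.2.2 * ψ (z.2.2 - B z.2.1 z.1) with hL
  have hLm : StronglyMeasurable L := hr.stronglyMeasurable_transport_process hBj ψ
  have hLi : ∀ w, ∀ᵐ t ∂ν, Integrable fun y => L (w, (t, y)) := fun w =>
    hr.regular.mono fun t ht => by
      simpa only [fderiv_translate, translate_apply] using
        ht.weakDiv.integrable_transport (translate ψ (B t w))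
  set G : Ω → ℝ≥0∞ := fun w => ∫⁻ t, (∫⁻ y, ‖L (w, (t, y))‖ₑ) ∂ν with hG
  have hGt : ∀ w, G w ≠ ⊤ := fun w => hr.lintegral_transport_path_ne_top p (hBc w) ψ
  have hLm1 : Measurable fun z : Ω × ℝ => ∫⁻ y, ‖L (z.1, (z.2, y))‖ₑ := by
    have h : Measurable fun z : (Ω × ℝ) × Space d => ‖L (z.1.1, (z.1.2, z.2))‖ₑ :=
      (hLm.comp_measurable (g := fun z : (Ω × ℝ) × Space d => (z.1.1, (z.1.2, z.2)))
        (by fun_prop)).enorm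
    exact h.lintegral_prod_right'
  have hGm : Measurable G := hLm1.lintegral_prod_right'
  -- the weight that makes the dual integrands integrable on the probability space
  set wt : Ω → ℝ := fun w => (1 + (G w).toReal)⁻¹ with hwt
  have hwt0 : ∀ w, 0 < wt w := fun w => inv_pos.2 (by positivity)
  have hwt1 : ∀ w, wt w ≤ 1 := fun w => inv_le_one_of_one_le₀ (by
    linarith [ENNReal.toReal_nonneg (a := G w)])
  have hwtG : ∀ w, wt w * (G w).toReal ≤ 1 := fun w => by
    rw [hwt, inv_mul_le_one₀ (by positivity)]
    linarith
  have hwtm : StronglyMeasurable wt :=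
    ((measurable_const.add hGm.ennreal_toReal).inv).stronglyMeasurable
  -- the two sides of the equation
  set X : Ω × ℝ → ℝ := fun z => ∫ y, U (z.1, (z.2, y)) * ψ (y - B z.2 z.1) with hX
  set X₀ : Ω → ℝ := fun w => ∫ x, u₀ x * ψ (x - B 0 w) with hX₀
  set k : Ω × ℝ → ℝ := fun z => ∫ y, U (z.1, (z.2, y)) * L (z.1, (z.2, y)) with hk
  have hass : Measurable fun z : (Ω × ℝ) × Space d => (z.1.1, (z.1.2, z.2)) := by fun_prop
  have hXm : StronglyMeasurable X := by
    have h := (hU.mul hΦm).comp_measurable hass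
    exact h.integral_prod_right'
  have hkm : StronglyMeasurable k := by
    have h := (hU.mul hLm).comp_measurable hass
    exact h.integral_prod_right'
  have hX₀m : StronglyMeasurable X₀ := stronglyMeasurable_initial hu₀ hBm ψ
  set N : ℝ := M * ∫ y, |ψ y| with hN
  have hXb : ∀ z, |X z| ≤ N := fun z => by
    refine (abs_integral_mul_testFun_le (u₀ := fun y => U (z.1, (z.2, y))) (fun y => hUM _)
      (hψi (B z.2 z.1))).trans_eq ?_
    rw [integral_sub_right_eq_self (fun x => |ψ x|)]
  have hX₀b : ∀ w, |X₀ w| ≤ N := fun w => by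
    refine (abs_integral_mul_testFun_le hM (hψi (B 0 w))).trans_eq ?_
    rw [integral_sub_right_eq_self (fun x => |ψ x|)]
  have hkb : ∀ w t, ‖k (w, t)‖ₑ ≤ ENNReal.ofReal M * ∫⁻ y, ‖L (w, (t, y))‖ₑ := by
    intro w t
    refine (enorm_integral_le_lintegral_enorm _).trans ?_
    rw [← lintegral_const_mul' _ _ ENNReal.ofReal_ne_top]
    refine lintegral_mono fun y => ?_
    rw [enorm_mul]
    gcongr
    rw [← ofReal_norm]
    exact ENNReal.ofReal_le_ofReal (hUM _)
  have hkG : ∀ w, ∫⁻ t, ‖k (w, t)‖ₑ ∂ν ≤ ENNReal.ofReal M * G w := by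
    intro w
    rw [hG, ← lintegral_const_mul' _ _ ENNReal.ofReal_ne_top]
    exact lintegral_mono fun t => hkb w t
  have hki : ∀ w, Integrable (fun t => k (w, t)) ν := fun w =>
    ⟨(hkm.comp_measurable measurable_prodMk_left).aestronglyMeasurable,
      (hkG w).trans_lt (ENNReal.mul_lt_top ENNReal.ofReal_lt_top (hGt w).lt_top)⟩
  set K : Ω × ℝ → ℝ := headIntegral T k with hK
  have hKm : StronglyMeasurable K := stronglyMeasurable_headIntegral hkm
  have hKb : ∀ w t, wt w * |K (w, t)| ≤ M := by
    intro w t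
    have h1 : |K (w, t)| ≤ M * (G w).toReal := by
      rw [← Real.norm_eq_abs, ← toReal_enorm, ← ENNReal.toReal_ofReal hM0, ← ENNReal.toReal_mul]
      refine ENNReal.toReal_mono (ENNReal.mul_ne_top ENNReal.ofReal_ne_top (hGt w)) ?_
      refine (enorm_integral_le_lintegral_enorm _).trans (le_trans (lintegral_mono fun r => ?_)
        (hkG w))
      exact enorm_indicator_le_enorm_self _ _
    calc wt w * |K (w, t)| ≤ wt w * (M * (G w).toReal) := by gcongr
      _ = M * (wt w * (G w).toReal) := by ring
      _ ≤ M * 1 := by gcongr; exact hwtG w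
      _ = M := mul_one M
  -- the weighted defect is integrable and its integral over every set vanishes
  set h : Ω × ℝ → ℝ := fun z => wt z.1 * (X z - X₀ z.1 - K z) with hh
  have hwm : StronglyMeasurable fun z : Ω × ℝ => wt z.1 := hwtm.comp_measurable measurable_fst
  have hX₀m' : StronglyMeasurable fun z : Ω × ℝ => X₀ z.1 := hX₀m.comp_measurable measurable_fst
  have hhi : Integrable h (P.prod ν) := by
    refine Integrable.of_bound (C := N + N + M)
      (hwm.mul ((hXm.sub hX₀m').sub hKm)).aestronglyMeasurable (ae_of_all _ fun z => ?_)
    have e : h z = wt z.1 * X z - wt z.1 * X₀ z.1 - wt z.1 * K z := by simp only [hh]; ring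
    have b1 : ∀ c : ℝ, |c| ≤ N → |wt z.1 * c| ≤ N := fun c hc => by
      rw [abs_mul, abs_of_pos (hwt0 _)]
      exact (mul_le_of_le_one_left (abs_nonneg _) (hwt1 _)).trans hc
    have b2 : |wt z.1 * K z| ≤ M := by
      rw [abs_mul, abs_of_pos (hwt0 _)]
      exact hKb z.1 z.2
    rw [e, Real.norm_eq_abs]
    have h1 := abs_sub (wt z.1 * X z - wt z.1 * X₀ z.1) (wt z.1 * K z)
    have h2 := abs_sub (wt z.1 * X z) (wt z.1 * X₀ z.1)
    linarith [b1 _ (hXb z), b1 _ (hX₀b z.1)]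
  have hzero : ∀ A, MeasurableSet A → ∫ z in A, h z ∂(P.prod ν) = 0 := by
    intro A hA
    set θ : Ω × ℝ → ℝ := A.indicator fun z => wt z.1 with hθ
    have hθm : StronglyMeasurable θ := hwm.indicator hA
    have hθw : ∀ z, |θ z| ≤ wt z.1 := fun z => by
      exact (norm_indicator_le_norm_self (fun z : Ω × ℝ => wt z.1) z).trans_eq
        (abs_of_pos (hwt0 _))
    have hθ1 : ∀ z, |θ z| ≤ 1 := fun z => (hθw z).trans (hwt1 _)
    have hθi : ∀ w, Integrable (fun t => θ (w, t)) ν := fun w =>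
      Integrable.of_bound (hθm.comp_measurable measurable_prodMk_left).aestronglyMeasurable 1
        (ae_of_all _ fun t => hθ1 _)
    have hηb : ∀ w t, |tailIntegral T θ (w, t)| ≤ T * wt w := fun w t =>
      abs_tailIntegral_le hT (fun r => hθw (w, r)) t
    -- integrability of the dual integrand
    have hτ : Integrable (dualProcess T b divb B θ ψ) (P.prod (ν.prod volume)) := by
      have m1 : StronglyMeasurable fun z : Ω × (ℝ × Space d) => θ (z.1, z.2.1) :=
        hθm.comp_measurable (by fun_prop)
      have m2 : StronglyMeasurable fun z : Ω × (ℝ × Space d) => tailIntegral T θ (z.1, z.2.1) :=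
        (stronglyMeasurable_tailIntegral hθm).comp_measurable (by fun_prop)
      have i1 : Integrable (fun z : Ω × (ℝ × Space d) =>
          θ (z.1, z.2.1) * ψ (z.2.2 - B z.2.1 z.1)) (P.prod (ν.prod volume)) := by
        refine ⟨(m1.mul hΦm).aestronglyMeasurable, ?_⟩
        have hm : Measurable fun z : Ω × (ℝ × Space d) =>
          ‖θ (z.1, z.2.1) * ψ (z.2.2 - B z.2.1 z.1)‖ₑ := (m1.mul hΦm).enorm
        rw [HasFiniteIntegral, lintegral_prod _ hm.aemeasurable]
        calc _ ≤ ∫⁻ _, (∫⁻ _, (∫⁻ y, ‖ψ y‖ₑ) ∂ν) ∂P := by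
              refine lintegral_mono fun w => ?_
              refine (lintegral_prod _ (hm.comp measurable_prodMk_left).aemeasurable).trans_le ?_
              refine lintegral_mono fun t => ?_
              rw [← lintegral_sub_right_eq_self (fun y => ‖ψ y‖ₑ) (B t w)]
              refine lintegral_mono fun y => ?_
              simp only [enorm_mul]
              refine mul_le_of_le_one_left bot_le ?_
              rw [← ofReal_norm, ← ENNReal.ofReal_one]
              exact ENNReal.ofReal_le_ofReal (hθ1 _)
          _ < ⊤ := by
              simp only [lintegral_const]
              have h1 : ∫⁻ y, ‖ψ y‖ₑ < ⊤ :=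
                (ψ.continuous.integrable_of_hasCompactSupport ψ.hasCompactSupport).2
              exact ENNReal.mul_lt_top (ENNReal.mul_lt_top h1 (measure_lt_top _ _))
                (measure_lt_top _ _)
      have i2 : Integrable (fun z : Ω × (ℝ × Space d) =>
          tailIntegral T θ (z.1, z.2.1) * L z) (P.prod (ν.prod volume)) := by
        refine ⟨(m2.mul hLm).aestronglyMeasurable, ?_⟩
        have hm : Measurable fun z : Ω × (ℝ × Space d) =>
          ‖tailIntegral T θ (z.1, z.2.1) * L z‖ₑ := (m2.mul hLm).enorm
        rw [HasFiniteIntegral, lintegral_prod _ hm.aemeasurable]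
        calc _ ≤ ∫⁻ _, ENNReal.ofReal T ∂P := by
              refine lintegral_mono fun w => ?_
              refine (lintegral_prod _ (hm.comp measurable_prodMk_left).aemeasurable).trans_le ?_
              calc _ ≤ ∫⁻ t, (∫⁻ y, ENNReal.ofReal (T * wt w) * ‖L (w, (t, y))‖ₑ) ∂ν := by
                    refine lintegral_mono fun t => lintegral_mono fun y => ?_
                    simp only [enorm_mul]
                    refine mul_le_mul_left ?_ _
                    rw [← ofReal_norm]
                    exact ENNReal.ofReal_le_ofReal (hηb w t)
                _ = ENNReal.ofReal (T * wt w) * G w := by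
                    simp only [lintegral_const_mul' _ _ ENNReal.ofReal_ne_top, hG]
                _ ≤ ENNReal.ofReal T := by
                    rw [← ENNReal.ofReal_toReal (hGt w), ← ENNReal.ofReal_mul
                      (mul_nonneg hT (hwt0 w).le)]
                    refine ENNReal.ofReal_le_ofReal ?_
                    rw [mul_assoc]
                    exact mul_le_of_le_one_right hT (hwtG w)
          _ < ⊤ := by simp
      exact i1.sub i2
    have hUτ : Integrable (fun z => U z * dualProcess T b divb B θ ψ z) (P.prod (ν.prod volume)) :=
      hτ.bdd_mul hU.aestronglyMeasurable (ae_of_all _ hUM)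
    -- the representation formula, written as an iterated integral
    have hθX : Integrable (fun z : Ω × ℝ => θ z * X₀ z.1) (P.prod ν) := by
      refine Integrable.of_bound (hθm.mul hX₀m').aestronglyMeasurable (1 * N)
        (ae_of_all _ fun z => ?_)
      simp only [norm_mul]
      exact mul_le_mul (hθ1 z) (hX₀b _) (norm_nonneg _) zero_le_one
    have e1 : ∀ w, tailIntegral T θ (w, 0) * X₀ w = ∫ t, θ (w, t) * X₀ w ∂ν := fun w => by
      rw [tailIntegral_eq _ _ ⟨le_rfl, hT⟩, integral_mul_const, hν, integral_Icc_eq_integral_Ioc,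
        ← intervalIntegral.integral_of_le hT]
    have j3 : ∀ w, Integrable (fun t => θ (w, t) * X (w, t)) ν := fun w =>
      (hθi w).mul_bdd (hXm.comp_measurable measurable_prodMk_left).aestronglyMeasurable
        (ae_of_all _ fun t => hXb _)
    have j5 : ∀ w, Integrable (fun t => θ (w, t) * K (w, t)) ν := fun w => by
      refine Integrable.of_bound ((hθm.mul hKm).comp_measurable
        measurable_prodMk_left).aestronglyMeasurable M (ae_of_all _ fun t => ?_)
      rw [Real.norm_eq_abs, abs_mul]
      exact (mul_le_mul_of_nonneg_right (hθw _) (abs_nonneg _)).trans (hKb w t)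
    have e2 : ∀ᵐ w ∂P, ∫ y, U (w, y) * dualProcess T b divb B θ ψ (w, y) ∂(ν.prod volume)
        = ∫ t, θ (w, t) * X (w, t) - θ (w, t) * K (w, t) ∂ν := by
      filter_upwards [hUτ.prod_right_ae] with w hw
      rw [integral_prod _ hw]
      have a1 : ∀ᵐ t ∂ν, ∫ y, U (w, (t, y)) * dualProcess T b divb B θ ψ (w, (t, y))
          = θ (w, t) * X (w, t) - tailIntegral T θ (w, t) * k (w, t) := by
        filter_upwards [hLi w] with t ht
        have hUm' : AEStronglyMeasurable (fun y => U (w, (t, y))) volume :=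
          (hU.comp_measurable (g := fun y => (w, (t, y))) (by fun_prop)).aestronglyMeasurable
        have j1 := ((hψi (B t w)).bdd_mul hUm' (ae_of_all _ fun y => hUM _)).const_mul (θ (w, t))
        have j2 := (ht.bdd_mul hUm' (ae_of_all _ fun y => hUM _)).const_mul
          (tailIntegral T θ (w, t))
        simp only [hX, hk]
        rw [← integral_const_mul, ← integral_const_mul, ← integral_sub j1 j2]
        refine integral_congr_ae (ae_of_all _ fun y => ?_)
        simp only [dualProcess, dualTerm, hL]
        ring
      have j4 : Integrable (fun t => tailIntegral T θ (w, t) * k (w, t)) ν :=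
        (hki w).bdd_mul ((stronglyMeasurable_tailIntegral hθm).comp_measurable
          measurable_prodMk_left).aestronglyMeasurable (ae_of_all _ fun t => hηb w t)
      rw [integral_congr_ae a1, integral_sub (j3 w) j4, integral_sub (j3 w) (j5 w)]
      congr 1
      have a2 := integral_tail_mul (θ := fun t => θ (w, t)) (k := fun t => k (w, t)) (hθi w) (hki w)
      refine Eq.trans (setIntegral_congr_fun measurableSet_Icc fun t ht => ?_)
        (a2.trans (setIntegral_congr_fun measurableSet_Icc fun t ht => ?_))
      · simp only [tailIntegral_eq θ w ht]
      · simp only [hK, headIntegral_eq k w ht]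
    have e3 := hrep θ ψ hθm hθ1 hτ
    rw [integral_prod _ hUτ, integral_congr_ae e2, integral_congr_ae (ae_of_all _ e1)] at e3
    have hC : Integrable (fun w => ∫ t, θ (w, t) * X (w, t) - θ (w, t) * K (w, t) ∂ν) P :=
      hUτ.integral_prod_left.congr e2
    rw [← integral_indicator hA, integral_prod _ (hhi.indicator hA)]
    have e4 : ∀ w, ∫ t, A.indicator h (w, t) ∂ν
        = (∫ t, θ (w, t) * X (w, t) - θ (w, t) * K (w, t) ∂ν) - ∫ t, θ (w, t) * X₀ w ∂ν := by
      intro w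
      refine Eq.trans ?_ (integral_sub ((j3 w).sub (j5 w)) ((hθi w).mul_const _))
      refine integral_congr_ae (ae_of_all _ fun t => ?_)
      by_cases hz : (w, t) ∈ A
      · simp only [hθ, indicator_of_mem hz, hh]
        ring
      · simp only [hθ, indicator_of_notMem hz]
        ring
    rw [integral_congr_ae (ae_of_all _ e4), integral_sub hC hθX.integral_prod_left, ← e3, sub_self]
  have hae := hhi.ae_eq_zero_of_forall_setIntegral_eq_zero fun A hA _ => hzero A hA
  have hmem : ∀ᵐ z ∂(P.prod ν), z.2 ∈ Icc 0 T :=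
    Measure.quasiMeasurePreserving_snd.ae (ae_restrict_mem measurableSet_Icc)
  filter_upwards [hae, hmem] with z hz hzT
  have h1 : X z - X₀ z.1 - K z = 0 := (mul_eq_zero.1 hz).resolve_left (hwt0 _).ne'
  have h2 : K z = ∫ s in (0 : ℝ)..z.2, transport (b s) (divb s) (fun y => U (z.1, (s, y)))
      (translate ψ (B s z.1)) := by
    rw [hK, headIntegral_eq k z.1 hzT]
    simp only [hk, hL, transport, fderiv_translate, translate_apply]
  rw [← h2]
  linarith

end

/-! ### Solutions with bounded initial value -/

section

variable {d : ℕ}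

theorem mollify_congr_ae {u v : Space d → ℝ} (h : u =ᵐ[volume] v) (n : ℕ) (x : Space d) :
    mollify n u x = mollify n v x := by
  refine integral_congr_ae (h.mono fun y hy => ?_)
  simp only [hy]

theorem ae_eq_of_mollify_eq {u v : Space d → ℝ} (hu : LocallyIntegrable u)
    (hv : LocallyIntegrable v) (h : ∀ n x, mollify n u x = mollify n v x) : u =ᵐ[volume] v := by
  filter_upwards [ae_tendsto_mollifier_convolution hu, ae_tendsto_mollifier_convolution hv]
    with x h1 h2
  exact tendsto_nhds_unique h1 (h2.congr fun n => (h n x).symm)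

theorem ShiftedEquation.congr_ae {b : ℝ → Space d → Space d} {divb : ℝ → Space d → ℝ}
    {B : ℝ → Space d} {u₀ u₀' : Space d → ℝ} {u u' : ℝ → Space d → ℝ} {T t : ℝ}
    {v v' : Space d → ℝ} (h : ShiftedEquation b divb B u₀ u t v) (h₀ : u₀ =ᵐ[volume] u₀')
    (hu : ∀ᵐ s ∂(volume.restrict (Icc 0 T)), u s =ᵐ[volume] u' s) (hv : v =ᵐ[volume] v')
    (ht : t ∈ Icc 0 T) : ShiftedEquation b divb B u₀' u' t v' := by
  intro n x
  rw [← mollify_congr_ae hv, ← mollify_congr_ae h₀, h n x, intervalIntegral.integral_of_le ht.1,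
    intervalIntegral.integral_of_le ht.1]
  congr 1
  refine integral_congr_ae ?_
  have hs : Ioc 0 t ⊆ Icc 0 T := fun s hs => ⟨hs.1.le, hs.2.trans ht.2⟩
  filter_upwards [ae_restrict_of_ae_restrict_of_subset hs hu] with s h1
  refine integral_congr_ae (h1.mono fun y hy => ?_)
  simp only [hy]

end

section

variable {d : ℕ} {Ω : Type*} [MeasurableSpace Ω] {P : Measure Ω} [IsProbabilityMeasure P]
  {p q : ℝ≥0∞} [ENNReal.HolderConjugate p q] {T : ℝ}
  {b : ℝ → Space d → Space d} {divb : ℝ → Space d → ℝ} {Db : ℝ → Space d → Space d →L[ℝ] Space d}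
  {f : ℝ → Space d → ℝ} {D F : ℝ → ℝ} {B : ℝ → Ω → Space d} {u₀ : Space d → ℝ}

/-- By continuity in the translation it suffices to test the equation at a dense set of points. -/
theorem RegularDrift.shiftedEquation_of_dense (hr : RegularDrift T q b divb Db f D F)
    {u : ℝ → Space d → ℝ} (hu : BoundedLpLoc T p u) {β : ℝ → Space d} (hβ : Continuous β)
    (hu₀ : LocallyIntegrable u₀) {t : ℝ} (ht : t ∈ Icc 0 T) {v : Space d → ℝ}
    (hv : LocallyIntegrable v) {Q : Set (Space d)} (hQ : Dense Q)
    (h : ∀ n, ∀ x ∈ Q, mollify n v (x + β t) = mollify n u₀ (x + β 0)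
      + ∫ s in (0 : ℝ)..t, transport (b s) (divb s) (u s)
          (translate (mollifierTest d n) (x + β s))) :
    ShiftedEquation b divb β u₀ u t v := by
  intro n x
  simp only [mollifiedTransport_eq_transport]
  have h0 : (0 : ℝ) ∈ Icc 0 T := ⟨le_rfl, ht.1.trans ht.2⟩
  refine congrFun (Continuous.ext_on hQ ((contDiff_mollify hv n).continuous.comp (by fun_prop))
    (((contDiff_mollify hu₀ n).continuous.comp (by fun_prop)).add ?_) (h n)) x
  refine continuous_iff_continuousAt.2 fun x₀ => ?_
  obtain ⟨ρ, -, hρ⟩ := exists_norm_le_path hβ T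
  obtain ⟨C, R, hC, hL⟩ := exists_transport_lipschitz (mollifierTest d n) (‖x₀‖ + 1 + ρ)
  have hi : ∀ y, IntervalIntegrable (fun s => transport (b s) (divb s) (u s)
      (translate (mollifierTest d n) (y + β s))) volume 0 t := fun y =>
    intervalIntegrable_of_mem (hr.integrableOn_transport hu (continuous_const.add hβ) _) h0 ht
  have hm := intervalIntegrable_of_mem ((hr.integrableOn_localMass hu R).const_mul C) h0 ht
  refine continuousAt_of_locally_lipschitz one_pos
    (∫ s in (0 : ℝ)..t, C * (localMass R (b s) (divb s) (u s)).toReal) fun y hy => ?_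
  rw [dist_eq_norm, ← intervalIntegral.integral_sub (hi y) (hi x₀),
    ← intervalIntegral.integral_mul_const]
  refine intervalIntegral.norm_integral_le_of_norm_le ht.1 ?_ (hm.mul_const _)
  filter_upwards [(ae_restrict_iff' measurableSet_Icc).1 hr.regular,
    (ae_restrict_iff' measurableSet_Icc).1 hu.memLpLoc] with s h1 h2 hs
  have hsT : s ∈ Icc 0 T := ⟨hs.1.le, hs.2.trans ht.2⟩
  have hy' : ‖y‖ ≤ ‖x₀‖ + 1 := by
    rw [dist_eq_norm] at hy
    linarith [norm_sub_norm_le y x₀]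
  refine (hL (h1 hsT) (h2 hsT) (y + β s) ?_ (x₀ + β s) ?_).trans_eq ?_
  · rw [mem_closedBall_zero_iff]
    linarith [norm_add_le y (β s), hρ s hsT]
  · rw [mem_closedBall_zero_iff]
    linarith [norm_add_le x₀ (β s), hρ s hsT]
  · rw [add_sub_add_right_eq_sub, dist_eq_norm]

/-- If a bounded function solves the equation at almost every time, then the equation determines a
bounded function at every time: the bound on the pairings with linear combinations of mollifiers is
preserved by continuity in time. -/
theorem RegularDrift.exists_shiftedEquation (p : ℝ≥0∞) [ENNReal.HolderConjugate p q] (hT : 0 < T)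
    (hr : RegularDrift T q b divb Db f D F) {u : ℝ → Space d → ℝ}
    (hu : StronglyMeasurable (Function.uncurry u)) {M : ℝ} (hM : ∀ t x, |u t x| ≤ M)
    {β : ℝ → Space d} (hβ : Continuous β)
    (hsf : ∀ᵐ s ∂(volume.restrict (Icc (0 : ℝ) T)), ShiftedEquation b divb β u₀ u s (u s))
    {t : ℝ} (ht : t ∈ Icc 0 T) : ∃ v : Space d → ℝ, StronglyMeasurable v ∧ (∀ x, |v x| ≤ M) ∧
      ShiftedEquation b divb β u₀ u t v := by
  have hM0 : 0 ≤ M := (abs_nonneg _).trans (hM 0 0)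
  have hub : BoundedLpLoc T p u := boundedLpLoc_of_bound hu hM
  have hτi : ∀ (i : ℕ × Space d) (a : Space d),
      Integrable fun y => mollifier d i.1 (y - a - i.2) := fun i a =>
    ((integrable_mollifier i.1).comp_sub_right i.2).comp_sub_right a
  set V : ℕ × Space d → ℝ → ℝ := fun i s => mollify i.1 u₀ (i.2 + β 0) + ∫ r in (0 : ℝ)..s,
    mollifiedTransport (b r) (divb r) (u r) i.1 (i.2 + β r) with hV
  have hVc : ∀ i, ContinuousOn (V i) (Icc 0 T) := fun i =>
    continuousOn_of_eq_primitive (hr.integrableOn_mollifiedTransport hub hβ i.1 i.2) fun s _ => by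
      simp only [hV, intervalIntegral.integral_same, add_zero]
  have e : ∀ (v : Space d → ℝ) (i : ℕ × Space d) s, mollify i.1 v (i.2 + β s)
      = ∫ y, v y * mollifier d i.1 (y - β s - i.2) := fun v i s => by
    rw [mollify_eq_integral_translate]
    refine integral_congr_ae (ae_of_all _ fun y => ?_)
    simp only [translate_apply, coe_mollifierTest, sub_sub, add_comm]
  have hb : ∀ (S : Finset (ℕ × Space d)) (c : ℕ × Space d → ℝ),
      |∑ i ∈ S, c i * V i t| ≤ M * ∫ y, |∑ i ∈ S, c i * mollifier d i.1 (y - β t - i.2)| := by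
    intro S c
    rw [integral_sub_right_eq_self (fun y => |∑ i ∈ S, c i * mollifier d i.1 (y - i.2)|)]
    refine le_of_ae_le_of_continuousOn hT (g := fun s => |∑ i ∈ S, c i * V i s|)
      (continuousOn_finsetSum _ fun i _ => continuousOn_const.mul (hVc i)).abs ?_ t ht
    filter_upwards [hsf] with s hs
    have hus : AEStronglyMeasurable (u s) volume :=
      (hu.comp_measurable measurable_prodMk_left).aestronglyMeasurable
    have e1 : ∑ i ∈ S, c i * V i s
        = ∫ y, u s y * ∑ i ∈ S, c i * mollifier d i.1 (y - β s - i.2) := by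
      simp only [Finset.mul_sum]
      rw [integral_finsetSum _ fun i _ =>
        ((hτi i (β s)).const_mul (c i)).bdd_mul hus (ae_of_all _ fun y => hM s y)]
      refine Finset.sum_congr rfl fun i _ => ?_
      rw [show V i s = mollify i.1 (u s) (i.2 + β s) from (hs i.1 i.2).symm, e,
        ← integral_const_mul]
      exact integral_congr_ae (ae_of_all _ fun y => by ring)
    rw [e1, ← integral_sub_right_eq_self (fun y => |∑ i ∈ S, c i * mollifier d i.1 (y - i.2)|) (β s)]
    exact abs_integral_mul_testFun_le (hM s) (integrable_finsetSum _ fun i _ =>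
      (hτi i (β s)).const_mul (c i))
  obtain ⟨v, hvm, hvM, hv⟩ := exists_bounded_density (κ := (volume : Measure (Space d)))
    (fun i => hτi i (β t)) hM0 hb
  exact ⟨v, hvm, hvM, fun n x => (e v (n, x) t).trans (hv (n, x)).symm⟩

/-- For a bounded initial value there is a bounded jointly measurable process which solves the
equation in moving coordinates. At every time it is recovered from its mollifications, which the
equation prescribes. -/
theorem RegularDrift.exists_bounded_solution (p : ℝ≥0∞) [ENNReal.HolderConjugate p q] (hT : 0 < T)
    (hr : RegularDrift T q b divb Db f D F)
    (hBc : ∀ w, Continuous fun t => B t w) (hBm : ∀ t, StronglyMeasurable (B t))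
    (hu₀ : StronglyMeasurable u₀) {M : ℝ} (hM : ∀ x, |u₀ x| ≤ M) :
    ∃ u : Ω × ℝ → Space d → ℝ, StronglyMeasurable (Function.uncurry u) ∧ (∀ z x, |u z x| ≤ M) ∧
      ∀ᵐ w ∂P, ∀ t ∈ Icc 0 T,
        ShiftedEquation b divb (fun s => B s w) u₀ (fun s => u (w, s)) t (u (w, t)) := by
  have hp1 : 1 ≤ p := ENNReal.HolderConjugate.one_le p q
  have hM0 : 0 ≤ M := (abs_nonneg _).trans (hM 0)
  have hli : ∀ {v : Space d → ℝ}, StronglyMeasurable v → (∀ x, |v x| ≤ M) → LocallyIntegrable v :=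
    fun h1 h2 => (memLpLoc_of_bound (p := p) h1 M h2).locallyIntegrable hp1
  obtain ⟨U, hU, hUM, hrep⟩ := hr.exists_dual_density (P := P) hT.le hBm hu₀ hM
  have hBj := stronglyMeasurable_process hBc hBm
  set V : ℕ → (Ω × Space d) × ℝ → ℝ := fun n z => mollify n u₀ (z.1.2 + B 0 z.1.1)
    + headIntegral T (fun y => transport (b y.2) (divb y.2) (fun x => U (y.1.1, (y.2, x)))
      (translate (mollifierTest d n) (y.1.2 + B y.2 y.1.1))) z with hV
  have hVm : ∀ n, StronglyMeasurable (V n) := by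
    intro n
    have h1 : StronglyMeasurable fun z : (Ω × Space d) × ℝ => z.1.2 + B 0 z.1.1 :=
      (measurable_snd.comp measurable_fst).stronglyMeasurable.add
        ((hBm 0).comp_measurable (measurable_fst.comp measurable_fst))
    refine ((contDiff_mollify (hli hu₀ hM) n).continuous.comp_stronglyMeasurable h1).add
      (stronglyMeasurable_headIntegral ?_)
    have h2 : StronglyMeasurable fun z : (Ω × Space d) × ℝ => z.1.2 + B z.2 z.1.1 :=
      (measurable_snd.comp measurable_fst).stronglyMeasurable.add
        (hBj.comp_measurable (g := fun z : (Ω × Space d) × ℝ => (z.1.1, z.2)) (by fun_prop))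
    have h3 := hr.stronglyMeasurable_transport_process (Ω := Ω × Space d)
      (B := fun s z => z.2 + B s z.1) h2 (mollifierTest d n)
    have h4 : StronglyMeasurable fun z : (Ω × Space d) × (ℝ × Space d) => U (z.1.1, z.2) :=
      hU.comp_measurable (by fun_prop)
    have h5 := (h4.mul h3).comp_measurable
      (g := fun z : ((Ω × Space d) × ℝ) × Space d => (z.1.1, (z.1.2, z.2))) (by fun_prop)
    simp only [transport, fderiv_translate, translate_apply]
    exact h5.integral_prod_right'
  have hlim : StronglyMeasurable fun z : (Ω × ℝ) × Space d =>
      limUnder atTop fun n => V n ((z.1.1, z.2 - B z.1.2 z.1.1), z.1.2) := by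
    have h1 : Measurable fun z : (Ω × ℝ) × Space d => z.2 - B z.1.2 z.1.1 :=
      measurable_snd.sub (hBj.measurable.comp measurable_fst)
    exact (stronglyMeasurable_limUnder_atTop hVm).comp_measurable
      (g := fun z : (Ω × ℝ) × Space d => ((z.1.1, z.2 - B z.1.2 z.1.1), z.1.2))
      ((measurable_fst.fst.prodMk h1).prodMk measurable_fst.snd)
  -- the truncation only serves to have the bound for exceptional arguments
  set u : Ω × ℝ → Space d → ℝ := fun z x => max (-M) (min M
    (limUnder atTop fun n => V n ((z.1, x - B z.2 z.1), z.2))) with hu_def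
  have hum : StronglyMeasurable (Function.uncurry u) :=
    stronglyMeasurable_const.sup (stronglyMeasurable_const.inf hlim)
  have huM : ∀ z x, |u z x| ≤ M := fun z x =>
    abs_le.2 ⟨le_max_left _ _, max_le (by linarith) (min_le_left _ _)⟩
  refine ⟨u, hum, huM, ?_⟩
  set Q : ℕ → Space d := TopologicalSpace.denseSeq (Space d) with hQ
  have hall : ∀ n k : ℕ, ∀ᵐ w ∂P, ∀ᵐ s ∂(volume.restrict (Icc (0 : ℝ) T)),
      ∫ y, U (w, (s, y)) * translate (mollifierTest d n) (Q k) (y - B s w)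
        = (∫ x, u₀ x * translate (mollifierTest d n) (Q k) (x - B 0 w))
          + ∫ r in (0 : ℝ)..s, transport (b r) (divb r) (fun y => U (w, (r, y)))
            (translate (translate (mollifierTest d n) (Q k)) (B r w)) := fun n k =>
    Measure.ae_ae_of_ae_prod (hr.ae_integral_eq_of_dual p hT.le hBc hBm hu₀ hM hU hUM hrep
      (translate (mollifierTest d n) (Q k)))
  filter_upwards [ae_all_iff.2 fun n => ae_all_iff.2 (hall n)] with w hw
  set U' : ℝ → Space d → ℝ := fun s y => U (w, (s, y)) with hU'
  have hU'm : StronglyMeasurable (Function.uncurry U') :=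
    hU.comp_measurable (g := fun z : ℝ × Space d => (w, z)) measurable_prodMk_left
  have hU's : ∀ s, StronglyMeasurable (U' s) := fun s => hU'm.comp_measurable measurable_prodMk_left
  have hus : ∀ s, StronglyMeasurable (u (w, s)) := fun s =>
    hum.comp_measurable (g := fun x : Space d => ((w, s), x)) measurable_prodMk_left
  have hU'b : BoundedLpLoc T p U' := boundedLpLoc_of_bound hU'm fun t x => hUM (w, (t, x))
  have hsf : ∀ᵐ s ∂(volume.restrict (Icc (0 : ℝ) T)),
      ShiftedEquation b divb (fun s => B s w) u₀ U' s (U' s) := by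
    filter_upwards [ae_all_iff.2 fun n => ae_all_iff.2 (hw n), ae_restrict_mem measurableSet_Icc] with s hs hsT
    refine hr.shiftedEquation_of_dense hU'b (hBc w) (hli hu₀ hM) hsT (hli (hU's s) fun x => hUM _)
      (TopologicalSpace.denseRange_denseSeq (Space d)) ?_
    rintro n - ⟨k, rfl⟩
    have h := hs n k
    simp only [translate_translate] at h
    rw [mollify_eq_integral_translate, mollify_eq_integral_translate, ← translate_translate,
      ← translate_translate]
    exact h
  have hu : ∀ t ∈ Icc 0 T, ShiftedEquation b divb (fun s => B s w) u₀ U' t (u (w, t)) := by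
    intro t ht
    obtain ⟨v, hvm, hvM, hv⟩ := hr.exists_shiftedEquation p hT hU'm (fun t x => hUM _) (hBc w) hsf ht
    refine hv.congr_ae (T := T) EventuallyEq.rfl (ae_of_all _ fun s => EventuallyEq.rfl) ?_ ht
    filter_upwards [ae_tendsto_mollifier_convolution (hli hvm hvM)] with x hx
    have e : ∀ n, V n ((w, x - B t w), t) = mollify n v x := fun n => by
      have h := hv n (x - B t w)
      rw [sub_add_cancel] at h
      rw [h, hV]
      simp only [headIntegral_eq _ (w, x - B t w) ht, mollifiedTransport_eq_transport, hU']
    simp only [hu_def, e]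
    have hl : (limUnder atTop fun n => mollify n v x) = v x := hx.limUnder_eq
    rw [hl, min_eq_right (abs_le.1 (hvM x)).2, max_eq_right (abs_le.1 (hvM x)).1]
  intro t ht
  refine (hu t ht).congr_ae EventuallyEq.rfl ?_ EventuallyEq.rfl ht
  filter_upwards [hsf, ae_restrict_mem measurableSet_Icc] with s hs hsT
  refine ae_eq_of_mollify_eq (hli (hU's s) fun x => hUM _) (hli (hus s) (huM _)) fun n x => ?_
  have h1 := hs n (x - B s w)
  have h2 := hu s hsT n (x - B s w)
  rw [sub_add_cancel] at h1 h2
  rw [h1, h2]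

end

/-! ### Solutions with initial value in `Lᵖ` -/

section

variable {d : ℕ} {p q : ℝ≥0∞} [ENNReal.HolderConjugate p q]

theorem tendsto_integral_mul_of_tendsto_eLpNorm [Fact (1 ≤ p)] {f : ℕ → Space d → ℝ}
    {v g : Space d → ℝ} (hf : ∀ k, MemLp (f k) p volume) (hv : MemLp v p volume)
    (h : Tendsto (fun k => eLpNorm (f k - v) p volume) atTop (𝓝 0)) (hg : MemLp g q volume) :
    Tendsto (fun k => ∫ x, f k x * g x) atTop (𝓝 (∫ x, v x * g x)) := by
  have h1 := ((continuous_integral_mul_of_memLp (p := p) hg).tendsto (hv.toLp v)).comp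
    ((Lp.tendsto_Lp_iff_tendsto_eLpNorm'' f hf v hv).2 h)
  have e : ∀ w (hw : MemLp w p volume), ∫ x, hw.toLp w x * g x = ∫ x, w x * g x := fun w hw =>
    integral_congr_ae (hw.coeFn_toLp.mono fun x hx => by simp only [hx])
  simpa only [Function.comp_def, e] using h1

theorem tendsto_mollify_of_tendsto_eLpNorm [Fact (1 ≤ p)] {f : ℕ → Space d → ℝ}
    {v : Space d → ℝ} (hf : ∀ k, MemLp (f k) p volume) (hv : MemLp v p volume)
    (h : Tendsto (fun k => eLpNorm (f k - v) p volume) atTop (𝓝 0)) (n : ℕ) (x : Space d) :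
    Tendsto (fun k => mollify n (f k) x) atTop (𝓝 (mollify n v x)) := by
  have hq : ENNReal.HolderConjugate p (ENNReal.conjExponent p) := .conjExponent Fact.out
  simp only [mollify_eq_integral_translate]
  exact tendsto_integral_mul_of_tendsto_eLpNorm hf hv h (memLp_testFun _ (ENNReal.conjExponent p))

theorem RegularField.memLp_transport {b : Space d → Space d} {divb : Space d → ℝ}
    {Db : Space d → Space d →L[ℝ] Space d} (hr : RegularField q b divb Db) (φ : TestFun d) :
    MemLp (fun x => fderiv ℝ φ x (b x) + divb x * φ x) q volume := by
  obtain ⟨C, R, hC, hR, h1, h2, h3⟩ := exists_testFun_bound φ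
  have hb : ∀ {F : Type} [NormedAddCommGroup F] {g : Space d → F}, MemLpLoc q g →
      MemLp ((Metric.closedBall 0 R).indicator fun x => ‖g x‖) q volume := fun {F} _ {g} hg =>
    (memLp_indicator_iff_restrict measurableSet_closedBall).2
      (MemLp.norm (⟨hg.1.aestronglyMeasurable, (hg.2 R).lt_top⟩ : MemLp g q _))
  refine ((hb hr.mem).add (hb hr.mem_div)).of_le_mul (c := C)
    (hr.weakDiv.integrable_transport φ).aestronglyMeasurable (ae_of_all _ fun x => ?_)
  by_cases hx : R < ‖x‖
  · rw [(h3 x hx).1, (h3 x hx).2, zero_apply, mul_zero, add_zero, norm_zero]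
    positivity
  · have hm : x ∈ Metric.closedBall 0 R := mem_closedBall_zero_iff.2 (not_lt.1 hx)
    simp only [Pi.add_apply, indicator_of_mem hm]
    rw [Real.norm_of_nonneg (by positivity : 0 ≤ ‖b x‖ + ‖divb x‖), mul_add]
    refine (norm_add_le _ _).trans (add_le_add ((ContinuousLinearMap.le_opNorm _ _).trans
      (mul_le_mul_of_nonneg_right (h2 x) (norm_nonneg _))) ?_)
    rw [norm_mul, mul_comm]
    exact mul_le_mul_of_nonneg_right (h1 x) (norm_nonneg _)

theorem stronglyMeasurable_mollify {α : Type*} [MeasurableSpace α] {u : α → Space d → ℝ}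
    (hu : StronglyMeasurable (Function.uncurry u)) (n : ℕ) :
    StronglyMeasurable fun z : α × Space d => mollify n (u z.1) z.2 := by
  have h1 : StronglyMeasurable fun z : (α × Space d) × Space d => mollifier d n (z.2 - z.1.2) :=
    (continuous_mollifier n).comp_stronglyMeasurable
      (measurable_snd.sub (measurable_snd.comp measurable_fst)).stronglyMeasurable
  have h2 : StronglyMeasurable fun z : (α × Space d) × Space d => u z.1.1 z.2 :=
    hu.comp_measurable (measurable_fst.fst.prodMk measurable_snd)
  exact (h1.smul h2).integral_prod_right'

end

section

variable {d : ℕ} {p q : ℝ≥0∞} [ENNReal.HolderConjugate p q] {T : ℝ}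
  {b : ℝ → Space d → Space d} {divb : ℝ → Space d → ℝ} {Db : ℝ → Space d → Space d →L[ℝ] Space d}
  {f : ℝ → Space d → ℝ} {D F : ℝ → ℝ}

theorem BoundedLpLoc.sub {u u' : ℝ → Space d → ℝ} (hp : 1 ≤ p) (hu : BoundedLpLoc T p u)
    (hu' : BoundedLpLoc T p u') : BoundedLpLoc T p fun t x => u t x - u' t x := by
  refine ⟨hu.meas.sub hu'.meas, fun R => ?_⟩
  obtain ⟨M, hM, h⟩ := hu.bound R
  obtain ⟨M', hM', h'⟩ := hu'.bound R
  refine ⟨M + M', ENNReal.add_ne_top.2 ⟨hM, hM'⟩, ?_⟩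
  filter_upwards [h, h', hu.memLpLoc, hu'.memLpLoc] with t ht ht' h1 h2
  exact (eLpNorm_sub_le h1.1.aestronglyMeasurable h2.1.aestronglyMeasurable hp).trans
    (add_le_add ht ht')

theorem RegularDrift.shiftedEquation_sub (hr : RegularDrift T q b divb Db f D F)
    {u u' : ℝ → Space d → ℝ} (hu : BoundedLpLoc T p u) (hu' : BoundedLpLoc T p u')
    {β : ℝ → Space d} (hβ : Continuous β) {u₀ u₀' v v' : Space d → ℝ} (h₀ : MemLpLoc p u₀)
    (h₀' : MemLpLoc p u₀') (hv : MemLpLoc p v) (hv' : MemLpLoc p v')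
    {t : ℝ} (ht : t ∈ Icc 0 T) (h : ShiftedEquation b divb β u₀ u t v)
    (h' : ShiftedEquation b divb β u₀' u' t v') :
    ShiftedEquation b divb β (fun x => u₀ x - u₀' x) (fun s x => u s x - u' s x) t
      (fun x => v x - v' x) := by
  intro n x
  have hp := ENNReal.HolderConjugate.one_le p q
  have h0 : (0 : ℝ) ∈ Icc 0 T := ⟨le_rfl, ht.1.trans ht.2⟩
  have hm : ∀ {a c : Space d → ℝ}, MemLpLoc p a → MemLpLoc p c → ∀ y,
      mollify n (fun z => a z - c z) y = mollify n a y - mollify n c y := fun ha hc y => by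
    simp only [mollify_eq_integral_translate, sub_mul]
    exact integral_sub (integrable_mul_testFun (ha.locallyIntegrable hp) _)
      (integrable_mul_testFun (hc.locallyIntegrable hp) _)
  have e : ∫ s in (0 : ℝ)..t, mollifiedTransport (b s) (divb s) (fun y => u s y - u' s y) n (x + β s)
      = (∫ s in (0 : ℝ)..t, mollifiedTransport (b s) (divb s) (u s) n (x + β s))
        - ∫ s in (0 : ℝ)..t, mollifiedTransport (b s) (divb s) (u' s) n (x + β s) := by
    rw [← intervalIntegral.integral_sub
      (intervalIntegrable_of_mem (hr.integrableOn_mollifiedTransport hu hβ n x) h0 ht)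
      (intervalIntegrable_of_mem (hr.integrableOn_mollifiedTransport hu' hβ n x) h0 ht)]
    refine intervalIntegral.integral_congr_ae ?_
    filter_upwards [(ae_restrict_iff' measurableSet_Icc).1 hr.regular,
      (ae_restrict_iff' measurableSet_Icc).1 hu.memLpLoc,
      (ae_restrict_iff' measurableSet_Icc).1 hu'.memLpLoc] with s h1 h2 h3 hs
    rw [uIoc_of_le ht.1] at hs
    have hsT : s ∈ Icc 0 T := ⟨hs.1.le, hs.2.trans ht.2⟩
    simp only [mollifiedTransport_eq_transport, transport, sub_mul]
    exact integral_sub ((h1 hsT).integrable_transport (h2 hsT) _)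
      ((h1 hsT).integrable_transport (h3 hsT) _)
  rw [hm hv hv', hm h₀ h₀', h n x, h' n x, e]
  ring

/-- Along a path, solutions whose initial values converge in `Lᵖ` converge in `Lᵖ`, by the stability
estimate for their differences, and the limit is a solution. -/
theorem RegularDrift.limit_solution [Fact (1 ≤ p)] (hp : p ≠ ⊤)
    (hr : RegularDrift T q b divb Db f D F)
    {β : ℝ → Space d} (hβ : Continuous β) {u₀ : Space d → ℝ} (hu₀ : MemLp u₀ p volume)
    {a : ℕ → Space d → ℝ} (haL : ∀ k, MemLpLoc p (a k)) (ha : ∀ k, MemLp (a k) p volume)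
    (hlim : ∀ k, eLpNorm (u₀ - a k) p volume < 2⁻¹ ^ k) {u : ℕ → ℝ → Space d → ℝ}
    (hu : ∀ k, BoundedLpLoc T p (u k)) (huL : ∀ k t, MemLpLoc p (u k t))
    (hsf : ∀ k, ∀ t ∈ Icc 0 T, ShiftedEquation b divb β (a k) (u k) t (u k t))
    {U : ℝ → Space d → ℝ} (hU : ∀ t x, U t x
      = limUnder atTop fun n => limUnder atTop fun k => mollify n (u k t) x) :
    ∀ t ∈ Icc 0 T, eLpNorm (U t) p volume
        ≤ (stabilityConst d T D F p + 1) * (eLpNorm u₀ p volume + 1) ∧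
      ShiftedEquation b divb β u₀ U t (U t) := by
  have hp1 : 1 ≤ p := Fact.out
  set c : ℝ≥0∞ := stabilityConst d T D F p + 1 with hc
  have hct : c ≠ ⊤ := ENNReal.add_ne_top.2 ⟨stabilityConst_ne_top T D F p, ENNReal.one_ne_top⟩
  have hc0 : c ≠ 0 := by simp [hc]
  have hpow : ∀ k : ℕ, (2⁻¹ : ℝ≥0∞) ^ k ≤ 1 := fun k => pow_le_one₀ bot_le (by simp)
  set N : ℝ≥0∞ := c * (eLpNorm u₀ p volume + 1) with hN
  have hNt : N ≠ ⊤ := ENNReal.mul_ne_top hct (ENNReal.add_ne_top.2 ⟨hu₀.2.ne, ENNReal.one_ne_top⟩)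
  have hae : ∀ k, ∀ᵐ s ∂(volume.restrict (Icc (0 : ℝ) T)),
      ShiftedEquation b divb β (a k) (u k) s (u k s) := fun k => by
    filter_upwards [ae_restrict_mem measurableSet_Icc] with s hs using hsf k s hs
  have hbd : ∀ k, ∀ t ∈ Icc 0 T, eLpNorm (u k t) p volume ≤ N := by
    intro k t ht
    refine (hr.eLpNorm_le hp (hu k) hβ (haL k) (hae k) ht (huL k t) (hsf k t ht)).trans
      (mul_le_mul' le_self_add ?_)
    have e : a k = u₀ - (u₀ - a k) := (sub_sub_cancel _ _).symm
    rw [e]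
    exact (eLpNorm_sub_le hu₀.1 (hu₀.1.sub (ha k).1) hp1).trans
      (add_le_add le_rfl ((hlim k).le.trans (hpow k)))
  have hmem : ∀ k, ∀ t ∈ Icc 0 T, MemLp (u k t) p volume := fun k t ht =>
    ⟨(huL k t).1.aestronglyMeasurable, (hbd k t ht).trans_lt hNt.lt_top⟩
  have hcau : ∀ t ∈ Icc 0 T, ∀ K n m : ℕ, K ≤ n → K ≤ m →
      eLpNorm (u n t - u m t) p volume < c * (2⁻¹ ^ K + 2⁻¹ ^ K) := by
    intro t ht K n m hn hm
    have hpw : ∀ k, K ≤ k → eLpNorm (u₀ - a k) p volume < 2⁻¹ ^ K := fun k hk =>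
      (hlim k).trans_le (pow_le_pow_of_le_one bot_le (by simp) hk)
    have hL : ∀ {x y : Space d → ℝ}, MemLpLoc p x → MemLpLoc p y → MemLpLoc p fun z => x z - y z :=
      fun hx hy => ⟨hx.1.sub hy.1, fun R => ((eLpNorm_sub_le hx.1.aestronglyMeasurable
        hy.1.aestronglyMeasurable hp1).trans_lt
          (ENNReal.add_lt_top.2 ⟨(hx.2 R).lt_top, (hy.2 R).lt_top⟩)).ne⟩
    have hd : ∀ s ∈ Icc 0 T, _ := fun s hs => hr.shiftedEquation_sub (hu n) (hu m) hβ (haL n) (haL m)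
      (huL n s) (huL m s) hs (hsf n s hs) (hsf m s hs)
    have h1 := hr.eLpNorm_le hp ((hu n).sub hp1 (hu m)) hβ (hL (haL n) (haL m))
      (by filter_upwards [ae_restrict_mem measurableSet_Icc] with s hs using hd s hs) ht
      (hL (huL n t) (huL m t)) (hd t ht)
    have e : (fun x => a n x - a m x) = (u₀ - a m) - (u₀ - a n) := (sub_sub_sub_cancel_left _ _ _).symm
    rw [e] at h1
    refine (h1.trans (mul_le_mul' (le_self_add (b := 1))
      (eLpNorm_sub_le (hu₀.1.sub (ha m).1) (hu₀.1.sub (ha n).1) hp1))).trans_lt ?_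
    exact (ENNReal.mul_lt_mul_iff_right hc0 hct).2 (ENNReal.add_lt_add (hpw m hm) (hpw n hn))
  have hsum : ∑' k : ℕ, c * ((2⁻¹ : ℝ≥0∞) ^ k + 2⁻¹ ^ k) ≠ ⊤ := by
    rw [ENNReal.tsum_mul_left, ENNReal.tsum_add, ENNReal.tsum_geometric]
    exact ENNReal.mul_ne_top hct (by simp)
  have hUt : ∀ t ∈ Icc 0 T, MemLp (U t) p volume ∧
      Tendsto (fun k => eLpNorm (u k t - U t) p volume) atTop (𝓝 0) := by
    intro t ht
    obtain ⟨v, hv, hvl⟩ := Lp.cauchy_complete_eLpNorm hp1 (fun k => hmem k t ht) hsum (hcau t ht)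
    have hvU : v =ᵐ[volume] U t := by
      filter_upwards [ae_tendsto_mollifier_convolution (hv.locallyIntegrable hp1)] with x hx
      have e : ∀ n, (limUnder atTop fun k => mollify n (u k t) x) = mollify n v x := fun n =>
        (tendsto_mollify_of_tendsto_eLpNorm (fun k => hmem k t ht) hv hvl n x).limUnder_eq
      simp only [hU, e]
      exact (Tendsto.limUnder_eq hx).symm
    exact ⟨(memLp_congr_ae hvU).1 hv,
      hvl.congr fun k => eLpNorm_congr_ae (EventuallyEq.rfl.sub hvU)⟩
  intro t ht
  have h0 : (0 : ℝ) ∈ Icc 0 T := ⟨le_rfl, ht.1.trans ht.2⟩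
  have hTIoc : ∀ s ∈ uIoc 0 t, s ∈ Icc 0 T := fun s hs => by
    rw [uIoc_of_le ht.1] at hs
    exact ⟨hs.1.le, hs.2.trans ht.2⟩
  refine ⟨?_, fun n x => ?_⟩
  · have h1 : Tendsto (fun k => N + eLpNorm (u k t - U t) p volume) atTop (𝓝 (N + 0)) :=
      tendsto_const_nhds.add (hUt t ht).2
    rw [add_zero] at h1
    refine ge_of_tendsto' h1 fun k => ?_
    have e : U t = u k t - (u k t - U t) := (sub_sub_cancel _ _).symm
    calc eLpNorm (U t) p volume = eLpNorm (u k t - (u k t - U t)) p volume := by rw [← e]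
      _ ≤ _ := (eLpNorm_sub_le (hmem k t ht).1 ((hmem k t ht).1.sub (hUt t ht).1.1) hp1).trans
        (add_le_add (hbd k t ht) le_rfl)
  · have ha0 : Tendsto (fun k => eLpNorm (a k - u₀) p volume) atTop (𝓝 0) := by
      refine tendsto_of_tendsto_of_tendsto_of_le_of_le tendsto_const_nhds
        (ENNReal.tendsto_pow_atTop_nhds_zero_of_lt_one (r := 2⁻¹) (by simp)) (fun _ => bot_le) fun k => ?_
      rw [eLpNorm_sub_comm]
      exact (hlim k).le
    obtain ⟨R, hR⟩ := hr.exists_path_bound_of_eLpNorm_le p hβ n ‖x‖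
    obtain ⟨A, hAm, hA, hAb⟩ := hR hNt
    have hint : Tendsto (fun k => ∫ s in (0 : ℝ)..t,
        mollifiedTransport (b s) (divb s) (u k s) n (x + β s)) atTop
        (𝓝 (∫ s in (0 : ℝ)..t, mollifiedTransport (b s) (divb s) (U s) n (x + β s))) := by
      refine intervalIntegral.tendsto_integral_filter_of_dominated_convergence
        (fun s => (A s).toReal) (Eventually.of_forall fun k => ?_) (Eventually.of_forall fun k => ?_)
        (intervalIntegrable_of_mem (integrable_toReal_of_lintegral_ne_top hAm.aemeasurable hA) h0 ht)
        ?_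
      · exact (intervalIntegrable_iff.1 (intervalIntegrable_of_mem
          (hr.integrableOn_mollifiedTransport (hu k) hβ n x) h0 ht)).aestronglyMeasurable
      · filter_upwards [(ae_restrict_iff' measurableSet_Icc).1 hAb,
          (ae_restrict_iff' measurableSet_Icc).1 (ae_lt_top hAm hA)] with s h1 h2 hs
        rw [← toReal_enorm]
        exact ENNReal.toReal_mono (h2 (hTIoc s hs)).ne (h1 (hTIoc s hs) _ (huL k s)
          ((eLpNorm_mono_measure _ Measure.restrict_le_self).trans (hbd k s (hTIoc s hs))) x le_rfl)
      · filter_upwards [(ae_restrict_iff' measurableSet_Icc).1 hr.regular] with s h1 hs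
        have hsT := hTIoc s hs
        simp only [mollifiedTransport_eq_transport]
        exact tendsto_integral_mul_of_tendsto_eLpNorm (fun k => hmem k s hsT) (hUt s hsT).1
          (hUt s hsT).2 ((h1 hsT).memLp_transport _)
    refine tendsto_nhds_unique (tendsto_mollify_of_tendsto_eLpNorm (fun k => hmem k t ht)
      (hUt t ht).1 (hUt t ht).2 n (x + β t)) ?_
    exact ((tendsto_mollify_of_tendsto_eLpNorm ha hu₀ ha0 n (x + β 0)).add hint).congr
      fun k => (hsf k t ht n x).symm

variable {Ω : Type*} [MeasurableSpace Ω] {P : Measure Ω} [IsProbabilityMeasure P]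
  {B : ℝ → Ω → Space d}

/-- For an initial value in `Lᵖ` there is a jointly measurable process which solves the equation in
moving coordinates and is bounded in `Lᵖ`: the limit of the solutions which start from simple
functions. -/
theorem RegularDrift.exists_solution [Fact (1 ≤ p)] (hp : p ≠ ⊤) (hT : 0 < T)
    (hr : RegularDrift T q b divb Db f D F)
    (hBc : ∀ w, Continuous fun t => B t w) (hBm : ∀ t, StronglyMeasurable (B t))
    {u₀ : Space d → ℝ} (hu₀ : MemLp u₀ p volume) :
    ∃ U : Ω × ℝ → Space d → ℝ, StronglyMeasurable (Function.uncurry U) ∧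
      ∀ᵐ w ∂P, ∀ t ∈ Icc 0 T, eLpNorm (U (w, t)) p volume
          ≤ (stabilityConst d T D F p + 1) * (eLpNorm u₀ p volume + 1) ∧
        ShiftedEquation b divb (fun s => B s w) u₀ (fun s => U (w, s)) t (U (w, t)) := by
  choose a ha haL using fun k : ℕ => hu₀.exists_simpleFunc_eLpNorm_sub_lt hp (ε := 2⁻¹ ^ k) (by simp)
  choose M hM using fun k => (a k).exists_forall_norm_le
  choose u hum huM hu using fun k => hr.exists_bounded_solution (P := P) p hT hBc hBm
    (a k).stronglyMeasurable (hM k)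
  refine ⟨fun z x => limUnder atTop fun n => limUnder atTop fun k => mollify n (u k z) x,
    stronglyMeasurable_limUnder_atTop fun n => stronglyMeasurable_limUnder_atTop fun k =>
      stronglyMeasurable_mollify (hum k) n, ?_⟩
  filter_upwards [ae_all_iff.2 hu] with w hw
  refine hr.limit_solution hp (hBc w) hu₀ (fun k => memLpLoc_of_bound (a k).stronglyMeasurable _ (hM k))
    haL ha (u := fun k s => u k (w, s)) (fun k => boundedLpLoc_of_bound ?_ fun t x => huM k (w, t) x)
    (fun k t => memLpLoc_of_bound ?_ _ (huM k (w, t))) hw fun t x => rfl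
  · exact (hum k).comp_measurable (g := fun z : ℝ × Space d => ((w, z.1), z.2)) (by fun_prop)
  · exact (hum k).comp_measurable (g := fun x : Space d => ((w, t), x)) (by fun_prop)

end

/-! ### Measurable versions of the drift -/

section

variable {d : ℕ} {T : ℝ} {F : Type*} [NormedAddCommGroup F]

theorem exists_stronglyMeasurable_version {f : ℝ → Space d → F}
    (hf : AEStronglyMeasurable (Function.uncurry f)
      ((volume.restrict (Icc (0 : ℝ) T)).prod (volume : Measure (Space d)))) :
    ∃ g : ℝ → Space d → F, StronglyMeasurable (Function.uncurry g) ∧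
      ∀ᵐ t ∂(volume.restrict (Icc (0 : ℝ) T)), f t =ᵐ[volume] g t :=
  ⟨fun t x => hf.mk _ (t, x), hf.stronglyMeasurable_mk, Measure.ae_ae_of_ae_prod hf.ae_eq_mk⟩

theorem lintegral_eLpNorm_congr_ae {f g : ℝ → Space d → F}
    (h : ∀ᵐ t ∂(volume.restrict (Icc (0 : ℝ) T)), f t =ᵐ[volume] g t) (r : ℝ≥0∞)
    {μ : Measure (Space d)} (hμ : μ ≪ volume) :
    ∫⁻ t in Icc 0 T, eLpNorm (f t) r μ = ∫⁻ t in Icc 0 T, eLpNorm (g t) r μ :=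
  lintegral_congr_ae (h.mono fun _ ht => eLpNorm_congr_ae (hμ.ae_eq ht))

theorem ae_memLpLoc {g : ℝ → Space d → F} (hg : StronglyMeasurable (Function.uncurry g)) {r : ℝ≥0∞}
    (h : ∀ R : ℝ, ∫⁻ t in Icc 0 T, eLpNorm (g t) r (volume.restrict (Metric.closedBall 0 R)) ≠ ⊤) :
    ∀ᵐ t ∂(volume.restrict (Icc (0 : ℝ) T)), MemLpLoc r (g t) := by
  filter_upwards [ae_all_iff.2 fun n : ℕ => ae_lt_top (measurable_eLpNorm_uncurry hg r) (h n)]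
    with t ht
  refine ⟨hg.comp_measurable measurable_prodMk_left, fun R => ?_⟩
  obtain ⟨n, hn⟩ := exists_nat_ge R
  exact ((eLpNorm_mono_measure _ (Measure.restrict_mono (Metric.closedBall_subset_closedBall hn)
    le_rfl)).trans_lt (ht n)).ne

theorem HasWeakDiv.congr_ae {f f' : Space d → Space d} {g g' : Space d → ℝ} (h : HasWeakDiv f g)
    (hf : f =ᵐ[volume] f') (hg : g =ᵐ[volume] g') : HasWeakDiv f' g' := by
  refine ⟨h.1.congr hf, h.2.1.congr hg, fun φ => ?_⟩
  rw [← integral_congr_ae (hf.mono fun x hx => congrArg (fderiv ℝ φ x) hx), h.2.2 φ,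
    integral_congr_ae (hg.mono fun x hx => congrArg (φ x * ·) hx)]

theorem HasWeakFDeriv.congr_ae {f f' : Space d → Space d} {g g' : Space d → Space d →L[ℝ] Space d}
    (h : HasWeakFDeriv f g) (hf : f =ᵐ[volume] f') (hg : g =ᵐ[volume] g') :
    HasWeakFDeriv f' g' := by
  refine ⟨h.1.congr hf, h.2.1.congr hg, fun φ v => ?_⟩
  rw [← integral_congr_ae (hf.mono fun x hx => congrArg (fderiv ℝ φ x v • ·) hx), h.2.2 φ v,
    integral_congr_ae (hg.mono fun x hx => congrArg (fun A => φ x • A v) hx)]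

/-- The hypotheses on the drift provide versions of the drift and of its divergence which are
measurable everywhere. -/
theorem exists_regularDrift {q : ℝ≥0∞} {b : ℝ → Space d → Space d} {divb : ℝ → Space d → ℝ}
    (hdiv : ∀ᵐ t ∂(volume.restrict (Icc (0 : ℝ) T)), HasWeakDiv (b t) (divb t))
    (hdivb : MemL1L T ∞ divb) (hb : MemL1W1Loc T q b) (hgrowth : GrowthCondition T b) :
    ∃ b' divb' Db f D F, RegularDrift T q b' divb' Db f D F ∧
      (∀ᵐ t ∂(volume.restrict (Icc (0 : ℝ) T)), b t =ᵐ[volume] b' t) ∧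
      ∀ᵐ t ∂(volume.restrict (Icc (0 : ℝ) T)), divb t =ᵐ[volume] divb' t := by
  obtain ⟨⟨hbm, hbK⟩, Db, ⟨hDm, hDK⟩, hbD⟩ := hb
  obtain ⟨f₁, f₂, ⟨h1m, h1⟩, ⟨h2m, h2⟩, hg⟩ := hgrowth
  obtain ⟨b', hb'm, hb'⟩ := exists_stronglyMeasurable_version hbm
  obtain ⟨e, hem, he⟩ := exists_stronglyMeasurable_version hdivb.1
  obtain ⟨D', hD'm, hD'⟩ := exists_stronglyMeasurable_version hDm
  obtain ⟨k₁, hk1m, hk1⟩ := exists_stronglyMeasurable_version h1m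
  obtain ⟨k₂, hk2m, hk2⟩ := exists_stronglyMeasurable_version h2m
  have hac : ∀ R : ℝ, volume.restrict (Metric.closedBall (0 : Space d) R) ≪ volume := fun R =>
    Measure.restrict_le_self.absolutelyContinuous
  have hbt : ∀ R : ℝ, ∫⁻ t in Icc 0 T, eLpNorm (b' t) q (volume.restrict (Metric.closedBall 0 R))
      ≠ ⊤ := fun R => by
    rw [← lintegral_eLpNorm_congr_ae hb' q (hac R)]
    exact (hbK _ (isCompact_closedBall 0 R)).ne
  have hDt : ∀ R : ℝ, ∫⁻ t in Icc 0 T, eLpNorm (D' t) q (volume.restrict (Metric.closedBall 0 R))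
      ≠ ⊤ := fun R => by
    rw [← lintegral_eLpNorm_congr_ae hD' q (hac R)]
    exact (hDK _ (isCompact_closedBall 0 R)).ne
  have het : ∫⁻ t in Icc 0 T, eLpNorm (e t) ⊤ volume ≠ ⊤ := by
    rw [← lintegral_eLpNorm_congr_ae he ⊤ Measure.AbsolutelyContinuous.rfl]
    exact hdivb.2.ne
  have h1t : ∫⁻ t in Icc 0 T, eLpNorm (k₁ t) 1 volume ≠ ⊤ := by
    rw [← lintegral_eLpNorm_congr_ae hk1 1 Measure.AbsolutelyContinuous.rfl]
    exact h1.ne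
  have h2t : ∫⁻ t in Icc 0 T, eLpNorm (k₂ t) ⊤ volume ≠ ⊤ := by
    rw [← lintegral_eLpNorm_congr_ae hk2 ⊤ Measure.AbsolutelyContinuous.rfl]
    exact h2.ne
  have heR : ∀ R : ℝ, ∫⁻ t in Icc 0 T, eLpNorm (e t) q (volume.restrict (Metric.closedBall 0 R))
      ≠ ⊤ := fun R => by
    set m : ℝ≥0∞ := (volume.restrict (Metric.closedBall (0 : Space d) R)) univ
      ^ (1 / q.toReal - 1 / (⊤ : ℝ≥0∞).toReal) with hm
    have hmt : m ≠ ⊤ := ENNReal.rpow_ne_top_of_nonneg (by simp) (measure_ne_top _ _)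
    refine ne_top_of_le_ne_top (b := ∫⁻ t in Icc 0 T, eLpNorm (e t) ⊤ volume * m) ?_
      (lintegral_mono fun t => ?_)
    · rw [lintegral_mul_const' _ _ hmt]
      exact ENNReal.mul_ne_top het hmt
    · exact (eLpNorm_le_eLpNorm_mul_rpow_measure_univ le_top
        (hem.comp_measurable measurable_prodMk_left).aestronglyMeasurable).trans
        (mul_le_mul' (eLpNorm_mono_measure _ Measure.restrict_le_self) le_rfl)
  have hsup : ∀ {g : ℝ → Space d → ℝ}, StronglyMeasurable (Function.uncurry g) →
      ∫⁻ t in Icc 0 T, eLpNorm (g t) ⊤ volume ≠ ⊤ → ∀ᵐ t ∂(volume.restrict (Icc (0 : ℝ) T)),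
        ∀ᵐ x, |g t x| ≤ (eLpNorm (g t) ⊤ volume).toReal := fun {g} hgm hgt => by
    filter_upwards [ae_lt_top (measurable_eLpNorm_uncurry hgm ⊤) hgt] with t ht
    filter_upwards [ae_le_eLpNormEssSup (f := g t)] with x hx
    rw [← Real.norm_eq_abs, ← toReal_enorm]
    exact ENNReal.toReal_mono ht.ne (hx.trans_eq eLpNorm_exponent_top.symm)
  refine ⟨b', e, D', fun t x => |k₁ t x|, fun t => (eLpNorm (e t) ⊤ volume).toReal,
    fun t => (eLpNorm (k₂ t) ⊤ volume).toReal, ?_, hb', he⟩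
  refine
    { meas := hb'm
      meas_div := hem
      meas_fderiv := hD'm
      meas_f := hk1m.norm
      regular := ?_
      lintegral_ne_top := fun R => ?_
      integrable_D := integrable_toReal_of_lintegral_ne_top
        (measurable_eLpNorm_uncurry hem ⊤).aemeasurable het
      integrable_F := integrable_toReal_of_lintegral_ne_top
        (measurable_eLpNorm_uncurry hk2m ⊤).aemeasurable h2t
      D_nonneg := fun _ => ENNReal.toReal_nonneg
      F_nonneg := fun _ => ENNReal.toReal_nonneg
      f_nonneg := fun _ _ => abs_nonneg _
      lintegral_f := by
        simpa only [eLpNorm_one_eq_lintegral_enorm, ← Real.norm_eq_abs, enorm_norm] using h1t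
      div_le := hsup hem het
      growth := ?_ }
  · filter_upwards [hdiv, hbD, hb', he, hD', ae_memLpLoc hb'm hbt, ae_memLpLoc hem heR,
      ae_memLpLoc hD'm hDt] with t g1 g2 g3 g4 g5 g6 g7 g8
    exact ⟨g1.congr_ae g3 g4, g2.congr_ae g3 g5, g6, g7, g8⟩
  · rw [lintegral_add_right _ (measurable_eLpNorm_uncurry hD'm q),
      lintegral_add_right _ (measurable_eLpNorm_uncurry hem q)]
    exact ENNReal.add_ne_top.2 ⟨ENNReal.add_ne_top.2 ⟨hbt R, heR R⟩, hDt R⟩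
  · filter_upwards [hg, hb', hk1, hk2, hsup hk2m h2t] with t g1 g2 g3 g4 g5
    filter_upwards [g1, g2, g3, g4, g5] with x x1 x2 x3 x4 x5
    rw [x2, x3, x4, div_eq_iff (by positivity)] at x1
    rw [x1, mul_comm]
    gcongr
    · exact le_abs_self _
    · exact (le_abs_self _).trans x5

theorem intervalIntegral_integral_congr_ae {G G' : ℝ → Space d → ℝ}
    (h : ∀ᵐ s ∂(volume.restrict (Icc (0 : ℝ) T)), G s =ᵐ[volume] G' s) {t : ℝ}
    (ht : t ∈ Icc 0 T) : ∫ s in (0 : ℝ)..t, ∫ x, G s x = ∫ s in (0 : ℝ)..t, ∫ x, G' s x := by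
  rw [intervalIntegral.integral_of_le ht.1, intervalIntegral.integral_of_le ht.1]
  have hs : Ioc 0 t ⊆ Icc 0 T := fun s hs => ⟨hs.1.le, hs.2.trans ht.2⟩
  exact integral_congr_ae ((ae_restrict_of_ae_restrict_of_subset hs h).mono fun s h1 =>
    integral_congr_ae h1)

theorem stieltjesIntegral_congr_right (hT : 0 ≤ T) (f : ℝ → ℝ) {g g' : ℝ → ℝ}
    (h : EqOn g g' (Icc 0 T)) (t : ℝ) : stieltjesIntegral T f g t = stieltjesIntegral T f g' t := by
  have e : (fun s => g (max 0 (min T s))) = fun s => g' (max 0 (min T s)) := funext fun s =>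
    h ⟨le_max_left _ _, max_le hT (min_le_left _ _)⟩
  unfold stieltjesIntegral
  generalize (fun s => g (max 0 (min T s))) = G at e
  subst e
  rfl

end

/-! ### Weak solutions and the equation in moving coordinates -/

section

variable {d : ℕ} {Ω : Type*} [MeasurableSpace Ω] {P : Measure Ω} [IsProbabilityMeasure P]
  {p q : ℝ≥0∞} [ENNReal.HolderConjugate p q] {T : ℝ}
  {b b' : ℝ → Space d → Space d} {divb divb' : ℝ → Space d → ℝ}
  {Db : ℝ → Space d → Space d →L[ℝ] Space d} {f : ℝ → Space d → ℝ} {D F : ℝ → ℝ}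
  {B B' : ℝ → Ω → Space d} {u₀ : Lp ℝ p (volume : Measure (Space d))}

theorem memLpLoc_of_eLpNorm_ne_top {v : Space d → ℝ} (hv : StronglyMeasurable v)
    (h : eLpNorm v p volume ≠ ⊤) : MemLpLoc p v :=
  ⟨hv, fun _ => ne_top_of_le_ne_top h (eLpNorm_mono_measure _ Measure.restrict_le_self)⟩

theorem boundedLpLoc_of_eLpNorm_le {u : ℝ → Space d → ℝ} (hu : StronglyMeasurable (Function.uncurry u))
    {M : ℝ≥0∞} (hM : M ≠ ⊤)
    (h : ∀ᵐ t ∂(volume.restrict (Icc (0 : ℝ) T)), eLpNorm (u t) p volume ≤ M) : BoundedLpLoc T p u :=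
  ⟨hu, fun _ => ⟨M, hM, h.mono fun _ ht =>
    (eLpNorm_mono_measure _ Measure.restrict_le_self).trans ht⟩⟩

variable [Fact (1 ≤ p)]

/-- The right-hand side of the weak equation depends only on the almost everywhere classes of the
drift, of its divergence and of the solution, and only on the driving path on `[0,T]`. -/
theorem weak_equation_congr (hT : 0 ≤ T)
    (hb : ∀ᵐ t ∂(volume.restrict (Icc (0 : ℝ) T)), b t =ᵐ[volume] b' t)
    (hdiv : ∀ᵐ t ∂(volume.restrict (Icc (0 : ℝ) T)), divb t =ᵐ[volume] divb' t)
    {u u' : ℝ → Space d → ℝ} (hu : ∀ᵐ t ∂(volume.restrict (Icc (0 : ℝ) T)), u t =ᵐ[volume] u' t)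
    {β β' : ℝ → Space d} (hβ : ∀ t ∈ Icc 0 T, β' t = β t) (φ : TestFun d) (Y : Fin d → ℝ → ℝ) (c : ℝ)
    {t : ℝ} (ht : t ∈ Icc 0 T) :
    c + (∫ s in (0 : ℝ)..t, ∫ x, fderiv ℝ φ x (b s x) * u s x)
        + (∫ s in (0 : ℝ)..t, ∫ x, divb s x * φ x * u s x)
        + ∑ i : Fin d, stieltjesIntegral T (Y i) (fun s => β s i) t
      = c + (∫ s in (0 : ℝ)..t, ∫ x, fderiv ℝ φ x (b' s x) * u' s x)
        + (∫ s in (0 : ℝ)..t, ∫ x, divb' s x * φ x * u' s x)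
        + ∑ i : Fin d, stieltjesIntegral T (Y i) (fun s => β' s i) t := by
  refine congrArg₂ (· + ·) (congrArg₂ (· + ·) (congrArg₂ (· + ·) rfl ?_) ?_)
    (Finset.sum_congr rfl fun i _ => stieltjesIntegral_congr_right hT _
      (fun s hs => congrArg (· i) (hβ s hs).symm) t)
  · refine intervalIntegral_integral_congr_ae ?_ ht
    filter_upwards [hb, hu] with s s1 s2
    filter_upwards [s1, s2] with x x1 x2
    rw [x1, x2]
  · refine intervalIntegral_integral_congr_ae ?_ ht
    filter_upwards [hdiv, hu] with s s1 s2
    filter_upwards [s1, s2] with x x1 x2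
    rw [x1, x2]

/-- A solution in moving coordinates provides a weak solution. -/
theorem RegularDrift.exists_isWeakLpSolution (hp : p ≠ ⊤) (hT : 0 < T)
    (hr : RegularDrift T q b' divb' Db f D F)
    (hb : ∀ᵐ t ∂(volume.restrict (Icc (0 : ℝ) T)), b t =ᵐ[volume] b' t)
    (hdiv : ∀ᵐ t ∂(volume.restrict (Icc (0 : ℝ) T)), divb t =ᵐ[volume] divb' t)
    (hBc : ∀ w, Continuous fun t => B' t w) (hBm : ∀ t, StronglyMeasurable (B' t))
    (hBB : ∀ᵐ w ∂P, ∀ t ∈ Icc 0 T, B' t w = B t w)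
    (hBV : ∀ᵐ w ∂P, BoundedVariationOn (fun t => B' t w) (Icc 0 T)) :
    ∃ (u : ℝ → Ω → Lp ℝ p (volume : Measure (Space d))) (V : Ω × ℝ → Space d → ℝ),
      IsWeakLpSolution P T p b divb B u₀ u ∧ (∀ t w, u t w =ᵐ[volume] V (w, t)) ∧
      (∀ w, BoundedLpLoc T p fun s => V (w, s)) ∧ (∀ z, MemLpLoc p (V z)) ∧
      ∀ᵐ w ∂P, ∀ t ∈ Icc 0 T,
        ShiftedEquation b' divb' (fun s => B' s w) u₀ (fun s => V (w, s)) t (V (w, t)) := by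
  obtain ⟨U, hU, hUsf⟩ := hr.exists_solution (P := P) hp hT hBc hBm (Lp.memLp u₀)
  set K : ℝ≥0∞ := (stabilityConst d T D F p + 1) * (eLpNorm u₀ p volume + 1) with hK
  have hKt : K ≠ ⊤ := ENNReal.mul_ne_top
    (ENNReal.add_ne_top.2 ⟨stabilityConst_ne_top T D F p, ENNReal.one_ne_top⟩)
    (ENNReal.add_ne_top.2 ⟨(Lp.memLp u₀).2.ne, ENNReal.one_ne_top⟩)
  -- on the exceptional set the solution is replaced by zero
  set A : Set (Ω × ℝ) := {z | eLpNorm (U z) p volume ≤ K} with hA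
  have hAm : MeasurableSet A := measurableSet_le (measurable_eLpNorm_uncurry hU p) measurable_const
  set V : Ω × ℝ → Space d → ℝ := fun z x => (A ×ˢ univ).indicator (Function.uncurry U) (z, x) with hV
  have hVm : StronglyMeasurable (Function.uncurry V) := hU.indicator (hAm.prod MeasurableSet.univ)
  have hVU : ∀ z ∈ A, V z = U z := fun z hz => funext fun x => by
    rw [hV]
    exact indicator_of_mem (mk_mem_prod hz (mem_univ x)) _
  have hVK : ∀ z, eLpNorm (V z) p volume ≤ K := fun z => by
    by_cases hz : z ∈ A
    · rw [hVU z hz]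
      exact hz
    · have e : V z = 0 := funext fun x => by
        rw [hV]
        exact indicator_of_notMem (fun h => hz h.1) _
      rw [e, eLpNorm_zero]
      exact bot_le
  have hVs : ∀ z, StronglyMeasurable (V z) := fun z =>
    hVm.comp_measurable (g := fun x : Space d => (z, x)) measurable_prodMk_left
  have hVL : ∀ z, MemLp (V z) p volume := fun z =>
    ⟨(hVs z).aestronglyMeasurable, (hVK z).trans_lt hKt.lt_top⟩
  have hVb : ∀ w, BoundedLpLoc T p fun s => V (w, s) := fun w => boundedLpLoc_of_eLpNorm_le
    (hVm.comp_measurable (g := fun z : ℝ × Space d => ((w, z.1), z.2)) (by fun_prop)) hKt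
    (ae_of_all _ fun s => hVK _)
  have hVloc : ∀ z, MemLpLoc p (V z) := fun z =>
    memLpLoc_of_eLpNorm_ne_top (hVs z) (hVL z).2.ne
  have hsf : ∀ᵐ w ∂P, ∀ t ∈ Icc 0 T, ShiftedEquation b' divb' (fun s => B' s w) u₀
      (fun s => V (w, s)) t (V (w, t)) := by
    filter_upwards [hUsf] with w hw t ht
    refine (hw t ht).2.congr_ae EventuallyEq.rfl ?_ (.of_eq (hVU (w, t) (hw t ht).1).symm) ht
    filter_upwards [ae_restrict_mem measurableSet_Icc] with s hs
    exact .of_eq (hVU (w, s) (hw s hs).1).symm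
  set g : Ω × ℝ → Lp ℝ p (volume : Measure (Space d)) := fun z => (hVL z).toLp (V z) with hg
  have hgm : StronglyMeasurable g := stronglyMeasurable_toLp hp hVm hVL
  have hgV : ∀ z, g z =ᵐ[volume] V z := fun z => (hVL z).coeFn_toLp
  refine ⟨fun t w => g (w, t), V, ⟨fun t _ => ?_, ?_, fun φ t w => ∫ x, V (w, t) x * φ x,
    fun φ => ⟨fun t _ => ae_of_all _ fun w => ?_, ?_, ?_⟩⟩, fun t w => hgV (w, t), hVb, hVloc, hsf⟩
  · exact (hgm.comp_measurable (g := fun w : Ω => (w, t)) measurable_prodMk_right).aestronglyMeasurable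
  · refine memLp_top_of_bound hgm.aestronglyMeasurable K.toReal (ae_of_all _ fun z => ?_)
    rw [hg, Lp.norm_toLp]
    exact ENNReal.toReal_mono hKt (hVK z)
  · exact integral_congr_ae ((hgV (w, t)).mono fun x hx => congrArg (· * φ x) hx.symm)
  all_goals
    filter_upwards [hsf, hBV, hBB] with w w1 w2 w3
    have h := hr.stieltjes_equation hp (hVb w) (hBc w) w2
      (memLpLoc_of_eLpNorm_ne_top (Lp.stronglyMeasurable u₀) (Lp.memLp u₀).2.ne)
      (Lp.memLp u₀).2.ne (fun t ht => ⟨hVloc (w, t), w1 t ht⟩) φ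
  · exact h.1
  · intro t ht
    exact (h.2 t ht).trans (weak_equation_congr hT.le hb hdiv (ae_of_all _ fun s => hgV (w, s)) w3 φ
      _ _ ht).symm

/-- A weak solution has a jointly measurable representative which solves the equation in moving
coordinates at almost every time. At each fixed time the weak solution itself almost surely solves
this equation. -/
theorem IsWeakLpSolution.shiftedEquation {u : ℝ → Ω → Lp ℝ p (volume : Measure (Space d))}
    (h : IsWeakLpSolution P T p b divb B u₀ u) (hT : 0 < T)
    (hr : RegularDrift T q b' divb' Db f D F)
    (hb : ∀ᵐ t ∂(volume.restrict (Icc (0 : ℝ) T)), b t =ᵐ[volume] b' t)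
    (hdiv : ∀ᵐ t ∂(volume.restrict (Icc (0 : ℝ) T)), divb t =ᵐ[volume] divb' t)
    (hBc : ∀ w, Continuous fun t => B' t w) (hBB : ∀ᵐ w ∂P, ∀ t ∈ Icc 0 T, B' t w = B t w)
    (hBV : ∀ᵐ w ∂P, BoundedVariationOn (fun t => B' t w) (Icc 0 T)) :
    ∃ W : Ω × ℝ → Space d → ℝ,
      (∀ᵐ w ∂P, BoundedLpLoc T p (fun s => W (w, s)) ∧
        ∀ᵐ s ∂(volume.restrict (Icc (0 : ℝ) T)),
          ShiftedEquation b' divb' (fun s => B' s w) u₀ (fun s => W (w, s)) s (W (w, s))) ∧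
      ∀ t ∈ Icc 0 T, ∀ᵐ w ∂P,
        ShiftedEquation b' divb' (fun s => B' s w) u₀ (fun s => W (w, s)) t (u t w) := by
  obtain ⟨hm, hL, X, hX⟩ := h
  set ν : Measure ℝ := volume.restrict (Icc 0 T) with hν
  set g := hL.1.mk _ with hg_def
  have hg : StronglyMeasurable g := hL.1.stronglyMeasurable_mk
  have hgae : ∀ᵐ z ∂(P.prod ν), u z.2 z.1 = g z := hL.1.ae_eq_mk
  obtain ⟨W, hW, hWg⟩ := exists_jointly_measurable (p := p) (q := q) hg
  set M : ℝ≥0∞ := eLpNorm (fun z : Ω × ℝ => u z.2 z.1) ⊤ (P.prod ν) with hM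
  have hbd : ∀ᵐ z ∂(P.prod ν), eLpNorm (W z) p volume ≤ M := by
    filter_upwards [hgae, ae_le_eLpNormEssSup (f := fun z : Ω × ℝ => u z.2 z.1)] with z h1 h2
    rw [eLpNorm_congr_ae (hWg z), ← Lp.enorm_def, ← h1]
    exact h2.trans_eq eLpNorm_exponent_top.symm
  have hWs : ∀ z, StronglyMeasurable (W z) := fun z =>
    hW.comp_measurable (g := fun x : Space d => (z, x)) measurable_prodMk_left
  -- the continuous modifications are pairings with `W` at almost every time, by Fubini's theorem
  have hXW : ∀ φ : TestFun d, ∀ᵐ w ∂P, ∀ᵐ s ∂ν, X φ s w = ∫ x, W (w, s) x * φ x := by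
    intro φ
    obtain ⟨h1, h2, -⟩ := hX φ
    obtain ⟨Y, hYc, hYm, hY⟩ := exists_continuous_version hT.le (fun t ht =>
      ((continuous_integral_mul_of_memLp (memLp_testFun φ q)).comp_aestronglyMeasurable
        (hm t ht)).congr ((h1 t ht).mono fun w hw => hw.symm)) h2
    have hYj : StronglyMeasurable fun z : Ω × ℝ => Y z.2 z.1 :=
      (stronglyMeasurable_uncurry_of_continuous_of_stronglyMeasurable hYc hYm).comp_measurable
        measurable_swap
    have hZ : StronglyMeasurable fun z : Ω × ℝ => ∫ x, W z x * φ x :=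
      (hW.mul (φ.continuous.comp_stronglyMeasurable
        measurable_snd.stronglyMeasurable)).integral_prod_right'
    have hswap : ∀ᵐ s ∂ν, ∀ᵐ w ∂P, u s w = g (w, s) :=
      Measure.ae_ae_of_ae_prod (Measure.measurePreserving_swap.quasiMeasurePreserving.ae hgae)
    have h3 : ∀ᵐ s ∂ν, ∀ᵐ w ∂P, Y s w = ∫ x, W (w, s) x * φ x := by
      filter_upwards [hswap, ae_restrict_mem measurableSet_Icc] with s hs hsT
      filter_upwards [hs, hY, h1 s hsT] with w w1 w2 w3
      rw [w2 s hsT, w3, w1]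
      exact integral_congr_ae ((hWg (w, s)).mono fun x hx => congrArg (· * φ x) hx.symm)
    have h4 := (Measure.ae_ae_comm (p := fun w s => Y s w = ∫ x, W (w, s) x * φ x)
      (measurableSet_eq_fun hYj.measurable hZ.measurable)).2 h3
    filter_upwards [h4, hY] with w w1 w2
    filter_upwards [w1, ae_restrict_mem measurableSet_Icc] with s s1 s2
    rw [← w2 s s2, s1]
  set y : ℕ → Space d := TopologicalSpace.denseSeq (Space d) with hy
  set Φ : ℕ → ℕ → TestFun d := fun n k => translate (mollifierTest d n) (y k) with hΦ
  have hpath : ∀ᵐ w ∂P, BoundedLpLoc T p (fun s => W (w, s)) ∧ ∀ t ∈ Icc 0 T, ∀ v : Space d → ℝ,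
      StronglyMeasurable v → eLpNorm v p volume ≠ ⊤ →
      (∀ n k, X (Φ n k) t w = ∫ x, v x * Φ n k x) →
      ShiftedEquation b' divb' (fun s => B' s w) u₀ (fun s => W (w, s)) t v := by
    filter_upwards [hBB, hBV, Measure.ae_ae_of_ae_prod hbd, Measure.ae_ae_of_ae_prod hgae,
      ae_all_iff.2 fun n => ae_all_iff.2 fun k => hXW (Φ n k),
      ae_all_iff.2 fun n => ae_all_iff.2 fun k => ae_all_iff.2 fun i : Fin d =>
        hXW (∂_{EuclideanSpace.single i (1 : ℝ)} (Φ n k)),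
      ae_all_iff.2 fun n => ae_all_iff.2 fun k => (hX (Φ n k)).2.1,
      ae_all_iff.2 fun n => ae_all_iff.2 fun k => ae_all_iff.2 fun i : Fin d =>
        (hX (∂_{EuclideanSpace.single i (1 : ℝ)} (Φ n k))).2.1,
      ae_all_iff.2 fun n => ae_all_iff.2 fun k => (hX (Φ n k)).2.2]
      with w w1 w2 w3 w4 w5 w6 w7 w8 w9
    have hWb : BoundedLpLoc T p fun s => W (w, s) := boundedLpLoc_of_eLpNorm_le
      (hW.comp_measurable (g := fun z : ℝ × Space d => ((w, z.1), z.2)) (by fun_prop)) hL.2.ne w3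
    have huW : ∀ᵐ s ∂ν, u s w =ᵐ[volume] W (w, s) := w4.mono fun s hs => by
      have e : u s w = g (w, s) := hs
      rw [e]
      exact (hWg (w, s)).symm
    refine ⟨hWb, fun t ht v hv hvn hvX n x => ?_⟩
    rw [mollify_eq_integral_translate, mollify_eq_integral_translate]
    simp only [mollifiedTransport_eq_transport]
    refine hr.integral_mul_translate_eq_of_stieltjes hT hWb hL.2.ne w3 (hBc w) w2
      (Lp.stronglyMeasurable u₀) (Lp.memLp u₀).2.ne (mollifierTest d n)
      (TopologicalSpace.denseRange_denseSeq (Space d)) (X := fun φ s => X φ s w) ?_ ?_ ?_ ?_ ?_ ht hv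
      hvn ?_ x
    · rintro - ⟨k, rfl⟩
      exact w7 n k
    · rintro i - ⟨k, rfl⟩
      exact w8 n k i
    · filter_upwards [ae_all_iff.2 (w5 n)] with s hs
      rintro - ⟨k, rfl⟩
      exact hs k
    · intro i
      filter_upwards [ae_all_iff.2 fun k => w6 n k i] with s hs
      rintro - ⟨k, rfl⟩
      exact hs k
    · rintro - ⟨k, rfl⟩ r hr
      exact (w9 n k r hr).trans (weak_equation_congr hT.le hb hdiv huW w1 _ _ _ hr)
    · rintro - ⟨k, rfl⟩
      exact hvX n k
  refine ⟨W, ?_, fun t ht => ?_⟩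
  · filter_upwards [hpath, Measure.ae_ae_of_ae_prod hbd,
      ae_all_iff.2 fun n => ae_all_iff.2 fun k => hXW (Φ n k)] with w w1 w2 w3
    refine ⟨w1.1, ?_⟩
    filter_upwards [w2, ae_all_iff.2 fun n => ae_all_iff.2 (w3 n),
      ae_restrict_mem measurableSet_Icc] with s s1 s2 s3
    exact w1.2 s s3 _ (hWs _) (ne_top_of_le_ne_top hL.2.ne s1) s2
  · filter_upwards [hpath, ae_all_iff.2 fun n => ae_all_iff.2 fun k => (hX (Φ n k)).1 t ht]
      with w w1 w2
    exact w1.2 t ht _ (Lp.stronglyMeasurable _) (Lp.memLp _).2.ne w2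

end

end StochTransport

end

theorem mainTheorem4 {d : ℕ} {Ω : Type*} [MeasurableSpace Ω] (P : Measure Ω)
    [IsProbabilityMeasure P] (T : ℝ) (hT : 0 < T)
    (p q : ℝ≥0∞) [Fact (1 ≤ p)] (hp : p ≠ ∞) (hpq : 1 / p + 1 / q = 1)
    (b : ℝ → StochTransport.Space d → StochTransport.Space d)
    (divb : ℝ → StochTransport.Space d → ℝ)
    (hdiv : ∀ᵐ t ∂(volume.restrict (Icc (0 : ℝ) T)), StochTransport.HasWeakDiv (b t) (divb t))
    (hdivb : StochTransport.MemL1L T ∞ divb)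
    (hb : StochTransport.MemL1W1Loc T q b)
    (hgrowth : StochTransport.GrowthCondition T b)
    (B : ℝ → Ω → StochTransport.Space d)
    (hB : StochTransport.IsContinuousBVProcess P T B)
    (u₀ : Lp ℝ p (volume : Measure (StochTransport.Space d))) :
    ∃ u : ℝ → Ω → Lp ℝ p (volume : Measure (StochTransport.Space d)),
      StochTransport.IsWeakLpSolution P T p b divb B u₀ u ∧
      ∀ u' : ℝ → Ω → Lp ℝ p (volume : Measure (StochTransport.Space d)),
        StochTransport.IsWeakLpSolution P T p b divb B u₀ u' →
          ∀ t ∈ Icc (0 : ℝ) T, u' t =ᵐ[P] u t := by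
  have hp1 : 1 ≤ p := Fact.out
  have hpq' : ENNReal.HolderConjugate p q := ⟨by simpa only [one_div, inv_one] using hpq⟩
  obtain ⟨b', divb', Db, f, D, F, hr, hb', hdiv'⟩ :=
    StochTransport.exists_regularDrift hdiv hdivb hb hgrowth
  obtain ⟨B', hBc, hBm, hBB⟩ := StochTransport.exists_continuous_version hT.le
    (fun t ht => (hB.measurable t ht).aestronglyMeasurable) hB.continuous
  have hBV : ∀ᵐ w ∂P, BoundedVariationOn (fun t => B' t w) (Icc 0 T) := by
    filter_upwards [hB.boundedVariation, hBB] with w w1 w2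
    rw [BoundedVariationOn, eVariationOn.eq_of_eqOn (fun t ht => w2 t ht)]
    exact w1
  obtain ⟨u, V, hu, huV, hVb, hVl, hV⟩ := hr.exists_isWeakLpSolution (P := P) (u₀ := u₀) hp hT hb'
    hdiv' hBc hBm hBB hBV
  refine ⟨u, hu, fun u' hu' t ht => ?_⟩
  obtain ⟨W, hW, hWt⟩ := hu'.shiftedEquation hT hr hb' hdiv' hBc hBB hBV
  filter_upwards [hV, hW, hWt t ht] with w w1 w2 w3
  have h₀ : StochTransport.MemLpLoc p u₀ := StochTransport.memLpLoc_of_eLpNorm_ne_top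
    (Lp.stronglyMeasurable u₀) (Lp.memLp u₀).2.ne
  have ht' : StochTransport.MemLpLoc p (u' t w) := StochTransport.memLpLoc_of_eLpNorm_ne_top
    (Lp.stronglyMeasurable _) (Lp.memLp _).2.ne
  have hmem : StochTransport.MemLpLoc p fun x => u' t w x - V (w, t) x :=
    ⟨ht'.1.sub (hVl _).1, fun R => ((eLpNorm_sub_le ht'.1.aestronglyMeasurable
      (hVl _).1.aestronglyMeasurable hp1).trans_lt
        (ENNReal.add_lt_top.2 ⟨(ht'.2 R).lt_top, ((hVl _).2 R).lt_top⟩)).ne⟩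
  -- The difference of two solutions is a solution with initial value zero, so its norm vanishes.
  have hzero : (fun x => u₀ x - u₀ x) = 0 := funext fun x => sub_self _
  have hsub := hr.eLpNorm_le hp (w2.1.sub hp1 (hVb w)) (hBc w)
    (u₀ := fun x => u₀ x - u₀ x)
    (by
      rw [hzero]
      exact StochTransport.memLpLoc_of_eLpNorm_ne_top stronglyMeasurable_zero (by simp))
    (by
      filter_upwards [w2.2, w2.1.memLpLoc, ae_restrict_mem measurableSet_Icc] with s s1 s2 s3
      exact hr.shiftedEquation_sub w2.1 (hVb w) (hBc w) h₀ h₀ s2 (hVl _) s3 s1 (w1 s s3))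
    ht hmem (hr.shiftedEquation_sub w2.1 (hVb w) (hBc w) h₀ h₀ ht' (hVl _) ht w3 (w1 t ht))
  rw [hzero, eLpNorm_zero, mul_zero, nonpos_iff_eq_zero, eLpNorm_eq_zero_iff
    hmem.1.aestronglyMeasurable (by positivity)] at hsub
  refine Lp.ext ?_
  filter_upwards [hsub, huV t w] with x x1 x2
  rw [x2]
  exact sub_eq_zero.1 x1
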